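/- Work in $\mathbf{Prof}$, the monoidal bicategory of small categories, profunctors $P:\mathcal A\nrightarrow\mathcal B$ (functors $P:\mathcal B^{\mathrm{op}}\times\mathcal A\to\mathbf{Set}$, composed by coends) and natural transformations, with monoidal product $\boxtimes$ given by the product of categories and with unit the one-object category $1$. Let $\mathcal C$ be a small category. An *interpretation*, with underlying object $\mathcal C$, of the rotational right $\otimes$-traced $*$-autonomous pseudomonoid presentation consists of: 1. a right-adjoint Frobenius pseudomonoid on $\mathcal C$: a pseudomonoid $(\mu:\mathcal C\boxtimes\mathcal C\nrightarrow\mathcal C,\ \eta:1\nrightarrow\mathcal C)$ (invertible associator and unitors, pentagon and triangle equations); a pseudocomonoid $(\Delta:\mathcal C\nrightarrow\mathcal C\boxtimes\mathcal C,\ \varepsilon:\mathcal C\nrightarrow 1)$ (dually); invertible Frobenius 2-morphisms $(1\boxtimes\mu)(\Delta\boxtimes1)\cong\Delta\mu\cong(\mu\boxtimes1)(1\boxtimes\Delta)$ that are coherent with the unitors, the counitors, the associator, the coassociator and each other; and right adjoints $\mu\dashv\mu^*$ and $\eta\dashv\eta^*$. From these one derives left adjoints $T\dashv\Delta$ and $U\dashv\varepsilon$,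 by bending all legs of $\mu^*$ and $\eta^*$ with the Frobenius cup $\varepsilon\mu$ and the Frobenius cap $\Delta\eta$; 2. a 2-morphism $\mathrm{Tr}:\mu\,(T\boxtimes 1)\,\bigl(1\boxtimes(\sigma\,\Delta\,\eta)\bigr)\Rightarrow 1_{\mathcal C}$, where $\sigma$ is the symmetry, subject to the three equations expressing vanishing for the unit, vanishing for the tensor product, and superposing, after its source is identified with $\int^{X}(\Delta T)\bigl((-,X),(=,X)\bigr)$ by means of the Frobenius structure. All these data are built from the generators by composition, $\boxtimes$, the symmetry and the adjunctions for 1-morphisms; the compact closed structure of $\mathbf{Prof}$ is not used. **Proposition.** Let $\mathcal C$ be a small Cauchy complete category. The interpretations with underlying object $\mathcal C$ are exactly the traced $*$-autonomous structures on $\mathcal C$ in which $\otimes$ is traced on the right, that is, the monoidal structures $(\otimes,I)$ on $\mathcal C$ (not necessarily symmetric) together with a dualizing object $\bot$ and a right trace $\mathrm{Tr}^X_{A,B}:\mathcal C(A\otimes X,B\otimes X)\to\mathcal C(A,B)$ satisfying tightening, sliding, vanishing and superposing. More precisely, there is an equivalence between the groupoid of interpretations with underlying object $\mathcal C$ (with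 invertible 2-morphisms between the generating 1-morphisms that respect all generating 2-morphisms) and the groupoid of such structures on $\mathcal C$ (with strong monoidal structures on the identity functor that respect the trace, together with isomorphisms of the dualizing objects). It sends every interpretation to a structure that represents it: $\Delta((A,B),X)\cong\mathcal C(A\otimes B,X)$, $\varepsilon(X)\cong\mathcal C(I,X)$, $\eta(Z)\cong\mathcal C(Z,\bot)$, $T(Z,(A,B))\cong\mathcal C(Z,A\otimes B)$, $U(Z)\cong\mathcal C(Z,I)$, and $\mu(Z,(X,Y))\cong\mathcal C(Z\otimes Y^{\bot},X)$, so that $\mu$ is represented by the par product, where $Y^{\bot}$ is the right dual of $Y$, with universal morphism $Y\otimes Y^{\bot}\to\bot$. Under these bijections the coassociator, the counitors and $\mathrm{Tr}$ become the associator, the unitors and the trace of $\otimes$, and the bijections for $\Delta$, $\varepsilon$ and $\eta$ are compatible with the isomorphisms of interpretations and of structures. -/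

import Mathlib

open CategoryTheory Opposite

universe u

namespace Prof

/-! ### Profunctors between small categories -/

section Basic

variable {A B D E A' B' : Type u} [SmallCategory A] [SmallCategory B] [SmallCategory D]
  [SmallCategory E] [SmallCategory A'] [SmallCategory B']

/-- The set `P(b, a)` of elements of a profunctor `P : A ⇸ B` (contravariant in `b`, covariant
in `a`). -/
abbrev El (P : Profunctor.{u} A B) (b : B) (a : A) : Type u := (P.obj a).obj (op b)

/-- The two-sided action of morphisms on the elements of a profunctor. -/
def act (P : Profunctor.{u} A B) {b' b : B} {a a' : A} (g : b' ⟶ b) (f : a ⟶ a')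
    (p : El P b a) : El P b' a' :=
  (P.map f).app (op b') ((P.obj a).map g.op p)

/-- The action of a 2-cell (a natural transformation of profunctors) on elements. -/
def ap {P Q : Profunctor.{u} A B} (θ : P ⟶ Q) {b : B} {a : A} (p : El P b a) : El Q b a :=
  (θ.app a).app (op b) p

theorem act_id (P : Profunctor.{u} A B) {b : B} {a : A} (p : El P b a) :
    act P (𝟙 b) (𝟙 a) p = p := by
  simp [act]

theorem act_act (P : Profunctor.{u} A B) {b b' b'' : B} {a a' a'' : A} (g : b' ⟶ b)
    (g' : b'' ⟶ b') (f : a ⟶ a') (f' : a' ⟶ a'') (p : El P b a) :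
    act P g' f' (act P g f p) = act P (g' ≫ g) (f ≫ f') p := by
  simp [act, NatTrans.naturality_apply]

theorem ap_id (P : Profunctor.{u} A B) {b : B} {a : A} (p : El P b a) : ap (𝟙 P) p = p := rfl

theorem ap_comp {P Q R : Profunctor.{u} A B} (θ : P ⟶ Q) (κ : Q ⟶ R) {b : B} {a : A}
    (p : El P b a) : ap (θ ≫ κ) p = ap κ (ap θ p) := rfl

/-- The identity profunctor: the hom-profunctor. -/
abbrev idP (A : Type u) [SmallCategory A] : Profunctor.{u} A A := Profunctor.id

/-- A compatible pair of elements `g ∈ G(d, b)`, `f ∈ F(b, a)`. -/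
structure Pair (G : Profunctor.{u} B D) (F : Profunctor.{u} A B) (d : D) (a : A) : Type u where
  /-- the intermediate object -/
  mid : B
  /-- the element of the outer profunctor -/
  outer : El G d mid
  /-- the element of the inner profunctor -/
  inner : El F mid a

/-- The relation generating the coend: morphisms move through the intermediate object. -/
inductive Slide (G : Profunctor.{u} B D) (F : Profunctor.{u} A B) (d : D) (a : A) :
    Pair G F d a → Pair G F d a → Prop
  | intro {b b' : B} (g : El G d b) (k : b ⟶ b') (f : El F b' a) :
      Slide G F d a ⟨b', act G (𝟙 d) k g, f⟩ ⟨b, g, act F k (𝟙 a) f⟩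

/-- Composition of profunctors, `(G ⋄ F)(d, a) = ∫^b G(d, b) × F(b, a)`. -/
def comp (G : Profunctor.{u} B D) (F : Profunctor.{u} A B) : Profunctor.{u} A D :=
  Profunctor.ofCore
    { obj := fun a d => Quot (Slide G F d a)
      map := fun {a a'} {d d'} f g => TypeCat.ofHom (Quot.map
        (fun p => ⟨p.mid, act G g (𝟙 _) p.outer, act F (𝟙 _) f p.inner⟩)
        (by
          rintro _ _ ⟨x, k, y⟩
          have h := Slide.intro (G := G) (F := F) (act G g (𝟙 _) x) k (act F (𝟙 _) f y)
          simpa only [act_act, Category.id_comp, Category.comp_id] using h))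
      map_id := by
        intro a d
        ext p
        induction p using Quot.ind with
        | mk p =>
          refine congrArg (Quot.mk _) ?_
          simp [act_id]
      map_comp := by
        intro _ _ _ _ _ _ f f' g g'
        ext p
        induction p using Quot.ind with
        | mk p =>
          refine congrArg (Quot.mk _) ?_
          simp [act_act] }

/-- The class of the pair `(g, f)` in the composite `G ⋄ F`. -/
def mk {G : Profunctor.{u} B D} {F : Profunctor.{u} A B} {d : D} {a : A} {b : B}
    (g : El G d b) (f : El F b a) : El (comp G F) d a :=
  Quot.mk _ ⟨b, g, f⟩

/-- The monoidal product of profunctors, `(P ⊠ Q)((b, b'), (a, a')) = P(b, a) × Q(b', a')`. -/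
def tensor (P : Profunctor.{u} A B) (Q : Profunctor.{u} A' B') :
    Profunctor.{u} (A × A') (B × B') :=
  Profunctor.ofCore
    { obj := fun a b => El P b.1 a.1 × El Q b.2 a.2
      map := fun f g => TypeCat.ofHom (fun p => (act P g.1 f.1 p.1, act Q g.2 f.2 p.2))
      map_id := by
        intro a b
        ext p
        · simp [act_id]
        · simp [act_id]
      map_comp := by
        intro _ _ _ _ _ _ f f' g g'
        ext p
        · simp [act_act]
        · simp [act_act] }

/-- `P ⊣ Q` in **Prof**: a unit and a counit satisfying the two triangle equations (evaluated on
elements). -/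
structure Adj (P : Profunctor.{u} A B) (Q : Profunctor.{u} B A) : Type u where
  /-- the unit -/
  unit : idP A ⟶ comp Q P
  /-- the counit -/
  counit : comp P Q ⟶ idP B
  triangle_left : ∀ {b b' : B} {a : A} (p : El P b a) (q : El Q a b') (p' : El P b' a),
    ap unit (b := a) (a := a) (𝟙 a) = mk q p' →
      act P (ap counit (mk p q) : b ⟶ b') (𝟙 a) p' = p
  triangle_right : ∀ {b b' : B} {a : A} (q₀ : El Q a b) (q : El Q a b') (p' : El P b' a),
    ap unit (b := a) (a := a) (𝟙 a) = mk q p' →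
      act Q (𝟙 a) (ap counit (mk p' q₀) : b' ⟶ b) q = q₀

end Basic

/-! ### Composite 1-cells used by the presentation

A composite of profunctors is a coend, so each of its elements is the class of a tuple of
compatible elements of the factors, and by sliding morphisms one may take the components at
identity wires to be identities.  For every composite we fix a name for these classes.  An equation
between pasted 2-cells is stated by evaluating both sides on an arbitrary tuple: a 2-cell that is
whiskered into a larger composite rewrites the corresponding part of the tuple, and the results of
the two sides are compared in the composite that is the common target. -/

section Composites

variable {C : Type u} [SmallCategory C]

/-- The unit object of **Prof**. -/
abbrev One : Type u := Discrete PUnit.{u + 1}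

/-- The object of the unit category. -/
abbrev pt : One.{u} := ⟨PUnit.unit⟩

/-- `μ ⋄ (μ ⊠ 1)`. -/
def MulL (M : Profunctor.{u} (C × C) C) : Profunctor.{u} ((C × C) × C) C :=
  comp M (tensor M (idP C))

/-- `μ ⋄ (1 ⊠ μ)`, with the inputs bracketed to the left. -/
def MulR (M : Profunctor.{u} (C × C) C) : Profunctor.{u} ((C × C) × C) C :=
  (comp M (tensor (idP C) M)).whiskerLeft₂ (prod.associator C C C) (𝟭 C)

/-- `μ ⋄ (η ⊠ 1)`. -/
def UnL (M : Profunctor.{u} (C × C) C) (H : Profunctor.{u} One C) : Profunctor.{u} C C :=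
  (comp M (tensor H (idP C))).whiskerLeft₂ (Prod.sectR pt C) (𝟭 C)

/-- `μ ⋄ (1 ⊠ η)`. -/
def UnR (M : Profunctor.{u} (C × C) C) (H : Profunctor.{u} One C) : Profunctor.{u} C C :=
  (comp M (tensor (idP C) H)).whiskerLeft₂ (Prod.sectL C pt) (𝟭 C)

/-- `(Δ ⊠ 1) ⋄ Δ`. -/
def ComulL (D : Profunctor.{u} C (C × C)) : Profunctor.{u} C ((C × C) × C) :=
  comp (tensor D (idP C)) D

/-- `(1 ⊠ Δ) ⋄ Δ`, with the outputs bracketed to the left. -/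
def ComulR (D : Profunctor.{u} C (C × C)) : Profunctor.{u} C ((C × C) × C) :=
  (comp (tensor (idP C) D) D).whiskerLeft₂ (𝟭 C) (prod.associator C C C)

/-- `(ε ⊠ 1) ⋄ Δ`. -/
def CounL (D : Profunctor.{u} C (C × C)) (E : Profunctor.{u} C One) : Profunctor.{u} C C :=
  (comp (tensor E (idP C)) D).whiskerLeft₂ (𝟭 C) (Prod.sectR pt C)

/-- `(1 ⊠ ε) ⋄ Δ`. -/
def CounR (D : Profunctor.{u} C (C × C)) (E : Profunctor.{u} C One) : Profunctor.{u} C C :=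
  (comp (tensor (idP C) E) D).whiskerLeft₂ (𝟭 C) (Prod.sectL C pt)

/-- `(1 ⊠ μ) ⋄ (Δ ⊠ 1)`. -/
def FrobL (M : Profunctor.{u} (C × C) C) (D : Profunctor.{u} C (C × C)) :
    Profunctor.{u} (C × C) (C × C) :=
  comp ((tensor (idP C) M).whiskerLeft₂ (prod.associator C C C) (𝟭 (C × C)))
    (tensor D (idP C))

/-- `(μ ⊠ 1) ⋄ (1 ⊠ Δ)`. -/
def FrobR (M : Profunctor.{u} (C × C) C) (D : Profunctor.{u} C (C × C)) :
    Profunctor.{u} (C × C) (C × C) :=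
  comp ((tensor M (idP C)).whiskerLeft₂ (prod.inverseAssociator C C C) (𝟭 (C × C)))
    (tensor (idP C) D)

/-- `Δ ⋄ μ`. -/
def FrobM (M : Profunctor.{u} (C × C) C) (D : Profunctor.{u} C (C × C)) :
    Profunctor.{u} (C × C) (C × C) :=
  comp D M

/-- `μ ⋄ (1 ⊠ μ) ⋄ (1 ⊠ 1 ⊠ μ)`. -/
def MulMulMul (M : Profunctor.{u} (C × C) C) : Profunctor.{u} (C × C × C × C) C :=
  comp M (comp (tensor (idP C) M) (tensor (idP C) (tensor (idP C) M)))

/-- `(1 ⊠ 1 ⊠ Δ) ⋄ (1 ⊠ Δ) ⋄ Δ`. -/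
def ComulComulComul (D : Profunctor.{u} C (C × C)) : Profunctor.{u} C (C × C × C × C) :=
  comp (tensor (idP C) (tensor (idP C) D)) (comp (tensor (idP C) D) D)

/-- `Δ ⋄ μ ⋄ (1 ⊠ μ)`. -/
def ComulMulMul (M : Profunctor.{u} (C × C) C) (D : Profunctor.{u} C (C × C)) :
    Profunctor.{u} (C × C × C) (C × C) :=
  comp D (comp M (tensor (idP C) M))

/-- `(1 ⊠ Δ) ⋄ Δ ⋄ μ`. -/
def ComulComulMul (M : Profunctor.{u} (C × C) C) (D : Profunctor.{u} C (C × C)) :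
    Profunctor.{u} (C × C) (C × C × C) :=
  comp (tensor (idP C) D) (comp D M)

variable {M : Profunctor.{u} (C × C) C} {H : Profunctor.{u} One C}
  {D : Profunctor.{u} C (C × C)} {E : Profunctor.{u} C One}

/-- The class of a tuple in `μ ⋄ (μ ⊠ 1)`. -/
def mulL {x y z w t : C} (m : El M w (t, z)) (n : El M t (x, y)) : El (MulL M) w ((x, y), z) :=
  mk (G := M) (F := tensor M (idP C)) (b := (t, z)) m (n, 𝟙 z)

/-- The class of a tuple in `μ ⋄ (1 ⊠ μ)`. -/
def mulR {x y z w t : C} (m : El M w (x, t)) (n : El M t (y, z)) : El (MulR M) w ((x, y), z) :=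
  mk (G := M) (F := tensor (idP C) M) (a := (x, (y, z))) (b := (x, t)) m (𝟙 x, n)

/-- The class of a tuple in `μ ⋄ (η ⊠ 1)`. -/
def unL {x z t : C} (m : El M z (t, x)) (n : El H t pt) : El (UnL M H) z x :=
  mk (G := M) (F := tensor H (idP C)) (a := (pt, x)) (b := (t, x)) m (n, 𝟙 x)

/-- The class of a tuple in `μ ⋄ (1 ⊠ η)`. -/
def unR {x z t : C} (m : El M z (x, t)) (n : El H t pt) : El (UnR M H) z x :=
  mk (G := M) (F := tensor (idP C) H) (a := (x, pt)) (b := (x, t)) m (𝟙 x, n)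

/-- The class of a tuple in `(Δ ⊠ 1) ⋄ Δ`. -/
def comulL {a b c x t : C} (d : El D (t, c) x) (d' : El D (a, b) t) :
    El (ComulL D) ((a, b), c) x :=
  mk (G := tensor D (idP C)) (F := D) (b := (t, c)) (d', 𝟙 c) d

/-- The class of a tuple in `(1 ⊠ Δ) ⋄ Δ`. -/
def comulR {a b c x t : C} (d : El D (a, t) x) (d' : El D (b, c) t) :
    El (ComulR D) ((a, b), c) x :=
  mk (G := tensor (idP C) D) (F := D) (d := (a, (b, c))) (b := (a, t)) (𝟙 a, d') d

/-- The class of a tuple in `(ε ⊠ 1) ⋄ Δ`. -/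
def counL {a x t : C} (d : El D (t, a) x) (e : El E pt t) : El (CounL D E) a x :=
  mk (G := tensor E (idP C)) (F := D) (d := (pt, a)) (b := (t, a)) (e, 𝟙 a) d

/-- The class of a tuple in `(1 ⊠ ε) ⋄ Δ`. -/
def counR {a x t : C} (d : El D (a, t) x) (e : El E pt t) : El (CounR D E) a x :=
  mk (G := tensor (idP C) E) (F := D) (d := (a, pt)) (b := (a, t)) (𝟙 a, e) d

/-- The class of a tuple in `(1 ⊠ μ) ⋄ (Δ ⊠ 1)`. -/
def frobL {a b x y t : C} (m : El M b (t, y)) (d : El D (a, t) x) :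
    El (FrobL M D) (a, b) (x, y) :=
  mk (G := (tensor (idP C) M).whiskerLeft₂ (prod.associator C C C) (𝟭 (C × C)))
    (F := tensor D (idP C)) (b := ((a, t), y)) (𝟙 a, m) (d, 𝟙 y)

/-- The class of a tuple in `(μ ⊠ 1) ⋄ (1 ⊠ Δ)`. -/
def frobR {a b x y t : C} (m : El M a (x, t)) (d : El D (t, b) y) :
    El (FrobR M D) (a, b) (x, y) :=
  mk (G := (tensor M (idP C)).whiskerLeft₂ (prod.inverseAssociator C C C) (𝟭 (C × C)))
    (F := tensor (idP C) D) (b := (x, (t, b))) (m, 𝟙 b) (𝟙 x, d)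

/-- The class of a tuple in `Δ ⋄ μ`. -/
def frobM {a b x y t : C} (d : El D (a, b) t) (m : El M t (x, y)) :
    El (FrobM M D) (a, b) (x, y) :=
  mk (G := D) (F := M) d m

/-- The class of a tuple in `μ ⋄ (1 ⊠ μ) ⋄ (1 ⊠ 1 ⊠ μ)`. -/
def mulMulMul {x y z w v s t : C} (m : El M v (x, s)) (m' : El M s (y, t))
    (m'' : El M t (z, w)) : El (MulMulMul M) v (x, (y, (z, w))) :=
  mk (G := M) (F := comp (tensor (idP C) M) (tensor (idP C) (tensor (idP C) M))) (b := (x, s)) m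
    (mk (G := tensor (idP C) M) (F := tensor (idP C) (tensor (idP C) M)) (b := (x, (y, t)))
      (𝟙 x, m') (𝟙 x, (𝟙 y, m'')))

/-- The class of a tuple in `(1 ⊠ 1 ⊠ Δ) ⋄ (1 ⊠ Δ) ⋄ Δ`. -/
def comulComulComul {a b c e x s t : C} (d : El D (a, s) x) (d' : El D (b, t) s)
    (d'' : El D (c, e) t) : El (ComulComulComul D) (a, (b, (c, e))) x :=
  mk (G := tensor (idP C) (tensor (idP C) D)) (F := comp (tensor (idP C) D) D)
    (b := (a, (b, t))) (𝟙 a, (𝟙 b, d''))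
    (mk (G := tensor (idP C) D) (F := D) (b := (a, s)) (𝟙 a, d') d)

/-- The class of a tuple in `Δ ⋄ μ ⋄ (1 ⊠ μ)`. -/
def comulMulMul {a b x y z s t : C} (d : El D (a, b) s) (m : El M s (x, t))
    (m' : El M t (y, z)) : El (ComulMulMul M D) (a, b) (x, (y, z)) :=
  mk (G := D) (F := comp M (tensor (idP C) M)) d
    (mk (G := M) (F := tensor (idP C) M) (b := (x, t)) m (𝟙 x, m'))

/-- The class of a tuple in `(1 ⊠ Δ) ⋄ Δ ⋄ μ`. -/
def comulComulMul {a b c x y s t : C} (d : El D (a, t) s) (d' : El D (b, c) t)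
    (m : El M s (x, y)) : El (ComulComulMul M D) (a, (b, c)) (x, y) :=
  mk (G := tensor (idP C) D) (F := comp D M) (b := (a, t)) (𝟙 a, d') (mk (G := D) (F := M) d m)

end Composites

section Presentations

/-! ### Interpretations of the presentations -/

variable (C : Type u) [SmallCategory C]

/-- A pseudomonoid `(C, μ, η)` in **Prof**. -/
structure Pseudomonoid where
  /-- the multiplication `μ : C ⊠ C ⇸ C` -/
  M : Profunctor.{u} (C × C) C
  /-- the unit `η : 1 ⇸ C` -/
  H : Profunctor.{u} One C
  /-- the associator -/
  assoc : MulL M ≅ MulR M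
  /-- the left unitor -/
  unitL : UnL M H ≅ idP C
  /-- the right unitor -/
  unitR : UnR M H ≅ idP C
  /-- the pentagon equation -/
  pentagon : ∀ {x y z w v s t p q r p' q' : C}
    (m₁ : El M v (s, w)) (m₂ : El M s (t, z)) (m₃ : El M t (x, y))
    (a₁ : El M s (x, p)) (a₂ : El M p (y, z)) (b₁ : El M v (x, q)) (b₂ : El M q (p, w))
    (c₁ : El M q (y, r)) (c₂ : El M r (z, w))
    (a₁' : El M v (t, p')) (a₂' : El M p' (z, w)) (b₁' : El M v (x, q')) (b₂' : El M q' (y, p')),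
    ap assoc.hom (mulL m₂ m₃) = mulR a₁ a₂ →
    ap assoc.hom (mulL m₁ a₁) = mulR b₁ b₂ →
    ap assoc.hom (mulL b₂ a₂) = mulR c₁ c₂ →
    ap assoc.hom (mulL m₁ m₂) = mulR a₁' a₂' →
    ap assoc.hom (mulL a₁' m₃) = mulR b₁' b₂' →
    mulMulMul b₁ c₁ c₂ = mulMulMul b₁' b₂' a₂'
  /-- the triangle equation -/
  triangle : ∀ {x y z s t t' : C} (m : El M z (t, y)) (m' : El M t (x, s)) (n : El H s pt)
    (a₁ : El M z (x, t')) (a₂ : El M t' (s, y)),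
    ap assoc.hom (mulL m m') = mulR a₁ a₂ →
    act M (𝟙 z) (Prod.mkHom (ap unitR.hom (unR m' n) : t ⟶ x) (𝟙 y)) m =
      act M (𝟙 z) (Prod.mkHom (𝟙 x) (ap unitL.hom (unL a₂ n) : t' ⟶ y)) a₁

/-- A pseudocomonoid `(C, Δ, ε)` in **Prof**. -/
structure Pseudocomonoid where
  /-- the comultiplication `Δ : C ⇸ C ⊠ C` -/
  D : Profunctor.{u} C (C × C)
  /-- the counit `ε : C ⇸ 1` -/
  E : Profunctor.{u} C One
  /-- the coassociator -/
  coassoc : ComulL D ≅ ComulR D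
  /-- the left counitor -/
  counitL : CounL D E ≅ idP C
  /-- the right counitor -/
  counitR : CounR D E ≅ idP C
  /-- the pentagon equation -/
  copentagon : ∀ {a b c e x p q s t r s' t' : C}
    (d₁ : El D (p, e) x) (d₂ : El D (q, c) p) (d₃ : El D (a, b) q)
    (f₁ : El D (a, s) p) (f₂ : El D (b, c) s) (g₁ : El D (a, t) x) (g₂ : El D (s, e) t)
    (h₁ : El D (b, r) t) (h₂ : El D (c, e) r)
    (f₁' : El D (q, s') x) (f₂' : El D (c, e) s') (g₁' : El D (a, t') x) (g₂' : El D (b, s') t'),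
    ap coassoc.hom (comulL d₂ d₃) = comulR f₁ f₂ →
    ap coassoc.hom (comulL d₁ f₁) = comulR g₁ g₂ →
    ap coassoc.hom (comulL g₂ f₂) = comulR h₁ h₂ →
    ap coassoc.hom (comulL d₁ d₂) = comulR f₁' f₂' →
    ap coassoc.hom (comulL f₁' d₃) = comulR g₁' g₂' →
    comulComulComul g₁ h₁ h₂ = comulComulComul g₁' g₂' f₂'
  /-- the triangle equation -/
  cotriangle : ∀ {a b x s t t' : C} (d : El D (t, b) x) (d' : El D (a, s) t) (e : El E pt s)
    (f₁ : El D (a, t') x) (f₂ : El D (s, b) t'),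
    ap coassoc.hom (comulL d d') = comulR f₁ f₂ →
    act D (Prod.mkHom (ap counitR.hom (counR d' e) : a ⟶ t) (𝟙 b)) (𝟙 x) d =
      act D (Prod.mkHom (𝟙 a) (ap counitL.hom (counL f₂ e) : b ⟶ t')) (𝟙 x) f₁

/-- A Frobenius pseudomonoid in **Prof**: a pseudomonoid and a pseudocomonoid on the same object
with invertible Frobenius 2-cells `(1 ⊠ μ) ⋄ (Δ ⊠ 1) ≅ Δ ⋄ μ ≅ (μ ⊠ 1) ⋄ (1 ⊠ Δ)`, coherent with
the unitors, the counitors, the associator, the coassociator and each other. -/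
structure FrobeniusPseudomonoid extends Pseudomonoid C, Pseudocomonoid C where
  /-- the left Frobenius 2-cell -/
  phiL : FrobL M D ≅ FrobM M D
  /-- the right Frobenius 2-cell -/
  phiR : FrobR M D ≅ FrobM M D
  /-- `phiL` and the right unitor -/
  phiL_unit : ∀ {a b x s t v : C} (d : El D (a, t) x) (m : El M b (t, s)) (n : El H s pt)
    (d₁ : El D (a, b) v) (m₁ : El M v (x, s)),
    ap phiL.hom (frobL m d) = frobM d₁ m₁ →
    act D (Prod.mkHom (𝟙 a) (ap unitR.hom (unR m n) : b ⟶ t)) (𝟙 x) d =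
      act D (𝟙 (a, b)) (ap unitR.hom (unR m₁ n) : v ⟶ x) d₁
  /-- `phiR` and the left unitor -/
  phiR_unit : ∀ {a b y s t v : C} (d : El D (t, b) y) (m : El M a (s, t)) (n : El H s pt)
    (d₁ : El D (a, b) v) (m₁ : El M v (s, y)),
    ap phiR.hom (frobR m d) = frobM d₁ m₁ →
    act D (Prod.mkHom (ap unitL.hom (unL m n) : a ⟶ t) (𝟙 b)) (𝟙 y) d =
      act D (𝟙 (a, b)) (ap unitL.hom (unL m₁ n) : v ⟶ y) d₁
  /-- `phiL` and the left counitor -/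
  phiL_counit : ∀ {b x y s t v : C} (e : El E pt s) (d : El D (s, t) x) (m : El M b (t, y))
    (d₁ : El D (s, b) v) (m₁ : El M v (x, y)),
    ap phiL.hom (frobL m d) = frobM d₁ m₁ →
    act M (𝟙 b) (Prod.mkHom (ap counitL.hom (counL d e) : t ⟶ x) (𝟙 y)) m =
      act M (ap counitL.hom (counL d₁ e) : b ⟶ v) (𝟙 (x, y)) m₁
  /-- `phiR` and the right counitor -/
  phiR_counit : ∀ {a x y s t v : C} (e : El E pt s) (d : El D (t, s) y) (m : El M a (x, t))
    (d₁ : El D (a, s) v) (m₁ : El M v (x, y)),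
    ap phiR.hom (frobR m d) = frobM d₁ m₁ →
    act M (𝟙 a) (Prod.mkHom (𝟙 x) (ap counitR.hom (counR d e) : t ⟶ y)) m =
      act M (ap counitR.hom (counR d₁ e) : a ⟶ v) (𝟙 (x, y)) m₁
  /-- `phiL` and the associator -/
  phiL_assoc : ∀ {a b x y z s t v r q k r' : C}
    (d : El D (a, t) x) (n : El M s (t, y)) (m : El M b (s, z))
    (d₁ : El D (a, s) v) (n₁ : El M v (x, y)) (d₂ : El D (a, b) r) (m₂ : El M r (v, z))
    (m₃ : El M r (x, r')) (n₃ : El M r' (y, z))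
    (m₁' : El M b (t, q)) (n₁' : El M q (y, z)) (d₂' : El D (a, b) k) (m₂' : El M k (x, q)),
    ap phiL.hom (frobL n d) = frobM d₁ n₁ →
    ap phiL.hom (frobL m d₁) = frobM d₂ m₂ →
    ap assoc.hom (mulL m₂ n₁) = mulR m₃ n₃ →
    ap assoc.hom (mulL m n) = mulR m₁' n₁' →
    ap phiL.hom (frobL m₁' d) = frobM d₂' m₂' →
    comulMulMul d₂ m₃ n₃ = comulMulMul d₂' m₂' n₁'
  /-- `phiR` and the associator -/
  phiR_assoc : ∀ {a b x y z s t v v' q r r' : C}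
    (m : El M a (x, s)) (m' : El M s (y, t)) (d : El D (t, b) z)
    (d₁ : El D (s, b) v) (m₁ : El M v (y, z)) (d₂ : El D (a, b) v') (m₂ : El M v' (x, v))
    (n : El M a (q, t)) (n' : El M q (x, y)) (d₃ : El D (a, b) r) (m₃ : El M r (q, z))
    (m₄ : El M r (x, r')) (m₅ : El M r' (y, z)),
    ap phiR.hom (frobR m' d) = frobM d₁ m₁ →
    ap phiR.hom (frobR m d₁) = frobM d₂ m₂ →
    ap assoc.hom (mulL n n') = mulR m m' →
    ap phiR.hom (frobR n d) = frobM d₃ m₃ →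
    ap assoc.hom (mulL m₃ n') = mulR m₄ m₅ →
    comulMulMul d₂ m₂ m₁ = comulMulMul d₃ m₄ m₅
  /-- `phiL` and `phiR`, with three inputs -/
  phi_mul : ∀ {a b x y z s t v w r v' w' : C}
    (m : El M a (x, s)) (d : El D (s, t) y) (m' : El M b (t, z))
    (d₁ : El D (a, t) v) (m₁ : El M v (x, y)) (d₂ : El D (a, b) w) (m₂ : El M w (v, z))
    (m₃ : El M w (x, r)) (m₄ : El M r (y, z))
    (d₁' : El D (s, b) v') (m₁' : El M v' (y, z)) (d₂' : El D (a, b) w') (m₂' : El M w' (x, v')),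
    ap phiR.hom (frobR m d) = frobM d₁ m₁ →
    ap phiL.hom (frobL m' d₁) = frobM d₂ m₂ →
    ap assoc.hom (mulL m₂ m₁) = mulR m₃ m₄ →
    ap phiL.hom (frobL m' d) = frobM d₁' m₁' →
    ap phiR.hom (frobR m d₁') = frobM d₂' m₂' →
    comulMulMul d₂ m₃ m₄ = comulMulMul d₂' m₂' m₁'
  /-- `phiR` and the coassociator -/
  phiR_coassoc : ∀ {a b c x y q s v r p p' k : C}
    (d : El D (q, c) y) (d' : El D (s, b) q) (m : El M a (x, s))
    (d₁ : El D (a, b) v) (m₁ : El M v (x, q)) (d₂ : El D (v, c) r) (m₂ : El M r (x, y))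
    (d₃ : El D (a, p) r) (d₄ : El D (b, c) p)
    (f₁ : El D (s, p') y) (f₂ : El D (b, c) p') (d₁' : El D (a, p') k) (m₁' : El M k (x, y)),
    ap phiR.hom (frobR m d') = frobM d₁ m₁ →
    ap phiR.hom (frobR m₁ d) = frobM d₂ m₂ →
    ap coassoc.hom (comulL d₂ d₁) = comulR d₃ d₄ →
    ap coassoc.hom (comulL d d') = comulR f₁ f₂ →
    ap phiR.hom (frobR m f₁) = frobM d₁' m₁' →
    comulComulMul d₃ d₄ m₂ = comulComulMul d₁' f₂ m₁'
  /-- `phiL` and the coassociator -/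
  phiL_coassoc : ∀ {a b c x y q s v p p' k r : C}
    (d : El D (q, s) x) (d' : El D (a, b) q) (m : El M c (s, y))
    (d₁ : El D (q, c) v) (m₁ : El M v (x, y)) (d₂ : El D (a, p) v) (d₃ : El D (b, c) p)
    (f₁ : El D (a, p') x) (f₂ : El D (b, s) p') (d₁' : El D (b, c) k) (m₁' : El M k (p', y))
    (d₂' : El D (a, k) r) (m₂' : El M r (x, y)),
    ap phiL.hom (frobL m d) = frobM d₁ m₁ →
    ap coassoc.hom (comulL d₁ d') = comulR d₂ d₃ →
    ap coassoc.hom (comulL d d') = comulR f₁ f₂ →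
    ap phiL.hom (frobL m f₂) = frobM d₁' m₁' →
    ap phiL.hom (frobL m₁' f₁) = frobM d₂' m₂' →
    comulComulMul d₂ d₃ m₁ = comulComulMul d₂' d₁' m₂'
  /-- `phiL` and `phiR`, with three outputs -/
  phi_comul : ∀ {a b c x y s t v r p k r' : C}
    (d : El D (a, s) x) (m : El M b (s, t)) (d' : El D (t, c) y)
    (d₁ : El D (a, b) v) (m₁ : El M v (x, t)) (d₂ : El D (v, c) r) (m₂ : El M r (x, y))
    (d₃ : El D (a, p) r) (d₄ : El D (b, c) p)
    (d₁' : El D (b, c) k) (m₁' : El M k (s, y)) (d₂' : El D (a, k) r') (m₂' : El M r' (x, y)),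
    ap phiL.hom (frobL m d) = frobM d₁ m₁ →
    ap phiR.hom (frobR m₁ d') = frobM d₂ m₂ →
    ap coassoc.hom (comulL d₂ d₁) = comulR d₃ d₄ →
    ap phiR.hom (frobR m d') = frobM d₁' m₁' →
    ap phiL.hom (frobL m₁' d) = frobM d₂' m₂' →
    comulComulMul d₃ d₄ m₂ = comulComulMul d₂' d₁' m₂'

/-- A right-adjoint Frobenius pseudomonoid in **Prof**: a Frobenius pseudomonoid with right
adjoints of the multiplication and of the unit. -/
structure RightAdjointFrobenius extends FrobeniusPseudomonoid C where
  /-- the right adjoint of the multiplication -/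
  Mr : Profunctor.{u} C (C × C)
  /-- the right adjoint of the unit -/
  Hr : Profunctor.{u} C One
  /-- the adjunction for the multiplication -/
  adjM : Adj M Mr
  /-- the adjunction for the unit -/
  adjH : Adj H Hr

end Presentations

/-! ### Derived 1-cells and 2-cells -/

section Derived

variable {C : Type u} [SmallCategory C]

/-- The Frobenius cup `ε ⋄ μ`. -/
def cup (F : FrobeniusPseudomonoid C) : Profunctor.{u} (C × C) One := comp F.E F.M

/-- The Frobenius cap `Δ ⋄ η`. -/
def cap (F : FrobeniusPseudomonoid C) : Profunctor.{u} One (C × C) := comp F.D F.H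

/-- The class of a tuple in the cup. -/
def cupMk {F : FrobeniusPseudomonoid C} {x y s : C} (e : El F.E pt s) (m : El F.M s (x, y)) :
    El (cup F) pt (x, y) := mk (G := F.E) (F := F.M) e m

/-- The class of a tuple in the cap. -/
def capMk {F : FrobeniusPseudomonoid C} {x y t : C} (d : El F.D (x, y) t) (n : El F.H t pt) :
    El (cap F) (x, y) pt := mk (G := F.D) (F := F.H) d n

/-- The rearrangement of wires `(a, b, p, q, z) ↦ (b, p, a, q, z)`. -/
def nest (C : Type u) [SmallCategory C] :
    (C × C) × ((C × C) × C) ⥤ ((C × C) × (C × C)) × C where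
  obj w := (((w.1.2, w.2.1.1), (w.1.1, w.2.1.2)), w.2.2)
  map f := Prod.mkHom (Prod.mkHom (Prod.mkHom f.1.2 f.2.1.1) (Prod.mkHom f.1.1 f.2.1.2)) f.2.2

/-- The rearrangement of wires `(b, y, x) ↦ (b, x, y)`, which uses the symmetry of **Prof**. -/
def swap (C : Type u) [SmallCategory C] : C × (C × C) ⥤ (C × C) × C where
  obj w := ((w.1, w.2.2), w.2.1)
  map f := Prod.mkHom (Prod.mkHom f.1 f.2.2) f.2.1

variable (F : RightAdjointFrobenius C)

/-- The derived 1-cell `⊗ : C ⊠ C ⇸ C`: the right adjoint `μ*` of the multiplication with all three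
legs bent by the Frobenius cup and cap.  Its input `(a, b)` is followed by a cap `(r, z)`; then `μ*`
is applied to `r`, giving `(p, q)`, and the nested cups join `b` to `p` and `a` to `q`, leaving the
output `z`. -/
def Ten : Profunctor.{u} (C × C) C :=
  comp ((tensor (tensor (cup F.toFrobeniusPseudomonoid) (cup F.toFrobeniusPseudomonoid))
      (idP C)).whiskerLeft₂ (nest C) (Prod.sectR (pt, pt) C))
    (comp (tensor (idP (C × C)) (tensor F.Mr (idP C)))
      ((tensor (idP (C × C)) (cap F.toFrobeniusPseudomonoid)).whiskerLeft₂
        (Prod.sectL (C × C) pt) (𝟭 ((C × C) × (C × C)))))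

/-- The derived 1-cell `I : 1 ⇸ C`: the right adjoint `η*` of the unit bent by the Frobenius
cap. -/
def Uni : Profunctor.{u} One C :=
  (comp (tensor F.Hr (idP C)) (cap F.toFrobeniusPseudomonoid)).whiskerLeft₂ (𝟭 One)
    (Prod.sectR pt C)

variable {F}

/-- The class of a tuple in the derived 1-cell `⊗`. -/
def tenMk {a b z p q r s₁ s₂ t : C} (e₁ : El F.E pt s₁) (m₁ : El F.M s₁ (b, p))
    (e₂ : El F.E pt s₂) (m₂ : El F.M s₂ (a, q)) (w : El F.Mr (p, q) r) (d : El F.D (r, z) t)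
    (n : El F.H t pt) : El (Ten F) z (a, b) :=
  mk (G := (tensor (tensor (cup F.toFrobeniusPseudomonoid) (cup F.toFrobeniusPseudomonoid))
      (idP C)).whiskerLeft₂ (nest C) (Prod.sectR (pt, pt) C))
    (F := comp (tensor (idP (C × C)) (tensor F.Mr (idP C)))
      ((tensor (idP (C × C)) (cap F.toFrobeniusPseudomonoid)).whiskerLeft₂
        (Prod.sectL (C × C) pt) (𝟭 ((C × C) × (C × C)))))
    (b := ((a, b), ((p, q), z))) ((cupMk e₁ m₁, cupMk e₂ m₂), 𝟙 z)
    (mk (G := tensor (idP (C × C)) (tensor F.Mr (idP C)))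
      (F := (tensor (idP (C × C)) (cap F.toFrobeniusPseudomonoid)).whiskerLeft₂
        (Prod.sectL (C × C) pt) (𝟭 ((C × C) × (C × C))))
      (b := ((a, b), (r, z))) (𝟙 (a, b), (w, 𝟙 z)) (𝟙 (a, b), capMk d n))

/-- The class of a tuple in the derived 1-cell `I`. -/
def uniMk {z r t : C} (w : El F.Hr pt r) (d : El F.D (r, z) t) (n : El F.H t pt) :
    El (Uni F) z pt :=
  mk (G := tensor F.Hr (idP C)) (F := cap F.toFrobeniusPseudomonoid) (d := (pt, z)) (b := (r, z))
    (w, 𝟙 z) (capMk d n)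

/-- The snake 2-cell `(cup ⊠ 1) ⋄ (1 ⊠ cap) ⇒ 1`, evaluated on a tuple: apply the right Frobenius
2-cell, the left counitor and the right unitor. -/
def Snake {z x r s t : C} (e : El F.E pt s) (m : El F.M s (x, r)) (d : El F.D (r, z) t)
    (n : El F.H t pt) (f : z ⟶ x) : Prop :=
  ∃ (v : C) (d' : El F.D (s, z) v) (m' : El F.M v (x, t)),
    ap F.phiR.hom (frobR m d) = frobM d' m' ∧
    f = (ap F.counitL.hom (counL d' e) : z ⟶ v) ≫ (ap F.unitR.hom (unR m' n) : v ⟶ x)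

/-- The counit `⊗ ⋄ Δ ⇒ 1` of the derived adjunction `⊗ ⊣ Δ`, evaluated on elements: remove the cup
at `b` by the left Frobenius 2-cell and the right counitor, merge with the cup at `a` by the
associator, apply the counit of `μ ⊣ μ*`, and straighten the remaining snake. -/
def TenCounit {a b x z : C} (τ : El (Ten F) z (a, b)) (δ : El F.D (a, b) x) (f : z ⟶ x) : Prop :=
  ∃ (p q r s₁ s₂ t v u : C) (e₁ : El F.E pt s₁) (m₁ : El F.M s₁ (b, p))
    (e₂ : El F.E pt s₂) (m₂ : El F.M s₂ (a, q)) (w : El F.Mr (p, q) r) (d : El F.D (r, z) t)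
    (n : El F.H t pt) (d' : El F.D (a, s₁) v) (m' : El F.M v (x, p))
    (m₃ : El F.M s₂ (x, u)) (m₄ : El F.M u (p, q)),
    τ = tenMk e₁ m₁ e₂ m₂ w d n ∧
    ap F.phiL.hom (frobL m₁ δ) = frobM d' m' ∧
    ap F.assoc.hom (mulL m₂ (act F.M (ap F.counitR.hom (counR d' e₁) : a ⟶ v) (𝟙 (x, p)) m')) =
      mulR m₃ m₄ ∧
    Snake e₂ (act F.M (𝟙 s₂) (Prod.mkHom (𝟙 x) (ap F.adjM.counit (mk m₄ w) : u ⟶ r)) m₃) d n f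

/-- The counit `I ⋄ ε ⇒ 1` of the derived adjunction `I ⊣ ε`, evaluated on elements: introduce a
unit by the inverse right unitor, apply the counit of `η ⊣ η*`, and straighten the snake. -/
def UniCounit {x z : C} (ι : El (Uni F) z pt) (e : El F.E pt x) (f : z ⟶ x) : Prop :=
  ∃ (r t u : C) (w : El F.Hr pt r) (d : El F.D (r, z) t) (n : El F.H t pt)
    (m : El F.M x (x, u)) (n' : El F.H u pt),
    ι = uniMk w d n ∧
    (ap F.unitR.hom (unR m n') : x ⟶ x) = 𝟙 x ∧
    Snake e (act F.M (𝟙 x) (Prod.mkHom (𝟙 x) (ap F.adjH.counit (mk n' w) : u ⟶ r)) m) d n f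

/-- The associator `⊗ ⋄ (1 ⊠ ⊗) ⇒ ⊗ ⋄ (⊗ ⊠ 1)` of the derived tensor product, which is the mate of
the coassociator under the derived adjunction: `(τ₁, τ₂)` corresponds to `(τ₃, τ₄)` if they pair in
the same way with elements that correspond to each other under the coassociator. -/
def TenAssoc {b p q z s s' : C} (τ₁ : El (Ten F) z (b, s)) (τ₂ : El (Ten F) s (p, q))
    (τ₃ : El (Ten F) z (s', q)) (τ₄ : El (Ten F) s' (b, p)) : Prop :=
  ∀ {x t t' : C} (δ₁ : El F.D (t', q) x) (δ₂ : El F.D (b, p) t') (δ₃ : El F.D (b, t) x)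
    (δ₄ : El F.D (p, q) t) (k : s ⟶ t) (k' : s' ⟶ t') (l l' : z ⟶ x),
    ap F.coassoc.hom (comulL δ₁ δ₂) = comulR δ₃ δ₄ →
    TenCounit τ₂ δ₄ k → TenCounit (act (Ten F) (𝟙 z) (Prod.mkHom (𝟙 b) k) τ₁) δ₃ l →
    TenCounit τ₄ δ₂ k' → TenCounit (act (Ten F) (𝟙 z) (Prod.mkHom k' (𝟙 q)) τ₃) δ₁ l' →
    l = l'

variable (F)

/-- The rotated source of the trace, `μ ⋄ (⊗ ⊠ 1) ⋄ (1 ⊠ (symmetry ⋄ Δ ⋄ η)) : C ⇸ C`: next to the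
input `b` a Frobenius cap `(y, x)` is created and crossed, `x` is tensored on the right of `b`, and
the result is multiplied with `y`.  No cup or cap of the compact structure of **Prof** is used. -/
def Loop : Profunctor.{u} C C :=
  comp F.M (comp ((tensor (Ten F) (idP C)).whiskerLeft₂ (swap C) (𝟭 (C × C)))
    ((tensor (idP C) (cap F.toFrobeniusPseudomonoid)).whiskerLeft₂ (Prod.sectL C pt)
      (𝟭 (C × (C × C)))))

variable {F}

/-- The class of a tuple in the rotated source of the trace. -/
def loopMk {a b w x y t : C} (m : El F.M a (w, y)) (τ : El (Ten F) w (b, x))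
    (d : El F.D (y, x) t) (n : El F.H t pt) : El (Loop F) a b :=
  mk (G := F.M)
    (F := comp ((tensor (Ten F) (idP C)).whiskerLeft₂ (swap C) (𝟭 (C × C)))
      ((tensor (idP C) (cap F.toFrobeniusPseudomonoid)).whiskerLeft₂ (Prod.sectL C pt)
        (𝟭 (C × (C × C))))) (b := (w, y)) m
    (mk (G := (tensor (Ten F) (idP C)).whiskerLeft₂ (swap C) (𝟭 (C × C)))
      (F := (tensor (idP C) (cap F.toFrobeniusPseudomonoid)).whiskerLeft₂ (Prod.sectL C pt)
        (𝟭 (C × (C × C)))) (b := (b, (y, x))) (τ, 𝟙 y) (𝟙 b, capMk d n))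

/-- For a 2-cell `tr : Loop ⇒ 1`, the value `f` of the trace at `a ⊗ x → z → b ⊗ x`, represented by
`δ ∈ Δ((a, x), z)` and `τ ∈ ⊗(z, (b, x))`: the pair is carried to the rotated 1-cell by introducing
a unit with the inverse right unitor and applying the inverse of the right Frobenius 2-cell. -/
def TraceAt (tr : Loop F ⟶ idP C) {a b x z : C} (δ : El F.D (a, x) z) (τ : El (Ten F) z (b, x))
    (f : a ⟶ b) : Prop :=
  ∃ (u y : C) (m₀ : El F.M z (z, u)) (n : El F.H u pt) (m : El F.M a (z, y))
    (d : El F.D (y, x) u),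
    (ap F.unitR.hom (unR m₀ n) : z ⟶ z) = 𝟙 z ∧
    ap F.phiR.hom (frobR m d) = frobM δ m₀ ∧
    f = ap tr (loopMk m τ d n)

end Derived

/-- An interpretation in **Prof**, with underlying object `C`, of the rotational right `⊗`-traced
`*`-autonomous pseudomonoid presentation: a right-adjoint Frobenius pseudomonoid with a 2-cell
`tr : Loop ⇒ 1` satisfying the trace axioms.  (Tightening and sliding are the naturality of `tr` and
the coend relation.) -/
structure Interp (C : Type u) [SmallCategory C] extends RightAdjointFrobenius C where
  /-- the trace 2-cell -/
  tr : Loop toRightAdjointFrobenius ⟶ idP C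
  /-- vanishing for the unit: if the looping wire is cut by `I ⋄ ε ⇒ 1`, the trace is the composite
  of the right (co)unitors of `Δ` and `⊗` -/
  vanishing_unit : ∀ {a b x x' z s : C} (δ : El D (a, x') z) (e : El E pt x')
    (ι : El (Uni toRightAdjointFrobenius) x pt) (τ : El (Ten toRightAdjointFrobenius) z (b, x))
    (k : x ⟶ x') (δ₀ : El D (b, s) b) (e₀ : El E pt s) (k₀ : x ⟶ s) (f : a ⟶ b) (g : z ⟶ b),
    UniCounit ι e k →
    TraceAt tr (act D (Prod.mkHom (𝟙 a) k) (𝟙 z) δ) τ f →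
    (ap counitR.hom (counR δ₀ e₀) : b ⟶ b) = 𝟙 b →
    UniCounit ι e₀ k₀ →
    TenCounit τ (act D (Prod.mkHom (𝟙 b) k₀) (𝟙 b) δ₀) g →
    f = (ap counitR.hom (counR δ e) : a ⟶ z) ≫ g
  /-- vanishing for the tensor product: if the looping wire is split by `⊗ ⋄ Δ ⇒ 1`, the trace is
  obtained by tracing the two resulting wires one after the other -/
  vanishing_tensor : ∀ {a b p q x x' z r r' : C}
    (δ₁ : El D (a, x) z) (δ₂ : El D (p, q) x)
    (τ₁ : El (Ten toRightAdjointFrobenius) z (b, x'))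
    (τ₂ : El (Ten toRightAdjointFrobenius) x' (p, q))
    (δ₃ : El D (r, q) z) (δ₄ : El D (a, p) r)
    (τ₃ : El (Ten toRightAdjointFrobenius) z (r', q))
    (τ₄ : El (Ten toRightAdjointFrobenius) r' (b, p))
    (k : x' ⟶ x) (f f' : a ⟶ b) (g : r ⟶ r'),
    TenCounit τ₂ δ₂ k →
    TraceAt tr δ₁ (act (Ten toRightAdjointFrobenius) (𝟙 z) (Prod.mkHom (𝟙 b) k) τ₁) f →
    ap coassoc.hom (comulL δ₃ δ₄) = comulR δ₁ δ₂ →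
    TenAssoc τ₁ τ₂ τ₃ τ₄ →
    TraceAt tr δ₃ τ₃ g →
    TraceAt tr (act D (𝟙 (a, p)) g δ₄) τ₄ f' →
    f = f'
  /-- superposing: tensoring with `c` on the left commutes with the trace.  Here
  `(δ', τ')` represents `r ⊗ x → (c ⊗ a) ⊗ x → c ⊗ z → (c ⊗ b) ⊗ x → v ⊗ x`, for
  `τ₀ : r → c ⊗ a` and `δ₀ : c ⊗ b → v`, as is tested by all `v ⊗ x → w` -/
  superposing : ∀ {a b c x z r v z' : C}
    (δ : El D (a, x) z) (τ : El (Ten toRightAdjointFrobenius) z (b, x)) (f : a ⟶ b)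
    (τ₀ : El (Ten toRightAdjointFrobenius) r (c, a)) (δ₀ : El D (c, b) v)
    (δ' : El D (r, x) z') (τ' : El (Ten toRightAdjointFrobenius) z' (v, x)) (l l' : r ⟶ v),
    TraceAt tr δ τ f →
    TenCounit τ₀ (act D (Prod.mkHom (𝟙 c) f) (𝟙 v) δ₀) l →
    (∀ {w s t : C} (d : El D (v, x) w) (d₁ : El D (c, s) w) (d₂ : El D (b, x) s)
      (f₁ : El D (t, x) w) (f₂ : El D (c, a) t) (k : z' ⟶ w) (k₂ : z ⟶ s) (k₃ : r ⟶ t),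
      ap coassoc.hom (comulL d δ₀) = comulR d₁ d₂ →
      TenCounit τ d₂ k₂ →
      ap coassoc.hom (comulL f₁ f₂) = comulR d₁ (act D (𝟙 (a, x)) k₂ δ) →
      TenCounit τ₀ f₂ k₃ →
      TenCounit τ' d k →
      act D (𝟙 (r, x)) k δ' = act D (Prod.mkHom k₃ (𝟙 x)) (𝟙 w) f₁) →
    TraceAt tr δ' τ' l' →
    l = l'

/-! ### The category of interpretations with a given underlying object -/

section Hom

variable {C : Type u} [SmallCategory C]

/-- An isomorphism of interpretations over `C`: invertible 2-cells between the generating 1-cells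
that commute with all generating 2-cells. -/
@[ext]
structure InterpHom (I J : Interp C) where
  /-- the component at `μ` -/
  M : I.M ≅ J.M
  /-- the component at `η` -/
  H : I.H ≅ J.H
  /-- the component at `Δ` -/
  D : I.D ≅ J.D
  /-- the component at `ε` -/
  E : I.E ≅ J.E
  /-- the component at `μ*` -/
  Mr : I.Mr ≅ J.Mr
  /-- the component at `η*` -/
  Hr : I.Hr ≅ J.Hr
  assoc : ∀ {x y z w t t' : C} (m : El I.M w (t, z)) (m' : El I.M t (x, y))
    (n : El I.M w (x, t')) (n' : El I.M t' (y, z)),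
    ap I.assoc.hom (mulL m m') = mulR n n' →
    ap J.assoc.hom (mulL (ap M.hom m) (ap M.hom m')) = mulR (ap M.hom n) (ap M.hom n')
  unitL : ∀ {x z t : C} (m : El I.M z (t, x)) (n : El I.H t pt),
    (ap J.unitL.hom (unL (ap M.hom m) (ap H.hom n)) : z ⟶ x) = ap I.unitL.hom (unL m n)
  unitR : ∀ {x z t : C} (m : El I.M z (x, t)) (n : El I.H t pt),
    (ap J.unitR.hom (unR (ap M.hom m) (ap H.hom n)) : z ⟶ x) = ap I.unitR.hom (unR m n)
  coassoc : ∀ {a b c x t t' : C} (d : El I.D (t, c) x) (d' : El I.D (a, b) t)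
    (f : El I.D (a, t') x) (f' : El I.D (b, c) t'),
    ap I.coassoc.hom (comulL d d') = comulR f f' →
    ap J.coassoc.hom (comulL (ap D.hom d) (ap D.hom d')) = comulR (ap D.hom f) (ap D.hom f')
  counitL : ∀ {a x t : C} (d : El I.D (t, a) x) (e : El I.E pt t),
    (ap J.counitL.hom (counL (ap D.hom d) (ap E.hom e)) : a ⟶ x) = ap I.counitL.hom (counL d e)
  counitR : ∀ {a x t : C} (d : El I.D (a, t) x) (e : El I.E pt t),
    (ap J.counitR.hom (counR (ap D.hom d) (ap E.hom e)) : a ⟶ x) = ap I.counitR.hom (counR d e)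
  phiL : ∀ {a b x y t v : C} (m : El I.M b (t, y)) (d : El I.D (a, t) x)
    (d' : El I.D (a, b) v) (m' : El I.M v (x, y)),
    ap I.phiL.hom (frobL m d) = frobM d' m' →
    ap J.phiL.hom (frobL (ap M.hom m) (ap D.hom d)) = frobM (ap D.hom d') (ap M.hom m')
  phiR : ∀ {a b x y t v : C} (m : El I.M a (x, t)) (d : El I.D (t, b) y)
    (d' : El I.D (a, b) v) (m' : El I.M v (x, y)),
    ap I.phiR.hom (frobR m d) = frobM d' m' →
    ap J.phiR.hom (frobR (ap M.hom m) (ap D.hom d)) = frobM (ap D.hom d') (ap M.hom m')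
  unitM : ∀ {x y t : C} (w : El I.Mr (x, y) t) (m : El I.M t (x, y)),
    ap I.adjM.unit (b := (x, y)) (a := (x, y)) (𝟙 (x, y)) = mk w m →
    ap J.adjM.unit (b := (x, y)) (a := (x, y)) (𝟙 (x, y)) = mk (ap Mr.hom w) (ap M.hom m)
  counitM : ∀ {x y s t : C} (m : El I.M s (x, y)) (w : El I.Mr (x, y) t),
    (ap J.adjM.counit (mk (ap M.hom m) (ap Mr.hom w)) : s ⟶ t) = ap I.adjM.counit (mk m w)
  unitH : ∀ {t : C} (w : El I.Hr pt t) (n : El I.H t pt),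
    ap I.adjH.unit (b := pt) (a := pt) (𝟙 pt) = mk w n →
    ap J.adjH.unit (b := pt) (a := pt) (𝟙 pt) = mk (ap Hr.hom w) (ap H.hom n)
  counitH : ∀ {s t : C} (n : El I.H s pt) (w : El I.Hr pt t),
    (ap J.adjH.counit (mk (ap H.hom n) (ap Hr.hom w)) : s ⟶ t) = ap I.adjH.counit (mk n w)
  tr : ∀ {a b o x y t p q r s₁ s₂ t' : C} (m : El I.M a (o, y)) (e₁ : El I.E pt s₁)
    (m₁ : El I.M s₁ (x, p)) (e₂ : El I.E pt s₂) (m₂ : El I.M s₂ (b, q)) (w : El I.Mr (p, q) r)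
    (d : El I.D (r, o) t) (n : El I.H t pt) (d' : El I.D (y, x) t') (n' : El I.H t' pt),
    (ap J.tr (loopMk (ap M.hom m)
      (tenMk (ap E.hom e₁) (ap M.hom m₁) (ap E.hom e₂) (ap M.hom m₂) (ap Mr.hom w)
        (ap D.hom d) (ap H.hom n)) (ap D.hom d') (ap H.hom n')) : a ⟶ b) =
    ap I.tr (loopMk m (tenMk e₁ m₁ e₂ m₂ w d n) d' n')

/-- The identity isomorphism. -/
def InterpHom.id (I : Interp C) : InterpHom I I where
  M := Iso.refl _
  H := Iso.refl _
  D := Iso.refl _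
  E := Iso.refl _
  Mr := Iso.refl _
  Hr := Iso.refl _
  assoc _ _ _ _ h := h
  unitL _ _ := rfl
  unitR _ _ := rfl
  coassoc _ _ _ _ h := h
  counitL _ _ := rfl
  counitR _ _ := rfl
  phiL _ _ _ _ h := h
  phiR _ _ _ _ h := h
  unitM _ _ h := h
  counitM _ _ := rfl
  unitH _ _ h := h
  counitH _ _ := rfl
  tr _ _ _ _ _ _ _ _ _ _ := rfl

/-- Composition of isomorphisms. -/
def InterpHom.comp {I J K : Interp C} (f : InterpHom I J) (g : InterpHom J K) :
    InterpHom I K where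
  M := f.M ≪≫ g.M
  H := f.H ≪≫ g.H
  D := f.D ≪≫ g.D
  E := f.E ≪≫ g.E
  Mr := f.Mr ≪≫ g.Mr
  Hr := f.Hr ≪≫ g.Hr
  assoc _ _ _ _ h := g.assoc _ _ _ _ (f.assoc _ _ _ _ h)
  unitL _ _ := (g.unitL _ _).trans (f.unitL _ _)
  unitR _ _ := (g.unitR _ _).trans (f.unitR _ _)
  coassoc _ _ _ _ h := g.coassoc _ _ _ _ (f.coassoc _ _ _ _ h)
  counitL _ _ := (g.counitL _ _).trans (f.counitL _ _)
  counitR _ _ := (g.counitR _ _).trans (f.counitR _ _)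
  phiL _ _ _ _ h := g.phiL _ _ _ _ (f.phiL _ _ _ _ h)
  phiR _ _ _ _ h := g.phiR _ _ _ _ (f.phiR _ _ _ _ h)
  unitM _ _ h := g.unitM _ _ (f.unitM _ _ h)
  counitM _ _ := (g.counitM _ _).trans (f.counitM _ _)
  unitH _ _ h := g.unitH _ _ (f.unitH _ _ h)
  counitH _ _ := (g.counitH _ _).trans (f.counitH _ _)
  tr _ _ _ _ _ _ _ _ _ _ :=
    (g.tr _ _ _ _ _ _ _ _ _ _).trans (f.tr _ _ _ _ _ _ _ _ _ _)

instance : Category (Interp C) where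
  Hom := InterpHom
  id := InterpHom.id
  comp := InterpHom.comp
  id_comp f := by apply InterpHom.ext <;> exact Iso.refl_trans _
  comp_id f := by apply InterpHom.ext <;> exact Iso.trans_refl _
  assoc f g h := by apply InterpHom.ext <;> exact Iso.trans_assoc _ _ _

end Hom

end Prof

/-! ### Traced `*`-autonomous categories -/

section StarAutonomous

open MonoidalCategory

variable (C : Type u) [SmallCategory C]

/-- A right trace on a (planar) monoidal category. -/
@[ext]
structure RightTrace [MonoidalCategory C] where
  /-- the trace over `x` -/
  tr : ∀ {a b : C} (x : C), (a ⊗ x ⟶ b ⊗ x) → (a ⟶ b)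
  tightening : ∀ {a a' b b' x : C} (g : a' ⟶ a) (f : a ⊗ x ⟶ b ⊗ x) (h : b ⟶ b'),
    tr x ((g ▷ x) ≫ f ≫ (h ▷ x)) = g ≫ tr x f ≫ h
  sliding : ∀ {a b x y : C} (f : a ⊗ x ⟶ b ⊗ y) (g : y ⟶ x),
    tr x (f ≫ (b ◁ g)) = tr y ((a ◁ g) ≫ f)
  vanishing_unit : ∀ {a b : C} (f : a ⊗ 𝟙_ C ⟶ b ⊗ 𝟙_ C),
    tr (𝟙_ C) f = (ρ_ a).inv ≫ f ≫ (ρ_ b).hom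
  vanishing_tensor : ∀ {a b x y : C} (f : a ⊗ (x ⊗ y) ⟶ b ⊗ (x ⊗ y)),
    tr (x ⊗ y) f = tr x (tr y ((α_ a x y).hom ≫ f ≫ (α_ b x y).inv))
  superposing : ∀ {a b x : C} (c : C) (f : a ⊗ x ⟶ b ⊗ x),
    tr x ((α_ c a x).hom ≫ (c ◁ f) ≫ (α_ c b x).inv) = c ◁ tr x f

variable {C}

/-- A morphism `ev : a ⊗ b ⟶ o` is an exact pairing if it exhibits `b` as the right dual of `a`
(it represents `x ↦ Hom(a ⊗ x, o)`) and `a` as the left dual of `b` (it represents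
`x ↦ Hom(x ⊗ b, o)`). -/
def IsExactPairing [MonoidalCategory C] {o a b : C} (ev : a ⊗ b ⟶ o) : Prop :=
  (∀ x : C, Function.Bijective (fun g : x ⟶ b => (a ◁ g) ≫ ev)) ∧
    (∀ x : C, Function.Bijective (fun f : x ⟶ a => (f ▷ b) ≫ ev))

/-- `o` is a dualizing object of a (nonsymmetric) monoidal category: every object has a right dual
and a left dual relative to `o`, and is canonically both the left dual of its right dual and the
right dual of its left dual. -/
def IsDualizing [MonoidalCategory C] (o : C) : Prop :=
  (∀ a : C, ∃ (b : C) (ev : a ⊗ b ⟶ o), IsExactPairing ev) ∧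
    (∀ b : C, ∃ (a : C) (ev : a ⊗ b ⟶ o), IsExactPairing ev)

variable (C)

/-- The structure of a (nonsymmetric) `*`-autonomous category on `C`, with a right trace for `⊗`. -/
structure TracedStarAut where
  /-- the monoidal structure `⊗`, `I` -/
  mon : MonoidalCategory C
  /-- the dualizing object -/
  bot : C
  dualizing : IsDualizing bot
  /-- the right trace -/
  trace : RightTrace C

variable {C}

/-- An isomorphism of traced `*`-autonomous structures on `C`: a strong monoidal structure on the
identity functor that preserves the trace, and an isomorphism of the dualizing objects. -/
@[ext]
structure TracedStarAutHom (S T : TracedStarAut C) where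
  /-- compatibility with the tensor products -/
  tens : ∀ a b : C, S.mon.tensorObj a b ≅ T.mon.tensorObj a b
  /-- compatibility with the units -/
  unit : S.mon.tensorUnit ≅ T.mon.tensorUnit
  /-- compatibility with the dualizing objects -/
  bot : S.bot ≅ T.bot
  natural : ∀ {a a' b b' : C} (f : a ⟶ a') (g : b ⟶ b'),
    S.mon.tensorHom f g ≫ (tens a' b').hom = (tens a b).hom ≫ T.mon.tensorHom f g
  assoc : ∀ a b c : C,
    S.mon.tensorHom (tens a b).hom (𝟙 c) ≫ (tens (T.mon.tensorObj a b) c).hom ≫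
        (T.mon.associator a b c).hom =
      (S.mon.associator a b c).hom ≫ S.mon.tensorHom (𝟙 a) (tens b c).hom ≫
        (tens a (T.mon.tensorObj b c)).hom
  left : ∀ a : C, S.mon.tensorHom unit.hom (𝟙 a) ≫ (tens T.mon.tensorUnit a).hom ≫
    (T.mon.leftUnitor a).hom = (S.mon.leftUnitor a).hom
  right : ∀ a : C, S.mon.tensorHom (𝟙 a) unit.hom ≫ (tens a T.mon.tensorUnit).hom ≫
    (T.mon.rightUnitor a).hom = (S.mon.rightUnitor a).hom
  trace : ∀ {a b : C} (x : C) (f : S.mon.tensorObj a x ⟶ S.mon.tensorObj b x),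
    @RightTrace.tr C _ T.mon T.trace a b x ((tens a x).inv ≫ f ≫ (tens b x).hom) =
      @RightTrace.tr C _ S.mon S.trace a b x f

/-- The identity isomorphism. -/
def TracedStarAutHom.id (S : TracedStarAut C) : TracedStarAutHom S S where
  tens _ _ := Iso.refl _
  unit := Iso.refl _
  bot := Iso.refl _
  natural _ _ := by simp
  assoc _ _ _ := by let _ := S.mon; simp
  left _ := by let _ := S.mon; simp
  right _ := by let _ := S.mon; simp
  trace _ _ := by simp

/-- Composition of isomorphisms. -/
def TracedStarAutHom.comp {S T U : TracedStarAut C} (f : TracedStarAutHom S T)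
    (g : TracedStarAutHom T U) : TracedStarAutHom S U where
  tens a b := f.tens a b ≪≫ g.tens a b
  unit := f.unit ≪≫ g.unit
  bot := f.bot ≪≫ g.bot
  natural h k := by
    simp only [Iso.trans_hom, Category.assoc]
    rw [← g.natural, reassoc_of% (f.natural h k)]
  assoc a b c := by
    have e₁ : S.mon.tensorHom ((f.tens a b).hom ≫ (g.tens a b).hom) (𝟙 c) =
        S.mon.tensorHom (f.tens a b).hom (𝟙 c) ≫ S.mon.tensorHom (g.tens a b).hom (𝟙 c) := by
      let _ := S.mon; simp
    have e₂ : S.mon.tensorHom (𝟙 a) ((f.tens b c).hom ≫ (g.tens b c).hom) =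
        S.mon.tensorHom (𝟙 a) (f.tens b c).hom ≫ S.mon.tensorHom (𝟙 a) (g.tens b c).hom := by
      let _ := S.mon; simp
    simp only [Iso.trans_hom, e₁, e₂, Category.assoc]
    rw [reassoc_of% (f.natural (g.tens a b).hom (𝟙 c)), g.assoc, reassoc_of% (f.assoc a b c),
      reassoc_of% (f.natural (𝟙 a) (g.tens b c).hom)]
  left a := by
    have e₁ : S.mon.tensorHom (f.unit.hom ≫ g.unit.hom) (𝟙 a) =
        S.mon.tensorHom f.unit.hom (𝟙 a) ≫ S.mon.tensorHom g.unit.hom (𝟙 a) := by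
      let _ := S.mon; simp
    simp only [Iso.trans_hom, e₁, Category.assoc]
    rw [reassoc_of% (f.natural g.unit.hom (𝟙 a)), g.left, f.left]
  right a := by
    have e₁ : S.mon.tensorHom (𝟙 a) (f.unit.hom ≫ g.unit.hom) =
        S.mon.tensorHom (𝟙 a) f.unit.hom ≫ S.mon.tensorHom (𝟙 a) g.unit.hom := by
      let _ := S.mon; simp
    simp only [Iso.trans_hom, e₁, Category.assoc]
    rw [reassoc_of% (f.natural (𝟙 a) g.unit.hom), g.right, f.right]
  trace x h := by
    rw [← f.trace, ← g.trace]
    simp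

instance : Category (TracedStarAut C) where
  Hom := TracedStarAutHom
  id := TracedStarAutHom.id
  comp := TracedStarAutHom.comp
  id_comp f := by
    apply TracedStarAutHom.ext
    · funext a b; exact Iso.refl_trans _
    · exact Iso.refl_trans _
    · exact Iso.refl_trans _
  comp_id f := by
    apply TracedStarAutHom.ext
    · funext a b; exact Iso.trans_refl _
    · exact Iso.trans_refl _
    · exact Iso.trans_refl _
  assoc f g h := by
    apply TracedStarAutHom.ext
    · funext a b; exact Iso.trans_assoc _ _ _
    · exact Iso.trans_assoc _ _ _
    · exact Iso.trans_assoc _ _ _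

/-! ### Representing an interpretation by a traced `*`-autonomous category -/

open Prof

/-- The interpretation `I` is represented by the `*`-autonomous structure with tensor product `⊗`,
unit `I`, dualizing object `o` and right trace `θ`: the comultiplication and the counit of `I` are
corepresented by `⊗` and the tensor unit, the unit of `I` is represented by `o`, the multiplication
by the par product `⅋`, the derived 1-cells by `⊗` and the tensor unit, the coassociator and the
counitors are the associator and the unitors of `⊗`, and the trace 2-cell is `θ`. -/
structure Represents (I : Interp C) [MonoidalCategory C] (o : C) (θ : RightTrace C) where
  /-- `Δ((a, b), x) ≃ Hom(a ⊗ b, x)` -/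
  D : ∀ {a b x : C}, El I.D (a, b) x ≃ (a ⊗ b ⟶ x)
  /-- `ε(x) ≃ Hom(I, x)` -/
  E : ∀ {x : C}, El I.E pt x ≃ (𝟙_ C ⟶ x)
  /-- `η(z) ≃ Hom(z, o)` -/
  H : ∀ {z : C}, El I.H z pt ≃ (z ⟶ o)
  /-- the derived 1-cell `⊗` satisfies `⊗(z, (a, b)) ≃ Hom(z, a ⊗ b)` -/
  T : ∀ {a b z : C}, El (Ten I.toRightAdjointFrobenius) z (a, b) ≃ (z ⟶ a ⊗ b)
  /-- the derived 1-cell `I` satisfies `I(z) ≃ Hom(z, I)` -/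
  U : ∀ {z : C}, El (Uni I.toRightAdjointFrobenius) z pt ≃ (z ⟶ 𝟙_ C)
  D_act : ∀ {a a' b b' x x' : C} (f : a' ⟶ a) (g : b' ⟶ b) (h : x ⟶ x') (d : El I.D (a, b) x),
    D (act I.D (Prod.mkHom f g) h d) = (f ⊗ₘ g) ≫ D d ≫ h
  E_act : ∀ {x x' : C} (h : x ⟶ x') (e : El I.E pt x), E (act I.E (𝟙 pt) h e) = E e ≫ h
  H_act : ∀ {z z' : C} (h : z' ⟶ z) (n : El I.H z pt), H (act I.H h (𝟙 pt) n) = h ≫ H n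
  T_act : ∀ {a a' b b' z z' : C} (f : a ⟶ a') (g : b ⟶ b') (h : z' ⟶ z)
    (τ : El (Ten I.toRightAdjointFrobenius) z (a, b)),
    T (act (Ten I.toRightAdjointFrobenius) h (Prod.mkHom f g) τ) = h ≫ T τ ≫ (f ⊗ₘ g)
  U_act : ∀ {z z' : C} (h : z' ⟶ z) (ι : El (Uni I.toRightAdjointFrobenius) z pt),
    U (act (Uni I.toRightAdjointFrobenius) h (𝟙 pt) ι) = h ≫ U ι
  T_counit : ∀ {a b x z : C} (τ : El (Ten I.toRightAdjointFrobenius) z (a, b))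
    (d : El I.D (a, b) x) (f : z ⟶ x), TenCounit τ d f ↔ f = T τ ≫ D d
  U_counit : ∀ {x z : C} (ι : El (Uni I.toRightAdjointFrobenius) z pt)
    (e : El I.E pt x) (f : z ⟶ x), UniCounit ι e f ↔ f = U ι ≫ E e
  coassoc : ∀ {a b c x t t' : C} (d : El I.D (t, c) x) (d' : El I.D (a, b) t)
    (f : El I.D (a, t') x) (f' : El I.D (b, c) t'),
    ap I.coassoc.hom (comulL d d') = comulR f f' →
    (α_ a b c).hom ≫ (a ◁ D f') ≫ D f = (D d' ▷ c) ≫ D d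
  counitL : ∀ {a x t : C} (d : El I.D (t, a) x) (e : El I.E pt t),
    (ap I.counitL.hom (counL d e) : a ⟶ x) = (λ_ a).inv ≫ (E e ▷ a) ≫ D d
  counitR : ∀ {a x t : C} (d : El I.D (a, t) x) (e : El I.E pt t),
    (ap I.counitR.hom (counR d e) : a ⟶ x) = (ρ_ a).inv ≫ (a ◁ E e) ≫ D d
  /-- `μ` is represented by `⅋`: if `y'` is the right dual of `y`, then
  `μ(z, (x, y)) ≃ Hom(z ⊗ y', x)`, by means of the Frobenius structure -/
  par : ∀ {x y y' z : C} (ev : y ⊗ y' ⟶ o), IsExactPairing ev → ∀ g : z ⊗ y' ⟶ x,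
    ∃! m : El I.M z (x, y), ∃ (v : C) (d : El I.D (z, y') v) (m' : El I.M v (x, o)),
      ap I.phiR.hom (frobR m (D.symm ev)) = frobM d m' ∧
      D d ≫ (ap I.unitR.hom (unR m' (H.symm (𝟙 o))) : v ⟶ x) = g
  trace : ∀ {a b x z : C} (d : El I.D (a, x) z)
    (τ : El (Ten I.toRightAdjointFrobenius) z (b, x)) (f : a ⟶ b),
    TraceAt I.tr d τ f ↔ f = θ.tr x (D d ≫ T τ)

/-- `I` is represented by the traced `*`-autonomous structure `S`. -/
abbrev RepresentedBy (I : Interp C) (S : TracedStarAut C) : Type u :=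
  @Represents C _ I S.mon S.bot S.trace

/-- An isomorphism of interpretations and an isomorphism of traced `*`-autonomous structures
correspond to each other under given representations. -/
def Corresponds {I J : Interp C} {S T : TracedStarAut C} (r : RepresentedBy I S)
    (r' : RepresentedBy J T) (f : InterpHom I J) (g : TracedStarAutHom S T) : Prop :=
  (∀ {a b x : C} (d : El I.D (a, b) x),
      @Represents.D C _ I S.mon S.bot S.trace r a b x d =
        (g.tens a b).hom ≫ @Represents.D C _ J T.mon T.bot T.trace r' a b x (ap f.D.hom d)) ∧
    (∀ {x : C} (e : El I.E pt x),
      @Represents.E C _ I S.mon S.bot S.trace r x e =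
        g.unit.hom ≫ @Represents.E C _ J T.mon T.bot T.trace r' x (ap f.E.hom e)) ∧
    (∀ {z : C} (n : El I.H z pt),
      @Represents.H C _ J T.mon T.bot T.trace r' z (ap f.H.hom n) =
        @Represents.H C _ I S.mon S.bot S.trace r z n ≫ g.bot.hom)

end StarAutonomous

namespace Prof

section Calculus

variable {A B D E A' B' : Type u} [SmallCategory A] [SmallCategory B] [SmallCategory D]
  [SmallCategory E] [SmallCategory A'] [SmallCategory B']

theorem ap_act {P Q : Profunctor.{u} A B} (θ : P ⟶ Q) {b b' : B} {a a' : A} (g : b' ⟶ b)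
    (f : a ⟶ a') (p : El P b a) : ap θ (act P g f p) = act Q g f (ap θ p) := by
  simp only [ap, act]
  have h₁ := ConcreteCategory.congr_hom (congrArg (fun t => t.app (op b')) (θ.naturality f))
    ((P.obj a).map g.op p)
  have h₂ := ConcreteCategory.congr_hom ((θ.app a).naturality g.op) p
  simp only [NatTrans.comp_app, CategoryTheory.comp_apply] at h₁ h₂
  rw [h₁, h₂]

@[simp]
theorem ap_hom_inv {P Q : Profunctor.{u} A B} (i : P ≅ Q) {b : B} {a : A} (p : El P b a) :
    ap i.inv (ap i.hom p) = p := by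
  rw [← ap_comp, i.hom_inv_id, ap_id]

@[simp]
theorem ap_inv_hom {P Q : Profunctor.{u} A B} (i : P ≅ Q) {b : B} {a : A} (q : El Q b a) :
    ap i.hom (ap i.inv q) = q := by
  rw [← ap_comp, i.inv_hom_id, ap_id]

theorem ap_hom_injective {P Q : Profunctor.{u} A B} (i : P ≅ Q) {b : B} {a : A} :
    Function.Injective (fun p : El P b a => ap i.hom p) :=
  Function.LeftInverse.injective (g := fun q => ap i.inv q) (ap_hom_inv i)

theorem act_idP {a a' b b' : A} (g : b' ⟶ b) (f : a ⟶ a') (p : b ⟶ a) :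
    act (idP A) g f p = g ≫ p ≫ f := by
  change ((Profunctor.id.map f).app (op b')) ((Profunctor.id.obj a).map g.op p) = _
  simp only [Profunctor.id_map_app, Profunctor.id_obj_map]
  exact (Category.assoc g p f)

/-- A morphism as an element of the identity profunctor. -/
def hel {a b : A} (f : b ⟶ a) : El (idP A) b a := f

theorem act_hel {a a' b b' : A} (g : b' ⟶ b) (f : a ⟶ a') (p : b ⟶ a) :
    act (idP A) g f (hel p) = hel (g ≫ p ≫ f) :=
  act_idP g f p

/-- A pair of elements as an element of the monoidal product. -/
def tmk {P : Profunctor.{u} A B} {Q : Profunctor.{u} A' B'} {b : B} {b' : B'} {a : A} {a' : A'}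
    (p : El P b a) (q : El Q b' a') : El (tensor P Q) (b, b') (a, a') := (p, q)

theorem act_comp_mk (G : Profunctor.{u} B D) (F : Profunctor.{u} A B) {d d' : D} {a a' : A}
    {b : B} (g : d' ⟶ d) (f : a ⟶ a') (x : El G d b) (y : El F b a) :
    act (comp G F) g f (mk x y) = mk (act G g (𝟙 b) x) (act F (𝟙 b) f y) := by
  change mk (act G (𝟙 _) (𝟙 _) (act G g (𝟙 _) x)) (act F (𝟙 _) f (act F (𝟙 _) (𝟙 _) y)) = _
  simp only [act_id]

/-- The first component of an element of a monoidal product. -/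
def tfst {P : Profunctor.{u} A B} {Q : Profunctor.{u} A' B'} {b : B × B'} {a : A × A'}
    (t : El (tensor P Q) b a) : El P b.1 a.1 := t.1

/-- The second component of an element of a monoidal product. -/
def tsnd {P : Profunctor.{u} A B} {Q : Profunctor.{u} A' B'} {b : B × B'} {a : A × A'}
    (t : El (tensor P Q) b a) : El Q b.2 a.2 := t.2

/-- The morphism given by an element of the identity profunctor. -/
def uhel {a b : A} (f : El (idP A) b a) : b ⟶ a := f

@[simp] theorem uhel_hel {a b : A} (f : b ⟶ a) : uhel (hel f) = f := rfl

@[simp] theorem tfst_tmk {P : Profunctor.{u} A B} {Q : Profunctor.{u} A' B'} {b : B} {b' : B'}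
    {a : A} {a' : A'} (p : El P b a) (q : El Q b' a') : tfst (tmk p q) = p := rfl

@[simp] theorem tsnd_tmk {P : Profunctor.{u} A B} {Q : Profunctor.{u} A' B'} {b : B} {b' : B'}
    {a : A} {a' : A'} (p : El P b a) (q : El Q b' a') : tsnd (tmk p q) = q := rfl

theorem exists_tmk {P : Profunctor.{u} A B} {Q : Profunctor.{u} A' B'} {b : B} {b' : B'} {a : A}
    {a' : A'} (t : El (tensor P Q) (b, b') (a, a')) :
    ∃ (p : El P b a) (q : El Q b' a'), t = tmk p q := ⟨t.1, t.2, rfl⟩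

theorem exists_tmk_hel {P : Profunctor.{u} A B} {b : B} {b' : A'} {a : A}
    {a' : A'} (t : El (tensor P (idP A')) (b, b') (a, a')) :
    ∃ (p : El P b a) (q : b' ⟶ a'), t = tmk p (hel q) := ⟨t.1, t.2, rfl⟩

theorem exists_hel_tmk {P : Profunctor.{u} A B} {b : B} {b' : A'} {a : A}
    {a' : A'} (t : El (tensor (idP A') P) (b', b) (a', a)) :
    ∃ (q : b' ⟶ a') (p : El P b a), t = tmk (hel q) p := ⟨t.1, t.2, rfl⟩

theorem act_tmk {P : Profunctor.{u} A B} {Q : Profunctor.{u} A' B'} {b₁ b₂ : B} {b₁' b₂' : B'}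
    {a₁ a₂ : A} {a₁' a₂' : A'} (g : (b₂, b₂') ⟶ (b₁, b₁')) (f : (a₁, a₁') ⟶ (a₂, a₂'))
    (p : El P b₁ a₁) (q : El Q b₁' a₁') :
    act (tensor P Q) g f (tmk p q) = tmk (act P g.1 f.1 p) (act Q g.2 f.2 q) := by
  change tmk (act P (𝟙 _) f.1 (act P g.1 (𝟙 _) p)) (act Q (𝟙 _) f.2 (act Q g.2 (𝟙 _) q)) = _
  simp only [act_act, Category.id_comp]

theorem mk_slide {G : Profunctor.{u} B D} {F : Profunctor.{u} A B} {d : D} {a : A} {b b' : B}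
    (g : El G d b) (k : b ⟶ b') (f : El F b' a) :
    mk (act G (𝟙 d) k g) f = mk g (act F k (𝟙 a) f) :=
  Quot.sound (Slide.intro g k f)

theorem exists_mk {G : Profunctor.{u} B D} {F : Profunctor.{u} A B} {d : D} {a : A}
    (p : El (comp G F) d a) : ∃ (b : B) (g : El G d b) (f : El F b a), mk g f = p := by
  induction p using Quot.ind with
  | mk p => exact ⟨p.mid, p.outer, p.inner, rfl⟩

/-- The universal property of a composite. -/
def compLift {G : Profunctor.{u} B D} {F : Profunctor.{u} A B} {d : D} {a : A} {X : Sort*}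
    (φ : ∀ {b : B}, El G d b → El F b a → X)
    (h : ∀ {b b' : B} (g : El G d b) (k : b ⟶ b') (f : El F b' a),
      φ (act G (𝟙 d) k g) f = φ g (act F k (𝟙 a) f)) : El (comp G F) d a → X :=
  Quot.lift (fun p => φ p.outer p.inner) (by rintro _ _ ⟨g, k, f⟩; exact h g k f)

/-- A natural relation that is bijective on elements is an isomorphism. -/
theorem exists_iso_of_rel {P Q : Profunctor.{u} A B}
    (R : ∀ {b : B} {a : A}, El P b a → El Q b a → Prop)
    (hR : ∀ {b b' : B} {a a' : A} (g : b' ⟶ b) (f : a ⟶ a') (p : El P b a) (q : El Q b a),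
      R p q → R (act P g f p) (act Q g f q))
    (h₁ : ∀ {b : B} {a : A} (p : El P b a), ∃! q : El Q b a, R p q)
    (h₂ : ∀ {b : B} {a : A} (q : El Q b a), ∃! p : El P b a, R p q) :
    ∃ i : P ≅ Q, ∀ {b : B} {a : A} (p : El P b a) (q : El Q b a), ap i.hom p = q ↔ R p q := by
  choose F hF hF' using fun (b : B) (a : A) (p : El P b a) => (h₁ p)
  choose G hG hG' using fun (b : B) (a : A) (q : El Q b a) => (h₂ q)
  have natF : ∀ {b b' : B} {a a' : A} (g : b' ⟶ b) (f : a ⟶ a') (p : El P b a),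
      F b' a' (act P g f p) = act Q g f (F b a p) := fun g f p =>
    (hF' _ _ _ _ (hR g f _ _ (hF _ _ p))).symm
  have FG : ∀ b a q, F b a (G b a q) = q := fun b a q => (hF' _ _ _ _ (hG b a q)).symm
  have GF : ∀ b a p, G b a (F b a p) = p := fun b a p => (hG' _ _ _ _ (hF b a p)).symm
  let i : P ≅ Q := NatIso.ofComponents (fun a => NatIso.ofComponents
      (fun b => Equiv.toIso ⟨F b.unop a, G b.unop a, GF _ _, FG _ _⟩) (by
        intro b b' g
        ext p
        have h := natF g.unop (𝟙 a) p
        simp only [act] at h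
        simpa using h)) (by
      intro a a' f
      ext b p
      have h := natF (𝟙 b.unop) f p
      simp only [act] at h
      simpa using h)
  refine ⟨i, fun {b a} p q => ?_⟩
  have hi : ap i.hom p = F b a p := rfl
  rw [hi]
  exact ⟨fun h => h ▸ hF b a p, fun h => (hF' _ _ _ _ h).symm⟩

end Calculus

section Partial

variable {A A' B B' B₁ D C : Type u} [SmallCategory A] [SmallCategory B] [SmallCategory D]
  [SmallCategory C] [SmallCategory A'] [SmallCategory B'] [SmallCategory B₁]

/-! Composites in which one of the factors is whiskered by an identity wire. -/

section InL
variable {G : Profunctor.{u} (B × C) D} {P : Profunctor.{u} A B} {d : D} {a : A} {c : C}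

theorem exists_mk_inL (p : El (comp G (tensor P (idP C))) d (a, c)) :
    ∃ (b : B) (g : El G d (b, c)) (f : El P b a),
      mk (F := tensor P (idP C)) (a := (a, c)) g (tmk f (hel (𝟙 c))) = p := by
  obtain ⟨⟨b, c'⟩, g, t, rfl⟩ := exists_mk p
  obtain ⟨f, k, rfl⟩ := exists_tmk_hel t
  refine ⟨b, act G (𝟙 d) (Prod.mkHom (𝟙 b) k) g, f, ?_⟩
  rw [mk_slide, act_tmk]
  simp [act_id, act_hel]

theorem slide_inL {b b' : B} (g : El G d (b, c)) (k : b ⟶ b') (f : El P b' a) :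
    mk (F := tensor P (idP C)) (a := (a, c)) (act G (𝟙 d) (Prod.mkHom k (𝟙 c)) g) (tmk f (hel (𝟙 c))) =
      mk (F := tensor P (idP C)) (a := (a, c)) g (tmk (act P k (𝟙 a) f) (hel (𝟙 c))) := by
  rw [mk_slide, act_tmk]
  simp [act_hel]

theorem act_inL {d' : D} {a' : A} {c' : C} {b : B} (h : d' ⟶ d) (k : a ⟶ a') (l : c ⟶ c')
    (g : El G d (b, c)) (f : El P b a) :
    act (comp G (tensor P (idP C))) h (Prod.mkHom k l)
      (mk (F := tensor P (idP C)) (a := (a, c)) g (tmk f (hel (𝟙 c)))) =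
    mk (F := tensor P (idP C)) (a := (a', c')) (b := (b, c')) (act G h (Prod.mkHom (𝟙 b) l) g)
      (tmk (act P (𝟙 b) k f) (hel (𝟙 c'))) := by
  rw [act_comp_mk, act_tmk]
  have e : act G h (Prod.mkHom (𝟙 b) l) g =
      act G (𝟙 d') (Prod.mkHom (𝟙 b) l) (act G h (𝟙 (b, c)) g) := by
    rw [act_act]; simp
  rw [e, mk_slide, act_tmk]
  simp [act_hel, act_act]

/-- The universal property of `G ⋄ (P ⊠ 1)`. -/
def liftInL {X : Sort*} (φ : ∀ {b : B}, El G d (b, c) → El P b a → X)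
    (h : ∀ {b b' : B} (g : El G d (b, c)) (k : b ⟶ b') (f : El P b' a),
      φ (act G (𝟙 d) (Prod.mkHom k (𝟙 c)) g) f = φ g (act P k (𝟙 a) f)) :
    El (comp G (tensor P (idP C))) d (a, c) → X :=
  compLift (fun {b} g f => φ (act G (𝟙 d) (Prod.mkHom (𝟙 b.1) (uhel (tsnd f))) g) (tfst f)) (by
    rintro ⟨b, c₁⟩ ⟨b', c₂⟩ g ⟨k, l⟩ t
    obtain ⟨f, f', rfl⟩ := exists_tmk_hel t
    simp only [act_tmk, act_hel, tfst_tmk, tsnd_tmk, uhel_hel, prod_id_fst, prod_id_snd]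
    rw [← h, act_act, act_act]
    simp)

theorem liftInL_mk {X : Sort*} (φ : ∀ {b : B}, El G d (b, c) → El P b a → X)
    (h : ∀ {b b' : B} (g : El G d (b, c)) (k : b ⟶ b') (f : El P b' a),
      φ (act G (𝟙 d) (Prod.mkHom k (𝟙 c)) g) f = φ g (act P k (𝟙 a) f)) {b : B}
    (g : El G d (b, c)) (f : El P b a) :
    liftInL (fun {_} => φ) (fun {_ _} => h)
      (mk (F := tensor P (idP C)) (a := (a, c)) g (tmk f (hel (𝟙 c)))) = φ g f := by
  change φ (act G (𝟙 d) (Prod.mkHom (𝟙 b) (𝟙 c)) g) f = φ g f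
  exact congrArg (fun t => φ t f) (act_id G g)

end InL

section InR
variable {G : Profunctor.{u} (C × B) D} {P : Profunctor.{u} A B} {d : D} {a : A} {c : C}

theorem exists_mk_inR (p : El (comp G (tensor (idP C) P)) d (c, a)) :
    ∃ (b : B) (g : El G d (c, b)) (f : El P b a),
      mk (F := tensor (idP C) P) (a := (c, a)) g (tmk (hel (𝟙 c)) f) = p := by
  obtain ⟨⟨c', b⟩, g, t, rfl⟩ := exists_mk p
  obtain ⟨k, f, rfl⟩ := exists_hel_tmk t
  refine ⟨b, act G (𝟙 d) (Prod.mkHom k (𝟙 b)) g, f, ?_⟩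
  rw [mk_slide, act_tmk]
  simp [act_id, act_hel]

theorem slide_inR {b b' : B} (g : El G d (c, b)) (k : b ⟶ b') (f : El P b' a) :
    mk (F := tensor (idP C) P) (a := (c, a)) (act G (𝟙 d) (Prod.mkHom (𝟙 c) k) g) (tmk (hel (𝟙 c)) f) =
      mk (F := tensor (idP C) P) (a := (c, a)) g (tmk (hel (𝟙 c)) (act P k (𝟙 a) f)) := by
  rw [mk_slide, act_tmk]
  simp [act_hel]

theorem act_inR {d' : D} {a' : A} {c' : C} {b : B} (h : d' ⟶ d) (k : a ⟶ a') (l : c ⟶ c')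
    (g : El G d (c, b)) (f : El P b a) :
    act (comp G (tensor (idP C) P)) h (Prod.mkHom l k)
      (mk (F := tensor (idP C) P) (a := (c, a)) g (tmk (hel (𝟙 c)) f)) =
    mk (F := tensor (idP C) P) (a := (c', a')) (b := (c', b)) (act G h (Prod.mkHom l (𝟙 b)) g)
      (tmk (hel (𝟙 c')) (act P (𝟙 b) k f)) := by
  rw [act_comp_mk, act_tmk]
  have e : act G h (Prod.mkHom l (𝟙 b)) g =
      act G (𝟙 d') (Prod.mkHom l (𝟙 b)) (act G h (𝟙 (c, b)) g) := by
    rw [act_act]; simp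
  rw [e, mk_slide, act_tmk]
  simp [act_hel, act_act]

/-- The universal property of `G ⋄ (1 ⊠ P)`. -/
def liftInR {X : Sort*} (φ : ∀ {b : B}, El G d (c, b) → El P b a → X)
    (h : ∀ {b b' : B} (g : El G d (c, b)) (k : b ⟶ b') (f : El P b' a),
      φ (act G (𝟙 d) (Prod.mkHom (𝟙 c) k) g) f = φ g (act P k (𝟙 a) f)) :
    El (comp G (tensor (idP C) P)) d (c, a) → X :=
  compLift (fun {b} g f => φ (act G (𝟙 d) (Prod.mkHom (uhel (tfst f)) (𝟙 b.2)) g) (tsnd f)) (by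
    rintro ⟨c₁, b⟩ ⟨c₂, b'⟩ g ⟨l, k⟩ t
    obtain ⟨f', f, rfl⟩ := exists_hel_tmk t
    simp only [act_tmk, act_hel, tfst_tmk, tsnd_tmk, uhel_hel, prod_id_fst, prod_id_snd]
    rw [← h, act_act, act_act]
    simp)

theorem liftInR_mk {X : Sort*} (φ : ∀ {b : B}, El G d (c, b) → El P b a → X)
    (h : ∀ {b b' : B} (g : El G d (c, b)) (k : b ⟶ b') (f : El P b' a),
      φ (act G (𝟙 d) (Prod.mkHom (𝟙 c) k) g) f = φ g (act P k (𝟙 a) f)) {b : B}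
    (g : El G d (c, b)) (f : El P b a) :
    liftInR (fun {_} => φ) (fun {_ _} => h)
      (mk (F := tensor (idP C) P) (a := (c, a)) g (tmk (hel (𝟙 c)) f)) = φ g f := by
  change φ (act G (𝟙 d) (Prod.mkHom (𝟙 c) (𝟙 b)) g) f = φ g f
  exact congrArg (fun t => φ t f) (act_id G g)

end InR

section OutL
variable {G : Profunctor.{u} A (B × C)} {P : Profunctor.{u} B D} {d : D} {a : A} {c : C}

theorem exists_mk_outL (p : El (comp (tensor P (idP C)) G) (d, c) a) :
    ∃ (b : B) (g : El G (b, c) a) (f : El P d b),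
      mk (G := tensor P (idP C)) (d := (d, c)) (b := (b, c)) (tmk f (hel (𝟙 c))) g = p := by
  obtain ⟨⟨b, c'⟩, t, g, rfl⟩ := exists_mk p
  obtain ⟨f, k, rfl⟩ := exists_tmk_hel t
  refine ⟨b, act G (Prod.mkHom (𝟙 b) k) (𝟙 a) g, f, ?_⟩
  rw [← mk_slide, act_tmk]
  simp [act_id, act_hel]

theorem slide_outL {b b' : B} (g : El G (b', c) a) (k : b ⟶ b') (f : El P d b) :
    mk (G := tensor P (idP C)) (d := (d, c)) (b := (b', c)) (tmk (act P (𝟙 d) k f) (hel (𝟙 c))) g =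
    mk (G := tensor P (idP C)) (d := (d, c)) (b := (b, c)) (tmk f (hel (𝟙 c))) (act G (Prod.mkHom k (𝟙 c)) (𝟙 a) g) := by
  rw [← mk_slide, act_tmk]
  simp [act_hel]

theorem act_outL {d' : D} {a' : A} {c' : C} {b : B} (h : d' ⟶ d) (k : a ⟶ a') (l : c' ⟶ c)
    (g : El G (b, c) a) (f : El P d b) :
    act (comp (tensor P (idP C)) G) (Prod.mkHom h l) k
      (mk (G := tensor P (idP C)) (d := (d, c)) (b := (b, c)) (tmk f (hel (𝟙 c))) g) =
    mk (G := tensor P (idP C)) (d := (d', c')) (b := (b, c')) (tmk (act P h (𝟙 b) f) (hel (𝟙 c')))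
      (act G (Prod.mkHom (𝟙 b) l) k g) := by
  rw [act_comp_mk, act_tmk]
  have e : act G (Prod.mkHom (𝟙 b) l) k g =
      act G (Prod.mkHom (𝟙 b) l) (𝟙 a') (act G (𝟙 (b, c)) k g) := by
    rw [act_act]; simp
  rw [e, ← mk_slide, act_tmk]
  simp [act_hel, act_act]

/-- The universal property of `(P ⊠ 1) ⋄ G`. -/
def liftOutL {X : Sort*} (φ : ∀ {b : B}, El G (b, c) a → El P d b → X)
    (h : ∀ {b b' : B} (g : El G (b', c) a) (k : b ⟶ b') (f : El P d b),
      φ g (act P (𝟙 d) k f) = φ (act G (Prod.mkHom k (𝟙 c)) (𝟙 a) g) f) :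
    El (comp (tensor P (idP C)) G) (d, c) a → X :=
  compLift (fun {b} f g => φ (act G (Prod.mkHom (𝟙 b.1) (uhel (tsnd f))) (𝟙 a) g) (tfst f)) (by
    rintro ⟨b, c₁⟩ ⟨b', c₂⟩ t ⟨k, l⟩ g
    obtain ⟨f, f', rfl⟩ := exists_tmk_hel t
    simp only [act_tmk, act_hel, tfst_tmk, tsnd_tmk, uhel_hel, prod_id_fst, prod_id_snd]
    rw [h, act_act, act_act]
    simp)

theorem liftOutL_mk {X : Sort*} (φ : ∀ {b : B}, El G (b, c) a → El P d b → X)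
    (h : ∀ {b b' : B} (g : El G (b', c) a) (k : b ⟶ b') (f : El P d b),
      φ g (act P (𝟙 d) k f) = φ (act G (Prod.mkHom k (𝟙 c)) (𝟙 a) g) f) {b : B}
    (g : El G (b, c) a) (f : El P d b) :
    liftOutL (fun {_} => φ) (fun {_ _} => h)
      (mk (G := tensor P (idP C)) (d := (d, c)) (b := (b, c)) (tmk f (hel (𝟙 c))) g) = φ g f := by
  change φ (act G (Prod.mkHom (𝟙 b) (𝟙 c)) (𝟙 a) g) f = φ g f
  exact congrArg (fun t => φ t f) (act_id G g)

end OutL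

section OutR
variable {G : Profunctor.{u} A (C × B)} {P : Profunctor.{u} B D} {d : D} {a : A} {c : C}

theorem exists_mk_outR (p : El (comp (tensor (idP C) P) G) (c, d) a) :
    ∃ (b : B) (g : El G (c, b) a) (f : El P d b),
      mk (G := tensor (idP C) P) (d := (c, d)) (b := (c, b)) (tmk (hel (𝟙 c)) f) g = p := by
  obtain ⟨⟨c', b⟩, t, g, rfl⟩ := exists_mk p
  obtain ⟨k, f, rfl⟩ := exists_hel_tmk t
  refine ⟨b, act G (Prod.mkHom k (𝟙 b)) (𝟙 a) g, f, ?_⟩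
  rw [← mk_slide, act_tmk]
  simp [act_id, act_hel]

theorem slide_outR {b b' : B} (g : El G (c, b') a) (k : b ⟶ b') (f : El P d b) :
    mk (G := tensor (idP C) P) (d := (c, d)) (b := (c, b')) (tmk (hel (𝟙 c)) (act P (𝟙 d) k f)) g =
    mk (G := tensor (idP C) P) (d := (c, d)) (b := (c, b)) (tmk (hel (𝟙 c)) f) (act G (Prod.mkHom (𝟙 c) k) (𝟙 a) g) := by
  rw [← mk_slide, act_tmk]
  simp [act_hel]

theorem act_outR {d' : D} {a' : A} {c' : C} {b : B} (h : d' ⟶ d) (k : a ⟶ a') (l : c' ⟶ c)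
    (g : El G (c, b) a) (f : El P d b) :
    act (comp (tensor (idP C) P) G) (Prod.mkHom l h) k
      (mk (G := tensor (idP C) P) (d := (c, d)) (b := (c, b)) (tmk (hel (𝟙 c)) f) g) =
    mk (G := tensor (idP C) P) (d := (c', d')) (b := (c', b)) (tmk (hel (𝟙 c')) (act P h (𝟙 b) f))
      (act G (Prod.mkHom l (𝟙 b)) k g) := by
  rw [act_comp_mk, act_tmk]
  have e : act G (Prod.mkHom l (𝟙 b)) k g =
      act G (Prod.mkHom l (𝟙 b)) (𝟙 a') (act G (𝟙 (c, b)) k g) := by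
    rw [act_act]; simp
  rw [e, ← mk_slide, act_tmk]
  simp [act_hel, act_act]

/-- The universal property of `(1 ⊠ P) ⋄ G`. -/
def liftOutR {X : Sort*} (φ : ∀ {b : B}, El G (c, b) a → El P d b → X)
    (h : ∀ {b b' : B} (g : El G (c, b') a) (k : b ⟶ b') (f : El P d b),
      φ g (act P (𝟙 d) k f) = φ (act G (Prod.mkHom (𝟙 c) k) (𝟙 a) g) f) :
    El (comp (tensor (idP C) P) G) (c, d) a → X :=
  compLift (fun {b} f g => φ (act G (Prod.mkHom (uhel (tfst f)) (𝟙 b.2)) (𝟙 a) g) (tsnd f)) (by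
    rintro ⟨c₁, b⟩ ⟨c₂, b'⟩ t ⟨l, k⟩ g
    obtain ⟨f', f, rfl⟩ := exists_hel_tmk t
    simp only [act_tmk, act_hel, tfst_tmk, tsnd_tmk, uhel_hel, prod_id_fst, prod_id_snd]
    rw [h, act_act, act_act]
    simp)

theorem liftOutR_mk {X : Sort*} (φ : ∀ {b : B}, El G (c, b) a → El P d b → X)
    (h : ∀ {b b' : B} (g : El G (c, b') a) (k : b ⟶ b') (f : El P d b),
      φ g (act P (𝟙 d) k f) = φ (act G (Prod.mkHom (𝟙 c) k) (𝟙 a) g) f) {b : B}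
    (g : El G (c, b) a) (f : El P d b) :
    liftOutR (fun {_} => φ) (fun {_ _} => h)
      (mk (G := tensor (idP C) P) (d := (c, d)) (b := (c, b)) (tmk (hel (𝟙 c)) f) g) = φ g f := by
  change φ (act G (Prod.mkHom (𝟙 c) (𝟙 b)) (𝟙 a) g) f = φ g f
  exact congrArg (fun t => φ t f) (act_id G g)

end OutR

end Partial

end Prof

namespace Prof

section Named

variable {C : Type u} [SmallCategory C] {M : Profunctor.{u} (C × C) C} {H : Profunctor.{u} One C}
  {D : Profunctor.{u} C (C × C)} {E : Profunctor.{u} C One}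

theorem exists_mulL {x y z w : C} (p : El (MulL M) w ((x, y), z)) :
    ∃ (t : C) (m : El M w (t, z)) (n : El M t (x, y)), mulL m n = p :=
  exists_mk_inL (G := M) (P := M) p

theorem mulL_slide {x y z w t t' : C} (m : El M w (t, z)) (k : t ⟶ t') (n : El M t' (x, y)) :
    mulL (act M (𝟙 w) (Prod.mkHom k (𝟙 z)) m) n = mulL m (act M k (𝟙 (x, y)) n) :=
  slide_inL (G := M) (P := M) m k n

theorem act_mulL {x y z w t x' y' z' w' : C} (h : w' ⟶ w) (f : x ⟶ x') (g : y ⟶ y') (k : z ⟶ z')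
    (m : El M w (t, z)) (n : El M t (x, y)) :
    act (MulL M) h (Prod.mkHom (Prod.mkHom f g) k) (mulL m n) =
      mulL (act M h (Prod.mkHom (𝟙 t) k) m) (act M (𝟙 t) (Prod.mkHom f g) n) :=
  act_inL (G := M) (P := M) h (Prod.mkHom f g) k m n

/-- The universal property of `MulL`. -/
def liftMulL {x y z w : C} {X : Sort*} (φ : ∀ {t : C}, El M w (t, z) → El M t (x, y) → X)
    (h : ∀ {t t' : C} (m : El M w (t, z)) (k : t ⟶ t') (n : El M t' (x, y)),
      φ (act M (𝟙 w) (Prod.mkHom k (𝟙 z)) m) n = φ m (act M k (𝟙 (x, y)) n)) :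
    El (MulL M) w ((x, y), z) → X :=
  liftInL (G := M) (P := M) φ h

theorem liftMulL_mk {x y z w : C} {X : Sort*} (φ : ∀ {t : C}, El M w (t, z) → El M t (x, y) → X)
    (h : ∀ {t t' : C} (m : El M w (t, z)) (k : t ⟶ t') (n : El M t' (x, y)),
      φ (act M (𝟙 w) (Prod.mkHom k (𝟙 z)) m) n = φ m (act M k (𝟙 (x, y)) n)) {t : C} (m : El M w (t, z))
    (n : El M t (x, y)) : liftMulL φ h (mulL m n) = φ m n :=
  liftInL_mk (G := M) (P := M) φ h m n

theorem exists_mulR {x y z w : C} (p : El (MulR M) w ((x, y), z)) :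
    ∃ (t : C) (m : El M w (x, t)) (n : El M t (y, z)), mulR m n = p :=
  exists_mk_inR (G := M) (P := M) (a := (y, z)) p

theorem mulR_slide {x y z w t t' : C} (m : El M w (x, t)) (k : t ⟶ t') (n : El M t' (y, z)) :
    mulR (act M (𝟙 w) (Prod.mkHom (𝟙 x) k) m) n = mulR m (act M k (𝟙 (y, z)) n) :=
  slide_inR (G := M) (P := M) (a := (y, z)) m k n

theorem act_mulR {x y z w t x' y' z' w' : C} (h : w' ⟶ w) (f : x ⟶ x') (g : y ⟶ y') (k : z ⟶ z')
    (m : El M w (x, t)) (n : El M t (y, z)) :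
    act (MulR M) h (Prod.mkHom (Prod.mkHom f g) k) (mulR m n) =
      mulR (act M h (Prod.mkHom f (𝟙 t)) m) (act M (𝟙 t) (Prod.mkHom g k) n) :=
  act_inR (G := M) (P := M) h (Prod.mkHom g k) f m n

/-- The universal property of `MulR`. -/
def liftMulR {x y z w : C} {X : Sort*} (φ : ∀ {t : C}, El M w (x, t) → El M t (y, z) → X)
    (h : ∀ {t t' : C} (m : El M w (x, t)) (k : t ⟶ t') (n : El M t' (y, z)),
      φ (act M (𝟙 w) (Prod.mkHom (𝟙 x) k) m) n = φ m (act M k (𝟙 (y, z)) n)) :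
    El (MulR M) w ((x, y), z) → X :=
  liftInR (G := M) (P := M) (a := (y, z)) φ h

theorem liftMulR_mk {x y z w : C} {X : Sort*} (φ : ∀ {t : C}, El M w (x, t) → El M t (y, z) → X)
    (h : ∀ {t t' : C} (m : El M w (x, t)) (k : t ⟶ t') (n : El M t' (y, z)),
      φ (act M (𝟙 w) (Prod.mkHom (𝟙 x) k) m) n = φ m (act M k (𝟙 (y, z)) n)) {t : C} (m : El M w (x, t))
    (n : El M t (y, z)) : liftMulR φ h (mulR m n) = φ m n :=
  liftInR_mk (G := M) (P := M) (a := (y, z)) φ h m n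

theorem exists_unL {x z : C} (p : El (UnL M H) z x) :
    ∃ (t : C) (m : El M z (t, x)) (n : El H t pt), unL m n = p :=
  exists_mk_inL (G := M) (P := H) (a := pt) p

theorem unL_slide {x z t t' : C} (m : El M z (t, x)) (k : t ⟶ t') (n : El H t' pt) :
    unL (act M (𝟙 z) (Prod.mkHom k (𝟙 x)) m) n = unL m (act H k (𝟙 pt) n) :=
  slide_inL (G := M) (P := H) (a := pt) m k n

theorem act_unL {x z t x' z' : C} (h : z' ⟶ z) (f : x ⟶ x')
    (m : El M z (t, x)) (n : El H t pt) :
    act (UnL M H) h f (unL m n) =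
      unL (act M h (Prod.mkHom (𝟙 t) f) m) (n) :=
  (act_inL (G := M) (P := H) h (𝟙 pt) f m n).trans (by rw [act_id]; rfl)

/-- The universal property of `UnL`. -/
def liftUnL {x z : C} {X : Sort*} (φ : ∀ {t : C}, El M z (t, x) → El H t pt → X)
    (h : ∀ {t t' : C} (m : El M z (t, x)) (k : t ⟶ t') (n : El H t' pt),
      φ (act M (𝟙 z) (Prod.mkHom k (𝟙 x)) m) n = φ m (act H k (𝟙 pt) n)) :
    El (UnL M H) z x → X :=
  liftInL (G := M) (P := H) (a := pt) φ h

theorem liftUnL_mk {x z : C} {X : Sort*} (φ : ∀ {t : C}, El M z (t, x) → El H t pt → X)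
    (h : ∀ {t t' : C} (m : El M z (t, x)) (k : t ⟶ t') (n : El H t' pt),
      φ (act M (𝟙 z) (Prod.mkHom k (𝟙 x)) m) n = φ m (act H k (𝟙 pt) n)) {t : C} (m : El M z (t, x))
    (n : El H t pt) : liftUnL φ h (unL m n) = φ m n :=
  liftInL_mk (G := M) (P := H) (a := pt) φ h m n

theorem exists_unR {x z : C} (p : El (UnR M H) z x) :
    ∃ (t : C) (m : El M z (x, t)) (n : El H t pt), unR m n = p :=
  exists_mk_inR (G := M) (P := H) (a := pt) p

theorem unR_slide {x z t t' : C} (m : El M z (x, t)) (k : t ⟶ t') (n : El H t' pt) :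
    unR (act M (𝟙 z) (Prod.mkHom (𝟙 x) k) m) n = unR m (act H k (𝟙 pt) n) :=
  slide_inR (G := M) (P := H) (a := pt) m k n

theorem act_unR {x z t x' z' : C} (h : z' ⟶ z) (f : x ⟶ x')
    (m : El M z (x, t)) (n : El H t pt) :
    act (UnR M H) h f (unR m n) =
      unR (act M h (Prod.mkHom f (𝟙 t)) m) (n) :=
  (act_inR (G := M) (P := H) h (𝟙 pt) f m n).trans (by rw [act_id]; rfl)

/-- The universal property of `UnR`. -/
def liftUnR {x z : C} {X : Sort*} (φ : ∀ {t : C}, El M z (x, t) → El H t pt → X)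
    (h : ∀ {t t' : C} (m : El M z (x, t)) (k : t ⟶ t') (n : El H t' pt),
      φ (act M (𝟙 z) (Prod.mkHom (𝟙 x) k) m) n = φ m (act H k (𝟙 pt) n)) :
    El (UnR M H) z x → X :=
  liftInR (G := M) (P := H) (a := pt) φ h

theorem liftUnR_mk {x z : C} {X : Sort*} (φ : ∀ {t : C}, El M z (x, t) → El H t pt → X)
    (h : ∀ {t t' : C} (m : El M z (x, t)) (k : t ⟶ t') (n : El H t' pt),
      φ (act M (𝟙 z) (Prod.mkHom (𝟙 x) k) m) n = φ m (act H k (𝟙 pt) n)) {t : C} (m : El M z (x, t))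
    (n : El H t pt) : liftUnR φ h (unR m n) = φ m n :=
  liftInR_mk (G := M) (P := H) (a := pt) φ h m n

theorem exists_comulL {a b c x : C} (p : El (ComulL D) ((a, b), c) x) :
    ∃ (t : C) (m : El D (t, c) x) (n : El D (a, b) t), comulL m n = p :=
  exists_mk_outL (G := D) (P := D) p

theorem comulL_slide {a b c x t t' : C} (m : El D (t', c) x) (k : t ⟶ t') (n : El D (a, b) t) :
    comulL m (act D (𝟙 (a, b)) k n) = comulL (act D (Prod.mkHom k (𝟙 c)) (𝟙 x) m) n :=
  slide_outL (G := D) (P := D) m k n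

theorem act_comulL {a b c x t a' b' c' x' : C} (f : a' ⟶ a) (g : b' ⟶ b) (k : c' ⟶ c) (h : x ⟶ x')
    (m : El D (t, c) x) (n : El D (a, b) t) :
    act (ComulL D) (Prod.mkHom (Prod.mkHom f g) k) h (comulL m n) =
      comulL (act D (Prod.mkHom (𝟙 t) k) h m) (act D (Prod.mkHom f g) (𝟙 t) n) :=
  act_outL (G := D) (P := D) (Prod.mkHom f g) h k m n

/-- The universal property of `ComulL`. -/
def liftComulL {a b c x : C} {X : Sort*} (φ : ∀ {t : C}, El D (t, c) x → El D (a, b) t → X)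
    (h : ∀ {t t' : C} (m : El D (t', c) x) (k : t ⟶ t') (n : El D (a, b) t),
      φ m (act D (𝟙 (a, b)) k n) = φ (act D (Prod.mkHom k (𝟙 c)) (𝟙 x) m) n) :
    El (ComulL D) ((a, b), c) x → X :=
  liftOutL (G := D) (P := D) φ h

theorem liftComulL_mk {a b c x : C} {X : Sort*} (φ : ∀ {t : C}, El D (t, c) x → El D (a, b) t → X)
    (h : ∀ {t t' : C} (m : El D (t', c) x) (k : t ⟶ t') (n : El D (a, b) t),
      φ m (act D (𝟙 (a, b)) k n) = φ (act D (Prod.mkHom k (𝟙 c)) (𝟙 x) m) n) {t : C} (m : El D (t, c) x)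
    (n : El D (a, b) t) : liftComulL φ h (comulL m n) = φ m n :=
  liftOutL_mk (G := D) (P := D) φ h m n

theorem exists_comulR {a b c x : C} (p : El (ComulR D) ((a, b), c) x) :
    ∃ (t : C) (m : El D (a, t) x) (n : El D (b, c) t), comulR m n = p :=
  exists_mk_outR (G := D) (P := D) (d := (b, c)) p

theorem comulR_slide {a b c x t t' : C} (m : El D (a, t') x) (k : t ⟶ t') (n : El D (b, c) t) :
    comulR m (act D (𝟙 (b, c)) k n) = comulR (act D (Prod.mkHom (𝟙 a) k) (𝟙 x) m) n :=
  slide_outR (G := D) (P := D) (d := (b, c)) m k n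

theorem act_comulR {a b c x t a' b' c' x' : C} (f : a' ⟶ a) (g : b' ⟶ b) (k : c' ⟶ c) (h : x ⟶ x')
    (m : El D (a, t) x) (n : El D (b, c) t) :
    act (ComulR D) (Prod.mkHom (Prod.mkHom f g) k) h (comulR m n) =
      comulR (act D (Prod.mkHom f (𝟙 t)) h m) (act D (Prod.mkHom g k) (𝟙 t) n) :=
  act_outR (G := D) (P := D) (Prod.mkHom g k) h f m n

/-- The universal property of `ComulR`. -/
def liftComulR {a b c x : C} {X : Sort*} (φ : ∀ {t : C}, El D (a, t) x → El D (b, c) t → X)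
    (h : ∀ {t t' : C} (m : El D (a, t') x) (k : t ⟶ t') (n : El D (b, c) t),
      φ m (act D (𝟙 (b, c)) k n) = φ (act D (Prod.mkHom (𝟙 a) k) (𝟙 x) m) n) :
    El (ComulR D) ((a, b), c) x → X :=
  liftOutR (G := D) (P := D) (d := (b, c)) φ h

theorem liftComulR_mk {a b c x : C} {X : Sort*} (φ : ∀ {t : C}, El D (a, t) x → El D (b, c) t → X)
    (h : ∀ {t t' : C} (m : El D (a, t') x) (k : t ⟶ t') (n : El D (b, c) t),
      φ m (act D (𝟙 (b, c)) k n) = φ (act D (Prod.mkHom (𝟙 a) k) (𝟙 x) m) n) {t : C} (m : El D (a, t) x)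
    (n : El D (b, c) t) : liftComulR φ h (comulR m n) = φ m n :=
  liftOutR_mk (G := D) (P := D) (d := (b, c)) φ h m n

theorem exists_counL {a x : C} (p : El (CounL D E) a x) :
    ∃ (t : C) (m : El D (t, a) x) (n : El E pt t), counL m n = p :=
  exists_mk_outL (G := D) (P := E) (d := pt) p

theorem counL_slide {a x t t' : C} (m : El D (t', a) x) (k : t ⟶ t') (n : El E pt t) :
    counL m (act E (𝟙 pt) k n) = counL (act D (Prod.mkHom k (𝟙 a)) (𝟙 x) m) n :=
  slide_outL (G := D) (P := E) (d := pt) m k n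

theorem act_counL {a x t a' x' : C} (f : a' ⟶ a) (h : x ⟶ x')
    (m : El D (t, a) x) (n : El E pt t) :
    act (CounL D E) f h (counL m n) =
      counL (act D (Prod.mkHom (𝟙 t) f) h m) (n) :=
  (act_outL (G := D) (P := E) (𝟙 pt) h f m n).trans (by rw [act_id]; rfl)

/-- The universal property of `CounL`. -/
def liftCounL {a x : C} {X : Sort*} (φ : ∀ {t : C}, El D (t, a) x → El E pt t → X)
    (h : ∀ {t t' : C} (m : El D (t', a) x) (k : t ⟶ t') (n : El E pt t),
      φ m (act E (𝟙 pt) k n) = φ (act D (Prod.mkHom k (𝟙 a)) (𝟙 x) m) n) :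
    El (CounL D E) a x → X :=
  liftOutL (G := D) (P := E) (d := pt) φ h

theorem liftCounL_mk {a x : C} {X : Sort*} (φ : ∀ {t : C}, El D (t, a) x → El E pt t → X)
    (h : ∀ {t t' : C} (m : El D (t', a) x) (k : t ⟶ t') (n : El E pt t),
      φ m (act E (𝟙 pt) k n) = φ (act D (Prod.mkHom k (𝟙 a)) (𝟙 x) m) n) {t : C} (m : El D (t, a) x)
    (n : El E pt t) : liftCounL φ h (counL m n) = φ m n :=
  liftOutL_mk (G := D) (P := E) (d := pt) φ h m n

theorem exists_counR {a x : C} (p : El (CounR D E) a x) :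
    ∃ (t : C) (m : El D (a, t) x) (n : El E pt t), counR m n = p :=
  exists_mk_outR (G := D) (P := E) (d := pt) p

theorem counR_slide {a x t t' : C} (m : El D (a, t') x) (k : t ⟶ t') (n : El E pt t) :
    counR m (act E (𝟙 pt) k n) = counR (act D (Prod.mkHom (𝟙 a) k) (𝟙 x) m) n :=
  slide_outR (G := D) (P := E) (d := pt) m k n

theorem act_counR {a x t a' x' : C} (f : a' ⟶ a) (h : x ⟶ x')
    (m : El D (a, t) x) (n : El E pt t) :
    act (CounR D E) f h (counR m n) =
      counR (act D (Prod.mkHom f (𝟙 t)) h m) (n) :=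
  (act_outR (G := D) (P := E) (𝟙 pt) h f m n).trans (by rw [act_id]; rfl)

/-- The universal property of `CounR`. -/
def liftCounR {a x : C} {X : Sort*} (φ : ∀ {t : C}, El D (a, t) x → El E pt t → X)
    (h : ∀ {t t' : C} (m : El D (a, t') x) (k : t ⟶ t') (n : El E pt t),
      φ m (act E (𝟙 pt) k n) = φ (act D (Prod.mkHom (𝟙 a) k) (𝟙 x) m) n) :
    El (CounR D E) a x → X :=
  liftOutR (G := D) (P := E) (d := pt) φ h

theorem liftCounR_mk {a x : C} {X : Sort*} (φ : ∀ {t : C}, El D (a, t) x → El E pt t → X)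
    (h : ∀ {t t' : C} (m : El D (a, t') x) (k : t ⟶ t') (n : El E pt t),
      φ m (act E (𝟙 pt) k n) = φ (act D (Prod.mkHom (𝟙 a) k) (𝟙 x) m) n) {t : C} (m : El D (a, t) x)
    (n : El E pt t) : liftCounR φ h (counR m n) = φ m n :=
  liftOutR_mk (G := D) (P := E) (d := pt) φ h m n

theorem frobM_slide {a b x y t t' : C} (d : El D (a, b) t) (k : t ⟶ t') (m : El M t' (x, y)) :
    frobM (act D (𝟙 (a, b)) k d) m = frobM d (act M k (𝟙 (x, y)) m) :=
  mk_slide d k m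

theorem exists_frobM {a b x y : C} (p : El (FrobM M D) (a, b) (x, y)) :
    ∃ (t : C) (d : El D (a, b) t) (m : El M t (x, y)), frobM d m = p :=
  exists_mk p

theorem act_frobM {a b x y t a' b' x' y' : C} (f : a' ⟶ a) (g : b' ⟶ b) (h : x ⟶ x') (k : y ⟶ y')
    (d : El D (a, b) t) (m : El M t (x, y)) :
    act (FrobM M D) (Prod.mkHom f g) (Prod.mkHom h k) (frobM d m) =
      frobM (act D (Prod.mkHom f g) (𝟙 t) d) (act M (𝟙 t) (Prod.mkHom h k) m) :=
  act_comp_mk D M _ _ d m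

/-- The universal property of `FrobM`. -/
def liftFrobM {a b x y : C} {X : Sort*} (φ : ∀ {t : C}, El D (a, b) t → El M t (x, y) → X)
    (h : ∀ {t t' : C} (d : El D (a, b) t) (k : t ⟶ t') (m : El M t' (x, y)),
      φ (act D (𝟙 (a, b)) k d) m = φ d (act M k (𝟙 (x, y)) m)) :
    El (FrobM M D) (a, b) (x, y) → X :=
  compLift φ h

/-- The class of a general pair in `FrobL`. -/
def frobLPair {a b x y a₁ t₁ y₁ : C} (g : El (tensor (idP C) M) (a, b) (a₁, (t₁, y₁)))
    (f : El (tensor D (idP C)) ((a₁, t₁), y₁) (x, y)) : El (FrobL M D) (a, b) (x, y) :=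
  mk (G := (tensor (idP C) M).whiskerLeft₂ (prod.associator C C C) (𝟭 (C × C)))
    (F := tensor D (idP C)) (d := (a, b)) (a := (x, y)) (b := ((a₁, t₁), y₁)) g f

/-- The class of a general pair in `FrobR`. -/
def frobRPair {a b x y x₁ t₁ b₁ : C} (g : El (tensor M (idP C)) (a, b) ((x₁, t₁), b₁))
    (f : El (tensor (idP C) D) (x₁, (t₁, b₁)) (x, y)) : El (FrobR M D) (a, b) (x, y) :=
  mk (G := (tensor M (idP C)).whiskerLeft₂ (prod.inverseAssociator C C C) (𝟭 (C × C)))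
    (F := tensor (idP C) D) (d := (a, b)) (a := (x, y)) (b := (x₁, (t₁, b₁))) g f

theorem frobLPair_slide {a b x y a₁ t₁ y₁ a₂ t₂ y₂ : C}
    (g : El (tensor (idP C) M) (a, b) (a₁, (t₁, y₁))) (k₁ : a₁ ⟶ a₂) (k₂ : t₁ ⟶ t₂) (k₃ : y₁ ⟶ y₂)
    (f : El (tensor D (idP C)) ((a₂, t₂), y₂) (x, y)) :
    frobLPair (act (tensor (idP C) M) (𝟙 (a, b)) (Prod.mkHom k₁ (Prod.mkHom k₂ k₃)) g) f =
      frobLPair g (act (tensor D (idP C)) (Prod.mkHom (Prod.mkHom k₁ k₂) k₃) (𝟙 (x, y)) f) :=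
  mk_slide (G := (tensor (idP C) M).whiskerLeft₂ (prod.associator C C C) (𝟭 (C × C)))
    (F := tensor D (idP C)) (d := (a, b)) (a := (x, y)) (b := ((a₁, t₁), y₁))
    (b' := ((a₂, t₂), y₂)) g (Prod.mkHom (Prod.mkHom k₁ k₂) k₃) f

theorem frobRPair_slide {a b x y x₁ t₁ b₁ x₂ t₂ b₂ : C}
    (g : El (tensor M (idP C)) (a, b) ((x₁, t₁), b₁)) (k₁ : x₁ ⟶ x₂) (k₂ : t₁ ⟶ t₂) (k₃ : b₁ ⟶ b₂)
    (f : El (tensor (idP C) D) (x₂, (t₂, b₂)) (x, y)) :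
    frobRPair (act (tensor M (idP C)) (𝟙 (a, b)) (Prod.mkHom (Prod.mkHom k₁ k₂) k₃) g) f =
      frobRPair g (act (tensor (idP C) D) (Prod.mkHom k₁ (Prod.mkHom k₂ k₃)) (𝟙 (x, y)) f) :=
  mk_slide (G := (tensor M (idP C)).whiskerLeft₂ (prod.inverseAssociator C C C) (𝟭 (C × C)))
    (F := tensor (idP C) D) (d := (a, b)) (a := (x, y)) (b := (x₁, (t₁, b₁)))
    (b' := (x₂, (t₂, b₂))) g (Prod.mkHom k₁ (Prod.mkHom k₂ k₃)) f

theorem frobL_eq {a b x y t : C} (m : El M b (t, y)) (d : El D (a, t) x) :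
    frobL m d = frobLPair (tmk (hel (𝟙 a)) m) (tmk d (hel (𝟙 y))) := rfl

theorem frobR_eq {a b x y t : C} (m : El M a (x, t)) (d : El D (t, b) y) :
    frobR m d = frobRPair (tmk m (hel (𝟙 b))) (tmk (hel (𝟙 x)) d) := rfl

theorem frobLPair_tmk {a b x y a₁ t₁ y₁ : C} (f : a ⟶ a₁) (m : El M b (t₁, y₁))
    (d : El D (a₁, t₁) x) (g : y₁ ⟶ y) :
    frobLPair (tmk (hel f) m) (tmk d (hel g)) =
    frobL (act M (𝟙 b) (Prod.mkHom (𝟙 t₁) g) m) (act D (Prod.mkHom f (𝟙 t₁)) (𝟙 x) d) := by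
  have h₁ := frobLPair_slide (tmk (hel (𝟙 a)) m) f (𝟙 t₁) (𝟙 y₁) (tmk d (hel g))
  have h₂ := frobLPair_slide (tmk (hel (𝟙 a)) m) (𝟙 a) (𝟙 t₁) g
    (tmk (act D (Prod.mkHom f (𝟙 t₁)) (𝟙 x) d) (hel (𝟙 y)))
  rw [act_tmk, act_tmk] at h₁ h₂
  simp only [act_hel, act_act, prod_id_fst, prod_id_snd, Category.id_comp, Category.comp_id] at h₁ h₂
  have e₁ : act M (𝟙 b) (Prod.mkHom (𝟙 t₁) (𝟙 y₁)) m = m := act_id M m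
  have e₂ : Prod.mkHom (𝟙 a) (𝟙 t₁) ≫ Prod.mkHom f (𝟙 t₁) = Prod.mkHom f (𝟙 t₁) := by simp
  rw [e₁] at h₁
  rw [e₂] at h₂
  rw [h₁, frobL_eq, h₂]

theorem frobRPair_tmk {a b x y x₁ t₁ b₁ : C} (f : x₁ ⟶ x) (m : El M a (x₁, t₁))
    (d : El D (t₁, b₁) y) (g : b ⟶ b₁) :
    frobRPair (tmk m (hel g)) (tmk (hel f) d) =
    frobR (act M (𝟙 a) (Prod.mkHom f (𝟙 t₁)) m) (act D (Prod.mkHom (𝟙 t₁) g) (𝟙 y) d) := by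
  have h₁ := frobRPair_slide (tmk m (hel (𝟙 b))) (𝟙 x₁) (𝟙 t₁) g (tmk (hel f) d)
  have h₂ := frobRPair_slide (tmk m (hel (𝟙 b))) f (𝟙 t₁) (𝟙 b)
    (tmk (hel (𝟙 x)) (act D (Prod.mkHom (𝟙 t₁) g) (𝟙 y) d))
  rw [act_tmk, act_tmk] at h₁ h₂
  simp only [act_hel, act_act, prod_id_fst, prod_id_snd, Category.id_comp, Category.comp_id] at h₁ h₂
  have e₁ : act M (𝟙 a) (Prod.mkHom (𝟙 x₁) (𝟙 t₁)) m = m := act_id M m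
  have e₂ : Prod.mkHom (𝟙 t₁) (𝟙 b) ≫ Prod.mkHom (𝟙 t₁) g = Prod.mkHom (𝟙 t₁) g := by simp
  rw [e₁] at h₁
  rw [e₂] at h₂
  rw [h₁, frobR_eq, h₂]

theorem exists_frobL {a b x y : C} (p : El (FrobL M D) (a, b) (x, y)) :
    ∃ (t : C) (m : El M b (t, y)) (d : El D (a, t) x), frobL m d = p := by
  obtain ⟨⟨⟨a₁, t₁⟩, y₁⟩, g, f, rfl⟩ := exists_mk p
  exact ⟨t₁, _, _, (frobLPair_tmk g.1 g.2 f.1 f.2).symm⟩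

theorem exists_frobR {a b x y : C} (p : El (FrobR M D) (a, b) (x, y)) :
    ∃ (t : C) (m : El M a (x, t)) (d : El D (t, b) y), frobR m d = p := by
  obtain ⟨⟨x₁, t₁, b₁⟩, g, f, rfl⟩ := exists_mk p
  exact ⟨t₁, _, _, (frobRPair_tmk f.1 g.1 f.2 g.2).symm⟩

theorem frobL_slide {a b x y t t' : C} (m : El M b (t, y)) (k : t ⟶ t') (d : El D (a, t') x) :
    frobL (act M (𝟙 b) (Prod.mkHom k (𝟙 y)) m) d =
      frobL m (act D (Prod.mkHom (𝟙 a) k) (𝟙 x) d) := by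
  have h := frobLPair_slide (tmk (hel (𝟙 a)) m) (𝟙 a) k (𝟙 y) (tmk d (hel (𝟙 y)))
  rw [act_tmk, act_tmk] at h
  simp only [act_hel, prod_id_fst, prod_id_snd, Category.id_comp] at h
  exact h

theorem frobR_slide {a b x y t t' : C} (m : El M a (x, t)) (k : t ⟶ t') (d : El D (t', b) y) :
    frobR (act M (𝟙 a) (Prod.mkHom (𝟙 x) k) m) d =
      frobR m (act D (Prod.mkHom k (𝟙 b)) (𝟙 y) d) := by
  have h := frobRPair_slide (tmk m (hel (𝟙 b))) (𝟙 x) k (𝟙 b) (tmk (hel (𝟙 x)) d)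
  rw [act_tmk, act_tmk] at h
  simp only [act_hel, prod_id_fst, prod_id_snd, Category.id_comp] at h
  exact h

theorem act_frobL {a b x y t a' b' x' y' : C} (f : a' ⟶ a) (g : b' ⟶ b) (h : x ⟶ x') (k : y ⟶ y')
    (m : El M b (t, y)) (d : El D (a, t) x) :
    act (FrobL M D) (Prod.mkHom f g) (Prod.mkHom h k) (frobL m d) =
      frobL (act M g (Prod.mkHom (𝟙 t) k) m) (act D (Prod.mkHom f (𝟙 t)) h d) := by
  refine (act_comp_mk _ _ _ _ _ _).trans ?_
  change frobLPair (act (tensor (idP C) M) (Prod.mkHom f g) (𝟙 (a, (t, y))) (tmk (hel (𝟙 a)) m))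
    (act (tensor D (idP C)) (𝟙 ((a, t), y)) (Prod.mkHom h k) (tmk d (hel (𝟙 y)))) = _
  rw [act_tmk, act_tmk]
  simp only [act_hel, prod_id_fst, prod_id_snd, Category.id_comp, Category.comp_id]
  rw [frobLPair_tmk]
  simp only [act_act]
  simp

theorem act_frobR {a b x y t a' b' x' y' : C} (f : a' ⟶ a) (g : b' ⟶ b) (h : x ⟶ x') (k : y ⟶ y')
    (m : El M a (x, t)) (d : El D (t, b) y) :
    act (FrobR M D) (Prod.mkHom f g) (Prod.mkHom h k) (frobR m d) =
      frobR (act M f (Prod.mkHom h (𝟙 t)) m) (act D (Prod.mkHom (𝟙 t) g) k d) := by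
  refine (act_comp_mk _ _ _ _ _ _).trans ?_
  change frobRPair (act (tensor M (idP C)) (Prod.mkHom f g) (𝟙 ((x, t), b)) (tmk m (hel (𝟙 b))))
    (act (tensor (idP C) D) (𝟙 (x, (t, b))) (Prod.mkHom h k) (tmk (hel (𝟙 x)) d)) = _
  rw [act_tmk, act_tmk]
  simp only [act_hel, prod_id_fst, prod_id_snd, Category.id_comp, Category.comp_id]
  rw [frobRPair_tmk]
  simp only [act_act]
  simp

/-- The universal property of `FrobL`. -/
def liftFrobL {a b x y : C} {X : Sort*} (φ : ∀ {t : C}, El M b (t, y) → El D (a, t) x → X)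
    (h : ∀ {t t' : C} (m : El M b (t, y)) (k : t ⟶ t') (d : El D (a, t') x),
      φ (act M (𝟙 b) (Prod.mkHom k (𝟙 y)) m) d = φ m (act D (Prod.mkHom (𝟙 a) k) (𝟙 x) d)) :
    El (FrobL M D) (a, b) (x, y) → X :=
  compLift (fun {w} g f => φ (act M (𝟙 b) (Prod.mkHom (𝟙 w.1.2) (uhel (tsnd f))) (tsnd g))
    (act D (Prod.mkHom (uhel (tfst g)) (𝟙 w.1.2)) (𝟙 x) (tfst f))) (by
      rintro ⟨⟨a₁, t₁⟩, y₁⟩ ⟨⟨a₂, t₂⟩, y₂⟩ g ⟨⟨k₁, k₂⟩, k₃⟩ f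
      obtain ⟨f₁, f₂, rfl⟩ := exists_tmk_hel f
      obtain ⟨g₁, g₂, rfl⟩ : ∃ (g₁ : a ⟶ a₁) (g₂ : El M b (t₁, y₁)),
        g = (tmk (hel g₁) g₂ : El (tensor (idP C) M) (a, b) (a₁, (t₁, y₁))) := ⟨g.1, g.2, rfl⟩
      change φ (act M (𝟙 b) (Prod.mkHom (𝟙 t₂) f₂) (tsnd (act (tensor (idP C) M) (𝟙 (a, b))
        (Prod.mkHom k₁ (Prod.mkHom k₂ k₃)) (tmk (hel g₁) g₂)))) (act D (Prod.mkHom (uhel (tfst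
          (act (tensor (idP C) M) (𝟙 (a, b)) (Prod.mkHom k₁ (Prod.mkHom k₂ k₃))
            (tmk (hel g₁) g₂)))) (𝟙 t₂)) (𝟙 x) f₁) = φ (act M (𝟙 b) (Prod.mkHom (𝟙 t₁) (uhel (tsnd
          (act (tensor D (idP C)) (Prod.mkHom (Prod.mkHom k₁ k₂) k₃) (𝟙 (x, y))
            (tmk f₁ (hel f₂)))))) g₂) (act D (Prod.mkHom g₁ (𝟙 t₁)) (𝟙 x) (tfst
          (act (tensor D (idP C)) (Prod.mkHom (Prod.mkHom k₁ k₂) k₃) (𝟙 (x, y))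
            (tmk f₁ (hel f₂)))))
      simp only [act_tmk, act_hel, tfst_tmk, tsnd_tmk, uhel_hel, prod_id_fst, prod_id_snd, act_act]
      have e : act M (𝟙 b ≫ 𝟙 b) (Prod.mkHom k₂ k₃ ≫ Prod.mkHom (𝟙 t₂) f₂) g₂ =
        act M (𝟙 b) (Prod.mkHom k₂ (𝟙 y))
          (act M (𝟙 b) (Prod.mkHom (𝟙 t₁) (k₃ ≫ f₂)) g₂) := by rw [act_act]; simp
      rw [e, h, act_act]
      simp)

theorem liftFrobL_mk {a b x y : C} {X : Sort*} (φ : ∀ {t : C}, El M b (t, y) → El D (a, t) x → X)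
    (h : ∀ {t t' : C} (m : El M b (t, y)) (k : t ⟶ t') (d : El D (a, t') x),
      φ (act M (𝟙 b) (Prod.mkHom k (𝟙 y)) m) d = φ m (act D (Prod.mkHom (𝟙 a) k) (𝟙 x) d)) {t : C}
    (m : El M b (t, y)) (d : El D (a, t) x) : liftFrobL φ h (frobL m d) = φ m d := by
  change φ (act M (𝟙 b) (𝟙 (t, y)) m) (act D (𝟙 (a, t)) (𝟙 x) d) = _
  rw [act_id, act_id]

/-- The universal property of `FrobR`. -/
def liftFrobR {a b x y : C} {X : Sort*} (φ : ∀ {t : C}, El M a (x, t) → El D (t, b) y → X)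
    (h : ∀ {t t' : C} (m : El M a (x, t)) (k : t ⟶ t') (d : El D (t', b) y),
      φ (act M (𝟙 a) (Prod.mkHom (𝟙 x) k) m) d = φ m (act D (Prod.mkHom k (𝟙 b)) (𝟙 y) d)) :
    El (FrobR M D) (a, b) (x, y) → X :=
  compLift (fun {w} g f => φ (act M (𝟙 a) (Prod.mkHom (uhel (tfst f)) (𝟙 w.2.1)) (tfst g))
    (act D (Prod.mkHom (𝟙 w.2.1) (uhel (tsnd g))) (𝟙 y) (tsnd f))) (by
      rintro ⟨x₁, t₁, b₁⟩ ⟨x₂, t₂, b₂⟩ g ⟨k₁, k₂, k₃⟩ f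
      obtain ⟨f₁, f₂, rfl⟩ := exists_hel_tmk f
      obtain ⟨g₁, g₂, rfl⟩ : ∃ (g₁ : El M a (x₁, t₁)) (g₂ : b ⟶ b₁),
        g = (tmk g₁ (hel g₂) : El (tensor M (idP C)) (a, b) ((x₁, t₁), b₁)) := ⟨g.1, g.2, rfl⟩
      change φ (act M (𝟙 a) (Prod.mkHom f₁ (𝟙 t₂)) (tfst (act (tensor M (idP C)) (𝟙 (a, b))
        (Prod.mkHom (Prod.mkHom k₁ k₂) k₃) (tmk g₁ (hel g₂))))) (act D (Prod.mkHom (𝟙 t₂) (uhel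
          (tsnd (act (tensor M (idP C)) (𝟙 (a, b)) (Prod.mkHom (Prod.mkHom k₁ k₂) k₃)
            (tmk g₁ (hel g₂)))))) (𝟙 y) f₂) = φ (act M (𝟙 a) (Prod.mkHom (uhel (tfst
          (act (tensor (idP C) D) (Prod.mkHom k₁ (Prod.mkHom k₂ k₃)) (𝟙 (x, y))
            (tmk (hel f₁) f₂)))) (𝟙 t₁)) g₁) (act D (Prod.mkHom (𝟙 t₁) g₂) (𝟙 y) (tsnd
          (act (tensor (idP C) D) (Prod.mkHom k₁ (Prod.mkHom k₂ k₃)) (𝟙 (x, y))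
            (tmk (hel f₁) f₂))))
      simp only [act_tmk, act_hel, tfst_tmk, tsnd_tmk, uhel_hel, prod_id_fst, prod_id_snd, act_act]
      have e : act M (𝟙 a ≫ 𝟙 a) (Prod.mkHom k₁ k₂ ≫ Prod.mkHom f₁ (𝟙 t₂)) g₁ =
        act M (𝟙 a) (Prod.mkHom (𝟙 x) k₂)
          (act M (𝟙 a) (Prod.mkHom (k₁ ≫ f₁) (𝟙 t₁)) g₁) := by rw [act_act]; simp
      rw [e, h, act_act]
      simp)

theorem liftFrobR_mk {a b x y : C} {X : Sort*} (φ : ∀ {t : C}, El M a (x, t) → El D (t, b) y → X)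
    (h : ∀ {t t' : C} (m : El M a (x, t)) (k : t ⟶ t') (d : El D (t', b) y),
      φ (act M (𝟙 a) (Prod.mkHom (𝟙 x) k) m) d = φ m (act D (Prod.mkHom k (𝟙 b)) (𝟙 y) d)) {t : C}
    (m : El M a (x, t)) (d : El D (t, b) y) : liftFrobR φ h (frobR m d) = φ m d := by
  change φ (act M (𝟙 a) (𝟙 (x, t)) m) (act D (𝟙 (t, b)) (𝟙 y) d) = _
  rw [act_id, act_id]

end Named

end Prof

namespace Prof

section Transformations

variable {A B : Type u} [SmallCategory A] [SmallCategory B]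

/-- A natural family of functions on elements is a 2-cell. -/
def homMk {P Q : Profunctor.{u} A B} (θ : ∀ {b : B} {a : A}, El P b a → El Q b a)
    (h : ∀ {b b' : B} {a a' : A} (g : b' ⟶ b) (f : a ⟶ a') (p : El P b a),
      θ (act P g f p) = act Q g f (θ p)) : P ⟶ Q where
  app a :=
    { app := fun b => TypeCat.ofHom (fun p => θ (b := b.unop) p)
      naturality := by
        intro b b' g
        ext p
        have e := h g.unop (𝟙 a) p
        simp only [act] at e
        simpa using e }
  naturality := by
    intro a a' f
    ext b p
    have e := h (𝟙 b.unop) f p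
    simp only [act] at e
    simpa using e

theorem hom_ext_ap {P Q : Profunctor.{u} A B} {θ κ : P ⟶ Q}
    (h : ∀ {b : B} {a : A} (p : El P b a), ap θ p = ap κ p) : θ = κ := by
  ext a b p
  exact h (b := b.unop) p

theorem iso_ext_ap {P Q : Profunctor.{u} A B} {θ κ : P ≅ Q}
    (h : ∀ {b : B} {a : A} (p : El P b a), ap θ.hom p = ap κ.hom p) : θ = κ :=
  Iso.ext (hom_ext_ap h)

end Transformations

section Triple

variable {C : Type u} [SmallCategory C] {M : Profunctor.{u} (C × C) C}
  {D : Profunctor.{u} C (C × C)}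

theorem mulMulMul_slide₁ {x y z w v s s' t : C} (m : El M v (x, s)) (k : s ⟶ s')
    (m' : El M s' (y, t)) (m'' : El M t (z, w)) :
    mulMulMul (act M (𝟙 v) (Prod.mkHom (𝟙 x) k) m) m' m'' =
      mulMulMul m (act M k (𝟙 (y, t)) m') m'' := by
  refine (mk_slide m (Prod.mkHom (𝟙 x) k) _).trans (congrArg (mk m) ?_)
  refine (act_comp_mk _ _ _ _ _ _).trans ?_
  change mk (G := tensor (idP C) M) (F := tensor (idP C) (tensor (idP C) M)) (b := (x, (y, t)))
    (act (tensor (idP C) M) (Prod.mkHom (𝟙 x) k) (𝟙 (x, (y, t))) (tmk (hel (𝟙 x)) m'))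
    (act (tensor (idP C) (tensor (idP C) M)) (𝟙 (x, (y, t))) (𝟙 (x, (y, (z, w))))
      (tmk (hel (𝟙 x)) (tmk (hel (𝟙 y)) m''))) = _
  rw [act_tmk, act_id]
  simp only [act_hel, prod_id_fst, prod_id_snd, Category.id_comp]
  rfl

theorem mulMulMul_slide₂ {x y z w v s t t' : C} (m : El M v (x, s))
    (m' : El M s (y, t)) (k : t ⟶ t') (m'' : El M t' (z, w)) :
    mulMulMul m (act M (𝟙 s) (Prod.mkHom (𝟙 y) k) m') m'' =
      mulMulMul m m' (act M k (𝟙 (z, w)) m'') := by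
  refine congrArg (mk m) ?_
  have h := mk_slide (G := tensor (idP C) M) (F := tensor (idP C) (tensor (idP C) M))
    (d := (x, s)) (a := (x, (y, (z, w)))) (b := (x, (y, t))) (b' := (x, (y, t')))
    (tmk (hel (𝟙 x)) m')
    (Prod.mkHom (𝟙 x) (Prod.mkHom (𝟙 y) k)) (tmk (hel (𝟙 x)) (tmk (hel (𝟙 y)) m''))
  rw [act_tmk, act_tmk, act_tmk] at h
  simp only [act_hel, prod_id_fst, prod_id_snd, Category.id_comp] at h
  exact h

theorem comulMulMul_slide₁ {a b x y z s s' t : C} (d : El D (a, b) s) (k : s ⟶ s')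
    (m : El M s' (x, t)) (m' : El M t (y, z)) :
    comulMulMul (act D (𝟙 (a, b)) k d) m m' = comulMulMul d (act M k (𝟙 (x, t)) m) m' := by
  refine (mk_slide d k _).trans (congrArg (mk d) ?_)
  refine (act_inR (G := M) (P := M) (a := (y, z)) k (𝟙 (y, z)) (𝟙 x) m m').trans ?_
  rw [act_id]
  rfl

theorem comulMulMul_slide₂ {a b x y z s t t' : C} (d : El D (a, b) s)
    (m : El M s (x, t)) (k : t ⟶ t') (m' : El M t' (y, z)) :
    comulMulMul d (act M (𝟙 s) (Prod.mkHom (𝟙 x) k) m) m' =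
      comulMulMul d m (act M k (𝟙 (y, z)) m') :=
  congrArg (mk d) (slide_inR (G := M) (P := M) (a := (y, z)) m k m')

theorem comulComulMul_slide₁ {a b c x y s t t' : C} (d : El D (a, t') s) (k : t ⟶ t')
    (d' : El D (b, c) t) (m : El M s (x, y)) :
    comulComulMul d (act D (𝟙 (b, c)) k d') m =
      comulComulMul (act D (Prod.mkHom (𝟙 a) k) (𝟙 s) d) d' m := by
  have h := mk_slide (G := tensor (idP C) D) (F := comp D M) (d := (a, (b, c))) (b := (a, t))
    (b' := (a, t')) (tmk (hel (𝟙 a)) d') (Prod.mkHom (𝟙 a) k) (mk d m)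
  rw [act_tmk, act_comp_mk, act_id] at h
  simp only [act_hel, prod_id_fst, prod_id_snd, Category.id_comp] at h
  exact h

theorem comulComulMul_slide₂ {a b c x y s s' t : C} (d : El D (a, t) s) (k : s ⟶ s')
    (d' : El D (b, c) t) (m : El M s' (x, y)) :
    comulComulMul (act D (𝟙 (a, t)) k d) d' m = comulComulMul d d' (act M k (𝟙 (x, y)) m) :=
  congrArg (mk (G := tensor (idP C) D) (b := (a, t)) (tmk (hel (𝟙 a)) d')) (mk_slide d k m)

theorem comulComulComul_slide₁ {a b c e x s s' t : C} (d : El D (a, s') x) (k : s ⟶ s')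
    (d' : El D (b, t) s) (d'' : El D (c, e) t) :
    comulComulComul d (act D (𝟙 (b, t)) k d') d'' =
      comulComulComul (act D (Prod.mkHom (𝟙 a) k) (𝟙 x) d) d' d'' :=
  congrArg (mk (G := tensor (idP C) (tensor (idP C) D)) (b := (a, (b, t)))
    (tmk (hel (𝟙 a)) (tmk (hel (𝟙 b)) d''))) (slide_outR (G := D) (P := D) (d := (b, t)) d k d')

theorem comulComulComul_slide₂ {a b c e x s t t' : C} (d : El D (a, s) x)
    (d' : El D (b, t') s) (k : t ⟶ t') (d'' : El D (c, e) t) :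
    comulComulComul d d' (act D (𝟙 (c, e)) k d'') =
      comulComulComul d (act D (Prod.mkHom (𝟙 b) k) (𝟙 s) d') d'' := by
  have h := mk_slide (G := tensor (idP C) (tensor (idP C) D)) (F := comp (tensor (idP C) D) D)
    (d := (a, (b, (c, e)))) (b := (a, (b, t))) (b' := (a, (b, t')))
    (tmk (hel (𝟙 a)) (tmk (hel (𝟙 b)) d'')) (Prod.mkHom (𝟙 a) (Prod.mkHom (𝟙 b) k))
    (mk (G := tensor (idP C) D) (F := D) (b := (a, s)) (tmk (hel (𝟙 a)) d') d)
  rw [act_tmk, act_tmk, act_comp_mk, act_tmk, act_id] at h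
  simp only [act_hel, prod_id_fst, prod_id_snd, Category.id_comp] at h
  exact h

/-- The universal property of `ComulMulMul`. -/
def liftComulMulMul {a b x y z : C} {X : Sort*}
    (φ : ∀ {s t : C}, El D (a, b) s → El M s (x, t) → El M t (y, z) → X)
    (h₁ : ∀ {s s' t : C} (d : El D (a, b) s) (k : s ⟶ s') (m : El M s' (x, t)) (m' : El M t (y, z)),
      φ (act D (𝟙 (a, b)) k d) m m' = φ d (act M k (𝟙 (x, t)) m) m')
    (h₂ : ∀ {s t t' : C} (d : El D (a, b) s) (m : El M s (x, t)) (k : t ⟶ t') (m' : El M t' (y, z)),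
      φ d (act M (𝟙 s) (Prod.mkHom (𝟙 x) k) m) m' = φ d m (act M k (𝟙 (y, z)) m')) :
    El (ComulMulMul M D) (a, b) (x, (y, z)) → X :=
  compLift (fun d r => liftInR (G := M) (P := M) (a := (y, z)) (fun m m' => φ d m m')
    (fun m k m' => h₂ d m k m') r) (by
      intro s s' d k r
      obtain ⟨t, m, m', rfl⟩ := exists_mk_inR (G := M) (P := M) (a := (y, z)) r
      have e := act_inR (G := M) (P := M) (a := (y, z)) k (𝟙 (y, z)) (𝟙 x) m m'
      change _ = liftInR (G := M) (P := M) (a := (y, z)) _ _ (act (comp M (tensor (idP C) M)) k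
        (Prod.mkHom (𝟙 x) (𝟙 (y, z))) _)
      rw [e, liftInR_mk, liftInR_mk, act_id, h₁]
      rfl)

theorem liftComulMulMul_mk {a b x y z : C} {X : Sort*}
    (φ : ∀ {s t : C}, El D (a, b) s → El M s (x, t) → El M t (y, z) → X)
    (h₁ : ∀ {s s' t : C} (d : El D (a, b) s) (k : s ⟶ s') (m : El M s' (x, t)) (m' : El M t (y, z)),
      φ (act D (𝟙 (a, b)) k d) m m' = φ d (act M k (𝟙 (x, t)) m) m')
    (h₂ : ∀ {s t t' : C} (d : El D (a, b) s) (m : El M s (x, t)) (k : t ⟶ t') (m' : El M t' (y, z)),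
      φ d (act M (𝟙 s) (Prod.mkHom (𝟙 x) k) m) m' = φ d m (act M k (𝟙 (y, z)) m'))
    {s t : C} (d : El D (a, b) s) (m : El M s (x, t)) (m' : El M t (y, z)) :
    liftComulMulMul φ h₁ h₂ (comulMulMul d m m') = φ d m m' :=
  liftInR_mk (G := M) (P := M) (a := (y, z)) (fun m m' => φ d m m')
    (fun m k m' => h₂ d m k m') m m'

/-- The universal property of `ComulComulMul`. -/
def liftComulComulMul {a b c x y : C} {X : Sort*}
    (φ : ∀ {s t : C}, El D (a, t) s → El D (b, c) t → El M s (x, y) → X)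
    (h₁ : ∀ {s t t' : C} (d : El D (a, t') s) (k : t ⟶ t') (d' : El D (b, c) t)
      (m : El M s (x, y)), φ d (act D (𝟙 (b, c)) k d') m =
        φ (act D (Prod.mkHom (𝟙 a) k) (𝟙 s) d) d' m)
    (h₂ : ∀ {s s' t : C} (d : El D (a, t) s) (k : s ⟶ s') (d' : El D (b, c) t)
      (m : El M s' (x, y)), φ (act D (𝟙 (a, t)) k d) d' m = φ d d' (act M k (𝟙 (x, y)) m)) :
    El (ComulComulMul M D) (a, (b, c)) (x, y) → X :=
  compLift (fun {w} g r => compLift (fun {_} d m =>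
      φ (act D (Prod.mkHom (uhel (tfst g)) (𝟙 w.2)) (𝟙 _) d) (tsnd g) m) (by
        intro s s' d k m
        rw [← h₂, act_act, act_act]
        simp) r) (by
    rintro ⟨a₁, t⟩ ⟨a₂, t'⟩ g ⟨k₁, k₂⟩ r
    obtain ⟨s, d, m, rfl⟩ := exists_mk r
    obtain ⟨g₁, g₂, rfl⟩ := exists_hel_tmk g
    rw [act_comp_mk, act_tmk, act_id]
    change φ (act D (Prod.mkHom (uhel (tfst (tmk _ _))) (𝟙 t')) (𝟙 s) d) _ m =
      φ (act D (Prod.mkHom (uhel (tfst (tmk _ _))) (𝟙 t)) (𝟙 s) (act D _ (𝟙 s) d)) _ m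
    simp only [act_hel, tfst_tmk, tsnd_tmk, uhel_hel, prod_id_fst, prod_id_snd]
    rw [h₁, act_act, act_act]
    simp)

theorem liftComulComulMul_mk {a b c x y : C} {X : Sort*}
    (φ : ∀ {s t : C}, El D (a, t) s → El D (b, c) t → El M s (x, y) → X)
    (h₁ : ∀ {s t t' : C} (d : El D (a, t') s) (k : t ⟶ t') (d' : El D (b, c) t)
      (m : El M s (x, y)), φ d (act D (𝟙 (b, c)) k d') m =
        φ (act D (Prod.mkHom (𝟙 a) k) (𝟙 s) d) d' m)
    (h₂ : ∀ {s s' t : C} (d : El D (a, t) s) (k : s ⟶ s') (d' : El D (b, c) t)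
      (m : El M s' (x, y)), φ (act D (𝟙 (a, t)) k d) d' m = φ d d' (act M k (𝟙 (x, y)) m))
    {s t : C} (d : El D (a, t) s) (d' : El D (b, c) t) (m : El M s (x, y)) :
    liftComulComulMul φ h₁ h₂ (comulComulMul d d' m) = φ d d' m := by
  change φ (act D (𝟙 (a, t)) (𝟙 s) d) d' m = _
  rw [act_id]

/-- The universal property of `ComulComulComul`. -/
def liftComulComulComul {a b c e x : C} {X : Sort*}
    (φ : ∀ {s t : C}, El D (a, s) x → El D (b, t) s → El D (c, e) t → X)
    (h₁ : ∀ {s s' t : C} (d : El D (a, s') x) (k : s ⟶ s') (d' : El D (b, t) s)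
      (d'' : El D (c, e) t), φ d (act D (𝟙 (b, t)) k d') d'' =
        φ (act D (Prod.mkHom (𝟙 a) k) (𝟙 x) d) d' d'')
    (h₂ : ∀ {s t t' : C} (d : El D (a, s) x) (d' : El D (b, t') s) (k : t ⟶ t')
      (d'' : El D (c, e) t), φ d d' (act D (𝟙 (c, e)) k d'') =
        φ d (act D (Prod.mkHom (𝟙 b) k) (𝟙 s) d') d'') :
    El (ComulComulComul D) (a, (b, (c, e))) x → X :=
  compLift (fun {w} g r => liftOutR (G := D) (P := D) (d := w.2) (c := w.1) (fun {s} d d' =>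
      φ (act D (Prod.mkHom (uhel (tfst g)) (𝟙 s)) (𝟙 _) d)
        (act D (Prod.mkHom (uhel (tfst (tsnd g))) (𝟙 w.2.2)) (𝟙 s) d') (tsnd (tsnd g))) (by
        intro s s' d k d'
        change φ _ (act D _ _ (act D (𝟙 (w.2.1, w.2.2)) k d')) _ = _
        have e' : act D (Prod.mkHom (uhel (tfst (tsnd g))) (𝟙 w.2.2)) (𝟙 s')
            (act D (𝟙 (w.2.1, w.2.2)) k d') = act D (𝟙 (b, w.2.2)) k
            (act D (Prod.mkHom (uhel (tfst (tsnd g))) (𝟙 w.2.2)) (𝟙 s) d') := by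
          rw [act_act, act_act]; simp
        rw [e', h₁, act_act, act_act]
        simp) r) (by
    rintro ⟨a₁, b₁, t⟩ ⟨a₂, b₂, t'⟩ g ⟨k₁, k₂, k₃⟩ r
    obtain ⟨s, d, d', rfl⟩ := exists_mk_outR (G := D) (P := D) (d := (b₂, t')) r
    obtain ⟨g₁, g', rfl⟩ := exists_hel_tmk g
    obtain ⟨g₂, g₃, rfl⟩ := exists_hel_tmk (b := (c, e)) g'
    have e₁ := act_outR (G := D) (P := D) (d := (b₂, t')) (d' := (b₁, t)) (Prod.mkHom k₂ k₃) (𝟙 x)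
      k₁ d d'
    erw [e₁, liftOutR_mk, liftOutR_mk]
    rw [act_tmk, act_tmk]
    simp only [act_hel, tfst_tmk, tsnd_tmk, uhel_hel, prod_id_fst, prod_id_snd]
    rw [h₂]
    simp only [act_act]
    simp)

theorem liftComulComulComul_mk {a b c e x : C} {X : Sort*}
    (φ : ∀ {s t : C}, El D (a, s) x → El D (b, t) s → El D (c, e) t → X)
    (h₁ : ∀ {s s' t : C} (d : El D (a, s') x) (k : s ⟶ s') (d' : El D (b, t) s)
      (d'' : El D (c, e) t), φ d (act D (𝟙 (b, t)) k d') d'' =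
        φ (act D (Prod.mkHom (𝟙 a) k) (𝟙 x) d) d' d'')
    (h₂ : ∀ {s t t' : C} (d : El D (a, s) x) (d' : El D (b, t') s) (k : t ⟶ t')
      (d'' : El D (c, e) t), φ d d' (act D (𝟙 (c, e)) k d'') =
        φ d (act D (Prod.mkHom (𝟙 b) k) (𝟙 s) d') d'')
    {s t : C} (d : El D (a, s) x) (d' : El D (b, t) s) (d'' : El D (c, e) t) :
    liftComulComulComul φ h₁ h₂ (comulComulComul d d' d'') = φ d d' d'' := by
  change φ (act D (𝟙 (a, s)) (𝟙 x) (act D (𝟙 (a, s)) (𝟙 x) d)) (act D (𝟙 (b, t)) (𝟙 s) d') d'' = _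
  rw [act_id, act_id, act_id]

/-- The universal property of `MulMulMul`. -/
def liftMulMulMul {x y z w v : C} {X : Sort*}
    (φ : ∀ {s t : C}, El M v (x, s) → El M s (y, t) → El M t (z, w) → X)
    (h₁ : ∀ {s s' t : C} (m : El M v (x, s)) (k : s ⟶ s') (m' : El M s' (y, t))
      (m'' : El M t (z, w)), φ (act M (𝟙 v) (Prod.mkHom (𝟙 x) k) m) m' m'' =
        φ m (act M k (𝟙 (y, t)) m') m'')
    (h₂ : ∀ {s t t' : C} (m : El M v (x, s)) (m' : El M s (y, t)) (k : t ⟶ t')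
      (m'' : El M t' (z, w)), φ m (act M (𝟙 s) (Prod.mkHom (𝟙 y) k) m') m'' =
        φ m m' (act M k (𝟙 (z, w)) m'')) :
    El (MulMulMul M) v (x, (y, (z, w))) → X :=
  compLift (fun {p} m r => compLift (fun {q} g f =>
      φ (act M (𝟙 v) (Prod.mkHom (uhel (tfst g) ≫ uhel (tfst f)) (𝟙 p.2)) m)
        (act M (𝟙 p.2) (Prod.mkHom (uhel (tfst (tsnd f))) (𝟙 q.2.2)) (tsnd g)) (tsnd (tsnd f))) (by
        obtain ⟨p₁, p₂⟩ := p
        rintro ⟨x₁, y₁, t⟩ ⟨x₂, y₂, t'⟩ g ⟨k₁, k₂, k₃⟩ f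
        obtain ⟨f₁, f', rfl⟩ := exists_hel_tmk f
        obtain ⟨f₂, f₃, rfl⟩ := exists_hel_tmk (a := (z, w)) f'
        obtain ⟨g₁, g₂, rfl⟩ := exists_hel_tmk (a := (y₁, t)) g
        rw [act_tmk, act_tmk]
        simp only [tsnd_tmk, tfst_tmk]
        rw [act_tmk]
        simp only [act_hel, tsnd_tmk, tfst_tmk, uhel_hel, prod_id_fst, prod_id_snd]
        rw [← h₂, act_act, act_act]
        simp) r) (by
    rintro ⟨x₁, s⟩ ⟨x₂, s'⟩ m ⟨k₁, k₂⟩ r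
    obtain ⟨⟨x₃, y₃, t⟩, g, f, rfl⟩ := exists_mk r
    obtain ⟨g₁, g₂, rfl⟩ := exists_hel_tmk (a := (y₃, t)) g
    rw [act_comp_mk, act_tmk, act_id]
    change φ (act M _ (Prod.mkHom (uhel (tfst (tmk _ _)) ≫ _) _) _)
      (act M (𝟙 s') _ (tsnd (tmk _ _))) _ = φ (act M _ (Prod.mkHom (uhel (tfst (tmk _ _)) ≫ _) _) _)
      (act M (𝟙 s) _ (tsnd (tmk _ _))) _
    simp only [act_hel, tsnd_tmk, tfst_tmk, uhel_hel, prod_id_fst, prod_id_snd]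
    have e : act M (𝟙 v) (Prod.mkHom (g₁ ≫ uhel (tfst f)) (𝟙 s')) (act M (𝟙 v) (k₁, k₂) m) =
      act M (𝟙 v) (Prod.mkHom (𝟙 x) k₂) (act M (𝟙 v) (Prod.mkHom (k₁ ≫ g₁ ≫ uhel (tfst f)) (𝟙 s))
        m) := by rw [act_act, act_act]; simp
    rw [e, h₁, act_act, act_act]
    simp)

theorem liftMulMulMul_mk {x y z w v : C} {X : Sort*}
    (φ : ∀ {s t : C}, El M v (x, s) → El M s (y, t) → El M t (z, w) → X)
    (h₁ : ∀ {s s' t : C} (m : El M v (x, s)) (k : s ⟶ s') (m' : El M s' (y, t))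
      (m'' : El M t (z, w)), φ (act M (𝟙 v) (Prod.mkHom (𝟙 x) k) m) m' m'' =
        φ m (act M k (𝟙 (y, t)) m') m'')
    (h₂ : ∀ {s t t' : C} (m : El M v (x, s)) (m' : El M s (y, t)) (k : t ⟶ t')
      (m'' : El M t' (z, w)), φ m (act M (𝟙 s) (Prod.mkHom (𝟙 y) k) m') m'' =
        φ m m' (act M k (𝟙 (z, w)) m''))
    {s t : C} (m : El M v (x, s)) (m' : El M s (y, t)) (m'' : El M t (z, w)) :
    liftMulMulMul φ h₁ h₂ (mulMulMul m m' m'') = φ m m' m'' := by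
  change φ (act M (𝟙 v) (Prod.mkHom (𝟙 x ≫ 𝟙 x) (𝟙 s)) m) (act M (𝟙 s) (𝟙 (y, t)) m') m'' = _
  rw [Category.comp_id, act_id]
  exact congrArg (fun r => φ r m' m'') (act_id M m)

end Triple

end Prof

namespace Prof

section DerivedCalculus

variable {C : Type u} [SmallCategory C] {F : RightAdjointFrobenius C}

/-- The class of a tuple in `⊗`, with the cups and the cap not split. -/
def tenPair {a b z p q r : C} (c₁ : El (cup F.toFrobeniusPseudomonoid) pt (b, p))
    (c₂ : El (cup F.toFrobeniusPseudomonoid) pt (a, q)) (w : El F.Mr (p, q) r)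
    (c : El (cap F.toFrobeniusPseudomonoid) (r, z) pt) : El (Ten F) z (a, b) :=
  mk (G := (tensor (tensor (cup F.toFrobeniusPseudomonoid) (cup F.toFrobeniusPseudomonoid))
      (idP C)).whiskerLeft₂ (nest C) (Prod.sectR (pt, pt) C))
    (F := comp (tensor (idP (C × C)) (tensor F.Mr (idP C)))
      ((tensor (idP (C × C)) (cap F.toFrobeniusPseudomonoid)).whiskerLeft₂
        (Prod.sectL (C × C) pt) (𝟭 ((C × C) × (C × C)))))
    (b := ((a, b), ((p, q), z))) (tmk (tmk c₁ c₂) (hel (𝟙 z)))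
    (mk (G := tensor (idP (C × C)) (tensor F.Mr (idP C)))
      (F := (tensor (idP (C × C)) (cap F.toFrobeniusPseudomonoid)).whiskerLeft₂
        (Prod.sectL (C × C) pt) (𝟭 ((C × C) × (C × C))))
      (b := ((a, b), (r, z))) (tmk (hel (𝟙 (a, b))) (tmk w (hel (𝟙 z))))
      (tmk (hel (𝟙 (a, b))) c))

/-- The class of a general tuple in `⊗`. -/
def tenGen {a b z p q z₁ r z₂ : C} {u v : C × C}
    (g : El (tensor (tensor (cup F.toFrobeniusPseudomonoid) (cup F.toFrobeniusPseudomonoid))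
      (idP C)) ((pt, pt), z) (((u.2, p), (u.1, q)), z₁))
    (i : El (tensor (idP (C × C)) (tensor F.Mr (idP C))) (u, ((p, q), z₁)) (v, (r, z₂)))
    (j : El (tensor (idP (C × C)) (cap F.toFrobeniusPseudomonoid)) (v, (r, z₂)) ((a, b), pt)) :
    El (Ten F) z (a, b) :=
  mk (G := (tensor (tensor (cup F.toFrobeniusPseudomonoid) (cup F.toFrobeniusPseudomonoid))
      (idP C)).whiskerLeft₂ (nest C) (Prod.sectR (pt, pt) C))
    (F := comp (tensor (idP (C × C)) (tensor F.Mr (idP C)))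
      ((tensor (idP (C × C)) (cap F.toFrobeniusPseudomonoid)).whiskerLeft₂
        (Prod.sectL (C × C) pt) (𝟭 ((C × C) × (C × C)))))
    (b := (u, ((p, q), z₁))) g
    (mk (G := tensor (idP (C × C)) (tensor F.Mr (idP C)))
      (F := (tensor (idP (C × C)) (cap F.toFrobeniusPseudomonoid)).whiskerLeft₂
        (Prod.sectL (C × C) pt) (𝟭 ((C × C) × (C × C))))
      (b := (v, (r, z₂))) i j)

theorem tenGen_slide₁ {a b z p q z₁ p' q' z₁' r z₂ : C} {u u' v : C × C}
    (g : El (tensor (tensor (cup F.toFrobeniusPseudomonoid) (cup F.toFrobeniusPseudomonoid))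
      (idP C)) ((pt, pt), z) (((u.2, p), (u.1, q)), z₁)) (k : u ⟶ u') (l : p ⟶ p') (l' : q ⟶ q')
    (h : z₁ ⟶ z₁')
    (i : El (tensor (idP (C × C)) (tensor F.Mr (idP C))) (u', ((p', q'), z₁')) (v, (r, z₂)))
    (j : El (tensor (idP (C × C)) (cap F.toFrobeniusPseudomonoid)) (v, (r, z₂)) ((a, b), pt)) :
    tenGen (u := u') (act _ (𝟙 ((pt, pt), z))
      (Prod.mkHom (Prod.mkHom (Prod.mkHom k.2 l) (Prod.mkHom k.1 l')) h) g) i j =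
    tenGen g (act _ (Prod.mkHom k (Prod.mkHom (Prod.mkHom l l') h)) (𝟙 (v, (r, z₂))) i) j := by
  refine (mk_slide (G := (tensor (tensor (cup F.toFrobeniusPseudomonoid)
      (cup F.toFrobeniusPseudomonoid))
      (idP C)).whiskerLeft₂ (nest C) (Prod.sectR (pt, pt) C)) (b := (u, ((p, q), z₁)))
      (b' := (u', ((p', q'), z₁')))
      g (Prod.mkHom k (Prod.mkHom (Prod.mkHom l l') h)) _).trans (congrArg (mk _) ?_)
  refine (act_comp_mk _ _ _ _ _ _).trans ?_
  exact congrArg (mk _) (act_id _ _)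

theorem tenGen_slide₂ {a b z p q z₁ r z₂ r' z₂' : C} {u v v' : C × C}
    (g : El (tensor (tensor (cup F.toFrobeniusPseudomonoid) (cup F.toFrobeniusPseudomonoid))
      (idP C)) ((pt, pt), z) (((u.2, p), (u.1, q)), z₁))
    (i : El (tensor (idP (C × C)) (tensor F.Mr (idP C))) (u, ((p, q), z₁)) (v, (r, z₂)))
    (k : v ⟶ v') (l : r ⟶ r') (h : z₂ ⟶ z₂')
    (j : El (tensor (idP (C × C)) (cap F.toFrobeniusPseudomonoid)) (v', (r', z₂')) ((a, b), pt)) :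
    tenGen g (act _ (𝟙 (u, ((p, q), z₁))) (Prod.mkHom k (Prod.mkHom l h)) i) j =
    tenGen g i (act _ (Prod.mkHom k (Prod.mkHom l h)) (𝟙 ((a, b), pt)) j) :=
  congrArg (mk _) (mk_slide (b := (v, (r, z₂))) (b' := (v', (r', z₂')))
    (F := (tensor (idP (C × C)) (cap F.toFrobeniusPseudomonoid)).whiskerLeft₂
        (Prod.sectL (C × C) pt) (𝟭 ((C × C) × (C × C)))) i (Prod.mkHom k (Prod.mkHom l h)) j)

theorem tenPair_eq {a b z p q r : C} (c₁ : El (cup F.toFrobeniusPseudomonoid) pt (b, p))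
    (c₂ : El (cup F.toFrobeniusPseudomonoid) pt (a, q)) (w : El F.Mr (p, q) r)
    (c : El (cap F.toFrobeniusPseudomonoid) (r, z) pt) :
    tenPair c₁ c₂ w c = tenGen (u := (a, b)) (v := (a, b)) (tmk (tmk c₁ c₂) (hel (𝟙 z)))
      (tmk (hel (𝟙 (a, b))) (tmk w (hel (𝟙 z)))) (tmk (hel (𝟙 (a, b))) c) := rfl

theorem tenMk_eq {a b z p q r s₁ s₂ t : C} (e₁ : El F.E pt s₁) (m₁ : El F.M s₁ (b, p))
    (e₂ : El F.E pt s₂) (m₂ : El F.M s₂ (a, q)) (w : El F.Mr (p, q) r) (d : El F.D (r, z) t)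
    (n : El F.H t pt) :
    tenMk e₁ m₁ e₂ m₂ w d n = tenPair (cupMk e₁ m₁) (cupMk e₂ m₂) w (capMk d n) := rfl

theorem tenGen_tmk {a b z p q z₁ r z₂ : C} {u v : C × C}
    (c₁ : El (cup F.toFrobeniusPseudomonoid) pt (u.2, p))
    (c₂ : El (cup F.toFrobeniusPseudomonoid) pt (u.1, q)) (h : z ⟶ z₁) (k : u ⟶ v)
    (w : El F.Mr (p, q) r) (h' : z₁ ⟶ z₂) (k' : v ⟶ (a, b))
    (c : El (cap F.toFrobeniusPseudomonoid) (r, z₂) pt) :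
    tenGen (tmk (tmk c₁ c₂) (hel h)) (tmk (hel k) (tmk w (hel h'))) (tmk (hel k') c) =
      tenPair (act (cup F.toFrobeniusPseudomonoid) (𝟙 pt) (Prod.mkHom (k.2 ≫ k'.2) (𝟙 p)) c₁)
        (act (cup F.toFrobeniusPseudomonoid) (𝟙 pt) (Prod.mkHom (k.1 ≫ k'.1) (𝟙 q)) c₂) w
        (act (cap F.toFrobeniusPseudomonoid) (Prod.mkHom (𝟙 r) (h ≫ h')) (𝟙 pt) c) := by
  have e₁ := tenGen_slide₁ (u := u) (u' := (a, b)) (v := (a, b)) (tmk (tmk c₁ c₂) (hel (𝟙 z)))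
    (k ≫ k') (𝟙 p) (𝟙 q) (𝟙 z) (tmk (hel (𝟙 (a, b))) (tmk w (hel (𝟙 z))))
    (tmk (hel (𝟙 (a, b))) (act (cap F.toFrobeniusPseudomonoid) (Prod.mkHom (𝟙 r) (h ≫ h'))
      (𝟙 pt) c))
  have e₃ := tenGen_slide₂ (u := u) (v := u) (v' := (a, b)) (tmk (tmk c₁ c₂) (hel (𝟙 z)))
    (tmk (hel (𝟙 u)) (tmk w (hel (𝟙 z)))) (k ≫ k') (𝟙 r) (𝟙 z) (tmk (hel (𝟙 (a, b)))
      (act (cap F.toFrobeniusPseudomonoid) (Prod.mkHom (𝟙 r) (h ≫ h')) (𝟙 pt) c))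
  have e₄ := tenGen_slide₁ (u := u) (u' := u) (v := v) (tmk (tmk c₁ c₂) (hel (𝟙 z)))
    (𝟙 u) (𝟙 p) (𝟙 q) h (tmk (hel k) (tmk w (hel h'))) (tmk (hel k') c)
  have e₅ := tenGen_slide₂ (u := u) (v := u) (v' := v) (tmk (tmk c₁ c₂) (hel (𝟙 z)))
    (tmk (hel (𝟙 u)) (tmk w (hel (𝟙 z)))) k (𝟙 r) (h ≫ h') (tmk (hel k') c)
  have f₁ : act F.Mr (Prod.mkHom (𝟙 p) (𝟙 q)) (𝟙 r) w = w := act_id _ _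
  have f₂ : act (cup F.toFrobeniusPseudomonoid) (𝟙 pt) (Prod.mkHom (𝟙 u.2) (𝟙 p)) c₁ = c₁ :=
    act_id _ _
  have f₃ : act (cup F.toFrobeniusPseudomonoid) (𝟙 pt) (Prod.mkHom (𝟙 u.1) (𝟙 q)) c₂ = c₂ :=
    act_id _ _
  simp only [act_tmk, act_hel, prod_id_fst, prod_id_snd, Category.id_comp, Category.comp_id, f₁, f₂,
    f₃, act_id, act_act, prod_comp_fst, prod_comp_snd] at e₁ e₃ e₄ e₅
  have f₄ : act (cap F.toFrobeniusPseudomonoid)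
      (Prod.mkHom (𝟙 r) (𝟙 z) ≫ Prod.mkHom (𝟙 r) (h ≫ h')) (𝟙 pt) c =
      act (cap F.toFrobeniusPseudomonoid) (Prod.mkHom (𝟙 r) (h ≫ h')) (𝟙 pt) c := by simp
  rw [f₄] at e₃
  rw [tenPair_eq]
  refine Eq.trans ?_ e₁.symm
  exact e₄.trans (e₅.trans e₃.symm)

theorem exists_tenPair {a b z : C} (τ : El (Ten F) z (a, b)) :
    ∃ (p q r : C) (c₁ : El (cup F.toFrobeniusPseudomonoid) pt (b, p))
      (c₂ : El (cup F.toFrobeniusPseudomonoid) pt (a, q)) (w : El F.Mr (p, q) r)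
      (c : El (cap F.toFrobeniusPseudomonoid) (r, z) pt), tenPair c₁ c₂ w c = τ := by
  obtain ⟨⟨u, ⟨p, q⟩, z₁⟩, g, t, rfl⟩ := exists_mk τ
  obtain ⟨⟨v, r, z₂⟩, i, j, rfl⟩ := exists_mk t
  exact ⟨p, q, r, _, _, _, _, (tenGen_tmk (u := u) (v := v) g.1.1 g.1.2 g.2 i.1 i.2.1 i.2.2 j.1
    j.2).symm⟩

theorem exists_cupMk {x y : C} (c : El (cup F.toFrobeniusPseudomonoid) pt (x, y)) :
    ∃ (s : C) (e : El F.E pt s) (m : El F.M s (x, y)), cupMk e m = c := exists_mk c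

theorem exists_capMk {x y : C} (c : El (cap F.toFrobeniusPseudomonoid) (x, y) pt) :
    ∃ (t : C) (d : El F.D (x, y) t) (n : El F.H t pt), capMk d n = c := exists_mk c

theorem exists_tenMk {a b z : C} (τ : El (Ten F) z (a, b)) :
    ∃ (p q r s₁ s₂ t : C) (e₁ : El F.E pt s₁) (m₁ : El F.M s₁ (b, p)) (e₂ : El F.E pt s₂)
      (m₂ : El F.M s₂ (a, q)) (w : El F.Mr (p, q) r) (d : El F.D (r, z) t) (n : El F.H t pt),
      tenMk e₁ m₁ e₂ m₂ w d n = τ := by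
  obtain ⟨p, q, r, c₁, c₂, w, c, rfl⟩ := exists_tenPair τ
  obtain ⟨s₁, e₁, m₁, rfl⟩ := exists_cupMk c₁
  obtain ⟨s₂, e₂, m₂, rfl⟩ := exists_cupMk c₂
  obtain ⟨t, d, n, rfl⟩ := exists_capMk c
  exact ⟨p, q, r, s₁, s₂, t, e₁, m₁, e₂, m₂, w, d, n, rfl⟩

theorem cupMk_slide {x y s s' : C} (e : El F.E pt s) (k : s ⟶ s') (m : El F.M s' (x, y)) :
    cupMk (act F.E (𝟙 pt) k e) m = cupMk e (act F.M k (𝟙 (x, y)) m) := mk_slide e k m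

theorem capMk_slide {x y s s' : C} (d : El F.D (x, y) s) (k : s ⟶ s') (n : El F.H s' pt) :
    capMk (act F.D (𝟙 (x, y)) k d) n = capMk d (act F.H k (𝟙 pt) n) := mk_slide d k n

theorem act_cupMk {x y x' y' s : C} (f : (x, y) ⟶ (x', y')) (e : El F.E pt s)
    (m : El F.M s (x, y)) :
    act (cup F.toFrobeniusPseudomonoid) (𝟙 pt) f (cupMk e m) = cupMk e (act F.M (𝟙 s) f m) :=
  (act_comp_mk _ _ _ _ _ _).trans (congrArg (fun t => cupMk t _) (act_id _ e))

theorem act_capMk {x y x' y' s : C} (f : (x', y') ⟶ (x, y)) (d : El F.D (x, y) s)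
    (n : El F.H s pt) :
    act (cap F.toFrobeniusPseudomonoid) f (𝟙 pt) (capMk d n) = capMk (act F.D f (𝟙 s) d) n :=
  (act_comp_mk _ _ _ _ _ _).trans (congrArg (fun t => capMk _ t) (act_id _ n))

theorem tenPair_slide₁ {a b z p q r p' q' : C}
    (c₁ : El (cup F.toFrobeniusPseudomonoid) pt (b, p))
    (c₂ : El (cup F.toFrobeniusPseudomonoid) pt (a, q)) (k : p ⟶ p') (l : q ⟶ q')
    (w : El F.Mr (p', q') r) (c : El (cap F.toFrobeniusPseudomonoid) (r, z) pt) :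
    tenPair (act _ (𝟙 pt) (Prod.mkHom (𝟙 b) k) c₁) (act _ (𝟙 pt) (Prod.mkHom (𝟙 a) l) c₂) w c =
      tenPair c₁ c₂ (act F.Mr (Prod.mkHom k l) (𝟙 r) w) c := by
  have e := tenGen_slide₁ (u := (a, b)) (u' := (a, b)) (v := (a, b)) (tmk (tmk c₁ c₂) (hel (𝟙 z)))
    (𝟙 (a, b)) k l (𝟙 z) (tmk (hel (𝟙 (a, b))) (tmk w (hel (𝟙 z)))) (tmk (hel (𝟙 (a, b))) c)
  simp only [act_tmk, act_hel, prod_id_fst, prod_id_snd, Category.comp_id] at e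
  exact e

theorem tenPair_slide₂ {a b z p q r r' : C}
    (c₁ : El (cup F.toFrobeniusPseudomonoid) pt (b, p))
    (c₂ : El (cup F.toFrobeniusPseudomonoid) pt (a, q)) (w : El F.Mr (p, q) r) (k : r ⟶ r')
    (c : El (cap F.toFrobeniusPseudomonoid) (r', z) pt) :
    tenPair c₁ c₂ (act F.Mr (𝟙 (p, q)) k w) c =
      tenPair c₁ c₂ w (act _ (Prod.mkHom k (𝟙 z)) (𝟙 pt) c) := by
  have e := tenGen_slide₂ (u := (a, b)) (v := (a, b)) (v' := (a, b))
    (tmk (tmk c₁ c₂) (hel (𝟙 z))) (tmk (hel (𝟙 (a, b))) (tmk w (hel (𝟙 z)))) (𝟙 (a, b)) k (𝟙 z)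
    (tmk (hel (𝟙 (a, b))) c)
  simp only [act_tmk, act_hel, prod_id_fst, prod_id_snd, Category.comp_id] at e
  exact e

theorem act_tenPair {a b z a' b' z' p q r : C} (f : a ⟶ a') (g : b ⟶ b') (h : z' ⟶ z)
    (c₁ : El (cup F.toFrobeniusPseudomonoid) pt (b, p))
    (c₂ : El (cup F.toFrobeniusPseudomonoid) pt (a, q)) (w : El F.Mr (p, q) r)
    (c : El (cap F.toFrobeniusPseudomonoid) (r, z) pt) :
    act (Ten F) h (Prod.mkHom f g) (tenPair c₁ c₂ w c) =
      tenPair (act _ (𝟙 pt) (Prod.mkHom g (𝟙 p)) c₁) (act _ (𝟙 pt) (Prod.mkHom f (𝟙 q)) c₂) w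
        (act _ (Prod.mkHom (𝟙 r) h) (𝟙 pt) c) := by
  have e : act (Ten F) h (Prod.mkHom f g) (tenPair c₁ c₂ w c) =
      tenGen (u := (a, b)) (v := (a, b)) (act (tensor (tensor (cup F.toFrobeniusPseudomonoid)
        (cup F.toFrobeniusPseudomonoid)) (idP C)) (Prod.mkHom (𝟙 (pt, pt)) h)
        (𝟙 (((b, p), (a, q)), z)) (tmk (tmk c₁ c₂) (hel (𝟙 z))))
      (act _ (𝟙 ((a, b), ((p, q), z))) (𝟙 ((a, b), (r, z)))
        (tmk (hel (𝟙 (a, b))) (tmk w (hel (𝟙 z)))))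
      (act _ (𝟙 ((a, b), (r, z))) (Prod.mkHom (Prod.mkHom f g) (𝟙 pt))
        (tmk (hel (𝟙 (a, b))) c)) := by
    refine (act_comp_mk _ _ _ _ _ _).trans (congrArg (mk _) ?_)
    exact act_comp_mk _ _ _ _ _ _
  rw [e]
  simp only [act_tmk, act_hel, prod_id_fst, prod_id_snd, Category.id_comp, Category.comp_id, act_id]
  rw [tenGen_tmk]
  simp

/-- The extension of a function on normalised tuples in `⊗` to general tuples. -/
def tenVal {a b z p q z₁ r z₂ : C} {u v : C × C} {X : Sort*} (φ : ∀ {p q r : C},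
      El (cup F.toFrobeniusPseudomonoid) pt (b, p) → El (cup F.toFrobeniusPseudomonoid) pt (a, q) →
      El F.Mr (p, q) r → El (cap F.toFrobeniusPseudomonoid) (r, z) pt → X)
    (g : El (tensor (tensor (cup F.toFrobeniusPseudomonoid) (cup F.toFrobeniusPseudomonoid))
      (idP C)) ((pt, pt), z) (((u.2, p), (u.1, q)), z₁))
    (i : El (tensor (idP (C × C)) (tensor F.Mr (idP C))) (u, ((p, q), z₁)) (v, (r, z₂)))
    (j : El (tensor (idP (C × C)) (cap F.toFrobeniusPseudomonoid)) (v, (r, z₂)) ((a, b), pt)) : X :=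
  φ (act (cup F.toFrobeniusPseudomonoid) (𝟙 pt)
      (Prod.mkHom ((uhel (tfst i) : u ⟶ v).2 ≫ (uhel (tfst j) : v ⟶ (a, b)).2) (𝟙 p))
        (tfst (tfst g)))
    (act (cup F.toFrobeniusPseudomonoid) (𝟙 pt)
      (Prod.mkHom ((uhel (tfst i) : u ⟶ v).1 ≫ (uhel (tfst j) : v ⟶ (a, b)).1) (𝟙 q))
        (tsnd (tfst g)))
    (tfst (tsnd i))
    (act (cap F.toFrobeniusPseudomonoid) (Prod.mkHom (𝟙 r) ((uhel (tsnd g) : z ⟶ z₁) ≫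
      (uhel (tsnd (tsnd i)) : z₁ ⟶ z₂))) (𝟙 pt) (tsnd j))

theorem tenVal_slide₁ {a b z p q z₁ p' q' z₁' r z₂ : C} {u u' v : C × C} {X : Sort*} (φ : ∀ {p q r : C},
      El (cup F.toFrobeniusPseudomonoid) pt (b, p) → El (cup F.toFrobeniusPseudomonoid) pt (a, q) →
      El F.Mr (p, q) r → El (cap F.toFrobeniusPseudomonoid) (r, z) pt → X)
    (h₁ : ∀ {p q r p' q' : C} (c₁ : El (cup F.toFrobeniusPseudomonoid) pt (b, p))
      (c₂ : El (cup F.toFrobeniusPseudomonoid) pt (a, q)) (k : p ⟶ p') (l : q ⟶ q')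
      (w : El F.Mr (p', q') r) (c : El (cap F.toFrobeniusPseudomonoid) (r, z) pt),
      φ (act _ (𝟙 pt) (Prod.mkHom (𝟙 b) k) c₁) (act _ (𝟙 pt) (Prod.mkHom (𝟙 a) l) c₂) w c =
        φ c₁ c₂ (act F.Mr (Prod.mkHom k l) (𝟙 r) w) c)
    (g : El (tensor (tensor (cup F.toFrobeniusPseudomonoid) (cup F.toFrobeniusPseudomonoid))
      (idP C)) ((pt, pt), z) (((u.2, p), (u.1, q)), z₁)) (k : u ⟶ u') (l : p ⟶ p') (l' : q ⟶ q')
    (h : z₁ ⟶ z₁')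
    (i : El (tensor (idP (C × C)) (tensor F.Mr (idP C))) (u', ((p', q'), z₁')) (v, (r, z₂)))
    (j : El (tensor (idP (C × C)) (cap F.toFrobeniusPseudomonoid)) (v, (r, z₂)) ((a, b), pt)) :
    tenVal (u := u') φ (act _ (𝟙 ((pt, pt), z))
      (Prod.mkHom (Prod.mkHom (Prod.mkHom k.2 l) (Prod.mkHom k.1 l')) h) g) i j =
    tenVal φ g (act _ (Prod.mkHom k (Prod.mkHom (Prod.mkHom l l') h)) (𝟙 (v, (r, z₂))) i) j := by
  obtain ⟨i₁, i', rfl⟩ := exists_hel_tmk i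
  obtain ⟨i₂, i₃, rfl⟩ := exists_tmk_hel i'
  obtain ⟨g₁, g₂, rfl⟩ := exists_tmk_hel g
  obtain ⟨c₁, c₂, rfl⟩ := exists_tmk g₁
  obtain ⟨j₁, j₂, rfl⟩ := exists_hel_tmk (b := (r, z₂)) j
  simp only [tenVal, act_tmk, act_hel, tsnd_tmk, tfst_tmk, uhel_hel, prod_id_fst, prod_id_snd]
  rw [← h₁, act_act, act_act, act_act, act_act]
  simp

theorem tenVal_slide₂ {a b z p q z₁ r z₂ r' z₂' : C} {u v v' : C × C} {X : Sort*} (φ : ∀ {p q r : C},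
      El (cup F.toFrobeniusPseudomonoid) pt (b, p) → El (cup F.toFrobeniusPseudomonoid) pt (a, q) →
      El F.Mr (p, q) r → El (cap F.toFrobeniusPseudomonoid) (r, z) pt → X)
    (h₂ : ∀ {p q r r' : C} (c₁ : El (cup F.toFrobeniusPseudomonoid) pt (b, p))
      (c₂ : El (cup F.toFrobeniusPseudomonoid) pt (a, q)) (w : El F.Mr (p, q) r) (k : r ⟶ r')
      (c : El (cap F.toFrobeniusPseudomonoid) (r', z) pt),
      φ c₁ c₂ (act F.Mr (𝟙 (p, q)) k w) c = φ c₁ c₂ w (act _ (Prod.mkHom k (𝟙 z)) (𝟙 pt) c))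
    (g : El (tensor (tensor (cup F.toFrobeniusPseudomonoid) (cup F.toFrobeniusPseudomonoid))
      (idP C)) ((pt, pt), z) (((u.2, p), (u.1, q)), z₁))
    (i : El (tensor (idP (C × C)) (tensor F.Mr (idP C))) (u, ((p, q), z₁)) (v, (r, z₂)))
    (k : v ⟶ v') (l : r ⟶ r') (h : z₂ ⟶ z₂')
    (j : El (tensor (idP (C × C)) (cap F.toFrobeniusPseudomonoid)) (v', (r', z₂')) ((a, b), pt)) :
    tenVal φ g (act _ (𝟙 (u, ((p, q), z₁))) (Prod.mkHom k (Prod.mkHom l h)) i) j =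
    tenVal φ g i (act _ (Prod.mkHom k (Prod.mkHom l h)) (𝟙 ((a, b), pt)) j) := by
  obtain ⟨i₁, i', rfl⟩ := exists_hel_tmk i
  obtain ⟨i₂, i₃, rfl⟩ := exists_tmk_hel i'
  obtain ⟨g₁, g₂, rfl⟩ := exists_tmk_hel g
  obtain ⟨c₁, c₂, rfl⟩ := exists_tmk g₁
  obtain ⟨j₁, j₂, rfl⟩ := exists_hel_tmk (b := (r', z₂')) j
  simp only [tenVal, act_tmk, act_hel, tsnd_tmk, tfst_tmk, uhel_hel, prod_id_fst, prod_id_snd]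
  rw [h₂, act_act, act_act]
  simp

/-- The universal property of `⊗`. -/
def liftTen {a b z : C} {X : Sort*} (φ : ∀ {p q r : C},
      El (cup F.toFrobeniusPseudomonoid) pt (b, p) → El (cup F.toFrobeniusPseudomonoid) pt (a, q) →
      El F.Mr (p, q) r → El (cap F.toFrobeniusPseudomonoid) (r, z) pt → X)
    (h₁ : ∀ {p q r p' q' : C} (c₁ : El (cup F.toFrobeniusPseudomonoid) pt (b, p))
      (c₂ : El (cup F.toFrobeniusPseudomonoid) pt (a, q)) (k : p ⟶ p') (l : q ⟶ q')
      (w : El F.Mr (p', q') r) (c : El (cap F.toFrobeniusPseudomonoid) (r, z) pt),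
      φ (act _ (𝟙 pt) (Prod.mkHom (𝟙 b) k) c₁) (act _ (𝟙 pt) (Prod.mkHom (𝟙 a) l) c₂) w c =
        φ c₁ c₂ (act F.Mr (Prod.mkHom k l) (𝟙 r) w) c)
    (h₂ : ∀ {p q r r' : C} (c₁ : El (cup F.toFrobeniusPseudomonoid) pt (b, p))
      (c₂ : El (cup F.toFrobeniusPseudomonoid) pt (a, q)) (w : El F.Mr (p, q) r) (k : r ⟶ r')
      (c : El (cap F.toFrobeniusPseudomonoid) (r', z) pt),
      φ c₁ c₂ (act F.Mr (𝟙 (p, q)) k w) c = φ c₁ c₂ w (act _ (Prod.mkHom k (𝟙 z)) (𝟙 pt) c)) :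
    El (Ten F) z (a, b) → X :=
  compLift (fun {u} g t => compLift (fun {v} i j =>
    tenVal (u := u.1) (v := v.1) (r := v.2.1) (z₂ := v.2.2) φ g i j) (by
      rintro ⟨v, r, z₂⟩ ⟨v', r', z₂'⟩ i ⟨k, l, h⟩ j
      exact tenVal_slide₂ φ h₂ g i k l h j) t) (by
    rintro ⟨u, ⟨p, q⟩, z₁⟩ ⟨u', ⟨p', q'⟩, z₁'⟩ g ⟨k, ⟨l, l'⟩, h⟩ t
    obtain ⟨⟨v, r, z₂⟩, i, j, rfl⟩ := exists_mk t
    refine (tenVal_slide₁ φ h₁ g k l l' h i j).trans ?_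
    rw [act_comp_mk]
    exact congrArg (tenVal φ g _) (act_id _ j).symm)

theorem liftTen_mk {a b z p q r : C} {X : Sort*} (φ : ∀ {p q r : C},
      El (cup F.toFrobeniusPseudomonoid) pt (b, p) → El (cup F.toFrobeniusPseudomonoid) pt (a, q) →
      El F.Mr (p, q) r → El (cap F.toFrobeniusPseudomonoid) (r, z) pt → X)
    (h₁ : ∀ {p q r p' q' : C} (c₁ : El (cup F.toFrobeniusPseudomonoid) pt (b, p))
      (c₂ : El (cup F.toFrobeniusPseudomonoid) pt (a, q)) (k : p ⟶ p') (l : q ⟶ q')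
      (w : El F.Mr (p', q') r) (c : El (cap F.toFrobeniusPseudomonoid) (r, z) pt),
      φ (act _ (𝟙 pt) (Prod.mkHom (𝟙 b) k) c₁) (act _ (𝟙 pt) (Prod.mkHom (𝟙 a) l) c₂) w c =
        φ c₁ c₂ (act F.Mr (Prod.mkHom k l) (𝟙 r) w) c)
    (h₂ : ∀ {p q r r' : C} (c₁ : El (cup F.toFrobeniusPseudomonoid) pt (b, p))
      (c₂ : El (cup F.toFrobeniusPseudomonoid) pt (a, q)) (w : El F.Mr (p, q) r) (k : r ⟶ r')
      (c : El (cap F.toFrobeniusPseudomonoid) (r', z) pt),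
      φ c₁ c₂ (act F.Mr (𝟙 (p, q)) k w) c = φ c₁ c₂ w (act _ (Prod.mkHom k (𝟙 z)) (𝟙 pt) c))
    (c₁ : El (cup F.toFrobeniusPseudomonoid) pt (b, p))
    (c₂ : El (cup F.toFrobeniusPseudomonoid) pt (a, q)) (w : El F.Mr (p, q) r)
    (c : El (cap F.toFrobeniusPseudomonoid) (r, z) pt) :
    liftTen φ h₁ h₂ (tenPair c₁ c₂ w c) = φ c₁ c₂ w c := by
  change φ (act _ (𝟙 pt) (Prod.mkHom (𝟙 b ≫ 𝟙 b) (𝟙 p)) c₁)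
    (act _ (𝟙 pt) (Prod.mkHom (𝟙 a ≫ 𝟙 a) (𝟙 q)) c₂) w
    (act _ (Prod.mkHom (𝟙 r) (𝟙 z ≫ 𝟙 z)) (𝟙 pt) c) = _
  rw [Category.comp_id, Category.comp_id, Category.comp_id]
  have e₁ := act_id (cup F.toFrobeniusPseudomonoid) c₁
  have e₂ := act_id (cup F.toFrobeniusPseudomonoid) c₂
  have e₃ := act_id (cap F.toFrobeniusPseudomonoid) c
  rw [prod_id] at e₁ e₂ e₃
  rw [e₁, e₂, e₃]

section Uni

theorem exists_uniMk {z : C} (ι : El (Uni F) z pt) :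
    ∃ (r t : C) (w : El F.Hr pt r) (d : El F.D (r, z) t) (n : El F.H t pt), uniMk w d n = ι := by
  obtain ⟨r, c, w, rfl⟩ := exists_mk_outL (G := cap F.toFrobeniusPseudomonoid) (P := F.Hr)
    (d := pt) (a := pt) (c := z) ι
  obtain ⟨t, d, n, rfl⟩ := exists_capMk c
  exact ⟨r, t, w, d, n, rfl⟩

theorem uniMk_slide {z r r' t : C} (w : El F.Hr pt r) (k : r ⟶ r') (d : El F.D (r', z) t)
    (n : El F.H t pt) :
    uniMk (act F.Hr (𝟙 pt) k w) d n = uniMk w (act F.D (Prod.mkHom k (𝟙 z)) (𝟙 t) d) n := by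
  have e := slide_outL (G := cap F.toFrobeniusPseudomonoid) (P := F.Hr) (d := pt) (a := pt)
    (c := z) (capMk d n) k w
  rw [act_capMk] at e
  exact e

theorem uniMk_slide' {z r t t' : C} (w : El F.Hr pt r) (d : El F.D (r, z) t) (k : t ⟶ t')
    (n : El F.H t' pt) :
    uniMk w (act F.D (𝟙 (r, z)) k d) n = uniMk w d (act F.H k (𝟙 pt) n) := by
  have e := capMk_slide d k n
  exact congrArg (fun c => mk (G := tensor F.Hr (idP C)) (F := cap F.toFrobeniusPseudomonoid)
    (d := (pt, z)) (b := (r, z)) (tmk w (hel (𝟙 z))) c) e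

theorem act_uniMk {z z' r t : C} (h : z' ⟶ z) (w : El F.Hr pt r) (d : El F.D (r, z) t)
    (n : El F.H t pt) :
    act (Uni F) h (𝟙 pt) (uniMk w d n) = uniMk w (act F.D (Prod.mkHom (𝟙 r) h) (𝟙 t) d) n := by
  have e := act_outL (G := cap F.toFrobeniusPseudomonoid) (P := F.Hr) (𝟙 pt) (𝟙 pt) h
    (capMk d n) w
  rw [act_capMk, act_id] at e
  exact e

/-- The universal property of the derived unit. -/
def liftUni {z : C} {X : Sort*}
    (φ : ∀ {r : C}, El F.Hr pt r → El (cap F.toFrobeniusPseudomonoid) (r, z) pt → X)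
    (h : ∀ {r r' : C} (w : El F.Hr pt r) (k : r ⟶ r')
      (c : El (cap F.toFrobeniusPseudomonoid) (r', z) pt),
      φ (act F.Hr (𝟙 pt) k w) c = φ w (act _ (Prod.mkHom k (𝟙 z)) (𝟙 pt) c)) :
    El (Uni F) z pt → X :=
  liftOutL (G := cap F.toFrobeniusPseudomonoid) (P := F.Hr) (d := pt) (a := pt) (c := z)
    (fun c w => φ w c) (fun c k w => h w k c)

theorem liftUni_mk {z r t : C} {X : Sort*}
    (φ : ∀ {r : C}, El F.Hr pt r → El (cap F.toFrobeniusPseudomonoid) (r, z) pt → X)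
    (h : ∀ {r r' : C} (w : El F.Hr pt r) (k : r ⟶ r')
      (c : El (cap F.toFrobeniusPseudomonoid) (r', z) pt),
      φ (act F.Hr (𝟙 pt) k w) c = φ w (act _ (Prod.mkHom k (𝟙 z)) (𝟙 pt) c))
    (w : El F.Hr pt r) (d : El F.D (r, z) t) (n : El F.H t pt) :
    liftUni φ h (uniMk w d n) = φ w (capMk d n) :=
  liftOutL_mk (G := cap F.toFrobeniusPseudomonoid) (P := F.Hr) (d := pt) (a := pt) (c := z)
    (fun c w => φ w c) (fun c k w => h w k c) (capMk d n) w

end Uni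

end DerivedCalculus

end Prof

namespace Prof

section Loop

variable {C : Type u} [SmallCategory C] {F : RightAdjointFrobenius C}

/-- The class of a general tuple in the rotated source of the trace. -/
def loopGen {a b w y₁ b₁ x₁ y₂ : C} (m : El F.M a (w, y₁))
    (i : El (tensor (Ten F) (idP C)) (w, y₁) ((b₁, x₁), y₂))
    (j : El (tensor (idP C) (cap F.toFrobeniusPseudomonoid)) (b₁, (y₂, x₁)) (b, pt)) :
    El (Loop F) a b :=
  mk (G := F.M)
    (F := comp ((tensor (Ten F) (idP C)).whiskerLeft₂ (swap C) (𝟭 (C × C)))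
      ((tensor (idP C) (cap F.toFrobeniusPseudomonoid)).whiskerLeft₂ (Prod.sectL C pt)
        (𝟭 (C × (C × C))))) (b := (w, y₁)) m
    (mk (G := (tensor (Ten F) (idP C)).whiskerLeft₂ (swap C) (𝟭 (C × C)))
      (F := (tensor (idP C) (cap F.toFrobeniusPseudomonoid)).whiskerLeft₂ (Prod.sectL C pt)
        (𝟭 (C × (C × C)))) (b := (b₁, (y₂, x₁))) i j)

theorem loopGen_slide₁ {a b w y₁ w' y₁' b₁ x₁ y₂ : C} (m : El F.M a (w, y₁)) (k : w ⟶ w')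
    (l : y₁ ⟶ y₁') (i : El (tensor (Ten F) (idP C)) (w', y₁') ((b₁, x₁), y₂))
    (j : El (tensor (idP C) (cap F.toFrobeniusPseudomonoid)) (b₁, (y₂, x₁)) (b, pt)) :
    loopGen (act F.M (𝟙 a) (Prod.mkHom k l) m) i j =
      loopGen m (act _ (Prod.mkHom k l) (𝟙 ((b₁, x₁), y₂)) i) j := by
  refine (mk_slide (G := F.M) (b := (w, y₁)) (b' := (w', y₁'))
      m (Prod.mkHom k l) _).trans (congrArg (mk _) ?_)
  refine (act_comp_mk _ _ _ _ _ _).trans ?_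
  exact congrArg (mk _) (act_id _ _)

theorem loopGen_slide₂ {a b w y₁ b₁ x₁ y₂ b₁' x₁' y₂' : C} (m : El F.M a (w, y₁))
    (i : El (tensor (Ten F) (idP C)) (w, y₁) ((b₁, x₁), y₂)) (k : b₁ ⟶ b₁') (l : x₁ ⟶ x₁')
    (h : y₂ ⟶ y₂')
    (j : El (tensor (idP C) (cap F.toFrobeniusPseudomonoid)) (b₁', (y₂', x₁')) (b, pt)) :
    loopGen m (act _ (𝟙 (w, y₁)) (Prod.mkHom (Prod.mkHom k l) h) i) j =
      loopGen m i (act _ (Prod.mkHom k (Prod.mkHom h l)) (𝟙 (b, pt)) j) :=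
  congrArg (mk _) (mk_slide (b := (b₁, (y₂, x₁))) (b' := (b₁', (y₂', x₁')))
    (G := (tensor (Ten F) (idP C)).whiskerLeft₂ (swap C) (𝟭 (C × C)))
    (F := (tensor (idP C) (cap F.toFrobeniusPseudomonoid)).whiskerLeft₂ (Prod.sectL C pt)
        (𝟭 (C × (C × C)))) i (Prod.mkHom k (Prod.mkHom h l)) j)

/-- The class of a tuple with a given element of the cap. -/
def loopPair {a b w x y : C} (m : El F.M a (w, y)) (τ : El (Ten F) w (b, x))
    (c : El (cap F.toFrobeniusPseudomonoid) (y, x) pt) : El (Loop F) a b :=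
  loopGen (b₁ := b) (x₁ := x) (y₂ := y) m (tmk τ (hel (𝟙 y))) (tmk (hel (𝟙 b)) c)

theorem loopMk_eq {a b w x y t : C} (m : El F.M a (w, y)) (τ : El (Ten F) w (b, x))
    (d : El F.D (y, x) t) (n : El F.H t pt) : loopMk m τ d n = loopPair m τ (capMk d n) := rfl

theorem loopGen_tmk {a b w y₁ b₁ x₁ y₂ : C} (m : El F.M a (w, y₁)) (τ : El (Ten F) w (b₁, x₁))
    (g : y₁ ⟶ y₂) (f : b₁ ⟶ b) (c : El (cap F.toFrobeniusPseudomonoid) (y₂, x₁) pt) :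
    loopGen m (tmk τ (hel g)) (tmk (hel f) c) =
      loopPair (act F.M (𝟙 a) (Prod.mkHom (𝟙 w) g) m)
        (act (Ten F) (𝟙 w) (Prod.mkHom f (𝟙 x₁)) τ) c := by
  have e₁ := loopGen_slide₁ m (𝟙 w) g
    (tmk (act (Ten F) (𝟙 w) (Prod.mkHom f (𝟙 x₁)) τ) (hel (𝟙 y₂))) (tmk (hel (𝟙 b)) c)
  have e₂ := loopGen_slide₂ m (tmk τ (hel g)) f (𝟙 x₁) (𝟙 y₂) (tmk (hel (𝟙 b)) c)
  have f₁ : act (cap F.toFrobeniusPseudomonoid) (Prod.mkHom (𝟙 y₂) (𝟙 x₁)) (𝟙 pt) c = c :=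
    act_id _ _
  simp only [act_tmk, act_hel, prod_id_fst, prod_id_snd, Category.comp_id, f₁, act_id] at e₁ e₂
  exact e₂.symm.trans e₁.symm

theorem exists_loopPair {a b : C} (l : El (Loop F) a b) :
    ∃ (w x y : C) (m : El F.M a (w, y)) (τ : El (Ten F) w (b, x))
      (c : El (cap F.toFrobeniusPseudomonoid) (y, x) pt), loopPair m τ c = l := by
  obtain ⟨⟨w, y₁⟩, m, t, rfl⟩ := exists_mk l
  obtain ⟨⟨b₁, y₂, x₁⟩, i, j, rfl⟩ := exists_mk t
  exact ⟨_, _, _, _, _, _, (loopGen_tmk m i.1 i.2 j.1 j.2).symm⟩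

theorem loopPair_slide₁ {a b w w' x y : C} (m : El F.M a (w, y)) (k : w ⟶ w')
    (τ : El (Ten F) w' (b, x)) (c : El (cap F.toFrobeniusPseudomonoid) (y, x) pt) :
    loopPair (act F.M (𝟙 a) (Prod.mkHom k (𝟙 y)) m) τ c =
      loopPair m (act (Ten F) k (𝟙 (b, x)) τ) c := by
  have e := loopGen_slide₁ (b₁ := b) (x₁ := x) (y₂ := y) m k (𝟙 y) (tmk τ (hel (𝟙 y)))
    (tmk (hel (𝟙 b)) c)
  simp only [act_tmk, act_hel, prod_id_fst, prod_id_snd, Category.comp_id] at e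
  exact e

theorem loopPair_slide₂ {a b w x y x' y' : C} (m : El F.M a (w, y)) (τ : El (Ten F) w (b, x))
    (l : x ⟶ x') (h : y ⟶ y') (c : El (cap F.toFrobeniusPseudomonoid) (y', x') pt) :
    loopPair (act F.M (𝟙 a) (Prod.mkHom (𝟙 w) h) m) (act (Ten F) (𝟙 w) (Prod.mkHom (𝟙 b) l) τ) c =
      loopPair m τ (act _ (Prod.mkHom h l) (𝟙 pt) c) := by
  have e := loopGen_slide₂ m (tmk τ (hel (𝟙 y))) (𝟙 b) l h (tmk (hel (𝟙 b)) c)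
  simp only [act_tmk, act_hel, prod_id_fst, prod_id_snd, Category.id_comp] at e
  rw [loopGen_tmk] at e
  have f₁ : act (Ten F) (𝟙 w) (Prod.mkHom (𝟙 b) (𝟙 x'))
      (act (Ten F) (𝟙 w) (Prod.mkHom (𝟙 b) l) τ) = act (Ten F) (𝟙 w) (Prod.mkHom (𝟙 b) l) τ :=
    act_id _ _
  rw [f₁] at e
  exact e

theorem act_loopPair {a b w x y a' b' : C} (f : a' ⟶ a) (g : b ⟶ b') (m : El F.M a (w, y))
    (τ : El (Ten F) w (b, x)) (c : El (cap F.toFrobeniusPseudomonoid) (y, x) pt) :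
    act (Loop F) f g (loopPair m τ c) =
      loopPair (act F.M f (𝟙 (w, y)) m) (act (Ten F) (𝟙 w) (Prod.mkHom g (𝟙 x)) τ) c := by
  have e : act (Loop F) f g (loopPair m τ c) = loopGen (act F.M f (𝟙 (w, y)) m)
      (act (tensor (Ten F) (idP C)) (𝟙 (w, y)) (𝟙 ((b, x), y)) (tmk τ (hel (𝟙 y))))
      (act _ (𝟙 (b, (y, x))) (Prod.mkHom g (𝟙 pt)) (tmk (hel (𝟙 b)) c)) := by
    refine (act_comp_mk _ _ _ _ _ _).trans (congrArg (mk _) ?_)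
    exact act_comp_mk _ _ _ _ _ _
  rw [e]
  simp only [act_tmk, act_hel, prod_id_fst, prod_id_snd, Category.id_comp, act_id]
  rw [loopGen_tmk]
  have f₁ : act F.M (𝟙 a') (Prod.mkHom (𝟙 w) (𝟙 y)) (act F.M f (𝟙 (w, y)) m) =
    act F.M f (𝟙 (w, y)) m := act_id _ _
  rw [f₁]

/-- The extension of a function on normalised tuples in the rotated source of the trace to general
tuples. -/
def loopVal {a b w y₁ b₁ x₁ y₂ : C} {X : Sort*}
    (φ : ∀ {w x y : C}, El F.M a (w, y) → El (Ten F) w (b, x) →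
      El (cap F.toFrobeniusPseudomonoid) (y, x) pt → X) (m : El F.M a (w, y₁))
    (i : El (tensor (Ten F) (idP C)) (w, y₁) ((b₁, x₁), y₂))
    (j : El (tensor (idP C) (cap F.toFrobeniusPseudomonoid)) (b₁, (y₂, x₁)) (b, pt)) : X :=
  φ (act F.M (𝟙 a) (Prod.mkHom (𝟙 w) (uhel (tsnd i))) m)
    (act (Ten F) (𝟙 w) (Prod.mkHom (uhel (tfst j)) (𝟙 x₁)) (tfst i)) (tsnd j)

theorem loopVal_slide₁ {a b w y₁ w' y₁' b₁ x₁ y₂ : C} {X : Sort*}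
    (φ : ∀ {w x y : C}, El F.M a (w, y) → El (Ten F) w (b, x) →
      El (cap F.toFrobeniusPseudomonoid) (y, x) pt → X)
    (h₁ : ∀ {w w' x y : C} (m : El F.M a (w, y)) (k : w ⟶ w')
      (τ : El (Ten F) w' (b, x)) (c : El (cap F.toFrobeniusPseudomonoid) (y, x) pt),
      φ (act F.M (𝟙 a) (Prod.mkHom k (𝟙 y)) m) τ c = φ m (act (Ten F) k (𝟙 (b, x)) τ) c)
    (m : El F.M a (w, y₁)) (k : w ⟶ w')
    (l : y₁ ⟶ y₁') (i : El (tensor (Ten F) (idP C)) (w', y₁') ((b₁, x₁), y₂))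
    (j : El (tensor (idP C) (cap F.toFrobeniusPseudomonoid)) (b₁, (y₂, x₁)) (b, pt)) :
    loopVal φ (act F.M (𝟙 a) (Prod.mkHom k l) m) i j =
      loopVal φ m (act _ (Prod.mkHom k l) (𝟙 ((b₁, x₁), y₂)) i) j := by
  obtain ⟨i₁, i₂, rfl⟩ := exists_tmk_hel i
  obtain ⟨j₁, j₂, rfl⟩ := exists_hel_tmk (b := (y₂, x₁)) j
  simp only [loopVal, act_tmk, act_hel, tsnd_tmk, tfst_tmk, uhel_hel, prod_id_fst, prod_id_snd]
  have f₁ : act F.M (𝟙 a) (Prod.mkHom (𝟙 w') i₂) (act F.M (𝟙 a) (Prod.mkHom k l) m) =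
      act F.M (𝟙 a) (Prod.mkHom k (𝟙 _)) (act F.M (𝟙 a) (Prod.mkHom (𝟙 w) (l ≫ i₂)) m) := by
    rw [act_act, act_act]; simp
  rw [f₁, h₁, act_act, act_act]
  simp

theorem loopVal_slide₂ {a b w y₁ b₁ x₁ y₂ b₁' x₁' y₂' : C} {X : Sort*}
    (φ : ∀ {w x y : C}, El F.M a (w, y) → El (Ten F) w (b, x) →
      El (cap F.toFrobeniusPseudomonoid) (y, x) pt → X)
    (h₂ : ∀ {w x y x' y' : C} (m : El F.M a (w, y)) (τ : El (Ten F) w (b, x))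
      (l : x ⟶ x') (h : y ⟶ y') (c : El (cap F.toFrobeniusPseudomonoid) (y', x') pt),
      φ (act F.M (𝟙 a) (Prod.mkHom (𝟙 w) h) m) (act (Ten F) (𝟙 w) (Prod.mkHom (𝟙 b) l) τ) c =
        φ m τ (act _ (Prod.mkHom h l) (𝟙 pt) c)) (m : El F.M a (w, y₁))
    (i : El (tensor (Ten F) (idP C)) (w, y₁) ((b₁, x₁), y₂)) (k : b₁ ⟶ b₁') (l : x₁ ⟶ x₁')
    (h : y₂ ⟶ y₂')
    (j : El (tensor (idP C) (cap F.toFrobeniusPseudomonoid)) (b₁', (y₂', x₁')) (b, pt)) :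
    loopVal φ m (act _ (𝟙 (w, y₁)) (Prod.mkHom (Prod.mkHom k l) h) i) j =
      loopVal φ m i (act _ (Prod.mkHom k (Prod.mkHom h l)) (𝟙 (b, pt)) j) := by
  obtain ⟨i₁, i₂, rfl⟩ := exists_tmk_hel i
  obtain ⟨j₁, j₂, rfl⟩ := exists_hel_tmk (b := (y₂', x₁')) j
  simp only [loopVal, act_tmk, act_hel, tsnd_tmk, tfst_tmk, uhel_hel, prod_id_fst, prod_id_snd]
  rw [← h₂, act_act, act_act, act_act]
  simp

/-- The universal property of the rotated source of the trace. -/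
def liftLoop {a b : C} {X : Sort*} (φ : ∀ {w x y : C}, El F.M a (w, y) → El (Ten F) w (b, x) →
      El (cap F.toFrobeniusPseudomonoid) (y, x) pt → X)
    (h₁ : ∀ {w w' x y : C} (m : El F.M a (w, y)) (k : w ⟶ w')
      (τ : El (Ten F) w' (b, x)) (c : El (cap F.toFrobeniusPseudomonoid) (y, x) pt),
      φ (act F.M (𝟙 a) (Prod.mkHom k (𝟙 y)) m) τ c = φ m (act (Ten F) k (𝟙 (b, x)) τ) c)
    (h₂ : ∀ {w x y x' y' : C} (m : El F.M a (w, y)) (τ : El (Ten F) w (b, x))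
      (l : x ⟶ x') (h : y ⟶ y') (c : El (cap F.toFrobeniusPseudomonoid) (y', x') pt),
      φ (act F.M (𝟙 a) (Prod.mkHom (𝟙 w) h) m) (act (Ten F) (𝟙 w) (Prod.mkHom (𝟙 b) l) τ) c =
        φ m τ (act _ (Prod.mkHom h l) (𝟙 pt) c)) : El (Loop F) a b → X :=
  compLift (fun {u} m t => compLift (fun {v} i j =>
    loopVal (w := u.1) (y₁ := u.2) (b₁ := v.1) (x₁ := v.2.2) (y₂ := v.2.1) φ m i j) (by
      rintro ⟨b₁, y₂, x₁⟩ ⟨b₁', y₂', x₁'⟩ i ⟨k, h, l⟩ j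
      exact loopVal_slide₂ φ h₂ m i k l h j) t) (by
    rintro ⟨w, y₁⟩ ⟨w', y₁'⟩ m ⟨k, l⟩ t
    obtain ⟨⟨b₁, y₂, x₁⟩, i, j, rfl⟩ := exists_mk t
    refine (loopVal_slide₁ φ h₁ m k l i j).trans ?_
    rw [act_comp_mk]
    exact congrArg (loopVal φ m _) (act_id _ j).symm)

theorem liftLoop_mk {a b w x y : C} {X : Sort*}
    (φ : ∀ {w x y : C}, El F.M a (w, y) → El (Ten F) w (b, x) →
      El (cap F.toFrobeniusPseudomonoid) (y, x) pt → X)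
    (h₁ : ∀ {w w' x y : C} (m : El F.M a (w, y)) (k : w ⟶ w')
      (τ : El (Ten F) w' (b, x)) (c : El (cap F.toFrobeniusPseudomonoid) (y, x) pt),
      φ (act F.M (𝟙 a) (Prod.mkHom k (𝟙 y)) m) τ c = φ m (act (Ten F) k (𝟙 (b, x)) τ) c)
    (h₂ : ∀ {w x y x' y' : C} (m : El F.M a (w, y)) (τ : El (Ten F) w (b, x))
      (l : x ⟶ x') (h : y ⟶ y') (c : El (cap F.toFrobeniusPseudomonoid) (y', x') pt),
      φ (act F.M (𝟙 a) (Prod.mkHom (𝟙 w) h) m) (act (Ten F) (𝟙 w) (Prod.mkHom (𝟙 b) l) τ) c =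
        φ m τ (act _ (Prod.mkHom h l) (𝟙 pt) c)) (m : El F.M a (w, y)) (τ : El (Ten F) w (b, x))
    (c : El (cap F.toFrobeniusPseudomonoid) (y, x) pt) :
    liftLoop φ h₁ h₂ (loopPair m τ c) = φ m τ c := by
  change φ (act F.M (𝟙 a) (𝟙 (w, y)) m) (act (Ten F) (𝟙 w) (𝟙 (b, x)) τ) c = _
  rw [act_id, act_id]

end Loop

end Prof

namespace Prof

section Representable

variable {A B : Type u} [SmallCategory A] [SmallCategory B]

/-- A contravariant functor that is a retract of a representable one is representable. -/
theorem exists_representing [IsIdempotentComplete B] (P : Profunctor.{u} A B) (a : A) {c : B}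
    (p' : El P c a) (φ : ∀ {b : B}, El P b a → (b ⟶ c))
    (hφ : ∀ {b b' : B} (g : b' ⟶ b) (p : El P b a), φ (act P g (𝟙 a) p) = g ≫ φ p)
    (h : ∀ {b : B} (p : El P b a), act P (φ p) (𝟙 a) p' = p) :
    ∃ (r : B) (p₀ : El P r a), ∀ {b : B} (p : El P b a), ∃! f : b ⟶ r, act P f (𝟙 a) p₀ = p := by
  obtain ⟨r, i, e, hi, he⟩ := IsIdempotentComplete.idempotents_split c (φ p') (by
    rw [← hφ, h])
  have hip : act P e (𝟙 a) (act P i (𝟙 a) p') = p' := by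
    rw [act_act, he, Category.comp_id, h]
  refine ⟨r, act P i (𝟙 a) p', fun {b} p => ⟨φ p ≫ e, ?_, fun f hf => ?_⟩⟩
  · change act P (φ p ≫ e) (𝟙 a) (act P i (𝟙 a) p') = p
    have e₁ : act P (φ p ≫ e) (𝟙 a) (act P i (𝟙 a) p') =
      act P (φ p) (𝟙 a) (act P e (𝟙 a) (act P i (𝟙 a) p')) := by simp [act_act]
    rw [e₁, hip, h]
  · change act P f (𝟙 a) (act P i (𝟙 a) p') = p at hf
    have e₁ : φ p = f ≫ i := by
      rw [← hf, act_act, Category.comp_id, hφ, ← he, Category.assoc, reassoc_of% hi]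
    change f = φ p ≫ e
    rw [e₁, Category.assoc, hi, Category.comp_id]

/-- A covariant functor that is a retract of a representable one is representable. -/
theorem exists_corepresenting [IsIdempotentComplete A] (P : Profunctor.{u} A B) (b : B) {c : A}
    (p' : El P b c) (φ : ∀ {a : A}, El P b a → (c ⟶ a))
    (hφ : ∀ {a a' : A} (g : a ⟶ a') (p : El P b a), φ (act P (𝟙 b) g p) = φ p ≫ g)
    (h : ∀ {a : A} (p : El P b a), act P (𝟙 b) (φ p) p' = p) :
    ∃ (r : A) (p₀ : El P b r), ∀ {a : A} (p : El P b a), ∃! f : r ⟶ a, act P (𝟙 b) f p₀ = p := by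
  obtain ⟨r, i, e, hi, he⟩ := IsIdempotentComplete.idempotents_split c (φ p') (by
    rw [← hφ, h])
  have hip : act P (𝟙 b) i (act P (𝟙 b) e p') = p' := by
    rw [act_act, he, Category.comp_id, h]
  refine ⟨r, act P (𝟙 b) e p', fun {a} p => ⟨i ≫ φ p, ?_, fun f hf => ?_⟩⟩
  · change act P (𝟙 b) (i ≫ φ p) (act P (𝟙 b) e p') = p
    have e₁ : act P (𝟙 b) (i ≫ φ p) (act P (𝟙 b) e p') =
      act P (𝟙 b) (φ p) (act P (𝟙 b) i (act P (𝟙 b) e p')) := by simp [act_act]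
    rw [e₁, hip, h]
  · change act P (𝟙 b) f (act P (𝟙 b) e p') = p at hf
    rw [← hf, act_act, Category.comp_id, hφ, ← he, Category.assoc, reassoc_of% hi, reassoc_of% hi]

theorem uhel_ap_act {P : Profunctor.{u} A A} (θ : P ⟶ idP A) {a a' b b' : A} (g : b' ⟶ b)
    (f : a ⟶ a') (p : El P b a) : uhel (ap θ (act P g f p)) = g ≫ uhel (ap θ p) ≫ f := by
  rw [ap_act]
  exact act_idP _ _ _

/-- The counit of an adjunction, evaluated on a pair of elements. -/
def couv {P : Profunctor.{u} A B} {Q : Profunctor.{u} B A} (h : Adj P Q) {a : A} {b b' : B}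
    (p : El P b a) (q : El Q a b') : b ⟶ b' := ap h.counit (Prof.mk p q)

theorem couv_act {P : Profunctor.{u} A B} {Q : Profunctor.{u} B A} (h : Adj P Q) {a : A}
    {b₁ b₂ b b' : B} (p : El P b a) (q : El Q a b') (g : b₁ ⟶ b) (f : b' ⟶ b₂) :
    couv h (act P g (𝟙 a) p) (act Q (𝟙 a) f q) = g ≫ couv h p q ≫ f := by
  have e := act_comp_mk P Q g f p q
  exact (congrArg (fun t => uhel (ap h.counit t)) e.symm).trans (uhel_ap_act _ _ _ _)

theorem couv_act_left {P : Profunctor.{u} A B} {Q : Profunctor.{u} B A} (h : Adj P Q) {a : A}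
    {b₁ b b' : B} (p : El P b a) (q : El Q a b') (g : b₁ ⟶ b) :
    couv h (act P g (𝟙 a) p) q = g ≫ couv h p q := by
  have e := couv_act h p q g (𝟙 b')
  rwa [act_id, Category.comp_id] at e

theorem couv_act_right {P : Profunctor.{u} A B} {Q : Profunctor.{u} B A} (h : Adj P Q) {a : A}
    {b₂ b b' : B} (p : El P b a) (q : El Q a b') (f : b' ⟶ b₂) :
    couv h p (act Q (𝟙 a) f q) = couv h p q ≫ f := by
  have e := couv_act h p q (𝟙 b) f
  rwa [act_id, Category.id_comp] at e

theorem couv_slide {P : Profunctor.{u} A B} {Q : Profunctor.{u} B A} (h : Adj P Q) {a a' : A}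
    {b b' : B} (p : El P b a) (k : a ⟶ a') (q : El Q a' b') :
    couv h (act P (𝟙 b) k p) q = couv h p (act Q k (𝟙 b') q) :=
  congrArg (fun t => uhel (ap h.counit t)) (mk_slide p k q)

/-- A profunctor with a right adjoint is pointwise representable if its codomain is Cauchy
complete. -/
theorem exists_universal_of_adj [IsIdempotentComplete B] {P : Profunctor.{u} A B}
    {Q : Profunctor.{u} B A} (h : Adj P Q) (a : A) :
    ∃ (r : B) (p₀ : El P r a), ∀ {b : B} (p : El P b a), ∃! f : b ⟶ r, act P f (𝟙 a) p₀ = p := by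
  obtain ⟨c, q, p', hq⟩ := exists_mk (ap h.unit (b := a) (a := a) (𝟙 a))
  exact exists_representing P a p' (fun p => couv h p q) (fun g p => couv_act_left h p q g)
    (fun p => h.triangle_left p q p' hq.symm)

/-- The right adjoint of a pointwise representable profunctor. -/
theorem exists_adj (P : Profunctor.{u} A B) (r : A → B) (p₀ : ∀ a, El P (r a) a)
    (h : ∀ {a : A} {b : B} (p : El P b a), ∃! f : b ⟶ r a, act P f (𝟙 a) (p₀ a) = p) :
    ∃ Q : Profunctor.{u} B A, Nonempty (Adj P Q) := by
  choose! φ hφ hφ' using fun (a : A) (b : B) (p : El P b a) => h p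
  have hφ'' : ∀ {a : A} {b : B} (f : b ⟶ r a), φ a b (act P f (𝟙 a) (p₀ a)) = f := fun f =>
    (hφ' _ _ _ f rfl).symm
  have nat : ∀ {a : A} {b b' : B} (g : b' ⟶ b) (p : El P b a),
      φ a b' (act P g (𝟙 a) p) = g ≫ φ a b p := fun g p => by
    symm
    refine hφ' _ _ _ _ ?_
    change act P _ _ _ = _
    have e := congrArg (act P g (𝟙 _)) (hφ _ _ p)
    change act P g (𝟙 _) (act P _ _ _) = _ at e
    rw [act_act] at e
    simpa using e
  let rm : ∀ {a a' : A} (f : a ⟶ a'), r a ⟶ r a' := fun {a a'} f => φ a' (r a) (act P (𝟙 _) f (p₀ a))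
  have rm_spec : ∀ {a a' : A} (f : a ⟶ a'), act P (rm f) (𝟙 a') (p₀ a') = act P (𝟙 _) f (p₀ a) :=
    fun f => hφ _ _ _
  have inj : ∀ {a : A} {b : B} {f g : b ⟶ r a}, act P f (𝟙 a) (p₀ a) = act P g (𝟙 a) (p₀ a) →
      f = g := fun {a b f g} e => by rw [← hφ'' f, e, hφ'']
  have rm_id : ∀ a : A, rm (𝟙 a) = 𝟙 (r a) := fun a => inj (by rw [rm_spec])
  have rm_comp : ∀ {a a' a'' : A} (f : a ⟶ a') (g : a' ⟶ a''), rm (f ≫ g) = rm f ≫ rm g :=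
    fun f g => inj (by
      rw [rm_spec]
      have e₁ := congrArg (act P (𝟙 _) g) (rm_spec f)
      have e₂ := congrArg (act P (rm f) (𝟙 _)) (rm_spec g)
      simp only [act_act, Category.id_comp, Category.comp_id] at e₁ e₂ ⊢
      rw [← e₁, ← e₂])
  have nat' : ∀ {a a' : A} {b : B} (f : a ⟶ a') (p : El P b a),
      φ a' b (act P (𝟙 b) f p) = φ a b p ≫ rm f := fun {a a' b} f p => inj (by
    have e₁ := hφ a' b (act P (𝟙 b) f p)
    have e₂ := congrArg (act P (𝟙 b) f) (hφ a b p)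
    have e₃ := congrArg (act P (φ a b p) (𝟙 a')) (rm_spec f)
    change act P _ _ _ = _ at e₁
    change act P _ _ (act P _ _ _) = _ at e₂
    simp only [act_act, Category.id_comp, Category.comp_id] at e₂ e₃
    rw [e₁, ← e₂, ← e₃])
  let Q : Profunctor.{u} B A := Profunctor.ofCore
    { obj := fun b a => r a ⟶ b
      map := fun f g => TypeCat.ofHom (fun k => rm g ≫ k ≫ f)
      map_id := by intro b a; ext k; simp [rm_id]
      map_comp := by intros; ext k; simp [rm_comp] }
  have actQ : ∀ {a a' : A} {b b' : B} (g : a' ⟶ a) (f : b ⟶ b') (k : r a ⟶ b),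
      act Q g f (k : El Q a b) = rm g ≫ k ≫ f := fun g f k => by
    change rm (𝟙 _) ≫ (rm g ≫ k ≫ 𝟙 _) ≫ f = _
    simp [rm_id]
  let toQ : ∀ {a : A} {b : B}, (r a ⟶ b) → El Q a b := fun k => k
  let ofQ : ∀ {a : A} {b : B}, El Q a b → (r a ⟶ b) := fun k => k
  have nat₂ : ∀ {a a' : A} {b b' : B} (g : b' ⟶ b) (f : a ⟶ a') (p : El P b a),
      φ a' b' (act P g f p) = g ≫ φ a b p ≫ rm f := fun g f p => by
    have e : act P g f p = act P g (𝟙 _) (act P (𝟙 _) f p) := by simp [act_act]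
    rw [e, nat, nat']
  have unit_nat : ∀ {a a' b b' : A} (g : b' ⟶ b) (f : a ⟶ a') (p : b ⟶ a),
      mk (G := Q) (F := P) (toQ (rm (g ≫ p ≫ f))) (p₀ a') =
        act (comp Q P) g f (mk (toQ (rm p)) (p₀ a)) := fun {a a' b b'} g f p => by
    rw [act_comp_mk, ← rm_spec, ← mk_slide, act_act]
    congr 1
    rw [Category.id_comp, Category.id_comp]
    exact (by rw [rm_comp, rm_comp] :
      rm (g ≫ p ≫ f) = rm g ≫ rm p ≫ rm f).trans (actQ _ _ _).symm
  let ψ : ∀ {b b' : B}, El (comp P Q) b b' → (b ⟶ b') := fun {b b'} => compLift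
    (fun {a} (p : El P b a) (q : El Q a b') => φ a b p ≫ ofQ q) (fun {a a'} p k q => by
      rw [nat']
      have e : ofQ (act Q k (𝟙 b') q) = rm k ≫ ofQ q ≫ 𝟙 _ := actQ k (𝟙 b') q
      rw [e]
      simp)
  have ψ_mk : ∀ {b b' : B} {a : A} (p : El P b a) (q : El Q a b'), ψ (mk p q) = φ a b p ≫ ofQ q :=
    fun p q => rfl
  have unit_lift : ∀ {X : Type u} {a b : A} (χ : El (comp Q P) b a → X) {c : B} (q : El Q b c)
      (p' : El P c a) (f : b ⟶ a), mk (toQ (rm f)) (p₀ a) = mk q p' →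
      χ (mk q p') = χ (mk (toQ (rm f)) (p₀ a)) := fun χ _ q p' f e => by rw [e]
  refine ⟨Q, ⟨{
    unit := homMk (fun {b a} (f : El (idP A) b a) => mk (toQ (rm (uhel f))) (p₀ a))
      (fun g f p => (congrArg (fun t => mk (toQ (rm t)) (p₀ _)) (act_idP g f p)).trans
        (unit_nat g f p))
    counit := homMk (fun {b b'} t => hel (ψ t)) (fun {b b' c c'} g f t => ?_)
    triangle_left := fun {b b' a} p q p' e => ?_
    triangle_right := fun {b b' a} q₀ q p' e => ?_ }⟩⟩
  · obtain ⟨a, p, q, rfl⟩ := exists_mk t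
    rw [act_comp_mk, act_hel]
    change ψ (mk _ _) = g ≫ (ψ (mk p q)) ≫ f
    rw [ψ_mk, ψ_mk, nat]
    have e : ofQ (act Q (𝟙 a) f q) = rm (𝟙 a) ≫ ofQ q ≫ f := actQ (𝟙 a) f q
    rw [e, rm_id]
    simp
  · let χ : El (comp Q P) a a → El P b a := compLift (fun q p' => act P (φ a b p ≫ ofQ q) (𝟙 a) p')
      (fun {c c'} q k p' => by
        have e : ofQ (act Q (𝟙 a) k q) = rm (𝟙 a) ≫ ofQ q ≫ k := actQ (𝟙 a) k q
        rw [e, rm_id, act_act]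
        simp)
    have e' : χ (mk (toQ (rm (𝟙 a))) (p₀ a)) = χ (mk q p') := congrArg χ e
    change act P (φ a b p ≫ rm (𝟙 a)) (𝟙 a) (p₀ a) = act P (φ a b p ≫ ofQ q) (𝟙 a) p' at e'
    rw [rm_id, Category.comp_id] at e'
    exact e'.symm.trans (hφ a b p)
  · let χ : El (comp Q P) a a → (r a ⟶ b) := compLift (fun q p' => ofQ q ≫ φ a _ p' ≫ ofQ q₀)
      (fun {c c'} q k p' => by
        have e : ofQ (act Q (𝟙 a) k q) = rm (𝟙 a) ≫ ofQ q ≫ k := actQ (𝟙 a) k q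
        rw [e, rm_id, nat]
        simp)
    have e' : χ (mk (toQ (rm (𝟙 a))) (p₀ a)) = χ (mk q p') := congrArg χ e
    change rm (𝟙 a) ≫ φ a _ (p₀ a) ≫ ofQ q₀ = ofQ q ≫ φ a b' p' ≫ ofQ q₀ at e'
    have e₂ : φ a _ (p₀ a) = 𝟙 _ := (hφ' _ _ _ _ (act_id _ _)).symm
    rw [rm_id, e₂, Category.id_comp, Category.id_comp] at e'
    refine (actQ (𝟙 a) (φ a b' p' ≫ ofQ q₀) q).trans ?_
    rw [rm_id, Category.id_comp]
    exact e'.symm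

/-- Elements of two right adjoints correspond to each other if they pair in the same way with the
elements of the left adjoints. -/
def AdjRel {P P' : Profunctor.{u} A B} {Q Q' : Profunctor.{u} B A} (h : Adj P Q)
    (h' : Adj P' Q') (i : P ≅ P') {a : A} {b : B} (q : El Q a b) (q' : El Q' a b) : Prop :=
  ∀ {c : B} (p : El P c a), couv h' (ap i.hom p) q' = couv h p q

theorem AdjRel.symm {P P' : Profunctor.{u} A B} {Q Q' : Profunctor.{u} B A} {h : Adj P Q}
    {h' : Adj P' Q'} {i : P ≅ P'} {a : A} {b : B} {q : El Q a b} {q' : El Q' a b}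
    (e : AdjRel h h' i q q') : AdjRel h' h i.symm q' q := fun p' => by
  have := e (ap i.inv p')
  rw [ap_inv_hom] at this
  exact this.symm

theorem adjRel_iff {P P' : Profunctor.{u} A B} {Q Q' : Profunctor.{u} B A} (h : Adj P Q)
    (h' : Adj P' Q') (i : P ≅ P') {a : A} {b c : B} {q₁ : El Q' a c} {p₁ : El P' c a}
    (e : ap h'.unit (b := a) (a := a) (𝟙 a) = mk q₁ p₁) (q : El Q a b) (q' : El Q' a b) :
    AdjRel h h' i q q' ↔ q' = act Q' (𝟙 a) (couv h (ap i.inv p₁) q) q₁ := by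
  constructor
  · intro hq
    have e₁ := h'.triangle_right q' q₁ p₁ e
    have e₂ := hq (ap i.inv p₁)
    rw [ap_inv_hom] at e₂
    rw [← e₂]
    exact e₁.symm
  · rintro rfl d p
    rw [couv_act_right, ← couv_act_left, ← ap_act]
    congr 1
    have e₁ : act P' (couv h' (ap i.hom p) q₁) (𝟙 a) p₁ = ap i.hom p :=
      h'.triangle_left (ap i.hom p) q₁ p₁ e
    rw [e₁, ap_hom_inv]

/-- Right adjoints are unique: an isomorphism of left adjoints extends to an isomorphism of right
adjoints that is compatible with the units and the counits. -/
theorem exists_iso_of_adj {P P' : Profunctor.{u} A B} {Q Q' : Profunctor.{u} B A} (h : Adj P Q)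
    (h' : Adj P' Q') (i : P ≅ P') :
    ∃ j : Q ≅ Q',
      (∀ {a : A} {b : B} (q : El Q a b) (p : El P b a),
        ap h.unit (b := a) (a := a) (𝟙 a) = mk q p →
        ap h'.unit (b := a) (a := a) (𝟙 a) = mk (ap j.hom q) (ap i.hom p)) ∧
      ∀ {a : A} {b b' : B} (p : El P b a) (q : El Q a b'),
        couv h' (ap i.hom p) (ap j.hom q) = couv h p q := by
  obtain ⟨j, hj⟩ := exists_iso_of_rel (P := Q) (Q := Q') (AdjRel h h' i)
    (fun {a a' b b'} g f q q' hq c p => by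
      have e₁ : act Q' g f q' = act Q' g (𝟙 _) (act Q' (𝟙 _) f q') := by simp [act_act]
      have e₂ : act Q g f q = act Q g (𝟙 _) (act Q (𝟙 _) f q) := by simp [act_act]
      rw [e₁, e₂, ← couv_slide, ← couv_slide, couv_act_right, couv_act_right, ← ap_act, hq])
    (fun {a b} q => by
      obtain ⟨c, q₁, p₁, e⟩ := exists_mk (ap h'.unit (b := a) (a := a) (𝟙 a))
      exact ⟨_, (adjRel_iff h h' i e.symm q _).2 rfl, fun q' hq' =>
        (adjRel_iff h h' i e.symm q q').1 hq'⟩)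
    (fun {a b} q' => by
      obtain ⟨c, q₁, p₁, e⟩ := exists_mk (ap h.unit (b := a) (a := a) (𝟙 a))
      exact ⟨_, AdjRel.symm ((adjRel_iff h' h i.symm e.symm q' _).2 rfl), fun q hq =>
        (adjRel_iff h' h i.symm e.symm q' q).1 (AdjRel.symm hq)⟩)
  refine ⟨j, fun {a b} q p e => ?_, fun {a b b'} p q => (hj q _).1 rfl p⟩
  obtain ⟨c, q₁, p₁, e₁⟩ := exists_mk (ap h'.unit (b := a) (a := a) (𝟙 a))
  rw [← e₁, (hj q _).2 ((adjRel_iff h h' i e₁.symm q _).2 rfl), mk_slide, ← ap_act]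
  have e₂ : act P (couv h (ap i.inv p₁) q) (𝟙 a) p = ap i.inv p₁ :=
    h.triangle_left (ap i.inv p₁) q p e
  rw [e₂, ap_inv_hom]

/-- A 2-cell between right adjoints is determined by its compatibility with the counits. -/
theorem eq_of_couv {P P' : Profunctor.{u} A B} {Q Q' : Profunctor.{u} B A} {h : Adj P Q}
    {h' : Adj P' Q'} {i : P ≅ P'} {j j' : Q ≅ Q'}
    (e : ∀ {a : A} {b b' : B} (p : El P b a) (q : El Q a b'),
        couv h' (ap i.hom p) (ap j.hom q) = couv h p q)
    (e' : ∀ {a : A} {b b' : B} (p : El P b a) (q : El Q a b'),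
        couv h' (ap i.hom p) (ap j'.hom q) = couv h p q) :
    j = j' := by
  refine iso_ext_ap (fun {a b} q => ?_)
  obtain ⟨c, q₁, p₁, e₁⟩ := exists_mk (ap h'.unit (b := a) (a := a) (𝟙 a))
  rw [(adjRel_iff h h' i e₁.symm q _).1 (fun p => e p q),
    (adjRel_iff h h' i e₁.symm q _).1 (fun p => e' p q)]

end Representable

end Prof

namespace Prof

section Universal

variable {A B : Type u} [SmallCategory A] [SmallCategory B]

/-- The element `p₀` represents the presheaf `P(-, a)`. -/
def Univ (P : Profunctor.{u} A B) {r : B} {a : A} (p₀ : El P r a) : Prop :=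
  ∀ ⦃b : B⦄ (p : El P b a), ∃! f : b ⟶ r, act P f (𝟙 a) p₀ = p

/-- The element `p₀` represents the functor `P(b, -)`. -/
def Couniv (P : Profunctor.{u} A B) {b : B} {r : A} (p₀ : El P b r) : Prop :=
  ∀ ⦃a : A⦄ (p : El P b a), ∃! f : r ⟶ a, act P (𝟙 b) f p₀ = p

variable {P : Profunctor.{u} A B}

/-- The morphism that represents an element. -/
noncomputable def Univ.desc {r : B} {a : A} {p₀ : El P r a} (h : Univ P p₀) {b : B} (p : El P b a) :
    b ⟶ r := (h p).choose

theorem Univ.act_desc {r : B} {a : A} {p₀ : El P r a} (h : Univ P p₀) {b : B} (p : El P b a) :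
    act P (h.desc p) (𝟙 a) p₀ = p := (h p).choose_spec.1

theorem Univ.hom_ext {r : B} {a : A} {p₀ : El P r a} (h : Univ P p₀) {b : B} {f g : b ⟶ r}
    (e : act P f (𝟙 a) p₀ = act P g (𝟙 a) p₀) : f = g := (h _).unique e rfl

theorem Univ.desc_act {r : B} {a : A} {p₀ : El P r a} (h : Univ P p₀) {b : B} (f : b ⟶ r) :
    h.desc (act P f (𝟙 a) p₀) = f := h.hom_ext (h.act_desc _)

theorem Univ.desc_act' {r : B} {a : A} {p₀ : El P r a} (h : Univ P p₀) {b b' : B} (f : b' ⟶ b)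
    (p : El P b a) : h.desc (act P f (𝟙 a) p) = f ≫ h.desc p := h.hom_ext (by
  rw [h.act_desc]
  have e := congrArg (act P f (𝟙 a)) (h.act_desc p)
  rw [act_act, Category.comp_id] at e
  exact e.symm)

theorem Univ.desc_self {r : B} {a : A} {p₀ : El P r a} (h : Univ P p₀) : h.desc p₀ = 𝟙 r :=
  h.hom_ext (by rw [h.act_desc, act_id])

/-- The morphism that represents an element. -/
noncomputable def Couniv.desc {b : B} {r : A} {p₀ : El P b r} (h : Couniv P p₀) {a : A}
    (p : El P b a) : r ⟶ a := (h p).choose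

theorem Couniv.act_desc {b : B} {r : A} {p₀ : El P b r} (h : Couniv P p₀) {a : A} (p : El P b a) :
    act P (𝟙 b) (h.desc p) p₀ = p := (h p).choose_spec.1

theorem Couniv.hom_ext {b : B} {r : A} {p₀ : El P b r} (h : Couniv P p₀) {a : A} {f g : r ⟶ a}
    (e : act P (𝟙 b) f p₀ = act P (𝟙 b) g p₀) : f = g := (h _).unique e rfl

theorem Couniv.desc_act {b : B} {r : A} {p₀ : El P b r} (h : Couniv P p₀) {a : A} (f : r ⟶ a) :
    h.desc (act P (𝟙 b) f p₀) = f := h.hom_ext (h.act_desc _)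

theorem Couniv.desc_act' {b : B} {r : A} {p₀ : El P b r} (h : Couniv P p₀) {a a' : A} (f : a ⟶ a')
    (p : El P b a) : h.desc (act P (𝟙 b) f p) = h.desc p ≫ f := h.hom_ext (by
  rw [h.act_desc]
  have e := congrArg (act P (𝟙 b) f) (h.act_desc p)
  rw [act_act, Category.comp_id] at e
  exact e.symm)

theorem Couniv.desc_self {b : B} {r : A} {p₀ : El P b r} (h : Couniv P p₀) : h.desc p₀ = 𝟙 r :=
  h.hom_ext (by rw [h.act_desc, act_id])

end Universal

variable {C : Type u} [SmallCategory C]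

theorem act_mkHom_id {A A' B : Type u} [SmallCategory A] [SmallCategory A'] [SmallCategory B]
    (P : Profunctor.{u} (A × A') B) {b : B} {a : A} {a' : A'} (p : El P b (a, a')) :
    act P (𝟙 b) (Prod.mkHom (𝟙 a) (𝟙 a')) p = p := act_id P p

theorem act_id_mkHom {A B B' : Type u} [SmallCategory A] [SmallCategory B] [SmallCategory B']
    (P : Profunctor.{u} A (B × B')) {a : A} {b : B} {b' : B'} (p : El P (b, b') a) :
    act P (Prod.mkHom (𝟙 b) (𝟙 b')) (𝟙 a) p = p := act_id P p

section Unitors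

variable {P : Pseudomonoid C}

/-- The right unitor, evaluated on a tuple. -/
def uniR {x z t : C} (m : El P.M z (x, t)) (n : El P.H t pt) : z ⟶ x := ap P.unitR.hom (unR m n)

/-- The left unitor, evaluated on a tuple. -/
def uniL {x z t : C} (m : El P.M z (t, x)) (n : El P.H t pt) : z ⟶ x := ap P.unitL.hom (unL m n)

theorem uniR_act {x z t x' z' : C} (g : z' ⟶ z) (f : x ⟶ x') (m : El P.M z (x, t))
    (n : El P.H t pt) : uniR (act P.M g (Prod.mkHom f (𝟙 t)) m) n = g ≫ uniR m n ≫ f :=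
  (congrArg (fun t => uhel (ap P.unitR.hom t)) (act_unR g f m n).symm).trans (uhel_ap_act _ _ _ _)

theorem uniL_act {x z t x' z' : C} (g : z' ⟶ z) (f : x ⟶ x') (m : El P.M z (t, x))
    (n : El P.H t pt) : uniL (act P.M g (Prod.mkHom (𝟙 t) f) m) n = g ≫ uniL m n ≫ f :=
  (congrArg (fun t => uhel (ap P.unitL.hom t)) (act_unL g f m n).symm).trans (uhel_ap_act _ _ _ _)

theorem uniR_slide {x z t t' : C} (m : El P.M z (x, t)) (k : t ⟶ t') (n : El P.H t' pt) :
    uniR (act P.M (𝟙 z) (Prod.mkHom (𝟙 x) k) m) n = uniR m (act P.H k (𝟙 pt) n) :=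
  congrArg (fun t => uhel (ap P.unitR.hom t)) (unR_slide m k n)

theorem uniL_slide {x z t t' : C} (m : El P.M z (t, x)) (k : t ⟶ t') (n : El P.H t' pt) :
    uniL (act P.M (𝟙 z) (Prod.mkHom k (𝟙 x)) m) n = uniL m (act P.H k (𝟙 pt) n) :=
  congrArg (fun t => uhel (ap P.unitL.hom t)) (unL_slide m k n)

theorem uniR_act_left {x z t z' : C} (g : z' ⟶ z) (m : El P.M z (x, t))
    (n : El P.H t pt) : uniR (act P.M g (𝟙 (x, t)) m) n = g ≫ uniR m n := by
  have e := uniR_act g (𝟙 x) m n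
  rwa [Category.comp_id] at e

theorem uniL_act_left {x z t z' : C} (g : z' ⟶ z) (m : El P.M z (t, x))
    (n : El P.H t pt) : uniL (act P.M g (𝟙 (t, x)) m) n = g ≫ uniL m n := by
  have e := uniL_act g (𝟙 x) m n
  rwa [Category.comp_id] at e

theorem uniR_act_right {x z t x' : C} (f : x ⟶ x') (m : El P.M z (x, t)) (n : El P.H t pt) :
    uniR (act P.M (𝟙 z) (Prod.mkHom f (𝟙 t)) m) n = uniR m n ≫ f := by
  rw [uniR_act, Category.id_comp]

theorem uniL_act_right {x z t x' : C} (f : x ⟶ x') (m : El P.M z (t, x)) (n : El P.H t pt) :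
    uniL (act P.M (𝟙 z) (Prod.mkHom (𝟙 t) f) m) n = uniL m n ≫ f := by
  rw [uniL_act, Category.id_comp]

theorem triangle' {x y z s t t' : C} (m : El P.M z (t, y)) (m' : El P.M t (x, s)) (n : El P.H s pt)
    (a₁ : El P.M z (x, t')) (a₂ : El P.M t' (s, y))
    (e : ap P.assoc.hom (mulL m m') = mulR a₁ a₂) :
    act P.M (𝟙 z) (Prod.mkHom (uniR m' n) (𝟙 y)) m =
      act P.M (𝟙 z) (Prod.mkHom (𝟙 x) (uniL a₂ n)) a₁ := P.triangle m m' n a₁ a₂ e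

variable {o : C} {h : El P.H o pt} (hu : Univ P.H h)

include hu

theorem exists_uniR_eq {z x : C} (f : z ⟶ x) : ∃ m : El P.M z (x, o), uniR m h = f := by
  obtain ⟨t, m, n, e⟩ := exists_unR (ap P.unitR.inv (hel f))
  refine ⟨act P.M (𝟙 z) (Prod.mkHom (𝟙 x) (hu.desc n)) m, ?_⟩
  rw [uniR_slide, hu.act_desc]
  exact (congrArg (fun t => uhel (ap P.unitR.hom t)) e).trans (congrArg uhel (ap_inv_hom _ _))

theorem exists_uniL_eq {z x : C} (f : z ⟶ x) : ∃ m : El P.M z (o, x), uniL m h = f := by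
  obtain ⟨t, m, n, e⟩ := exists_unL (ap P.unitL.inv (hel f))
  refine ⟨act P.M (𝟙 z) (Prod.mkHom (hu.desc n) (𝟙 x)) m, ?_⟩
  rw [uniL_slide, hu.act_desc]
  exact (congrArg (fun t => uhel (ap P.unitL.hom t)) e).trans (congrArg uhel (ap_inv_hom _ _))

theorem uniR_injective {z x : C} {m m' : El P.M z (x, o)} (e : uniR m h = uniR m' h) : m = m' := by
  have e₁ : unR m h = unR m' h := ap_hom_injective P.unitR e
  have e₂ := congrArg (liftUnR (fun {t} (m : El P.M z (x, t)) n =>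
    act P.M (𝟙 z) (Prod.mkHom (𝟙 x) (hu.desc n)) m) (fun m k n => by
      rw [hu.desc_act', act_act]; simp)) e₁
  rw [liftUnR_mk, liftUnR_mk, hu.desc_self, act_mkHom_id, act_mkHom_id] at e₂
  exact e₂

/-- The associator and the right unitor. -/
theorem act_uniR_of_assoc {w t o' x y : C} {m : El P.M w (t, o)} {m' : El P.M t (x, y)}
    {n : El P.M w (x, o')} {n' : El P.M o' (y, o)}
    (e : ap P.assoc.hom (mulL m m') = mulR n n') :
    act P.M (uniR m h) (𝟙 (x, y)) m' = act P.M (𝟙 w) (Prod.mkHom (𝟙 x) (uniR n' h)) n := by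
  obtain ⟨m₁, hm₁⟩ := exists_uniR_eq hu (𝟙 w)
  obtain ⟨q, b₁, b₂, hb⟩ := exists_mulR (ap P.assoc.hom (mulL m₁ n))
  obtain ⟨r, c₁, c₂, hc⟩ := exists_mulR (ap P.assoc.hom (mulL b₂ n'))
  obtain ⟨p', a₁', a₂', ha⟩ := exists_mulR (ap P.assoc.hom (mulL m₁ m))
  obtain ⟨q', b₁', b₂', hb'⟩ := exists_mulR (ap P.assoc.hom (mulL a₁' m'))
  have e₁ := P.pentagon m₁ m m' n n' b₁ b₂ c₁ c₂ a₁' a₂' b₁' b₂' e hb.symm hc.symm ha.symm hb'.symm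
  have e₂ := congrArg (liftMulMulMul (fun {s t} (b : El P.M w (x, s)) (c : El P.M s (y, t))
    (c' : El P.M t (o, o)) => (mulR b (act P.M (𝟙 s) (Prod.mkHom (𝟙 y) (uniL c' h)) c) :
      El (MulR P.M) w ((x, y), o)))
      (fun b k c c' => by
        rw [mulR_slide, act_act, act_act]
        simp)
      (fun b c k c' => by
        rw [uniL_act_left, act_act]
        simp)) e₁
  rw [liftMulMulMul_mk, liftMulMulMul_mk, ← triangle' b₂ n' h c₁ c₂ hc.symm] at e₂
  have e₃ := congrArg (act (MulR P.M) (𝟙 w) (Prod.mkHom (Prod.mkHom (𝟙 x) (𝟙 y)) (uniL a₂' h))) hb'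
  rw [act_mulR, ← ap_act, act_mulL, act_mkHom_id, act_mkHom_id,
    ← triangle' m₁ m h a₁' a₂' ha.symm, mulL_slide] at e₃
  have e₄ := congrArg (act (MulR P.M) (𝟙 w) (Prod.mkHom (Prod.mkHom (𝟙 x) (uniR n' h)) (𝟙 o))) hb
  rw [act_mulR, ← ap_act, act_mulL, act_mkHom_id, act_mkHom_id] at e₄
  have e₅ := ap_hom_injective P.assoc (e₃.symm.trans (e₂.symm.trans e₄))
  have e₆ := congrArg (liftMulL (fun {t} (m : El P.M w (t, o)) (k : El P.M t (x, y)) =>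
    act P.M (uniR m h) (𝟙 (x, y)) k) (fun m k n => by
      rw [uniR_act_right, act_act]; simp)) e₅
  rw [liftMulL_mk, liftMulL_mk, hm₁, act_id, act_id] at e₆
  exact e₆

/-- The unitors agree on the unit. -/
theorem uniL_eq_uniR {v : C} (m : El P.M v (o, o)) : uniL m h = uniR m h := by
  obtain ⟨n, hn⟩ := exists_uniL_eq hu (𝟙 v)
  obtain ⟨t, k, k', hk⟩ := exists_mulL (ap P.assoc.inv (mulR n m))
  have e : ap P.assoc.hom (mulL k k') = mulR n m := by rw [hk, ap_inv_hom]
  have e₁ := act_uniR_of_assoc hu e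
  have e₂ := triangle' k k' h n m e
  have e₃ : act P.M (uniR k h) (𝟙 (o, o)) k' =
      act P.M (𝟙 v) (Prod.mkHom (uniR k' h) (𝟙 o)) k := by
    apply uniR_injective hu
    rw [uniR_act_left, uniR_act_right]
  have e₄ := congrArg (fun m => uniL m h) (e₂.symm.trans (e₃.symm.trans e₁))
  simp only [uniL_act_right, hn, Category.id_comp] at e₄
  exact e₄

end Unitors

section Counitors

variable {P : Pseudocomonoid C}

/-- The right counitor, evaluated on a tuple. -/
def couR {a x t : C} (d : El P.D (a, t) x) (e : El P.E pt t) : a ⟶ x :=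
  ap P.counitR.hom (counR d e)

/-- The left counitor, evaluated on a tuple. -/
def couL {a x t : C} (d : El P.D (t, a) x) (e : El P.E pt t) : a ⟶ x :=
  ap P.counitL.hom (counL d e)

theorem couR_act {a a' x x' t : C} (f : a' ⟶ a) (g : x ⟶ x') (d : El P.D (a, t) x)
    (e : El P.E pt t) : couR (act P.D (Prod.mkHom f (𝟙 t)) g d) e = f ≫ couR d e ≫ g :=
  (congrArg (fun t => uhel (ap P.counitR.hom t)) (act_counR f g d e).symm).trans
    (uhel_ap_act _ _ _ _)

theorem couL_act {a a' x x' t : C} (f : a' ⟶ a) (g : x ⟶ x') (d : El P.D (t, a) x)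
    (e : El P.E pt t) : couL (act P.D (Prod.mkHom (𝟙 t) f) g d) e = f ≫ couL d e ≫ g :=
  (congrArg (fun t => uhel (ap P.counitL.hom t)) (act_counL f g d e).symm).trans
    (uhel_ap_act _ _ _ _)

theorem couR_slide {a x t t' : C} (d : El P.D (a, t') x) (k : t ⟶ t') (e : El P.E pt t) :
    couR d (act P.E (𝟙 pt) k e) = couR (act P.D (Prod.mkHom (𝟙 a) k) (𝟙 x) d) e :=
  congrArg (fun t => uhel (ap P.counitR.hom t)) (counR_slide d k e)

theorem couL_slide {a x t t' : C} (d : El P.D (t', a) x) (k : t ⟶ t') (e : El P.E pt t) :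
    couL d (act P.E (𝟙 pt) k e) = couL (act P.D (Prod.mkHom k (𝟙 a)) (𝟙 x) d) e :=
  congrArg (fun t => uhel (ap P.counitL.hom t)) (counL_slide d k e)

theorem couR_act_right {a x x' t : C} (g : x ⟶ x') (d : El P.D (a, t) x)
    (e : El P.E pt t) : couR (act P.D (𝟙 (a, t)) g d) e = couR d e ≫ g := by
  have e := couR_act (𝟙 a) g d e
  rwa [Category.id_comp] at e

theorem couL_act_right {a x x' t : C} (g : x ⟶ x') (d : El P.D (t, a) x)
    (e : El P.E pt t) : couL (act P.D (𝟙 (t, a)) g d) e = couL d e ≫ g := by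
  have e := couL_act (𝟙 a) g d e
  rwa [Category.id_comp] at e

theorem couR_act_left {a a' x t : C} (f : a' ⟶ a) (d : El P.D (a, t) x)
    (e : El P.E pt t) : couR (act P.D (Prod.mkHom f (𝟙 t)) (𝟙 x) d) e = f ≫ couR d e := by
  rw [couR_act, Category.comp_id]

theorem couL_act_left {a a' x t : C} (f : a' ⟶ a) (d : El P.D (t, a) x)
    (e : El P.E pt t) : couL (act P.D (Prod.mkHom (𝟙 t) f) (𝟙 x) d) e = f ≫ couL d e := by
  rw [couL_act, Category.comp_id]

theorem exists_couR_eq {a x : C} (f : a ⟶ x) :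
    ∃ (t : C) (d : El P.D (a, t) x) (e : El P.E pt t), couR d e = f := by
  obtain ⟨t, d, e, h⟩ := exists_counR (ap P.counitR.inv (hel f))
  exact ⟨t, d, e, (congrArg (fun t => uhel (ap P.counitR.hom t)) h).trans
    (congrArg uhel (ap_inv_hom _ _))⟩

theorem exists_couL_eq {a x : C} (f : a ⟶ x) :
    ∃ (t : C) (d : El P.D (t, a) x) (e : El P.E pt t), couL d e = f := by
  obtain ⟨t, d, e, h⟩ := exists_counL (ap P.counitL.inv (hel f))
  exact ⟨t, d, e, (congrArg (fun t => uhel (ap P.counitL.hom t)) h).trans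
    (congrArg uhel (ap_inv_hom _ _))⟩

theorem cotriangle' {a b x s t t' : C} (d : El P.D (t, b) x) (d' : El P.D (a, s) t)
    (e : El P.E pt s) (f₁ : El P.D (a, t') x) (f₂ : El P.D (s, b) t')
    (h : ap P.coassoc.hom (comulL d d') = comulR f₁ f₂) :
    act P.D (Prod.mkHom (couR d' e) (𝟙 b)) (𝟙 x) d =
      act P.D (Prod.mkHom (𝟙 a) (couL f₂ e)) (𝟙 x) f₁ := P.cotriangle d d' e f₁ f₂ h

end Counitors

end Prof

namespace Prof

variable {C : Type u} [SmallCategory C]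

section Evaluation

variable {F : FrobeniusPseudomonoid C} {o : C}

/-- Evaluation by the right Frobenius 2-cell and the right unitor. -/
def evR (h : El F.H o pt) {x y z w : C} (m : El F.M z (x, y)) (d : El F.D (y, w) o) :
    El F.D (z, w) x :=
  liftFrobM (fun d m => act F.D (𝟙 (z, w)) (uniR m h) d) (fun d k m => by
    rw [uniR_act_left, act_act, Category.id_comp]) (ap F.phiR.hom (frobR m d))

/-- Evaluation by the left Frobenius 2-cell and the left unitor. -/
def evL (h : El F.H o pt) {a b t y : C} (m : El F.M b (t, y)) (d : El F.D (a, t) o) :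
    El F.D (a, b) y :=
  liftFrobM (fun d m => act F.D (𝟙 (a, b)) (uniL m h) d) (fun d k m => by
    rw [uniL_act_left, act_act, Category.id_comp]) (ap F.phiL.hom (frobL m d))

variable {h : El F.H o pt}

theorem evR_eq {x y z w v : C} {m : El F.M z (x, y)} {d : El F.D (y, w) o} {d' : El F.D (z, w) v}
    {m' : El F.M v (x, o)} (e : ap F.phiR.hom (frobR m d) = frobM d' m') :
    evR h m d = act F.D (𝟙 (z, w)) (uniR m' h) d' := by
  rw [evR, e]
  rfl

theorem evL_eq {a b t y v : C} {m : El F.M b (t, y)} {d : El F.D (a, t) o} {d' : El F.D (a, b) v}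
    {m' : El F.M v (o, y)} (e : ap F.phiL.hom (frobL m d) = frobM d' m') :
    evL h m d = act F.D (𝟙 (a, b)) (uniL m' h) d' := by
  rw [evL, e]
  rfl

theorem evR_slide {x y y' z w : C} (m : El F.M z (x, y)) (k : y ⟶ y') (d : El F.D (y', w) o) :
    evR h (act F.M (𝟙 z) (Prod.mkHom (𝟙 x) k) m) d =
      evR h m (act F.D (Prod.mkHom k (𝟙 w)) (𝟙 o) d) := by
  rw [evR, evR, frobR_slide]

theorem evL_slide {a b t t' y : C} (m : El F.M b (t, y)) (k : t ⟶ t') (d : El F.D (a, t') o) :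
    evL h (act F.M (𝟙 b) (Prod.mkHom k (𝟙 y)) m) d =
      evL h m (act F.D (Prod.mkHom (𝟙 a) k) (𝟙 o) d) := by
  rw [evL, evL, frobL_slide]

theorem evR_act {x x' y z z' w w' : C} (f : z' ⟶ z) (g : w' ⟶ w) (k : x ⟶ x')
    (m : El F.M z (x, y)) (d : El F.D (y, w) o) :
    evR h (act F.M f (Prod.mkHom k (𝟙 y)) m) (act F.D (Prod.mkHom (𝟙 y) g) (𝟙 o) d) =
      act F.D (Prod.mkHom f g) k (evR h m d) := by
  obtain ⟨v, d', m', e⟩ := exists_frobM (ap F.phiR.hom (frobR m d))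
  have e₁ := congrArg (act (FrobM F.M F.D) (Prod.mkHom f g) (Prod.mkHom k (𝟙 o))) e
  rw [act_frobM, ← ap_act, act_frobR] at e₁
  rw [evR_eq e.symm, evR_eq e₁.symm, uniR_act_right, act_act, act_act, Category.comp_id,
    Category.id_comp, Category.id_comp]

theorem evL_act {a a' b b' t y y' : C} (f : a' ⟶ a) (g : b' ⟶ b) (k : y ⟶ y')
    (m : El F.M b (t, y)) (d : El F.D (a, t) o) :
    evL h (act F.M g (Prod.mkHom (𝟙 t) k) m) (act F.D (Prod.mkHom f (𝟙 t)) (𝟙 o) d) =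
      act F.D (Prod.mkHom f g) k (evL h m d) := by
  obtain ⟨v, d', m', e⟩ := exists_frobM (ap F.phiL.hom (frobL m d))
  have e₁ := congrArg (act (FrobM F.M F.D) (Prod.mkHom f g) (Prod.mkHom (𝟙 o) k)) e
  rw [act_frobM, ← ap_act, act_frobL] at e₁
  rw [evL_eq e.symm, evL_eq e₁.symm, uniL_act_right, act_act, act_act, Category.comp_id,
    Category.id_comp, Category.id_comp]

theorem evR_act_left {x y z z' w : C} (f : z' ⟶ z) (m : El F.M z (x, y)) (d : El F.D (y, w) o) :
    evR h (act F.M f (𝟙 (x, y)) m) d = act F.D (Prod.mkHom f (𝟙 w)) (𝟙 x) (evR h m d) := by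
  have e := evR_act (h := h) f (𝟙 w) (𝟙 x) m d
  rwa [act_id_mkHom] at e

theorem evR_act_mid {x x' y z w : C} (k : x ⟶ x') (m : El F.M z (x, y)) (d : El F.D (y, w) o) :
    evR h (act F.M (𝟙 z) (Prod.mkHom k (𝟙 y)) m) d = act F.D (𝟙 (z, w)) k (evR h m d) := by
  have e := evR_act (h := h) (𝟙 z) (𝟙 w) k m d
  rwa [act_id_mkHom] at e

theorem evR_act_right {x y z w w' : C} (g : w' ⟶ w) (m : El F.M z (x, y)) (d : El F.D (y, w) o) :
    evR h m (act F.D (Prod.mkHom (𝟙 y) g) (𝟙 o) d) =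
      act F.D (Prod.mkHom (𝟙 z) g) (𝟙 x) (evR h m d) := by
  have e := evR_act (h := h) (𝟙 z) g (𝟙 x) m d
  rwa [act_mkHom_id] at e

theorem evL_act_left {a a' b t y : C} (f : a' ⟶ a) (m : El F.M b (t, y)) (d : El F.D (a, t) o) :
    evL h m (act F.D (Prod.mkHom f (𝟙 t)) (𝟙 o) d) =
      act F.D (Prod.mkHom f (𝟙 b)) (𝟙 y) (evL h m d) := by
  have e := evL_act (h := h) f (𝟙 b) (𝟙 y) m d
  rwa [act_mkHom_id] at e

variable (hu : Univ F.H h)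

include hu

theorem exists_evR_eq {z w x : C} (δ : El F.D (z, w) x) :
    ∃ (y : C) (m : El F.M z (x, y)) (d : El F.D (y, w) o), evR h m d = δ := by
  obtain ⟨m₁, hm₁⟩ := exists_uniR_eq hu (𝟙 x)
  obtain ⟨y, m, d, e⟩ := exists_frobR (ap F.phiR.inv (frobM δ m₁))
  refine ⟨y, m, d, ?_⟩
  rw [evR_eq (d' := δ) (m' := m₁) (by rw [e, ap_inv_hom]), hm₁, act_id]

theorem exists_evL_eq {a b y : C} (δ : El F.D (a, b) y) :
    ∃ (t : C) (m : El F.M b (t, y)) (d : El F.D (a, t) o), evL h m d = δ := by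
  obtain ⟨m₁, hm₁⟩ := exists_uniL_eq hu (𝟙 y)
  obtain ⟨t, m, d, e⟩ := exists_frobL (ap F.phiL.inv (frobM δ m₁))
  refine ⟨t, m, d, ?_⟩
  rw [evL_eq (d' := δ) (m' := m₁) (by rw [e, ap_inv_hom]), hm₁, act_id]

theorem frobR_eq_of_evR {x y y' z w : C} {m : El F.M z (x, y)} {d : El F.D (y, w) o}
    {m' : El F.M z (x, y')} {d' : El F.D (y', w) o} (e : evR h m d = evR h m' d') :
    frobR m d = frobR m' d' := by
  obtain ⟨v, d₁, m₁, e₁⟩ := exists_frobM (ap F.phiR.hom (frobR m d))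
  obtain ⟨v', d₁', m₁', e₁'⟩ := exists_frobM (ap F.phiR.hom (frobR m' d'))
  obtain ⟨k, hk⟩ := exists_uniR_eq hu (𝟙 x)
  apply ap_hom_injective F.phiR
  change ap F.phiR.hom (frobR m d) = ap F.phiR.hom (frobR m' d')
  rw [evR_eq e₁.symm, evR_eq e₁'.symm] at e
  have key : ∀ {v : C} (d₁ : El F.D (z, w) v) (m₁ : El F.M v (x, o)),
      frobM d₁ m₁ = frobM (act F.D (𝟙 (z, w)) (uniR m₁ h) d₁) k := fun d₁ m₁ => by
    rw [frobM_slide]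
    congr 1
    apply uniR_injective hu
    rw [uniR_act_left, hk, Category.comp_id]
  rw [← e₁, ← e₁', key d₁ m₁, key d₁' m₁', e]

/-- The two evaluations and the coassociator. -/
theorem coassoc_ev {a b c s t : C} (d : El F.D (a, s) o) (m : El F.M b (s, t))
    (d' : El F.D (t, c) o) :
    ap F.coassoc.hom (comulL d' (evL h m d)) = comulR d (evR h m d') := by
  obtain ⟨v, d₁, m₁, e₁⟩ := exists_frobM (ap F.phiL.hom (frobL m d))
  obtain ⟨r, d₂, m₂, e₂⟩ := exists_frobM (ap F.phiR.hom (frobR m₁ d'))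
  obtain ⟨p, d₃, d₄, e₃⟩ := exists_comulR (ap F.coassoc.hom (comulL d₂ d₁))
  obtain ⟨k, d₁', m₁', e₁'⟩ := exists_frobM (ap F.phiR.hom (frobR m d'))
  obtain ⟨r', d₂', m₂', e₂'⟩ := exists_frobM (ap F.phiL.hom (frobL m₁' d))
  have e := F.phi_comul d m d' d₁ m₁ d₂ m₂ d₃ d₄ d₁' m₁' d₂' m₂' e₁.symm e₂.symm e₃.symm e₁'.symm
    e₂'.symm
  have e' := congrArg (liftComulComulMul (fun {s t} (d₃ : El F.D (a, t) s) (d₄ : El F.D (b, c) t)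
      (m₂ : El F.M s (o, o)) =>
        (comulR (act F.D (𝟙 (a, t)) (uniR m₂ h) d₃) d₄ : El (ComulR F.D) ((a, b), c) o))
      (fun d k d' m => by
        rw [comulR_slide, act_act, act_act]
        simp)
      (fun d k d' m => by
        rw [uniR_act_left, act_act]
        simp)) e
  rw [liftComulComulMul_mk, liftComulComulMul_mk] at e'
  have f₁ := congrArg (act (ComulR F.D) (Prod.mkHom (Prod.mkHom (𝟙 a) (𝟙 b)) (𝟙 c))
    (uniR m₂ h)) e₃
  rw [← ap_act, act_comulL, act_comulR, act_id_mkHom, act_id_mkHom] at f₁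
  have f₂ := F.phiR_unit d' m₁ h d₂ m₂ e₂.symm
  have f₃ := F.phiL_unit d m₁' h d₂' m₂' e₂'.symm
  change act F.D (Prod.mkHom (uniL m₁ h) (𝟙 c)) (𝟙 o) d' = act F.D (𝟙 (v, c)) (uniL m₂ h) d₂ at f₂
  change act F.D (Prod.mkHom (𝟙 a) (uniR m₁' h)) (𝟙 o) d = act F.D (𝟙 (a, k)) (uniR m₂' h) d₂' at f₃
  rw [evL_eq e₁.symm, evR_eq e₁'.symm, comulL_slide, comulR_slide, f₂, f₃, ← e',
    uniL_eq_uniR hu]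
  exact f₁.symm

end Evaluation

section Duals

variable {F : FrobeniusPseudomonoid C} {o : C} {h : El F.H o pt}

/-- The pairing of an element of the cup with an element of `Δ` on the right. -/
def pairR (h : El F.H o pt) {b c y z : C} (e : El F.E pt b) (m : El F.M b (c, y))
    (d : El F.D (y, z) o) : z ⟶ c := couL (evR h m d) e

/-- The pairing of an element of the cup with an element of `Δ` on the left. -/
def pairL (h : El F.H o pt) {b c y z : C} (e : El F.E pt b) (m : El F.M b (c, y))
    (d : El F.D (z, c) o) : z ⟶ y := couR (evL h m d) e

theorem pairR_act_right {b c y z z' : C} (e : El F.E pt b) (m : El F.M b (c, y))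
    (d : El F.D (y, z) o) (f : z' ⟶ z) :
    pairR h e m (act F.D (Prod.mkHom (𝟙 y) f) (𝟙 o) d) = f ≫ pairR h e m d := by
  rw [pairR, evR_act_right, couL_act_left, pairR]

theorem pairR_act_mid {b c c' y z : C} (e : El F.E pt b) (m : El F.M b (c, y))
    (d : El F.D (y, z) o) (f : c ⟶ c') :
    pairR h e (act F.M (𝟙 b) (Prod.mkHom f (𝟙 y)) m) d = pairR h e m d ≫ f := by
  rw [pairR, evR_act_mid, couL_act_right, pairR]

theorem pairR_slide {b c y y' z : C} (e : El F.E pt b) (m : El F.M b (c, y)) (f : y ⟶ y')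
    (d : El F.D (y', z) o) :
    pairR h e (act F.M (𝟙 b) (Prod.mkHom (𝟙 c) f) m) d =
      pairR h e m (act F.D (Prod.mkHom f (𝟙 z)) (𝟙 o) d) := by
  rw [pairR, evR_slide, pairR]

theorem pairR_slide' {b b' c y z : C} (e : El F.E pt b) (k : b ⟶ b') (m : El F.M b' (c, y))
    (d : El F.D (y, z) o) :
    pairR h (act F.E (𝟙 pt) k e) m d = pairR h e (act F.M k (𝟙 (c, y)) m) d := by
  rw [pairR, couL_slide, pairR, evR_act_left]

theorem pairL_act_left {b c y z z' : C} (e : El F.E pt b) (m : El F.M b (c, y))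
    (d : El F.D (z, c) o) (f : z' ⟶ z) :
    pairL h e m (act F.D (Prod.mkHom f (𝟙 c)) (𝟙 o) d) = f ≫ pairL h e m d := by
  rw [pairL, evL_act_left, couR_act_left, pairL]

theorem pairL_slide {b c c' y z : C} (e : El F.E pt b) (m : El F.M b (c, y)) (f : c ⟶ c')
    (d : El F.D (z, c') o) :
    pairL h e (act F.M (𝟙 b) (Prod.mkHom f (𝟙 y)) m) d =
      pairL h e m (act F.D (Prod.mkHom (𝟙 z) f) (𝟙 o) d) := by
  rw [pairL, evL_slide, pairL]

section

variable (hu : Univ F.H h)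
include hu

/-- The two pairings are adjoint to each other. -/
theorem act_pairR_eq_act_pairL {b c y z y' : C} (e : El F.E pt b) (m : El F.M b (c, y))
    (d : El F.D (y, z) o) (d' : El F.D (y', c) o) :
    act F.D (Prod.mkHom (𝟙 y') (pairR h e m d)) (𝟙 o) d' =
      act F.D (Prod.mkHom (pairL h e m d') (𝟙 z)) (𝟙 o) d :=
  (cotriangle' d (evL h m d') e d' (evR h m d) (coassoc_ev hu d' m d)).symm

theorem exists_pairR_eq (c : C) : ∃ (b y : C) (e : El F.E pt b) (m : El F.M b (c, y))
    (d : El F.D (y, c) o), pairR h e m d = 𝟙 c := by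
  obtain ⟨b, δ, e, hδ⟩ := exists_couL_eq (P := F.toPseudocomonoid) (𝟙 c)
  obtain ⟨y, m, d, hd⟩ := exists_evR_eq hu δ
  exact ⟨b, y, e, m, d, by rw [pairR, hd, hδ]⟩

theorem exists_pairL_eq (y : C) : ∃ (b c : C) (e : El F.E pt b) (m : El F.M b (c, y))
    (d : El F.D (y, c) o), pairL h e m d = 𝟙 y := by
  obtain ⟨b, δ, e, hδ⟩ := exists_couR_eq (P := F.toPseudocomonoid) (𝟙 y)
  obtain ⟨t, m, d, hd⟩ := exists_evL_eq hu δ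
  exact ⟨b, t, e, m, d, by rw [pairL, hd, hδ]⟩

end

/-- A dual pair: `y'` is the right dual of `y` and `y` is the left dual of `y'`. -/
structure DualPair (h : El F.H o pt) (y y' : C) where
  /-- the universal element -/
  u : El F.D (y, y') o
  /-- the source of the coevaluation -/
  b : C
  /-- the counit part of the coevaluation -/
  e : El F.E pt b
  /-- the multiplication part of the coevaluation -/
  m : El F.M b (y', y)
  pairR_u : pairR h e m u = 𝟙 y'
  pairL_u : pairL h e m u = 𝟙 y

section

variable (hu : Univ F.H h)

include hu

theorem exists_dualPair_right [IsIdempotentComplete C] (y : C) :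
    ∃ y' : C, Nonempty (DualPair h y y') := by
  obtain ⟨b, c, e, m, d, hd⟩ := exists_pairL_eq hu y
  obtain ⟨y', u, hy⟩ := exists_representing (F.D.whiskerLeft₂ (𝟭 C) (Prod.sectR y C)) o (c := c) d
    (fun {z} (δ : El F.D (y, z) o) => pairR h e m δ) (fun g δ => pairR_act_right e m δ g)
    (fun {z} (δ : El F.D (y, z) o) => by
      refine (act_pairR_eq_act_pairL hu e m δ d).trans ?_
      rw [hd, act_id_mkHom])
  change El F.D (y, y') o at u
  change ∀ {z : C} (δ : El F.D (y, z) o), ∃! f : z ⟶ y',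
    act F.D (Prod.mkHom (𝟙 y) f) (𝟙 o) u = δ at hy
  obtain ⟨k, hk, -⟩ := hy d
  change act F.D (Prod.mkHom (𝟙 y) k) (𝟙 o) u = d at hk
  have h₁ : pairL h e (act F.M (𝟙 b) (Prod.mkHom k (𝟙 y)) m) u = 𝟙 y := by
    rw [pairL_slide, hk, hd]
  have h₂ := act_pairR_eq_act_pairL hu e (act F.M (𝟙 b) (Prod.mkHom k (𝟙 y)) m) u u
  rw [h₁, act_id_mkHom] at h₂
  exact ⟨y', ⟨u, b, e, _, (hy u).unique h₂ (act_id_mkHom F.D u), h₁⟩⟩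

theorem exists_dualPair_left [IsIdempotentComplete C] (z : C) :
    ∃ z' : C, Nonempty (DualPair h z' z) := by
  obtain ⟨b, y, e, m, d, hd⟩ := exists_pairR_eq hu z
  obtain ⟨z', u, hz⟩ := exists_representing (F.D.whiskerLeft₂ (𝟭 C) (Prod.sectL C z)) o (c := y) d
    (fun {x} (δ : El F.D (x, z) o) => pairL h e m δ) (fun g δ => pairL_act_left e m δ g)
    (fun {x} (δ : El F.D (x, z) o) => by
      refine (act_pairR_eq_act_pairL hu e m d δ).symm.trans ?_
      rw [hd, act_id_mkHom])
  change El F.D (z', z) o at u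
  change ∀ {x : C} (δ : El F.D (x, z) o), ∃! f : x ⟶ z',
    act F.D (Prod.mkHom f (𝟙 z)) (𝟙 o) u = δ at hz
  obtain ⟨k, hk, -⟩ := hz d
  change act F.D (Prod.mkHom k (𝟙 z)) (𝟙 o) u = d at hk
  have h₁ : pairR h e (act F.M (𝟙 b) (Prod.mkHom (𝟙 z) k) m) u = 𝟙 z := by
    rw [pairR_slide, hk, hd]
  have h₂ := act_pairR_eq_act_pairL hu e (act F.M (𝟙 b) (Prod.mkHom (𝟙 z) k) m) u u
  rw [h₁, act_id_mkHom] at h₂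
  exact ⟨z', ⟨u, b, e, _, h₁, ((hz u).unique (act_id_mkHom F.D u) h₂.symm).symm⟩⟩

variable {y y' : C} (p : DualPair h y y')

theorem DualPair.act_right {z : C} (d : El F.D (y, z) o) :
    act F.D (Prod.mkHom (𝟙 y) (pairR h p.e p.m d)) (𝟙 o) p.u = d := by
  rw [act_pairR_eq_act_pairL hu, p.pairL_u, act_id_mkHom]

theorem DualPair.act_left {x : C} (d : El F.D (x, y') o) :
    act F.D (Prod.mkHom (pairL h p.e p.m d) (𝟙 y')) (𝟙 o) p.u = d := by
  rw [← act_pairR_eq_act_pairL hu, p.pairR_u, act_id_mkHom]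

omit hu in
theorem DualPair.pairR_act {z : C} (f : z ⟶ y') :
    pairR h p.e p.m (act F.D (Prod.mkHom (𝟙 y) f) (𝟙 o) p.u) = f := by
  rw [pairR_act_right, p.pairR_u, Category.comp_id]

omit hu in
theorem DualPair.pairL_act {x : C} (f : x ⟶ y) :
    pairL h p.e p.m (act F.D (Prod.mkHom f (𝟙 y')) (𝟙 o) p.u) = f := by
  rw [pairL_act_left, p.pairL_u, Category.comp_id]

theorem DualPair.exists_evR_eq {z x : C} (δ : El F.D (z, y') x) :
    ∃ m : El F.M z (x, y), evR h m p.u = δ := by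
  obtain ⟨t, m, d, hd⟩ := Prof.exists_evR_eq hu δ
  exact ⟨_, (evR_slide m (pairL h p.e p.m d) p.u).trans (by rw [p.act_left hu, hd])⟩

theorem DualPair.evR_injective {z x : C} {m m' : El F.M z (x, y)}
    (e : evR h m p.u = evR h m' p.u) : m = m' := by
  have e₁ := congrArg (liftFrobR (fun {t} (m : El F.M z (x, t)) (d : El F.D (t, y') o) =>
    act F.M (𝟙 z) (Prod.mkHom (𝟙 x) (pairL h p.e p.m d)) m)
    (fun m k d => by rw [pairL_act_left, act_act]; simp)) (frobR_eq_of_evR hu e)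
  rw [liftFrobR_mk, liftFrobR_mk, p.pairL_u, act_mkHom_id, act_mkHom_id] at e₁
  exact e₁

theorem DualPair.cupMk_eq {b b' x : C} {e : El F.E pt b} {m : El F.M b (x, y)} {e' : El F.E pt b'}
    {m' : El F.M b' (x, y)} (eq : pairR h e m p.u = pairR h e' m' p.u) :
    cupMk e m = cupMk e' m' := by
  have e₁ : counL (evR h m p.u) e = counL (evR h m' p.u) e' := ap_hom_injective F.counitL eq
  choose G hG using fun (z x : C) (δ : El F.D (z, y') x) => p.exists_evR_eq hu δ
  have hG' : ∀ {z : C} (m : El F.M z (x, y)), G z x (evR h m p.u) = m := fun m =>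
    p.evR_injective hu (hG _ _ _)
  have slide : ∀ {t t' : C} (δ : El F.D (t', y') x) (k : t ⟶ t') (e : El F.E pt t),
      cupMk (F := F) (act F.E (𝟙 pt) k e) (G t' x δ) =
        cupMk e (G t x (act F.D (Prod.mkHom k (𝟙 y')) (𝟙 x) δ)) := fun {t t'} δ k e => by
    refine (mk_slide e k _).trans (congrArg (cupMk e) ?_)
    apply p.evR_injective hu
    rw [evR_act_left, hG, hG]
  have e₂ := (liftCounL_mk (fun {t} (δ : El F.D (t, y') x) (e : El F.E pt t) =>
      cupMk (F := F) e (G t x δ)) slide (evR h m p.u) e).symm.trans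
    ((congrArg (liftCounL _ slide) e₁).trans (liftCounL_mk _ slide (evR h m' p.u) e'))
  rw [hG', hG'] at e₂
  exact e₂

end

/-- The counit is representable. -/
theorem exists_couniv_E [IsIdempotentComplete C] (hu : Univ F.H h) :
    ∃ (i : C) (e₀ : El F.E pt i), Couniv F.E e₀ := by
  obtain ⟨o', ⟨p⟩⟩ := exists_dualPair_right hu o
  choose k hk using fun x : C => exists_uniR_eq hu (𝟙 x)
  refine exists_corepresenting F.E pt (c := o') (act F.E (𝟙 pt) (uniR p.m h) p.e)
    (fun {x} e => pairR h e (k x) p.u) (fun {x x'} g e => ?_) (fun {x} e => ?_)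
  · rw [pairR_slide', ← pairR_act_mid]
    congr 1
    apply uniR_injective hu
    rw [uniR_act_left, uniR_act_right, hk, hk, Category.id_comp, Category.comp_id]
  · have e₁ : cupMk p.e (act F.M (𝟙 p.b) (Prod.mkHom (pairR h e (k x) p.u) (𝟙 o)) p.m) =
        cupMk e (k x) := p.cupMk_eq hu (by rw [pairR_act_mid, p.pairR_u, Category.id_comp])
    have e₂ := congrArg (compLift (fun {b} (e : El F.E pt b) (m : El F.M b (x, o)) =>
      act F.E (𝟙 pt) (uniR m h) e) (fun {b b'} e k m => by
        rw [uniR_act_left, act_act, Category.id_comp])) e₁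
    change act F.E (𝟙 pt) (uniR _ h) p.e = act F.E (𝟙 pt) (uniR (k x) h) e at e₂
    rw [uniR_act_right, hk, act_id] at e₂
    rw [act_act, Category.id_comp]
    exact e₂

/-- The comultiplication is representable. -/
theorem exists_couniv_D [IsIdempotentComplete C] (hu : Univ F.H h)
    (hM : ∀ x y : C, ∃ (r : C) (m : El F.M r (x, y)), Univ F.M m) (a b : C) :
    ∃ (c : C) (d₀ : El F.D (a, b) c), Couniv F.D d₀ := by
  obtain ⟨b', ⟨p⟩⟩ := exists_dualPair_left hu b
  obtain ⟨a', ⟨q⟩⟩ := exists_dualPair_left hu a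
  obtain ⟨r, U, hU⟩ := hM b' a'
  obtain ⟨r', ⟨s⟩⟩ := exists_dualPair_right hu r
  -- the element of the cup on `r` that belongs to an element of `Δ`
  let A : ∀ {x : C}, El (MulR F.M) q.b ((x, b'), a') → El F.M q.b (x, r) := fun {x} =>
    liftMulR (fun n n' => act F.M (𝟙 q.b) (Prod.mkHom (𝟙 x) (hU.desc n')) n) (fun n k n' => by
      rw [hU.desc_act', act_act]; simp)
  have A_mk : ∀ {x t : C} (n : El F.M q.b (x, t)) (n' : El F.M t (b', a')),
      A (mulR n n') = act F.M (𝟙 q.b) (Prod.mkHom (𝟙 x) (hU.desc n')) n := fun n n' =>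
    liftMulR_mk _ _ _ _
  have mulR_A : ∀ {x : C} (X : El (MulR F.M) q.b ((x, b'), a')), mulR (A X) U = X := fun X => by
    obtain ⟨t, n, n', rfl⟩ := exists_mulR X
    rw [A_mk, mulR_slide, hU.act_desc]
  have A_act : ∀ {x x' : C} (g : x ⟶ x') (X : El (MulR F.M) q.b ((x, b'), a')),
      A (act (MulR F.M) (𝟙 q.b) (Prod.mkHom (Prod.mkHom g (𝟙 b')) (𝟙 a')) X) =
        act F.M (𝟙 q.b) (Prod.mkHom g (𝟙 r)) (A X) := fun g X => by
    obtain ⟨t, n, n', rfl⟩ := exists_mulR X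
    rw [act_mulR, A_mk, A_mk, act_mkHom_id, act_act, act_act]
    simp
  choose m₂ hm₂ using fun (x : C) (d : El F.D (a, b) x) => p.exists_evR_eq hu d
  have m₂_act : ∀ {x x' : C} (g : x ⟶ x') (d : El F.D (a, b) x),
      m₂ x' (act F.D (𝟙 (a, b)) g d) = act F.M (𝟙 a) (Prod.mkHom g (𝟙 b')) (m₂ x d) := fun g d =>
    p.evR_injective hu (by rw [evR_act_mid, hm₂, hm₂])
  -- the function back
  let G : ∀ {x t : C}, El F.E pt t → El (MulL F.M) t ((x, b'), a') → El F.D (a, b) x :=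
    fun {x t} e => liftMulL (fun {v} (m : El F.M t (v, a')) (m' : El F.M v (x, b')) =>
      evR h (act F.M (pairR h e m q.u) (𝟙 (x, b')) m') p.u) (fun m k m' => by
        rw [pairR_act_mid, act_act]; simp)
  have G_mk : ∀ {x t v : C} (e : El F.E pt t) (m : El F.M t (v, a')) (m' : El F.M v (x, b')),
      G e (mulL m m') = evR h (act F.M (pairR h e m q.u) (𝟙 (x, b')) m') p.u := fun e m m' =>
    liftMulL_mk _ _ _ _
  have G_act : ∀ {x x' t : C} (e : El F.E pt t) (g : x ⟶ x') (X : El (MulL F.M) t ((x, b'), a')),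
      G e (act (MulL F.M) (𝟙 t) (Prod.mkHom (Prod.mkHom g (𝟙 b')) (𝟙 a')) X) =
        act F.D (𝟙 (a, b)) g (G e X) := fun {x x' t} e g X => by
    obtain ⟨v, m, m', rfl⟩ := exists_mulL X
    rw [act_mulL, G_mk, G_mk, act_mkHom_id, ← evR_act_mid, act_act, act_act]
    simp
  have G_slide : ∀ {x t t' : C} (e : El F.E pt t) (k : t ⟶ t') (X : El (MulL F.M) t' ((x, b'), a')),
      G (act F.E (𝟙 pt) k e) X = G e (act (MulL F.M) k (𝟙 ((x, b'), a')) X) := fun {x t t'} e k X => by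
    obtain ⟨v, m, m', rfl⟩ := exists_mulL X
    have e₁ := act_mulL k (𝟙 x) (𝟙 b') (𝟙 a') m m'
    rw [act_mkHom_id] at e₁
    refine Eq.trans ?_ (congrArg (G e) e₁.symm)
    rw [G_mk, G_mk, pairR_slide']
    rfl
  refine exists_corepresenting F.D (a, b) (c := r') (G s.e (ap F.assoc.inv (mulR s.m U)))
    (fun {x} d => pairR h q.e (A (ap F.assoc.hom (mulL q.m (m₂ x d)))) s.u)
    (fun {x x'} g d => ?_) (fun {x} d => ?_)
  · have e₁ := act_mulL (𝟙 q.b) g (𝟙 b') (𝟙 a') q.m (m₂ x d)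
    rw [act_mkHom_id] at e₁
    rw [m₂_act, ← e₁, ap_act, A_act, pairR_act_mid]
  · let f : r' ⟶ x := pairR h q.e (A (ap F.assoc.hom (mulL q.m (m₂ x d)))) s.u
    have e₁ : cupMk s.e (act F.M (𝟙 s.b) (Prod.mkHom f (𝟙 r)) s.m) =
        cupMk q.e (A (ap F.assoc.hom (mulL q.m (m₂ x d)))) :=
      s.cupMk_eq hu (by rw [pairR_act_mid, s.pairR_u, Category.id_comp])
    have e₂ := congrArg (compLift (fun {t} (e : El F.E pt t) (n : El F.M t (x, r)) =>
      G e (ap F.assoc.inv (mulR n U))) (fun {t t'} e k n => by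
        rw [G_slide, ← ap_act]
        congr 2
        refine (act_mulR k (𝟙 x) (𝟙 b') (𝟙 a') n U).trans ?_
        rw [act_mkHom_id]
        rfl)) e₁
    change G s.e (ap F.assoc.inv (mulR _ U)) = G q.e (ap F.assoc.inv (mulR _ U)) at e₂
    rw [mulR_A, ap_hom_inv, G_mk, q.pairR_u, act_id, hm₂] at e₂
    refine Eq.trans ?_ e₂
    rw [← G_act, ← ap_act, act_mulR, act_mkHom_id]

end Duals

end Prof

namespace Prof

variable {C : Type u} [SmallCategory C]

/-- Representing objects for the comultiplication and the counit of a pseudocomonoid. -/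
structure Corep (P : Pseudocomonoid C) where
  /-- the object that represents `Δ((a, b), -)` -/
  t : C → C → C
  /-- the universal element of `Δ((a, b), -)` -/
  d : ∀ a b : C, El P.D (a, b) (t a b)
  /-- its universal property -/
  hd : ∀ a b : C, Couniv P.D (d a b)
  /-- the object that represents `ε` -/
  i : C
  /-- the universal element of `ε` -/
  e : El P.E pt i
  /-- its universal property -/
  he : Couniv P.E e

namespace Corep

variable {P : Pseudocomonoid C} (T : Corep P)

/-- The morphism that represents an element of `Δ`. -/
noncomputable def D {a b x : C} (d : El P.D (a, b) x) : T.t a b ⟶ x := (T.hd a b).desc d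

/-- The morphism that represents an element of `ε`. -/
noncomputable def E {x : C} (e : El P.E pt x) : T.i ⟶ x := T.he.desc e

/-- The tensor product of morphisms. -/
noncomputable def th {a b a' b' : C} (f : a ⟶ a') (g : b ⟶ b') : T.t a b ⟶ T.t a' b' :=
  T.D (act P.D (Prod.mkHom f g) (𝟙 _) (T.d a' b'))

theorem D_d (a b : C) : T.D (T.d a b) = 𝟙 _ := (T.hd a b).desc_self

theorem E_e : T.E T.e = 𝟙 _ := T.he.desc_self

theorem act_D {a b x : C} (d : El P.D (a, b) x) : act P.D (𝟙 (a, b)) (T.D d) (T.d a b) = d :=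
  (T.hd a b).act_desc d

theorem act_E {x : C} (e : El P.E pt x) : act P.E (𝟙 pt) (T.E e) T.e = e := T.he.act_desc e

theorem D_act_right {a b x x' : C} (d : El P.D (a, b) x) (k : x ⟶ x') :
    T.D (act P.D (𝟙 (a, b)) k d) = T.D d ≫ k := (T.hd a b).desc_act' k d

theorem E_act {x x' : C} (e : El P.E pt x) (k : x ⟶ x') :
    T.E (act P.E (𝟙 pt) k e) = T.E e ≫ k := T.he.desc_act' k e

theorem D_act {a b a' b' x x' : C} (f : a' ⟶ a) (g : b' ⟶ b) (k : x ⟶ x') (d : El P.D (a, b) x) :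
    T.D (act P.D (Prod.mkHom f g) k d) = T.th f g ≫ T.D d ≫ k := by
  rw [th, ← T.D_act_right]
  congr 1
  conv_lhs => rw [← T.act_D d]
  simp [act_act]

theorem D_act_left {a b a' b' x : C} (f : a' ⟶ a) (g : b' ⟶ b) (d : El P.D (a, b) x) :
    T.D (act P.D (Prod.mkHom f g) (𝟙 x) d) = T.th f g ≫ T.D d := by
  rw [D_act, Category.comp_id]

theorem D_injective {a b x : C} {d d' : El P.D (a, b) x} (h : T.D d = T.D d') : d = d' := by
  rw [← T.act_D d, h, T.act_D]

theorem th_id (a b : C) : T.th (𝟙 a) (𝟙 b) = 𝟙 _ := by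
  rw [th, act_id_mkHom, D_d]

theorem th_comp {a b a' b' a'' b'' : C} (f : a ⟶ a') (g : b ⟶ b') (f' : a' ⟶ a'') (g' : b' ⟶ b'') :
    T.th f g ≫ T.th f' g' = T.th (f ≫ f') (g ≫ g') := by
  rw [th.eq_def T f' g', ← D_act_left, act_act, Category.comp_id]
  rfl

theorem th_comp_assoc {a b a' b' a'' b'' x : C} (f : a ⟶ a') (g : b ⟶ b') (f' : a' ⟶ a'')
    (g' : b' ⟶ b'') (k : T.t a'' b'' ⟶ x) :
    T.th f g ≫ T.th f' g' ≫ k = T.th (f ≫ f') (g ≫ g') ≫ k := by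
  rw [← Category.assoc, th_comp]

theorem AL_slide {a b c x t t' : C} (d : El P.D (t', c) x) (k : t ⟶ t') (d' : El P.D (a, b) t) :
    T.th (T.D (act P.D (𝟙 (a, b)) k d')) (𝟙 c) ≫ T.D d =
      T.th (T.D d') (𝟙 c) ≫ T.D (act P.D (Prod.mkHom k (𝟙 c)) (𝟙 x) d) := by
  rw [D_act_right, D_act_left, ← Category.assoc, th_comp, Category.comp_id]

/-- The morphism that represents an element of `(Δ ⊠ 1) ⋄ Δ`. -/
noncomputable def AL {a b c x : C} : El (ComulL P.D) ((a, b), c) x → (T.t (T.t a b) c ⟶ x) :=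
  liftComulL (fun d d' => T.th (T.D d') (𝟙 c) ≫ T.D d) T.AL_slide

theorem AL_comulL {a b c x t : C} (d : El P.D (t, c) x) (d' : El P.D (a, b) t) :
    T.AL (comulL d d') = T.th (T.D d') (𝟙 c) ≫ T.D d := by
  rw [AL, liftComulL_mk _ T.AL_slide]

theorem AR_slide {a b c x t t' : C} (d : El P.D (a, t') x) (k : t ⟶ t') (d' : El P.D (b, c) t) :
    T.th (𝟙 a) (T.D (act P.D (𝟙 (b, c)) k d')) ≫ T.D d =
      T.th (𝟙 a) (T.D d') ≫ T.D (act P.D (Prod.mkHom (𝟙 a) k) (𝟙 x) d) := by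
  rw [D_act_right, D_act_left, ← Category.assoc, th_comp, Category.comp_id]

/-- The morphism that represents an element of `(1 ⊠ Δ) ⋄ Δ`. -/
noncomputable def AR {a b c x : C} : El (ComulR P.D) ((a, b), c) x → (T.t a (T.t b c) ⟶ x) :=
  liftComulR (fun d d' => T.th (𝟙 a) (T.D d') ≫ T.D d) T.AR_slide

theorem AR_comulR {a b c x t : C} (d : El P.D (a, t) x) (d' : El P.D (b, c) t) :
    T.AR (comulR d d') = T.th (𝟙 a) (T.D d') ≫ T.D d := by
  rw [AR, liftComulR_mk _ T.AR_slide]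

theorem AL_act {a b c a' b' c' x x' : C} (f : a' ⟶ a) (g : b' ⟶ b) (k : c' ⟶ c) (l : x ⟶ x')
    (X : El (ComulL P.D) ((a, b), c) x) :
    T.AL (act (ComulL P.D) (Prod.mkHom (Prod.mkHom f g) k) l X) =
      T.th (T.th f g) k ≫ T.AL X ≫ l := by
  obtain ⟨t, d, d', rfl⟩ := exists_comulL X
  rw [act_comulL, AL_comulL, AL_comulL]
  simp only [D_act, Category.comp_id, Category.id_comp, Category.assoc, th_comp_assoc]

theorem AR_act {a b c a' b' c' x x' : C} (f : a' ⟶ a) (g : b' ⟶ b) (k : c' ⟶ c) (l : x ⟶ x')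
    (X : El (ComulR P.D) ((a, b), c) x) :
    T.AR (act (ComulR P.D) (Prod.mkHom (Prod.mkHom f g) k) l X) =
      T.th f (T.th g k) ≫ T.AR X ≫ l := by
  obtain ⟨t, d, d', rfl⟩ := exists_comulR X
  rw [act_comulR, AR_comulR, AR_comulR]
  simp only [D_act, Category.comp_id, Category.id_comp, Category.assoc, th_comp_assoc]

theorem act_AL {a b c x : C} (X : El (ComulL P.D) ((a, b), c) x) :
    act (ComulL P.D) (𝟙 ((a, b), c)) (T.AL X) (comulL (T.d (T.t a b) c) (T.d a b)) = X := by
  obtain ⟨t, d, d', rfl⟩ := exists_comulL X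
  have e := act_comulL (𝟙 a) (𝟙 b) (𝟙 c) (T.AL (comulL d d')) (T.d (T.t a b) c) (T.d a b)
  refine e.trans ?_
  rw [act_id_mkHom, AL_comulL]
  have e₁ : act P.D (Prod.mkHom (𝟙 (T.t a b)) (𝟙 c)) (T.th (T.D d') (𝟙 c) ≫ T.D d)
      (T.d (T.t a b) c) = act P.D (Prod.mkHom (T.D d') (𝟙 c)) (𝟙 x) d := by
    apply T.D_injective
    rw [D_act, D_act_left, th_id, D_d]
    simp
  rw [e₁, ← comulL_slide, act_D]

theorem act_AR {a b c x : C} (X : El (ComulR P.D) ((a, b), c) x) :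
    act (ComulR P.D) (𝟙 ((a, b), c)) (T.AR X) (comulR (T.d a (T.t b c)) (T.d b c)) = X := by
  obtain ⟨t, d, d', rfl⟩ := exists_comulR X
  have e := act_comulR (𝟙 a) (𝟙 b) (𝟙 c) (T.AR (comulR d d')) (T.d a (T.t b c)) (T.d b c)
  refine e.trans ?_
  rw [act_id_mkHom, AR_comulR]
  have e₁ : act P.D (Prod.mkHom (𝟙 a) (𝟙 (T.t b c))) (T.th (𝟙 a) (T.D d') ≫ T.D d)
      (T.d a (T.t b c)) = act P.D (Prod.mkHom (𝟙 a) (T.D d')) (𝟙 x) d := by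
    apply T.D_injective
    rw [D_act, D_act_left, th_id, D_d]
    simp
  rw [e₁, ← comulR_slide, act_D]

theorem AL_act_right {a b c x x' : C} (l : x ⟶ x') (X : El (ComulL P.D) ((a, b), c) x) :
    T.AL (act (ComulL P.D) (𝟙 ((a, b), c)) l X) = T.AL X ≫ l := by
  have e := T.AL_act (𝟙 a) (𝟙 b) (𝟙 c) l X
  rwa [th_id, th_id, Category.id_comp] at e

theorem AR_act_right {a b c x x' : C} (l : x ⟶ x') (X : El (ComulR P.D) ((a, b), c) x) :
    T.AR (act (ComulR P.D) (𝟙 ((a, b), c)) l X) = T.AR X ≫ l := by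
  have e := T.AR_act (𝟙 a) (𝟙 b) (𝟙 c) l X
  rwa [th_id, th_id, Category.id_comp] at e

/-- The associator. -/
noncomputable def assocHom (a b c : C) : T.t (T.t a b) c ⟶ T.t a (T.t b c) :=
  T.AL (ap P.coassoc.inv (comulR (T.d a (T.t b c)) (T.d b c)))

/-- The inverse of the associator. -/
noncomputable def assocInv (a b c : C) : T.t a (T.t b c) ⟶ T.t (T.t a b) c :=
  T.AR (ap P.coassoc.hom (comulL (T.d (T.t a b) c) (T.d a b)))

theorem AL_eq {a b c x : C} (X : El (ComulL P.D) ((a, b), c) x) :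
    T.AL X = T.assocHom a b c ≫ T.AR (ap P.coassoc.hom X) := by
  rw [assocHom, ← AL_act_right, ← ap_act, act_AR, ap_hom_inv]

theorem AR_eq {a b c x : C} (X : El (ComulR P.D) ((a, b), c) x) :
    T.AR X = T.assocInv a b c ≫ T.AL (ap P.coassoc.inv X) := by
  rw [assocInv, ← AR_act_right, ← ap_act, act_AL, ap_inv_hom]

/-- The associator. -/
noncomputable def assoc (a b c : C) : T.t (T.t a b) c ≅ T.t a (T.t b c) where
  hom := T.assocHom a b c
  inv := T.assocInv a b c
  hom_inv_id := by
    rw [assocInv, ← AL_eq, AL_comulL, D_d, D_d, th_id, Category.id_comp]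
  inv_hom_id := by
    rw [assocHom, ← AR_eq, AR_comulR, D_d, D_d, th_id, Category.id_comp]

theorem assoc_spec {a b c x t t' : C} {d : El P.D (t, c) x} {d' : El P.D (a, b) t}
    {f : El P.D (a, t') x} {f' : El P.D (b, c) t'}
    (h : ap P.coassoc.hom (comulL d d') = comulR f f') :
    (T.assoc a b c).hom ≫ T.th (𝟙 a) (T.D f') ≫ T.D f = T.th (T.D d') (𝟙 c) ≫ T.D d := by
  rw [← AL_comulL, AL_eq, h, AR_comulR]
  rfl

theorem assoc_naturality {a b c a' b' c' : C} (f : a ⟶ a') (g : b ⟶ b') (h : c ⟶ c') :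
    T.th (T.th f g) h ≫ (T.assoc a' b' c').hom = (T.assoc a b c).hom ≫ T.th f (T.th g h) := by
  have e := T.AL_act f g h (𝟙 _) (ap P.coassoc.inv (comulR (T.d a' (T.t b' c')) (T.d b' c')))
  rw [Category.comp_id] at e
  refine e.symm.trans ?_
  rw [AL_eq, ap_act, ap_inv_hom, AR_act, AR_comulR, D_d, D_d, th_id]
  simp only [Category.comp_id]
  rfl

theorem CL_slide {a x t t' : C} (d : El P.D (t', a) x) (k : t ⟶ t') (e : El P.E pt t) :
    T.th (T.E (act P.E (𝟙 pt) k e)) (𝟙 a) ≫ T.D d =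
      T.th (T.E e) (𝟙 a) ≫ T.D (act P.D (Prod.mkHom k (𝟙 a)) (𝟙 x) d) := by
  rw [E_act, D_act_left, ← Category.assoc, th_comp, Category.comp_id]

/-- The morphism that represents an element of `(ε ⊠ 1) ⋄ Δ`. -/
noncomputable def CL {a x : C} : El (CounL P.D P.E) a x → (T.t T.i a ⟶ x) :=
  liftCounL (fun d e => T.th (T.E e) (𝟙 a) ≫ T.D d) T.CL_slide

theorem CL_counL {a x t : C} (d : El P.D (t, a) x) (e : El P.E pt t) :
    T.CL (counL d e) = T.th (T.E e) (𝟙 a) ≫ T.D d := by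
  rw [CL, liftCounL_mk _ T.CL_slide]

theorem CR_slide {a x t t' : C} (d : El P.D (a, t') x) (k : t ⟶ t') (e : El P.E pt t) :
    T.th (𝟙 a) (T.E (act P.E (𝟙 pt) k e)) ≫ T.D d =
      T.th (𝟙 a) (T.E e) ≫ T.D (act P.D (Prod.mkHom (𝟙 a) k) (𝟙 x) d) := by
  rw [E_act, D_act_left, ← Category.assoc, th_comp, Category.comp_id]

/-- The morphism that represents an element of `(1 ⊠ ε) ⋄ Δ`. -/
noncomputable def CR {a x : C} : El (CounR P.D P.E) a x → (T.t a T.i ⟶ x) :=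
  liftCounR (fun d e => T.th (𝟙 a) (T.E e) ≫ T.D d) T.CR_slide

theorem CR_counR {a x t : C} (d : El P.D (a, t) x) (e : El P.E pt t) :
    T.CR (counR d e) = T.th (𝟙 a) (T.E e) ≫ T.D d := by
  rw [CR, liftCounR_mk _ T.CR_slide]

theorem CL_act {a a' x x' : C} (f : a' ⟶ a) (l : x ⟶ x') (X : El (CounL P.D P.E) a x) :
    T.CL (act (CounL P.D P.E) f l X) = T.th (𝟙 _) f ≫ T.CL X ≫ l := by
  obtain ⟨t, d, e, rfl⟩ := exists_counL X
  rw [act_counL, CL_counL, CL_counL]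
  simp only [D_act, Category.comp_id, Category.id_comp, Category.assoc, th_comp_assoc]

theorem CR_act {a a' x x' : C} (f : a' ⟶ a) (l : x ⟶ x') (X : El (CounR P.D P.E) a x) :
    T.CR (act (CounR P.D P.E) f l X) = T.th f (𝟙 _) ≫ T.CR X ≫ l := by
  obtain ⟨t, d, e, rfl⟩ := exists_counR X
  rw [act_counR, CR_counR, CR_counR]
  simp only [D_act, Category.comp_id, Category.id_comp, Category.assoc, th_comp_assoc]

theorem couL_eq {a x t : C} (d : El P.D (t, a) x) (e : El P.E pt t) :
    couL d e = couL (T.d T.i a) T.e ≫ T.th (T.E e) (𝟙 a) ≫ T.D d := by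
  rw [← couL_act_right]
  have e₁ : act P.D (𝟙 (T.i, a)) (T.th (T.E e) (𝟙 a) ≫ T.D d) (T.d T.i a) =
      act P.D (Prod.mkHom (T.E e) (𝟙 a)) (𝟙 x) d := by
    apply T.D_injective
    rw [D_act_right, D_d, D_act_left, Category.id_comp]
  rw [e₁, ← couL_slide, act_E]

theorem couR_eq {a x t : C} (d : El P.D (a, t) x) (e : El P.E pt t) :
    couR d e = couR (T.d a T.i) T.e ≫ T.th (𝟙 a) (T.E e) ≫ T.D d := by
  rw [← couR_act_right]
  have e₁ : act P.D (𝟙 (a, T.i)) (T.th (𝟙 a) (T.E e) ≫ T.D d) (T.d a T.i) =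
      act P.D (Prod.mkHom (𝟙 a) (T.E e)) (𝟙 x) d := by
    apply T.D_injective
    rw [D_act_right, D_d, D_act_left, Category.id_comp]
  rw [e₁, ← couR_slide, act_E]

/-- The left unitor. -/
noncomputable def left (a : C) : T.t T.i a ≅ a where
  hom := T.CL (ap P.counitL.inv (hel (𝟙 a)))
  inv := couL (T.d T.i a) T.e
  hom_inv_id := by
    have e := T.CL_act (𝟙 a) (couL (T.d T.i a) T.e) (ap P.counitL.inv (hel (𝟙 a)))
    rw [th_id, Category.id_comp] at e
    rw [← e, ← ap_act, act_hel, Category.id_comp, Category.id_comp]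
    have e₁ : ap P.counitL.inv (hel (couL (T.d T.i a) T.e)) = counL (T.d T.i a) T.e :=
      ap_hom_inv P.counitL _
    rw [e₁, CL_counL, D_d, E_e, th_id, Category.comp_id]
  inv_hom_id := by
    obtain ⟨t, d, e, h⟩ := exists_counL (ap P.counitL.inv (hel (𝟙 a)))
    rw [← h, CL_counL, ← couL_eq, couL, h]
    exact ap_inv_hom P.counitL _

/-- The right unitor. -/
noncomputable def right (a : C) : T.t a T.i ≅ a where
  hom := T.CR (ap P.counitR.inv (hel (𝟙 a)))
  inv := couR (T.d a T.i) T.e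
  hom_inv_id := by
    have e := T.CR_act (𝟙 a) (couR (T.d a T.i) T.e) (ap P.counitR.inv (hel (𝟙 a)))
    rw [th_id, Category.id_comp] at e
    rw [← e, ← ap_act, act_hel, Category.id_comp, Category.id_comp]
    have e₁ : ap P.counitR.inv (hel (couR (T.d a T.i) T.e)) = counR (T.d a T.i) T.e :=
      ap_hom_inv P.counitR _
    rw [e₁, CR_counR, D_d, E_e, th_id, Category.comp_id]
  inv_hom_id := by
    obtain ⟨t, d, e, h⟩ := exists_counR (ap P.counitR.inv (hel (𝟙 a)))
    rw [← h, CR_counR, ← couR_eq, couR, h]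
    exact ap_inv_hom P.counitR _

theorem left_naturality {a b : C} (f : a ⟶ b) :
    T.th (𝟙 _) f ≫ (T.left b).hom = (T.left a).hom ≫ f := by
  rw [← cancel_epi (T.left a).inv, Iso.inv_hom_id_assoc]
  have e₁ : (T.left a).inv ≫ T.th (𝟙 _) f = f ≫ (T.left b).inv := by
    change couL _ _ ≫ _ = f ≫ couL _ _
    have e := T.couL_eq (act P.D (Prod.mkHom (𝟙 _) f) (𝟙 _) (T.d _ b)) T.e
    rw [couL_act_left, D_act_left, E_e, th_id, Category.id_comp, D_d, Category.comp_id] at e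
    exact e.symm
  rw [← Category.assoc, e₁, Category.assoc, Iso.inv_hom_id, Category.comp_id]

theorem right_naturality {a b : C} (f : a ⟶ b) :
    T.th f (𝟙 _) ≫ (T.right b).hom = (T.right a).hom ≫ f := by
  rw [← cancel_epi (T.right a).inv, Iso.inv_hom_id_assoc]
  have e₁ : (T.right a).inv ≫ T.th f (𝟙 _) = f ≫ (T.right b).inv := by
    change couR _ _ ≫ _ = f ≫ couR _ _
    have e := T.couR_eq (act P.D (Prod.mkHom f (𝟙 _)) (𝟙 _) (T.d b _)) T.e
    rw [couR_act_left, D_act_left, E_e, th_id, Category.id_comp, D_d, Category.comp_id] at e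
    exact e.symm
  rw [← Category.assoc, e₁, Category.assoc, Iso.inv_hom_id, Category.comp_id]

theorem triangle (a b : C) :
    (T.assoc a T.i b).hom ≫ T.th (𝟙 a) (T.left b).hom = T.th (T.right a).hom (𝟙 b) := by
  obtain ⟨t', f₁, f₂, h⟩ := exists_comulR (ap P.coassoc.hom (comulL (T.d (T.t a T.i) b)
    (T.d a T.i)))
  have e := congrArg T.D (cotriangle' _ _ T.e f₁ f₂ h.symm)
  have e₁ := T.assoc_spec h.symm
  rw [D_act_left, D_act_left, couL_eq, E_e, th_id, D_d, Category.id_comp, Category.comp_id] at e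
  rw [D_d, D_d, th_id, Category.id_comp, ← Iso.eq_inv_comp, Category.comp_id] at e₁
  change T.th (T.right a).inv (𝟙 b) = T.th (𝟙 a) ((T.left b).inv ≫ T.D f₂) ≫ T.D f₁ at e
  have e₂ : T.th (𝟙 a) ((T.left b).inv ≫ T.D f₂) =
      T.th (𝟙 a) (T.left b).inv ≫ T.th (𝟙 a) (T.D f₂) := by
    rw [th_comp, Category.comp_id]
  rw [e₂, Category.assoc, e₁] at e
  have e₃ : T.th (T.right a).hom (𝟙 b) ≫ T.th (T.right a).inv (𝟙 b) = 𝟙 _ := by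
    rw [th_comp, Iso.hom_inv_id, Category.comp_id, th_id]
  have e₄ : T.th (𝟙 a) (T.left b).inv ≫ T.th (𝟙 a) (T.left b).hom = 𝟙 _ := by
    rw [th_comp, Iso.inv_hom_id, Category.comp_id, th_id]
  rw [e] at e₃
  calc (T.assoc a T.i b).hom ≫ T.th (𝟙 a) (T.left b).hom
      = (T.th (T.right a).hom (𝟙 b) ≫ T.th (𝟙 a) (T.left b).inv ≫ (T.assoc a T.i b).inv) ≫
        (T.assoc a T.i b).hom ≫ T.th (𝟙 a) (T.left b).hom := by rw [e₃, Category.id_comp]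
    _ = T.th (T.right a).hom (𝟙 b) := by
      simp only [Category.assoc, Iso.inv_hom_id_assoc, e₄, Category.comp_id]

theorem pentagon (a b c e : C) :
    T.th (T.assoc a b c).hom (𝟙 e) ≫ (T.assoc a (T.t b c) e).hom ≫
        T.th (𝟙 a) (T.assoc b c e).hom =
      (T.assoc (T.t a b) c e).hom ≫ (T.assoc a b (T.t c e)).hom := by
  obtain ⟨s, f₁, f₂, hf⟩ := exists_comulR (ap P.coassoc.hom (comulL (T.d (T.t a b) c) (T.d a b)))
  obtain ⟨t, g₁, g₂, hg⟩ := exists_comulR (ap P.coassoc.hom (comulL (T.d (T.t (T.t a b) c) e) f₁))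
  obtain ⟨r, h₁, h₂, hh⟩ := exists_comulR (ap P.coassoc.hom (comulL g₂ f₂))
  obtain ⟨s', f₁', f₂', hf'⟩ := exists_comulR (ap P.coassoc.hom
    (comulL (T.d (T.t (T.t a b) c) e) (T.d (T.t a b) c)))
  obtain ⟨t', g₁', g₂', hg'⟩ := exists_comulR (ap P.coassoc.hom (comulL f₁' (T.d a b)))
  have key := P.copentagon _ _ _ f₁ f₂ g₁ g₂ h₁ h₂ f₁' f₂' g₁' g₂' hf.symm hg.symm hh.symm hf'.symm
    hg'.symm
  have key' := congrArg (liftComulComulComul (fun {s t} (d : El P.D (a, s) _) (d' : El P.D (b, t) s)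
    (d'' : El P.D (c, e) t) => T.th (𝟙 a) (T.th (𝟙 b) (T.D d'')) ≫ T.th (𝟙 a) (T.D d') ≫ T.D d)
    (fun d k d' d'' => by
      rw [D_act_right, D_act_left, ← Category.assoc (T.th (𝟙 a) (T.D d')), th_comp,
        Category.comp_id])
    (fun d d' k d'' => by
      simp only [D_act_right, D_act_left, th_comp_assoc, Category.comp_id])) key
  rw [liftComulComulComul_mk, liftComulComulComul_mk] at key'
  have ef := T.assoc_spec hf.symm
  have eg := T.assoc_spec hg.symm
  have eh := T.assoc_spec hh.symm
  have ef' := T.assoc_spec hf'.symm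
  have eg' := T.assoc_spec hg'.symm
  simp only [D_d, th_id, Category.comp_id, Category.id_comp] at ef eg ef' eg'
  have wl : ∀ {x y z w : C} (f : y ⟶ z) (g : z ⟶ w), T.th (𝟙 x) f ≫ T.th (𝟙 x) g =
      T.th (𝟙 x) (f ≫ g) := fun f g => by rw [th_comp, Category.comp_id]
  have wr : ∀ {x y z w : C} (f : y ⟶ z) (g : z ⟶ w), T.th f (𝟙 x) ≫ T.th g (𝟙 x) =
      T.th (f ≫ g) (𝟙 x) := fun f g => by rw [th_comp, Category.comp_id]
  -- both sides composed with the left hand side of `key'` are the identity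
  have l : T.th (T.assoc a b c).hom (𝟙 e) ≫ (T.assoc a (T.t b c) e).hom ≫
      T.th (𝟙 a) (T.assoc b c e).hom ≫ T.th (𝟙 a) (T.th (𝟙 b) (T.D h₂)) ≫ T.th (𝟙 a) (T.D h₁) ≫
        T.D g₁ = 𝟙 _ := by
    have e₁ : T.th (𝟙 a) (T.assoc b c e).hom ≫ T.th (𝟙 a) (T.th (𝟙 b) (T.D h₂)) ≫
        T.th (𝟙 a) (T.D h₁) ≫ T.D g₁ =
        T.th (𝟙 a) (T.th (T.D f₂) (𝟙 e)) ≫ T.th (𝟙 a) (T.D g₂) ≫ T.D g₁ := by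
      simp only [← Category.assoc, wl]
      rw [Category.assoc (T.assoc b c e).hom, eh]
    rw [e₁, ← Category.assoc (T.assoc a (T.t b c) e).hom, ← assoc_naturality, Category.assoc, eg,
      wr, wr, ef, th_id]
  have r : (T.assoc (T.t a b) c e).hom ≫ (T.assoc a b (T.t c e)).hom ≫
      T.th (𝟙 a) (T.th (𝟙 b) (T.D f₂')) ≫ T.th (𝟙 a) (T.D g₂') ≫ T.D g₁' = 𝟙 _ := by
    rw [← Category.assoc (T.assoc a b (T.t c e)).hom, ← assoc_naturality, Category.assoc, eg', th_id,
      ef']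
  have iso : IsIso (T.th (𝟙 a) (T.th (𝟙 b) (T.D h₂)) ≫ T.th (𝟙 a) (T.D h₁) ≫ T.D g₁) := by
    refine ⟨(T.assoc (T.t a b) c e).hom ≫ (T.assoc a b (T.t c e)).hom, ?_, ?_⟩
    · rw [key']
      rw [← cancel_epi (T.assoc a b (T.t c e)).hom, ← cancel_epi (T.assoc (T.t a b) c e).hom]
      have := congrArg (fun k => k ≫ (T.assoc (T.t a b) c e).hom ≫ (T.assoc a b (T.t c e)).hom) r
      simp only [Category.assoc, Category.id_comp, Category.comp_id] at this ⊢
      exact this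
    · rw [key']
      simp only [Category.assoc]
      exact r
  rw [← cancel_mono (T.th (𝟙 a) (T.th (𝟙 b) (T.D h₂)) ≫ T.th (𝟙 a) (T.D h₁) ≫ T.D g₁)]
  simp only [Category.assoc]
  rw [l, key', r]

/-- The monoidal category given by a representable pseudocomonoid. -/
noncomputable abbrev monoidal : MonoidalCategory C :=
  letI : MonoidalCategoryStruct C :=
    { tensorObj := T.t
      whiskerLeft := fun a {_ _} f => T.th (𝟙 a) f
      whiskerRight := fun f b => T.th f (𝟙 b)
      tensorHom := fun f g => T.th f g
      tensorUnit := T.i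
      associator := T.assoc
      leftUnitor := T.left
      rightUnitor := T.right }
  MonoidalCategory.ofTensorHom (fun a b => T.th_id a b) (fun _ {_ _} _ => rfl)
    (fun _ _ => rfl) (fun f₁ f₂ g₁ g₂ => T.th_comp f₁ f₂ g₁ g₂)
    (fun f g h => T.assoc_naturality f g h) (fun f => T.left_naturality f)
    (fun f => T.right_naturality f) (fun a b c d => T.pentagon a b c d)
    (fun a b => T.triangle a b)

end Corep

section Comonoidal

open MonoidalCategory

/-- A pseudocomonoid is represented by a monoidal category. -/
structure Comonoidal (P : Pseudocomonoid C) [MonoidalCategory C] where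
  /-- `Δ((a, b), x) ≃ Hom(a ⊗ b, x)` -/
  D : ∀ {a b x : C}, El P.D (a, b) x ≃ (a ⊗ b ⟶ x)
  /-- `ε(x) ≃ Hom(I, x)` -/
  E : ∀ {x : C}, El P.E pt x ≃ (𝟙_ C ⟶ x)
  D_act : ∀ {a a' b b' x x' : C} (f : a' ⟶ a) (g : b' ⟶ b) (h : x ⟶ x') (d : El P.D (a, b) x),
    D (act P.D (Prod.mkHom f g) h d) = (f ⊗ₘ g) ≫ D d ≫ h
  E_act : ∀ {x x' : C} (h : x ⟶ x') (e : El P.E pt x), E (act P.E (𝟙 pt) h e) = E e ≫ h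
  coassoc : ∀ {a b c x t t' : C} (d : El P.D (t, c) x) (d' : El P.D (a, b) t)
    (f : El P.D (a, t') x) (f' : El P.D (b, c) t'),
    ap P.coassoc.hom (comulL d d') = comulR f f' →
    (α_ a b c).hom ≫ (a ◁ D f') ≫ D f = (D d' ▷ c) ≫ D d
  counitL : ∀ {a x t : C} (d : El P.D (t, a) x) (e : El P.E pt t),
    couL d e = (λ_ a).inv ≫ (E e ▷ a) ≫ D d
  counitR : ∀ {a x t : C} (d : El P.D (a, t) x) (e : El P.E pt t),
    couR d e = (ρ_ a).inv ≫ (a ◁ E e) ≫ D d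

/-- A representable pseudocomonoid is represented by a monoidal category. -/
theorem exists_comonoidal (P : Pseudocomonoid C)
    (hD : ∀ a b : C, ∃ (c : C) (d₀ : El P.D (a, b) c), Couniv P.D d₀)
    (hE : ∃ (i : C) (e₀ : El P.E pt i), Couniv P.E e₀) :
    ∃ m : MonoidalCategory C, Nonempty (@Comonoidal C _ P m) := by
  choose t d hd using hD
  obtain ⟨i, e, he⟩ := hE
  let T : Corep P := ⟨t, d, hd, i, e, he⟩
  let _ := T.monoidal
  exact ⟨T.monoidal, ⟨{
    D := fun {a b x} => ⟨T.D, fun f => act P.D (𝟙 (a, b)) f (T.d a b), T.act_D,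
      (T.hd a b).desc_act⟩
    E := fun {x} => ⟨T.E, fun f => act P.E (𝟙 pt) f T.e, T.act_E, T.he.desc_act⟩
    D_act := T.D_act
    E_act := fun h e => T.E_act e h
    coassoc := fun d d' f f' h => T.assoc_spec h
    counitL := fun d e => T.couL_eq d e
    counitR := fun d e => T.couR_eq d e }⟩⟩

end Comonoidal

end Prof

section ExactPairing

open MonoidalCategory

variable {C : Type u} [SmallCategory C] [MonoidalCategory C] {o a b : C} {ev : a ⊗ b ⟶ o}

/-- The morphism into the right dual. -/
noncomputable def IsExactPairing.curry (h : IsExactPairing ev) {x : C} (δ : a ⊗ x ⟶ o) : x ⟶ b :=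
  ((h.1 x).2 δ).choose

theorem IsExactPairing.curry_spec (h : IsExactPairing ev) {x : C} (δ : a ⊗ x ⟶ o) :
    (a ◁ h.curry δ) ≫ ev = δ := ((h.1 x).2 δ).choose_spec

theorem IsExactPairing.hom_ext (h : IsExactPairing ev) {x : C} {f g : x ⟶ b}
    (e : (a ◁ f) ≫ ev = (a ◁ g) ≫ ev) : f = g := (h.1 x).1 e

/-- The morphism into the left dual. -/
noncomputable def IsExactPairing.lcurry (h : IsExactPairing ev) {x : C} (δ : x ⊗ b ⟶ o) : x ⟶ a :=
  ((h.2 x).2 δ).choose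

theorem IsExactPairing.lcurry_spec (h : IsExactPairing ev) {x : C} (δ : x ⊗ b ⟶ o) :
    (h.lcurry δ ▷ b) ≫ ev = δ := ((h.2 x).2 δ).choose_spec

theorem IsExactPairing.lhom_ext (h : IsExactPairing ev) {x : C} {f g : x ⟶ a}
    (e : (f ▷ b) ≫ ev = (g ▷ b) ≫ ev) : f = g := (h.2 x).1 e

/-- An object with the universal property of a left dual is the left dual. -/
theorem IsExactPairing.of_left (h : IsExactPairing ev) {a' : C} {ev' : a' ⊗ b ⟶ o}
    (h' : ∀ x : C, Function.Bijective (fun f : x ⟶ a' => (f ▷ b) ≫ ev')) : IsExactPairing ev' := by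
  refine ⟨fun x => ?_, h'⟩
  obtain ⟨k, hk⟩ := (h' a).2 ev
  change (k ▷ b) ≫ ev' = ev at hk
  have hk' := h.lcurry_spec ev'
  have e₁ : k ≫ h.lcurry ev' = 𝟙 a := h.lhom_ext (by
    rw [comp_whiskerRight, Category.assoc, hk', hk, id_whiskerRight, Category.id_comp])
  have e₂ : h.lcurry ev' ≫ k = 𝟙 a' := (h' a').1 (by
    change (_ ▷ b) ≫ ev' = (_ ▷ b) ≫ ev'
    rw [comp_whiskerRight, Category.assoc, hk, hk', id_whiskerRight, Category.id_comp])
  constructor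
  · intro f g e
    apply h.hom_ext
    have e' := congrArg (fun t => (k ▷ x) ≫ t) e
    simpa only [← whisker_exchange_assoc, hk] using e'
  · intro δ
    refine ⟨h.curry ((k ▷ x) ≫ δ), ?_⟩
    change (a' ◁ _) ≫ ev' = δ
    rw [← hk', whisker_exchange_assoc, h.curry_spec, ← comp_whiskerRight_assoc, e₂,
      id_whiskerRight, Category.id_comp]

/-- The unit is dual to the dualizing object. -/
theorem isExactPairing_rightUnitor (hd : IsDualizing o) :
    IsExactPairing (ρ_ o).hom := by
  obtain ⟨a, ev, h⟩ := hd.2 (𝟙_ C)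
  refine h.of_left (fun x => ⟨fun f g e => ?_, fun δ => ⟨(ρ_ x).inv ≫ δ, ?_⟩⟩)
  · simpa using e
  · simp

end ExactPairing

namespace Prof

open MonoidalCategory

variable {C : Type u} [SmallCategory C] [MonoidalCategory C]

/-- Representations of four profunctors by a `*`-autonomous category. -/
structure Frame (o : C) (PM : Profunctor.{u} (C × C) C) (PH : Profunctor.{u} One C)
    (PD : Profunctor.{u} C (C × C)) (PE : Profunctor.{u} C One) where
  /-- `Δ((a, b), x) ≃ Hom(a ⊗ b, x)` -/
  D : ∀ {a b x : C}, El PD (a, b) x ≃ (a ⊗ b ⟶ x)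
  /-- `ε(x) ≃ Hom(I, x)` -/
  E : ∀ {x : C}, El PE pt x ≃ (𝟙_ C ⟶ x)
  /-- `η(z) ≃ Hom(z, o)` -/
  H : ∀ {z : C}, El PH z pt ≃ (z ⟶ o)
  /-- an element of `μ(z, (x, y))`, as a family of functions `Hom(y ⊗ w, o) → Hom(z ⊗ w, x)` -/
  ev : ∀ {x y z w : C}, El PM z (x, y) → (y ⊗ w ⟶ o) → (z ⊗ w ⟶ x)
  D_act : ∀ {a a' b b' x x' : C} (f : a' ⟶ a) (g : b' ⟶ b) (h : x ⟶ x') (d : El PD (a, b) x),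
    D (act PD (Prod.mkHom f g) h d) = (f ⊗ₘ g) ≫ D d ≫ h
  E_act : ∀ {x x' : C} (h : x ⟶ x') (e : El PE pt x), E (act PE (𝟙 pt) h e) = E e ≫ h
  H_act : ∀ {z z' : C} (h : z' ⟶ z) (n : El PH z pt), H (act PH h (𝟙 pt) n) = h ≫ H n
  ev_act : ∀ {x x' y y' z z' w : C} (f : z' ⟶ z) (g : x ⟶ x') (h : y ⟶ y') (m : El PM z (x, y))
    (δ : y' ⊗ w ⟶ o),
    ev (act PM f (Prod.mkHom g h) m) δ = (f ▷ w) ≫ ev m ((h ▷ w) ≫ δ) ≫ g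
  ev_nat : ∀ {x y z w w' : C} (m : El PM z (x, y)) (k : w' ⟶ w) (δ : y ⊗ w ⟶ o),
    ev m ((y ◁ k) ≫ δ) = (z ◁ k) ≫ ev m δ
  ev_bijective : ∀ {x y y' z : C} {ε : y ⊗ y' ⟶ o}, IsExactPairing ε →
    Function.Bijective (fun m : El PM z (x, y) => ev m ε)
  dual : IsDualizing o

namespace Frame

variable {o : C} {M : Profunctor.{u} (C × C) C} {H : Profunctor.{u} One C}
    {D : Profunctor.{u} C (C × C)} {E : Profunctor.{u} C One} (R : Frame o M H D E)

theorem D_right {a b x x' : C} (h : x ⟶ x') (d : El D (a, b) x) :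
    R.D (act D (𝟙 (a, b)) h d) = R.D d ≫ h := by
  have e := R.D_act (𝟙 a) (𝟙 b) h d
  rwa [id_tensorHom_id, Category.id_comp] at e

theorem D_left {a a' b b' x : C} (f : a' ⟶ a) (g : b' ⟶ b) (d : El D (a, b) x) :
    R.D (act D (Prod.mkHom f g) (𝟙 x) d) = (f ⊗ₘ g) ≫ R.D d := by
  rw [R.D_act, Category.comp_id]

theorem ev_left {x y z z' w : C} (f : z' ⟶ z) (m : El M z (x, y)) (δ : y ⊗ w ⟶ o) :
    R.ev (act M f (𝟙 (x, y)) m) δ = (f ▷ w) ≫ R.ev m δ := by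
  have e := R.ev_act f (𝟙 x) (𝟙 y) m δ
  rwa [id_whiskerRight, Category.id_comp, Category.comp_id] at e

theorem ev_mid {x x' y z w : C} (g : x ⟶ x') (m : El M z (x, y)) (δ : y ⊗ w ⟶ o) :
    R.ev (act M (𝟙 z) (Prod.mkHom g (𝟙 y)) m) δ = R.ev m δ ≫ g := by
  rw [R.ev_act, id_whiskerRight, id_whiskerRight, Category.id_comp, Category.id_comp]

theorem ev_slide {x y y' z w : C} (h : y ⟶ y') (m : El M z (x, y)) (δ : y' ⊗ w ⟶ o) :
    R.ev (act M (𝟙 z) (Prod.mkHom (𝟙 x) h) m) δ = R.ev m ((h ▷ w) ≫ δ) := by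
  rw [R.ev_act, id_whiskerRight, Category.id_comp, Category.comp_id]

theorem ev_injective {x y y' z : C} {ε : y ⊗ y' ⟶ o} (hε : IsExactPairing ε) {m m' : El M z (x, y)}
    (h : R.ev m ε = R.ev m' ε) : m = m' := (R.ev_bijective hε).1 h

theorem exists_ev {x y y' z : C} {ε : y ⊗ y' ⟶ o} (hε : IsExactPairing ε) (f : z ⊗ y' ⟶ x) :
    ∃ m : El M z (x, y), R.ev m ε = f := (R.ev_bijective hε).2 f

/-- Evaluation is determined by its value at an exact pairing. -/
theorem ev_eq {x y y' z w : C} {ε : y ⊗ y' ⟶ o} (hε : IsExactPairing ε) (m : El M z (x, y))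
    (δ : y ⊗ w ⟶ o) : R.ev m δ = (z ◁ hε.curry δ) ≫ R.ev m ε := by
  rw [← R.ev_nat, hε.curry_spec]

theorem ext {x y z : C} {m m' : El M z (x, y)}
    (h : ∀ {w : C} (δ : y ⊗ w ⟶ o), R.ev m δ = R.ev m' δ) : m = m' := by
  obtain ⟨y', ε, hε⟩ := R.dual.1 y
  exact R.ev_injective hε (h ε)

/-- The pairing of an element of `μ` with two pairings. -/
def pair {t y z u v : C} (n : El M t (y, z)) (δ : z ⊗ u ⟶ o) (δ' : y ⊗ v ⟶ o) :
    t ⊗ (u ⊗ v) ⟶ o :=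
  (α_ t u v).inv ≫ (R.ev n δ ▷ v) ≫ δ'

theorem pair_act {t t' y y' z z' u v : C} (f : t' ⟶ t) (g : y ⟶ y') (h : z ⟶ z') (n : El M t (y, z))
    (δ : z' ⊗ u ⟶ o) (δ' : y' ⊗ v ⟶ o) :
    R.pair (act M f (Prod.mkHom g h) n) δ δ' =
      (f ▷ (u ⊗ v)) ≫ R.pair n ((h ▷ u) ≫ δ) ((g ▷ v) ≫ δ') := by
  simp [pair, R.ev_act]

theorem pair_left {t t' y z u v : C} (f : t' ⟶ t) (n : El M t (y, z))
    (δ : z ⊗ u ⟶ o) (δ' : y ⊗ v ⟶ o) :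
    R.pair (act M f (𝟙 (y, z)) n) δ δ' = (f ▷ (u ⊗ v)) ≫ R.pair n δ δ' := by
  have e := R.pair_act f (𝟙 y) (𝟙 z) n δ δ'
  rwa [id_whiskerRight, id_whiskerRight, Category.id_comp, Category.id_comp] at e

theorem pair_nat {t y z u u' v v' : C} (n : El M t (y, z)) (k : u' ⟶ u) (l : v' ⟶ v)
    (δ : z ⊗ u ⟶ o) (δ' : y ⊗ v ⟶ o) :
    R.pair n ((z ◁ k) ≫ δ) ((y ◁ l) ≫ δ') = (t ◁ (k ⊗ₘ l)) ≫ R.pair n δ δ' := by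
  rw [pair, pair, R.ev_nat, comp_whiskerRight_assoc, ← whisker_exchange_assoc,
    MonoidalCategory.tensorHom_def, MonoidalCategory.whiskerLeft_comp_assoc,
    associator_inv_naturality_right_assoc, associator_inv_naturality_middle_assoc,
    whisker_exchange_assoc]

/-- The pairing at exact pairings represents `μ(t, (y, z))`. -/
theorem pair_bijective {t y y' z z' : C} {ε : z ⊗ z' ⟶ o} {ε' : y ⊗ y' ⟶ o}
    (hε : IsExactPairing ε) (hε' : IsExactPairing ε') :
    Function.Bijective (fun n : El M t (y, z) => R.pair n ε ε') := by
  constructor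
  · intro n n' e
    apply R.ev_injective hε
    apply hε'.lhom_ext
    simpa [pair] using e
  · intro δ
    obtain ⟨n, hn⟩ := R.exists_ev (z := t) hε (hε'.lcurry ((α_ t z' y').hom ≫ δ))
    exact ⟨n, by simp [pair, hn, hε'.lcurry_spec]⟩

theorem exists_univ (R : Frame o M H D E) (y z : C) : ∃ (p : C) (n : El M p (y, z)), Univ M n := by
  obtain ⟨y', ε', hε'⟩ := R.dual.1 y
  obtain ⟨z', ε, hε⟩ := R.dual.1 z
  obtain ⟨p, π, hπ⟩ := R.dual.2 (z' ⊗ y')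
  obtain ⟨n, hn⟩ := (R.pair_bijective (t := p) hε hε').2 π
  change R.pair n ε ε' = π at hn
  refine ⟨p, n, fun t m => ⟨hπ.lcurry (R.pair m ε ε'), ?_, fun f hf => ?_⟩⟩
  · apply (R.pair_bijective hε hε').1
    change R.pair (act M _ (𝟙 (y, z)) n) ε ε' = R.pair m ε ε'
    rw [pair_left, hn, hπ.lcurry_spec]
  · apply hπ.lhom_ext
    change act M f (𝟙 (y, z)) n = m at hf
    rw [hπ.lcurry_spec, ← hf, pair_left, hn]

theorem pair_exact {p y y' z z' : C} {n : El M p (y, z)} (hn : Univ M n) {ε : z ⊗ z' ⟶ o}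
    {ε' : y ⊗ y' ⟶ o} (hε : IsExactPairing ε) (hε' : IsExactPairing ε') :
    IsExactPairing (R.pair n ε ε') := by
  obtain ⟨q, π, hπ⟩ := R.dual.2 (z' ⊗ y')
  refine hπ.of_left (fun x => ?_)
  have e : (fun f : x ⟶ p => (f ▷ (z' ⊗ y')) ≫ R.pair n ε ε') =
      (fun m : El M x (y, z) => R.pair m ε ε') ∘ (fun f : x ⟶ p => act M f (𝟙 (y, z)) n) := by
    funext f
    exact (R.pair_left f n ε ε').symm
  rw [e]
  refine (R.pair_bijective hε hε').comp ⟨fun f g h => hn.hom_ext h, fun m => ?_⟩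
  exact ⟨hn.desc m, hn.act_desc m⟩

/-- A universal element of `Δ((-, b), y)`. -/
theorem exists_univ_D (b y : C) : ∃ (p : C) (d : El D (p, b) y),
    (∀ {t : C} (d' : El D (t, b) y), ∃ k : t ⟶ p, act D (Prod.mkHom k (𝟙 b)) (𝟙 y) d = d') ∧
    ∀ {y' : C} {ε : y ⊗ y' ⟶ o}, IsExactPairing ε →
      IsExactPairing ((α_ p b y').inv ≫ (R.D d ▷ y') ≫ ε) := by
  obtain ⟨y', ε, hε⟩ := R.dual.1 y
  obtain ⟨p, π, hπ⟩ := R.dual.2 (b ⊗ y')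
  obtain ⟨d, hd⟩ : ∃ d : El D (p, b) y, (R.D d ▷ y') ≫ ε = (α_ p b y').hom ≫ π :=
    ⟨R.D.symm (hε.lcurry ((α_ p b y').hom ≫ π)), by
      rw [Equiv.apply_symm_apply, hε.lcurry_spec]⟩
  have key : ∀ {t : C} (d' : El D (t, b) y),
      ∃ k : t ⟶ p, act D (Prod.mkHom k (𝟙 b)) (𝟙 y) d = d' := fun {t} d' => by
    refine ⟨hπ.lcurry ((α_ t b y').inv ≫ (R.D d' ▷ y') ≫ ε), R.D.injective (hε.lhom_ext ?_)⟩
    rw [R.D_left, comp_whiskerRight, Category.assoc, hd, tensorHom_id,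
      associator_naturality_left_assoc, hπ.lcurry_spec, Iso.hom_inv_id_assoc]
  refine ⟨p, d, key, fun {y''} {ε'} hε' => ?_⟩
  obtain ⟨q, π', hπ'⟩ := R.dual.2 (b ⊗ y'')
  refine hπ'.of_left (fun x => ⟨fun f g h => ?_, fun δ => ?_⟩)
  · apply hπ.lhom_ext
    have h' : ((f ▷ b) ≫ R.D d) = ((g ▷ b) ≫ R.D d) := hε'.lhom_ext (by
      simpa [associator_inv_naturality_left_assoc] using h)
    have h'' := congrArg (fun t => (α_ x b y').inv ≫ (t ▷ y') ≫ ε) h'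
    simpa [hd, associator_inv_naturality_left_assoc] using h''
  · obtain ⟨k, hk⟩ := key (R.D.symm (hε'.lcurry ((α_ x b y'').hom ≫ δ)))
    refine ⟨k, ?_⟩
    have hk' := congrArg R.D hk
    rw [R.D_left, Equiv.apply_symm_apply, tensorHom_id] at hk'
    change (k ▷ (b ⊗ y'')) ≫ (α_ p b y'').inv ≫ (R.D d ▷ y'') ≫ ε' = δ
    rw [associator_inv_naturality_left_assoc, ← comp_whiskerRight_assoc, hk', hε'.lcurry_spec,
      Iso.inv_hom_id_assoc]

end Frame

end Prof

namespace Prof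

open MonoidalCategory

section Iso

variable {A B : Type u} [SmallCategory A] [SmallCategory B]

/-- Two profunctors whose elements are described by the same values are isomorphic. -/
theorem exists_iso_of_values {P Q : Profunctor.{u} A B}
    (R : ∀ {b : B} {a : A}, El P b a → El Q b a → Prop)
    (hR : ∀ {b b' : B} {a a' : A} (g : b' ⟶ b) (f : a ⟶ a') (p : El P b a) (q : El Q b a),
      R p q → R (act P g f p) (act Q g f q))
    (h : ∀ (b : B) (a : A), ∃ (V : Type u) (φ : El P b a → V) (ψ : El Q b a → V),
      Function.Bijective φ ∧ Function.Bijective ψ ∧ ∀ p q, φ p = ψ q ↔ R p q) :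
    ∃ i : P ≅ Q, ∀ {b : B} {a : A} (p : El P b a) (q : El Q b a), ap i.hom p = q ↔ R p q := by
  refine exists_iso_of_rel R hR (fun {b a} p => ?_) (fun {b a} q => ?_)
  · obtain ⟨V, φ, ψ, hφ, hψ, e⟩ := h b a
    obtain ⟨q, hq⟩ := hψ.2 (φ p)
    exact ⟨q, (e p q).1 hq.symm, fun q' hq' => hψ.1 (((e p q').2 hq').symm.trans hq.symm)⟩
  · obtain ⟨V, φ, ψ, hφ, hψ, e⟩ := h b a
    obtain ⟨p, hp⟩ := hφ.2 (ψ q)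
    exact ⟨p, (e p q).1 hp, fun p' hp' => hφ.1 (((e p' q).2 hp').trans hp.symm)⟩

end Iso

section

variable {C : Type u} [SmallCategory C] {M : Profunctor.{u} (C × C) C}

theorem exists_mulR_eq {x y z w p : C} {n : El M p (y, z)} (hn : Univ M n)
    (q : El (MulR M) w ((x, y), z)) : ∃ m, q = mulR m n := by
  obtain ⟨t, m, m', rfl⟩ := exists_mulR q
  exact ⟨_, by rw [← hn.act_desc m', ← mulR_slide]⟩

end

variable {C : Type u} [SmallCategory C] [MonoidalCategory C]

namespace Frame

variable {o : C} {M : Profunctor.{u} (C × C) C} {H : Profunctor.{u} One C}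
    {D : Profunctor.{u} C (C × C)} {E : Profunctor.{u} C One} (R : Frame o M H D E)

/-! ### Iterated multiplications -/

/-- The value of an element of `MulL`. -/
def mulLVal {x y z w u v : C} (δ : z ⊗ u ⟶ o) (δ' : y ⊗ v ⟶ o) :
    El (MulL M) w ((x, y), z) → ((w ⊗ u) ⊗ v ⟶ x) :=
  liftMulL (fun m m' => (R.ev m δ ▷ v) ≫ R.ev m' δ') (fun m k n => by
    rw [R.ev_mid, R.ev_left, comp_whiskerRight_assoc])

theorem mulLVal_mk {x y z w t u v : C} (δ : z ⊗ u ⟶ o) (δ' : y ⊗ v ⟶ o) (m : El M w (t, z))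
    (m' : El M t (x, y)) : R.mulLVal δ δ' (mulL m m') = (R.ev m δ ▷ v) ≫ R.ev m' δ' :=
  liftMulL_mk _ (fun m k n => by rw [R.ev_mid, R.ev_left, comp_whiskerRight_assoc]) m m'

theorem mulLVal_act {x y z w x' y' z' w' u v : C} (h : w' ⟶ w) (f : x ⟶ x') (g : y ⟶ y')
    (k : z ⟶ z') (δ : z' ⊗ u ⟶ o) (δ' : y' ⊗ v ⟶ o) (p : El (MulL M) w ((x, y), z)) :
    R.mulLVal δ δ' (act (MulL M) h (Prod.mkHom (Prod.mkHom f g) k) p) =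
      ((h ▷ u) ▷ v) ≫ R.mulLVal ((k ▷ u) ≫ δ) ((g ▷ v) ≫ δ') p ≫ f := by
  obtain ⟨t, m, m', rfl⟩ := exists_mulL p
  rw [act_mulL, mulLVal_mk, mulLVal_mk, R.ev_act, R.ev_act]
  simp

theorem mulLVal_nat {x y z w u v u' v' : C} (k : u' ⟶ u) (l : v' ⟶ v) (δ : z ⊗ u ⟶ o)
    (δ' : y ⊗ v ⟶ o) (p : El (MulL M) w ((x, y), z)) :
    R.mulLVal ((z ◁ k) ≫ δ) ((y ◁ l) ≫ δ') p = ((w ◁ k) ⊗ₘ l) ≫ R.mulLVal δ δ' p := by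
  obtain ⟨t, m, m', rfl⟩ := exists_mulL p
  rw [mulLVal_mk, mulLVal_mk, R.ev_nat, R.ev_nat, MonoidalCategory.tensorHom_def, Category.assoc,
    comp_whiskerRight_assoc, whisker_exchange_assoc]

theorem mulLVal_bijective {x y z w z' y' : C} {ε : z ⊗ z' ⟶ o} {ε' : y ⊗ y' ⟶ o}
    (hε : IsExactPairing ε) (hε' : IsExactPairing ε') :
    Function.Bijective (R.mulLVal (x := x) (w := w) ε ε') := by
  obtain ⟨m₀, hm₀⟩ := R.exists_ev (z := w) hε (𝟙 (w ⊗ z'))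
  have nf : ∀ p : El (MulL M) w ((x, y), z), ∃ m', p = mulL m₀ m' := fun p => by
    obtain ⟨t, m, m', rfl⟩ := exists_mulL p
    have e : m = act M (𝟙 w) (Prod.mkHom (R.ev m ε) (𝟙 z)) m₀ := R.ev_injective hε (by
      rw [R.ev_mid, hm₀, Category.id_comp])
    exact ⟨_, by rw [e, mulL_slide]⟩
  constructor
  · intro p q h
    obtain ⟨m, rfl⟩ := nf p
    obtain ⟨n, rfl⟩ := nf q
    rw [mulLVal_mk, mulLVal_mk, hm₀, id_whiskerRight, Category.id_comp, Category.id_comp] at h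
    rw [R.ev_injective hε' h]
  · intro f
    obtain ⟨m', hm'⟩ := R.exists_ev hε' f
    exact ⟨mulL m₀ m', by rw [mulLVal_mk, hm₀, id_whiskerRight, Category.id_comp, hm']⟩

/-- The value of an element of `MulR`. -/
def mulRVal {x y z w u v : C} (δ : z ⊗ u ⟶ o) (δ' : y ⊗ v ⟶ o) :
    El (MulR M) w ((x, y), z) → ((w ⊗ u) ⊗ v ⟶ x) :=
  liftMulR (fun m n => (α_ w u v).hom ≫ R.ev m (R.pair n δ δ')) (fun m k n => by
    rw [R.ev_slide, R.pair_left])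

theorem mulRVal_mk {x y z w t u v : C} (δ : z ⊗ u ⟶ o) (δ' : y ⊗ v ⟶ o) (m : El M w (x, t))
    (n : El M t (y, z)) :
    R.mulRVal δ δ' (mulR m n) = (α_ w u v).hom ≫ R.ev m (R.pair n δ δ') :=
  liftMulR_mk (fun m n => (α_ w u v).hom ≫ R.ev m (R.pair n δ δ'))
    (fun m k n => by rw [R.ev_slide, R.pair_left]) m n

theorem mulRVal_act {x y z w x' y' z' w' u v : C} (h : w' ⟶ w) (f : x ⟶ x') (g : y ⟶ y')
    (k : z ⟶ z') (δ : z' ⊗ u ⟶ o) (δ' : y' ⊗ v ⟶ o) (p : El (MulR M) w ((x, y), z)) :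
    R.mulRVal δ δ' (act (MulR M) h (Prod.mkHom (Prod.mkHom f g) k) p) =
      ((h ▷ u) ▷ v) ≫ R.mulRVal ((k ▷ u) ≫ δ) ((g ▷ v) ≫ δ') p ≫ f := by
  obtain ⟨t, m, n, rfl⟩ := exists_mulR p
  rw [act_mulR, mulRVal_mk, mulRVal_mk, R.ev_act, R.pair_act]
  simp

theorem mulRVal_nat {x y z w u v u' v' : C} (k : u' ⟶ u) (l : v' ⟶ v) (δ : z ⊗ u ⟶ o)
    (δ' : y ⊗ v ⟶ o) (p : El (MulR M) w ((x, y), z)) :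
    R.mulRVal ((z ◁ k) ≫ δ) ((y ◁ l) ≫ δ') p = ((w ◁ k) ⊗ₘ l) ≫ R.mulRVal δ δ' p := by
  obtain ⟨t, m, n, rfl⟩ := exists_mulR p
  rw [mulRVal_mk, mulRVal_mk, R.pair_nat, R.ev_nat, ← id_tensorHom, ← id_tensorHom,
    associator_naturality_assoc]

theorem mulRVal_bijective {x y z w z' y' : C} {ε : z ⊗ z' ⟶ o} {ε' : y ⊗ y' ⟶ o}
    (hε : IsExactPairing ε) (hε' : IsExactPairing ε') :
    Function.Bijective (R.mulRVal (x := x) (w := w) ε ε') := by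
  obtain ⟨p, n, hn⟩ := R.exists_univ y z
  have hp := R.pair_exact hn hε hε'
  constructor
  · intro p q h
    obtain ⟨m, rfl⟩ := exists_mulR_eq hn p
    obtain ⟨m', rfl⟩ := exists_mulR_eq hn q
    rw [mulRVal_mk, mulRVal_mk, Iso.cancel_iso_hom_left] at h
    rw [R.ev_injective hp h]
  · intro f
    obtain ⟨m, hm⟩ := R.exists_ev hp ((α_ w z' y').inv ≫ f)
    exact ⟨mulR m n, by rw [mulRVal_mk, hm, Iso.hom_inv_id_assoc]⟩

theorem mulR_ext {x y z w t t' : C} {m : El M w (x, t)} {n : El M t (y, z)} {m' : El M w (x, t')}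
    {n' : El M t' (y, z)}
    (h : ∀ {u v : C} (δ : z ⊗ u ⟶ o) (δ' : y ⊗ v ⟶ o),
      R.ev m (R.pair n δ δ') = R.ev m' (R.pair n' δ δ')) : mulR m n = mulR m' n' := by
  obtain ⟨y', ε', hε'⟩ := R.dual.1 y
  obtain ⟨z', ε, hε⟩ := R.dual.1 z
  refine (R.mulRVal_bijective hε hε').1 ?_
  rw [mulRVal_mk, mulRVal_mk, h]

theorem mulMulMul_ext {x y z w v s t s' t' : C} {m : El M v (x, s)} {m' : El M s (y, t)}
    {m'' : El M t (z, w)} {n : El M v (x, s')} {n' : El M s' (y, t')} {n'' : El M t' (z, w)}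
    (h : ∀ {a b c : C} (δ : w ⊗ a ⟶ o) (δ' : z ⊗ b ⟶ o) (δ'' : y ⊗ c ⟶ o),
      R.ev m (R.pair m' (R.pair m'' δ δ') δ'') = R.ev n (R.pair n' (R.pair n'' δ δ') δ'')) :
    mulMulMul m m' m'' = mulMulMul n n' n'' := by
  obtain ⟨y', εy, hy⟩ := R.dual.1 y
  obtain ⟨z', εz, hz⟩ := R.dual.1 z
  obtain ⟨w', εw, hw⟩ := R.dual.1 w
  obtain ⟨p, e, he⟩ := R.exists_univ z w
  obtain ⟨q, f, hf⟩ := R.exists_univ y p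
  have h' := h εw εz εy
  rw [← he.act_desc m'', ← he.act_desc n'', ← mulMulMul_slide₂, ← mulMulMul_slide₂]
  rw [← he.act_desc m'', ← he.act_desc n'', R.pair_left, R.pair_left] at h'
  generalize he.desc m'' = k at h' ⊢
  generalize he.desc n'' = l at h' ⊢
  have e₁ := R.pair_act (𝟙 s) (𝟙 y) k m' (R.pair e εw εz) εy
  have e₂ := R.pair_act (𝟙 s') (𝟙 y) l n' (R.pair e εw εz) εy
  rw [id_whiskerRight, id_whiskerRight, Category.id_comp, Category.id_comp] at e₁ e₂
  rw [← e₁, ← e₂] at h'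
  generalize act M (𝟙 s) (Prod.mkHom (𝟙 y) k) m' = m₁ at h' ⊢
  generalize act M (𝟙 s') (Prod.mkHom (𝟙 y) l) n' = n₁ at h' ⊢
  rw [← hf.act_desc m₁, ← hf.act_desc n₁, R.pair_left, R.pair_left, ← R.ev_slide, ← R.ev_slide] at h'
  rw [← hf.act_desc m₁, ← hf.act_desc n₁, ← mulMulMul_slide₁, ← mulMulMul_slide₁]
  rw [R.ev_injective (R.pair_exact hf (R.pair_exact he hw hz) hy) h']

/-! ### The units of `μ` -/

/-- The value of an element of `UnL`. -/
def unLVal {x z w : C} (δ : x ⊗ w ⟶ o) : El (UnL M H) z x → (z ⊗ w ⟶ o) :=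
  liftUnL (fun m n => R.ev m δ ≫ R.H n) (fun m k n => by
    rw [R.ev_mid, R.H_act, Category.assoc])

theorem unLVal_mk {x z w t : C} (δ : x ⊗ w ⟶ o) (m : El M z (t, x)) (n : El H t pt) :
    R.unLVal δ (unL m n) = R.ev m δ ≫ R.H n :=
  liftUnL_mk (fun m n => R.ev m δ ≫ R.H n)
    (fun m k n => by rw [R.ev_mid, R.H_act, Category.assoc]) m n

theorem unLVal_act {x x' z z' w : C} (h : z' ⟶ z) (f : x ⟶ x') (δ : x' ⊗ w ⟶ o)
    (p : El (UnL M H) z x) :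
    R.unLVal δ (act (UnL M H) h f p) = (h ▷ w) ≫ R.unLVal ((f ▷ w) ≫ δ) p := by
  obtain ⟨t, m, n, rfl⟩ := exists_unL p
  rw [act_unL, unLVal_mk, unLVal_mk, R.ev_act]
  simp

theorem unLVal_nat {x z w w' : C} (k : w' ⟶ w) (δ : x ⊗ w ⟶ o) (p : El (UnL M H) z x) :
    R.unLVal ((x ◁ k) ≫ δ) p = (z ◁ k) ≫ R.unLVal δ p := by
  obtain ⟨t, m, n, rfl⟩ := exists_unL p
  rw [unLVal_mk, unLVal_mk, R.ev_nat, Category.assoc]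

theorem unLVal_bijective {x x' z : C} {ε : x ⊗ x' ⟶ o} (hε : IsExactPairing ε) :
    Function.Bijective (R.unLVal (z := z) ε) := by
  have nf : ∀ p : El (UnL M H) z x, ∃ m, p = unL m (R.H.symm (𝟙 o)) := fun p => by
    obtain ⟨t, m, n, rfl⟩ := exists_unL p
    have e : n = act H (R.H n) (𝟙 pt) (R.H.symm (𝟙 o)) := R.H.injective (by
      rw [R.H_act, Equiv.apply_symm_apply, Category.comp_id])
    exact ⟨_, by rw [e, ← unL_slide]⟩
  constructor
  · intro p q h
    obtain ⟨m, rfl⟩ := nf p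
    obtain ⟨m', rfl⟩ := nf q
    rw [unLVal_mk, unLVal_mk, Equiv.apply_symm_apply, Category.comp_id, Category.comp_id] at h
    rw [R.ev_injective hε h]
  · intro f
    obtain ⟨m, hm⟩ := R.exists_ev hε f
    exact ⟨unL m (R.H.symm (𝟙 o)), by
      rw [unLVal_mk, Equiv.apply_symm_apply, Category.comp_id, hm]⟩

/-- The value of an element of `UnR`. -/
def unRVal {x z : C} : El (UnR M H) z x → (z ⟶ x) :=
  liftUnR (fun {t} m n => (ρ_ z).inv ≫ R.ev m ((ρ_ t).hom ≫ R.H n)) (fun m k n => by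
    rw [R.ev_slide, R.H_act, rightUnitor_naturality_assoc])

theorem unRVal_mk {x z t : C} (m : El M z (x, t)) (n : El H t pt) :
    R.unRVal (unR m n) = (ρ_ z).inv ≫ R.ev m ((ρ_ t).hom ≫ R.H n) :=
  liftUnR_mk (fun {t} m n => (ρ_ z).inv ≫ R.ev m ((ρ_ t).hom ≫ R.H n))
    (fun m k n => by rw [R.ev_slide, R.H_act, rightUnitor_naturality_assoc]) m n

theorem unRVal_act {x x' z z' : C} (h : z' ⟶ z) (f : x ⟶ x') (p : El (UnR M H) z x) :
    R.unRVal (act (UnR M H) h f p) = h ≫ R.unRVal p ≫ f := by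
  obtain ⟨t, m, n, rfl⟩ := exists_unR p
  rw [act_unR, unRVal_mk, unRVal_mk, R.ev_act]
  simp

theorem unRVal_bijective {x z : C} : Function.Bijective (R.unRVal (x := x) (z := z)) := by
  have ho := isExactPairing_rightUnitor R.dual
  have nf : ∀ p : El (UnR M H) z x, ∃ m, p = unR m (R.H.symm (𝟙 o)) := fun p => by
    obtain ⟨t, m, n, rfl⟩ := exists_unR p
    have e : n = act H (R.H n) (𝟙 pt) (R.H.symm (𝟙 o)) := R.H.injective (by
      rw [R.H_act, Equiv.apply_symm_apply, Category.comp_id])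
    exact ⟨_, by rw [e, ← unR_slide]⟩
  constructor
  · intro p q h
    obtain ⟨m, rfl⟩ := nf p
    obtain ⟨m', rfl⟩ := nf q
    rw [unRVal_mk, unRVal_mk, Equiv.apply_symm_apply, Category.comp_id,
      Iso.cancel_iso_inv_left] at h
    rw [R.ev_injective ho h]
  · intro f
    obtain ⟨m, hm⟩ := R.exists_ev ho ((ρ_ z).hom ≫ f)
    exact ⟨unR m (R.H.symm (𝟙 o)), by
      rw [unRVal_mk, Equiv.apply_symm_apply, Category.comp_id, hm, Iso.inv_hom_id_assoc]⟩

/-! ### Iterated comultiplications -/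

/-- The value of an element of `ComulL`. -/
def comulLVal {a b c x : C} : El (ComulL D) ((a, b), c) x → ((a ⊗ b) ⊗ c ⟶ x) :=
  liftComulL (fun d d' => (R.D d' ▷ c) ≫ R.D d) (fun m k n => by
    rw [R.D_right, R.D_left, tensorHom_id, comp_whiskerRight_assoc])

theorem comulLVal_mk {a b c x t : C} (d : El D (t, c) x) (d' : El D (a, b) t) :
    R.comulLVal (comulL d d') = (R.D d' ▷ c) ≫ R.D d :=
  liftComulL_mk (fun d d' => (R.D d' ▷ c) ≫ R.D d) (fun m k n => by
    rw [R.D_right, R.D_left, tensorHom_id, comp_whiskerRight_assoc]) d d'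

theorem comulLVal_act {a b c x a' b' c' x' : C} (f : a' ⟶ a) (g : b' ⟶ b) (k : c' ⟶ c)
    (h : x ⟶ x') (p : El (ComulL D) ((a, b), c) x) :
    R.comulLVal (act (ComulL D) (Prod.mkHom (Prod.mkHom f g) k) h p) =
      ((f ⊗ₘ g) ⊗ₘ k) ≫ R.comulLVal p ≫ h := by
  obtain ⟨t, d, d', rfl⟩ := exists_comulL p
  rw [act_comulL, comulLVal_mk, comulLVal_mk, R.D_act, R.D_act]
  rw [Category.comp_id, comp_whiskerRight, id_tensorHom, MonoidalCategory.tensorHom_def (f ⊗ₘ g) k]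
  simp only [Category.assoc]
  rw [whisker_exchange_assoc]

theorem comulLVal_bijective {a b c x : C} :
    Function.Bijective (R.comulLVal (a := a) (b := b) (c := c) (x := x)) := by
  have nf : ∀ p : El (ComulL D) ((a, b), c) x, ∃ d, p = comulL d (R.D.symm (𝟙 (a ⊗ b))) :=
    fun p => by
      obtain ⟨t, d, d', rfl⟩ := exists_comulL p
      have e : d' = act D (𝟙 (a, b)) (R.D d') (R.D.symm (𝟙 (a ⊗ b))) := R.D.injective (by
        rw [R.D_right, Equiv.apply_symm_apply, Category.id_comp])
      exact ⟨_, by rw [e, comulL_slide]⟩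
  constructor
  · intro p q h
    obtain ⟨d, rfl⟩ := nf p
    obtain ⟨d', rfl⟩ := nf q
    rw [comulLVal_mk, comulLVal_mk, Equiv.apply_symm_apply, id_whiskerRight, Category.id_comp,
      Category.id_comp] at h
    rw [R.D.injective h]
  · intro f
    exact ⟨comulL (R.D.symm f) (R.D.symm (𝟙 (a ⊗ b))), by simp [comulLVal_mk]⟩

/-- The value of an element of `ComulR`. -/
def comulRVal {a b c x : C} : El (ComulR D) ((a, b), c) x → ((a ⊗ b) ⊗ c ⟶ x) :=
  liftComulR (fun d d' => (α_ a b c).hom ≫ (a ◁ R.D d') ≫ R.D d) (fun m k n => by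
    rw [R.D_right, R.D_left, id_tensorHom, MonoidalCategory.whiskerLeft_comp_assoc])

theorem comulRVal_mk {a b c x t : C} (d : El D (a, t) x) (d' : El D (b, c) t) :
    R.comulRVal (comulR d d') = (α_ a b c).hom ≫ (a ◁ R.D d') ≫ R.D d :=
  liftComulR_mk (fun d d' => (α_ a b c).hom ≫ (a ◁ R.D d') ≫ R.D d) (fun m k n => by
    rw [R.D_right, R.D_left, id_tensorHom, MonoidalCategory.whiskerLeft_comp_assoc]) d d'

theorem comulRVal_act {a b c x a' b' c' x' : C} (f : a' ⟶ a) (g : b' ⟶ b) (k : c' ⟶ c)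
    (h : x ⟶ x') (p : El (ComulR D) ((a, b), c) x) :
    R.comulRVal (act (ComulR D) (Prod.mkHom (Prod.mkHom f g) k) h p) =
      ((f ⊗ₘ g) ⊗ₘ k) ≫ R.comulRVal p ≫ h := by
  obtain ⟨t, d, d', rfl⟩ := exists_comulR p
  rw [act_comulR, comulRVal_mk, comulRVal_mk, R.D_act, R.D_act]
  simp only [Category.comp_id, MonoidalCategory.whiskerLeft_comp, tensorHom_id, Category.assoc]
  rw [associator_naturality_assoc, MonoidalCategory.tensorHom_def' f, Category.assoc,
    whisker_exchange_assoc]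

theorem comulRVal_bijective {a b c x : C} :
    Function.Bijective (R.comulRVal (a := a) (b := b) (c := c) (x := x)) := by
  have nf : ∀ p : El (ComulR D) ((a, b), c) x, ∃ d, p = comulR d (R.D.symm (𝟙 (b ⊗ c))) :=
    fun p => by
      obtain ⟨t, d, d', rfl⟩ := exists_comulR p
      have e : d' = act D (𝟙 (b, c)) (R.D d') (R.D.symm (𝟙 (b ⊗ c))) := R.D.injective (by
        rw [R.D_right, Equiv.apply_symm_apply, Category.id_comp])
      exact ⟨_, by rw [e, comulR_slide]⟩
  constructor
  · intro p q h
    obtain ⟨d, rfl⟩ := nf p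
    obtain ⟨d', rfl⟩ := nf q
    rw [comulRVal_mk, comulRVal_mk, Equiv.apply_symm_apply, MonoidalCategory.whiskerLeft_id,
      Category.id_comp, Category.id_comp, Iso.cancel_iso_hom_left] at h
    rw [R.D.injective h]
  · intro f
    exact ⟨comulR (R.D.symm ((α_ a b c).inv ≫ f)) (R.D.symm (𝟙 (b ⊗ c))), by simp [comulRVal_mk]⟩

theorem comulR_ext {a b c x t t' : C} {d : El D (a, t) x} {d' : El D (b, c) t} {e : El D (a, t') x}
    {e' : El D (b, c) t'} (h : (a ◁ R.D d') ≫ R.D d = (a ◁ R.D e') ≫ R.D e) :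
    comulR d d' = comulR e e' := by
  refine R.comulRVal_bijective.1 ?_
  rw [comulRVal_mk, comulRVal_mk, h]

theorem comulComulComul_ext {a b c e x s t s' t' : C} {d : El D (a, s) x} {d' : El D (b, t) s}
    {d'' : El D (c, e) t} {f : El D (a, s') x} {f' : El D (b, t') s'} {f'' : El D (c, e) t'}
    (h : (a ◁ ((b ◁ R.D d'') ≫ R.D d')) ≫ R.D d = (a ◁ ((b ◁ R.D f'') ≫ R.D f')) ≫ R.D f) :
    comulComulComul d d' d'' = comulComulComul f f' f'' := by
  have nf : ∀ {s t : C} (d : El D (a, s) x) (d' : El D (b, t) s) (d'' : El D (c, e) t),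
      comulComulComul d d' d'' = comulComulComul
        (R.D.symm ((a ◁ ((b ◁ R.D d'') ≫ R.D d')) ≫ R.D d)) (R.D.symm (𝟙 (b ⊗ (c ⊗ e))))
        (R.D.symm (𝟙 (c ⊗ e))) := fun {s t} d d' d'' => by
    have e₁ : d'' = act D (𝟙 (c, e)) (R.D d'') (R.D.symm (𝟙 (c ⊗ e))) := R.D.injective (by
        rw [R.D_right, Equiv.apply_symm_apply, Category.id_comp])
    have e₂ : act D (Prod.mkHom (𝟙 b) (R.D d'')) (𝟙 s) d' =
        act D (𝟙 (b, c ⊗ e)) ((b ◁ R.D d'') ≫ R.D d') (R.D.symm (𝟙 (b ⊗ (c ⊗ e)))) :=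
      R.D.injective (by
        rw [R.D_right, R.D_left, Equiv.apply_symm_apply, Category.id_comp, id_tensorHom])
    have e₃ : act D (Prod.mkHom (𝟙 a) ((b ◁ R.D d'') ≫ R.D d')) (𝟙 x) d =
        R.D.symm ((a ◁ ((b ◁ R.D d'') ≫ R.D d')) ≫ R.D d) :=
      R.D.injective (by rw [R.D_left, Equiv.apply_symm_apply, id_tensorHom])
    conv_lhs => rw [e₁]
    rw [comulComulComul_slide₂, e₂, comulComulComul_slide₁, e₃]
  rw [nf, nf f, h]

/-! ### The counits of `Δ` -/

/-- The value of an element of `CounL`. -/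
def counLVal {a x : C} : El (CounL D E) a x → (a ⟶ x) :=
  liftCounL (fun d e => (λ_ a).inv ≫ (R.E e ▷ a) ≫ R.D d) (fun m k n => by
    rw [R.E_act, R.D_left, tensorHom_id, comp_whiskerRight_assoc])

theorem counLVal_mk {a x t : C} (d : El D (t, a) x) (e : El E pt t) :
    R.counLVal (counL d e) = (λ_ a).inv ≫ (R.E e ▷ a) ≫ R.D d :=
  liftCounL_mk (fun d e => (λ_ a).inv ≫ (R.E e ▷ a) ≫ R.D d) (fun m k n => by
    rw [R.E_act, R.D_left, tensorHom_id, comp_whiskerRight_assoc]) d e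

theorem counLVal_act {a x a' x' : C} (f : a' ⟶ a) (h : x ⟶ x') (p : El (CounL D E) a x) :
    R.counLVal (act (CounL D E) f h p) = f ≫ R.counLVal p ≫ h := by
  obtain ⟨t, d, e, rfl⟩ := exists_counL p
  rw [act_counL, counLVal_mk, counLVal_mk, R.D_act]
  rw [id_tensorHom, Category.assoc, Category.assoc, ← whisker_exchange_assoc]
  simp

theorem counLVal_bijective {a x : C} : Function.Bijective (R.counLVal (a := a) (x := x)) := by
  have nf : ∀ p : El (CounL D E) a x, ∃ d, p = counL d (R.E.symm (𝟙 (𝟙_ C))) := fun p => by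
    obtain ⟨t, d, e, rfl⟩ := exists_counL p
    have h : e = act E (𝟙 pt) (R.E e) (R.E.symm (𝟙 (𝟙_ C))) := R.E.injective (by
      rw [R.E_act, Equiv.apply_symm_apply, Category.id_comp])
    exact ⟨_, by rw [h, counL_slide]⟩
  constructor
  · intro p q h
    obtain ⟨d, rfl⟩ := nf p
    obtain ⟨d', rfl⟩ := nf q
    rw [counLVal_mk, counLVal_mk, Equiv.apply_symm_apply, id_whiskerRight, Category.id_comp,
      Category.id_comp, Iso.cancel_iso_inv_left] at h
    rw [R.D.injective h]
  · intro f
    exact ⟨counL (R.D.symm ((λ_ a).hom ≫ f)) (R.E.symm (𝟙 (𝟙_ C))), by simp [counLVal_mk]⟩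

/-- The value of an element of `CounR`. -/
def counRVal {a x : C} : El (CounR D E) a x → (a ⟶ x) :=
  liftCounR (fun d e => (ρ_ a).inv ≫ (a ◁ R.E e) ≫ R.D d) (fun m k n => by
    rw [R.E_act, R.D_left, id_tensorHom, MonoidalCategory.whiskerLeft_comp_assoc])

theorem counRVal_mk {a x t : C} (d : El D (a, t) x) (e : El E pt t) :
    R.counRVal (counR d e) = (ρ_ a).inv ≫ (a ◁ R.E e) ≫ R.D d :=
  liftCounR_mk (fun d e => (ρ_ a).inv ≫ (a ◁ R.E e) ≫ R.D d) (fun m k n => by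
    rw [R.E_act, R.D_left, id_tensorHom, MonoidalCategory.whiskerLeft_comp_assoc]) d e

theorem counRVal_act {a x a' x' : C} (f : a' ⟶ a) (h : x ⟶ x') (p : El (CounR D E) a x) :
    R.counRVal (act (CounR D E) f h p) = f ≫ R.counRVal p ≫ h := by
  obtain ⟨t, d, e, rfl⟩ := exists_counR p
  rw [act_counR, counRVal_mk, counRVal_mk, R.D_act]
  simp [whisker_exchange_assoc]

theorem counRVal_bijective {a x : C} : Function.Bijective (R.counRVal (a := a) (x := x)) := by
  have nf : ∀ p : El (CounR D E) a x, ∃ d, p = counR d (R.E.symm (𝟙 (𝟙_ C))) := fun p => by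
    obtain ⟨t, d, e, rfl⟩ := exists_counR p
    have h : e = act E (𝟙 pt) (R.E e) (R.E.symm (𝟙 (𝟙_ C))) := R.E.injective (by
      rw [R.E_act, Equiv.apply_symm_apply, Category.id_comp])
    exact ⟨_, by rw [h, counR_slide]⟩
  constructor
  · intro p q h
    obtain ⟨d, rfl⟩ := nf p
    obtain ⟨d', rfl⟩ := nf q
    rw [counRVal_mk, counRVal_mk, Equiv.apply_symm_apply, MonoidalCategory.whiskerLeft_id,
      Category.id_comp, Category.id_comp, Iso.cancel_iso_inv_left] at h
    rw [R.D.injective h]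
  · intro f
    exact ⟨counR (R.D.symm ((ρ_ a).hom ≫ f)) (R.E.symm (𝟙 (𝟙_ C))), by simp [counRVal_mk]⟩

/-! ### The composites of `Δ` and `μ` -/

/-- The value of an element of `FrobM`. -/
def frobMVal {a b x y w : C} (δ : y ⊗ w ⟶ o) :
    El (FrobM M D) (a, b) (x, y) → ((a ⊗ b) ⊗ w ⟶ x) :=
  liftFrobM (fun d m => (R.D d ▷ w) ≫ R.ev m δ) (fun d k m => by
    rw [R.D_right, R.ev_left, comp_whiskerRight_assoc])

theorem frobMVal_mk {a b x y w t : C} (δ : y ⊗ w ⟶ o) (d : El D (a, b) t) (m : El M t (x, y)) :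
    R.frobMVal δ (frobM d m) = (R.D d ▷ w) ≫ R.ev m δ := rfl

theorem frobMVal_act {a b x y w a' b' x' y' : C} (f : a' ⟶ a) (g : b' ⟶ b) (h : x ⟶ x')
    (k : y ⟶ y') (δ : y' ⊗ w ⟶ o) (p : El (FrobM M D) (a, b) (x, y)) :
    R.frobMVal δ (act (FrobM M D) (Prod.mkHom f g) (Prod.mkHom h k) p) =
      ((f ⊗ₘ g) ▷ w) ≫ R.frobMVal ((k ▷ w) ≫ δ) p ≫ h := by
  obtain ⟨t, d, m, rfl⟩ := exists_frobM p
  rw [act_frobM, frobMVal_mk, frobMVal_mk, R.D_act, R.ev_act]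
  simp

theorem frobMVal_nat {a b x y w w' : C} (k : w' ⟶ w) (δ : y ⊗ w ⟶ o)
    (p : El (FrobM M D) (a, b) (x, y)) :
    R.frobMVal ((y ◁ k) ≫ δ) p = ((a ⊗ b) ◁ k) ≫ R.frobMVal δ p := by
  obtain ⟨t, d, m, rfl⟩ := exists_frobM p
  rw [frobMVal_mk, frobMVal_mk, R.ev_nat, whisker_exchange_assoc]

theorem frobMVal_bijective {a b x y y' : C} {ε : y ⊗ y' ⟶ o} (hε : IsExactPairing ε) :
    Function.Bijective (R.frobMVal (a := a) (b := b) (x := x) ε) := by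
  have nf : ∀ p : El (FrobM M D) (a, b) (x, y), ∃ m, p = frobM (R.D.symm (𝟙 (a ⊗ b))) m :=
    fun p => by
      obtain ⟨t, d, m, rfl⟩ := exists_frobM p
      have e : d = act D (𝟙 (a, b)) (R.D d) (R.D.symm (𝟙 (a ⊗ b))) := R.D.injective (by
        rw [R.D_right, Equiv.apply_symm_apply, Category.id_comp])
      exact ⟨_, by rw [e, frobM_slide]⟩
  constructor
  · intro p q h
    obtain ⟨m, rfl⟩ := nf p
    obtain ⟨m', rfl⟩ := nf q
    rw [frobMVal_mk, frobMVal_mk, Equiv.apply_symm_apply, id_whiskerRight, Category.id_comp,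
      Category.id_comp] at h
    rw [R.ev_injective hε h]
  · intro f
    obtain ⟨m, hm⟩ := R.exists_ev hε f
    exact ⟨frobM (R.D.symm (𝟙 (a ⊗ b))) m, by simp [frobMVal_mk, hm]⟩

theorem frobM_ext {a b x y s t : C} {d : El D (a, b) s} {m : El M s (x, y)} {d' : El D (a, b) t}
    {m' : El M t (x, y)}
    (h : ∀ {w : C} (δ : y ⊗ w ⟶ o), (R.D d ▷ w) ≫ R.ev m δ = (R.D d' ▷ w) ≫ R.ev m' δ) :
    frobM d m = frobM d' m' := by
  obtain ⟨y', ε, hε⟩ := R.dual.1 y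
  exact (R.frobMVal_bijective hε).1 (h ε)

/-- The value of an element of `FrobL`. -/
def frobLVal {a b x y w : C} (δ : y ⊗ w ⟶ o) :
    El (FrobL M D) (a, b) (x, y) → ((a ⊗ b) ⊗ w ⟶ x) :=
  liftFrobL (fun m d => (α_ a b w).hom ≫ (a ◁ R.ev m δ) ≫ R.D d) (fun m k d => by
    rw [R.ev_mid, R.D_left, id_tensorHom, MonoidalCategory.whiskerLeft_comp_assoc])

theorem frobLVal_mk {a b x y w t : C} (δ : y ⊗ w ⟶ o) (m : El M b (t, y)) (d : El D (a, t) x) :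
    R.frobLVal δ (frobL m d) = (α_ a b w).hom ≫ (a ◁ R.ev m δ) ≫ R.D d :=
  liftFrobL_mk (fun m d => (α_ a b w).hom ≫ (a ◁ R.ev m δ) ≫ R.D d) (fun m k d => by
    rw [R.ev_mid, R.D_left, id_tensorHom, MonoidalCategory.whiskerLeft_comp_assoc]) m d

theorem frobLVal_act {a b x y w a' b' x' y' : C} (f : a' ⟶ a) (g : b' ⟶ b) (h : x ⟶ x')
    (k : y ⟶ y') (δ : y' ⊗ w ⟶ o) (p : El (FrobL M D) (a, b) (x, y)) :
    R.frobLVal δ (act (FrobL M D) (Prod.mkHom f g) (Prod.mkHom h k) p) =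
      ((f ⊗ₘ g) ▷ w) ≫ R.frobLVal ((k ▷ w) ≫ δ) p ≫ h := by
  obtain ⟨t, m, d, rfl⟩ := exists_frobL p
  rw [act_frobL, frobLVal_mk, frobLVal_mk, R.D_act, R.ev_act]
  simp [MonoidalCategory.tensorHom_def', whisker_exchange_assoc]

theorem frobLVal_nat {a b x y w w' : C} (k : w' ⟶ w) (δ : y ⊗ w ⟶ o)
    (p : El (FrobL M D) (a, b) (x, y)) :
    R.frobLVal ((y ◁ k) ≫ δ) p = ((a ⊗ b) ◁ k) ≫ R.frobLVal δ p := by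
  obtain ⟨t, m, d, rfl⟩ := exists_frobL p
  rw [frobLVal_mk, frobLVal_mk, R.ev_nat]
  simp

theorem frobLVal_bijective {a b x y y' : C} {ε : y ⊗ y' ⟶ o} (hε : IsExactPairing ε) :
    Function.Bijective (R.frobLVal (a := a) (b := b) (x := x) ε) := by
  obtain ⟨m₀, hm₀⟩ := R.exists_ev (z := b) hε (𝟙 (b ⊗ y'))
  have nf : ∀ p : El (FrobL M D) (a, b) (x, y), ∃ d, p = frobL m₀ d := fun p => by
    obtain ⟨t, m, d, rfl⟩ := exists_frobL p
    have e : m = act M (𝟙 b) (Prod.mkHom (R.ev m ε) (𝟙 y)) m₀ := R.ev_injective hε (by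
      rw [R.ev_mid, hm₀, Category.id_comp])
    exact ⟨_, by rw [e, frobL_slide]⟩
  constructor
  · intro p q h
    obtain ⟨d, rfl⟩ := nf p
    obtain ⟨d', rfl⟩ := nf q
    rw [frobLVal_mk, frobLVal_mk, hm₀, MonoidalCategory.whiskerLeft_id, Category.id_comp,
      Category.id_comp, Iso.cancel_iso_hom_left] at h
    rw [R.D.injective h]
  · intro f
    exact ⟨frobL m₀ (R.D.symm ((α_ a b y').inv ≫ f)), by simp [frobLVal_mk, hm₀]⟩

/-- The value of an element of `FrobR`. -/
def frobRVal {a b x y w : C} (δ : y ⊗ w ⟶ o) :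
    El (FrobR M D) (a, b) (x, y) → ((a ⊗ b) ⊗ w ⟶ x) :=
  liftFrobR (fun {t} m d => (α_ a b w).hom ≫ R.ev m ((α_ t b w).inv ≫ (R.D d ▷ w) ≫ δ))
    (fun m k d => by
      rw [R.ev_slide, R.D_left, tensorHom_id, comp_whiskerRight_assoc,
        associator_inv_naturality_left_assoc])

theorem frobRVal_mk {a b x y w t : C} (δ : y ⊗ w ⟶ o) (m : El M a (x, t)) (d : El D (t, b) y) :
    R.frobRVal δ (frobR m d) =
      (α_ a b w).hom ≫ R.ev m ((α_ t b w).inv ≫ (R.D d ▷ w) ≫ δ) :=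
  liftFrobR_mk (fun {t} m d => (α_ a b w).hom ≫ R.ev m ((α_ t b w).inv ≫ (R.D d ▷ w) ≫ δ))
    (fun m k d => by
      rw [R.ev_slide, R.D_left, tensorHom_id, comp_whiskerRight_assoc,
        associator_inv_naturality_left_assoc]) m d

theorem frobRVal_act {a b x y w a' b' x' y' : C} (f : a' ⟶ a) (g : b' ⟶ b) (h : x ⟶ x')
    (k : y ⟶ y') (δ : y' ⊗ w ⟶ o) (p : El (FrobR M D) (a, b) (x, y)) :
    R.frobRVal δ (act (FrobR M D) (Prod.mkHom f g) (Prod.mkHom h k) p) =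
      ((f ⊗ₘ g) ▷ w) ≫ R.frobRVal ((k ▷ w) ≫ δ) p ≫ h := by
  obtain ⟨t, m, d, rfl⟩ := exists_frobR p
  rw [act_frobR, frobRVal_mk, frobRVal_mk, R.ev_act, R.D_act]
  have e : (α_ t b' w).inv ≫ ((𝟙 t ⊗ₘ g) ≫ R.D d ≫ k) ▷ w ≫ δ =
      (t ◁ (g ▷ w)) ≫ (α_ t b w).inv ≫ (R.D d ▷ w) ≫ (k ▷ w) ≫ δ := by simp
  rw [id_whiskerRight, Category.id_comp, e, R.ev_nat]
  simp [MonoidalCategory.tensorHom_def]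

theorem frobRVal_nat {a b x y w w' : C} (k : w' ⟶ w) (δ : y ⊗ w ⟶ o)
    (p : El (FrobR M D) (a, b) (x, y)) :
    R.frobRVal ((y ◁ k) ≫ δ) p = ((a ⊗ b) ◁ k) ≫ R.frobRVal δ p := by
  obtain ⟨t, m, d, rfl⟩ := exists_frobR p
  rw [frobRVal_mk, frobRVal_mk]
  have e : (α_ t b w').inv ≫ R.D d ▷ w' ≫ y ◁ k ≫ δ =
      (t ◁ (b ◁ k)) ≫ (α_ t b w).inv ≫ (R.D d ▷ w) ≫ δ := by
    rw [← whisker_exchange_assoc, associator_inv_naturality_right_assoc]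
  rw [e, R.ev_nat, associator_naturality_right_assoc]

theorem frobRVal_bijective {a b x y y' : C} {ε : y ⊗ y' ⟶ o} (hε : IsExactPairing ε) :
    Function.Bijective (R.frobRVal (a := a) (b := b) (x := x) ε) := by
  obtain ⟨p, d₀, hd₀, hp⟩ := R.exists_univ_D b y
  have hp := hp hε
  have nf : ∀ p : El (FrobR M D) (a, b) (x, y), ∃ m, p = frobR m d₀ := fun p => by
    obtain ⟨t, m, d, rfl⟩ := exists_frobR p
    obtain ⟨k, rfl⟩ := hd₀ d
    exact ⟨_, by rw [← frobR_slide]⟩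
  constructor
  · intro p q h
    obtain ⟨m, rfl⟩ := nf p
    obtain ⟨m', rfl⟩ := nf q
    rw [frobRVal_mk, frobRVal_mk, Iso.cancel_iso_hom_left] at h
    rw [R.ev_injective hp h]
  · intro f
    obtain ⟨m, hm⟩ := R.exists_ev hp ((α_ a b y').inv ≫ f)
    exact ⟨frobR m d₀, by rw [frobRVal_mk, hm, Iso.hom_inv_id_assoc]⟩

theorem comulMulMul_ext {a b x y z s t s' t' : C} {d : El D (a, b) s} {m : El M s (x, t)}
    {m' : El M t (y, z)} {e : El D (a, b) s'} {n : El M s' (x, t')} {n' : El M t' (y, z)}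
    (h : ∀ {u v : C} (δ : z ⊗ u ⟶ o) (δ' : y ⊗ v ⟶ o),
      (R.D d ▷ (u ⊗ v)) ≫ R.ev m (R.pair m' δ δ') = (R.D e ▷ (u ⊗ v)) ≫ R.ev n (R.pair n' δ δ')) :
    comulMulMul d m m' = comulMulMul e n n' := by
  obtain ⟨y', ε', hε'⟩ := R.dual.1 y
  obtain ⟨z', ε, hε⟩ := R.dual.1 z
  obtain ⟨p, f, hf⟩ := R.exists_univ y z
  have h' := h ε ε'
  rw [← hf.act_desc m', ← hf.act_desc n', ← comulMulMul_slide₂, ← comulMulMul_slide₂]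
  rw [← hf.act_desc m', ← hf.act_desc n', R.pair_left, R.pair_left, ← R.ev_slide,
    ← R.ev_slide] at h'
  generalize act M (𝟙 s) (Prod.mkHom (𝟙 x) (hf.desc m')) m = m₁ at h' ⊢
  generalize act M (𝟙 s') (Prod.mkHom (𝟙 x) (hf.desc n')) n = n₁ at h' ⊢
  have hp := R.pair_exact hf hε hε'
  have e₁ : ∀ {s : C} (d : El D (a, b) s),
      d = act D (𝟙 (a, b)) (R.D d) (R.D.symm (𝟙 (a ⊗ b))) := fun d => R.D.injective (by
        rw [R.D_right, Equiv.apply_symm_apply, Category.id_comp])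
  rw [e₁ d, e₁ e, comulMulMul_slide₁, comulMulMul_slide₁]
  rw [← R.ev_left, ← R.ev_left] at h'
  rw [R.ev_injective hp h']

theorem comulComulMul_ext {a b c x y s t s' t' : C} {d : El D (a, t) s} {d' : El D (b, c) t}
    {m : El M s (x, y)} {e : El D (a, t') s'} {e' : El D (b, c) t'} {n : El M s' (x, y)}
    (h : ∀ {w : C} (δ : y ⊗ w ⟶ o),
      (((a ◁ R.D d') ≫ R.D d) ▷ w) ≫ R.ev m δ = (((a ◁ R.D e') ≫ R.D e) ▷ w) ≫ R.ev n δ) :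
    comulComulMul d d' m = comulComulMul e e' n := by
  obtain ⟨y', ε, hε⟩ := R.dual.1 y
  have nf : ∀ {s t : C} (d : El D (a, t) s) (d' : El D (b, c) t) (m : El M s (x, y)),
      comulComulMul d d' m = comulComulMul (R.D.symm (𝟙 (a ⊗ (b ⊗ c)))) (R.D.symm (𝟙 (b ⊗ c)))
        (act M ((a ◁ R.D d') ≫ R.D d) (𝟙 (x, y)) m) := fun {s t} d d' m => by
    have e₁ : d' = act D (𝟙 (b, c)) (R.D d') (R.D.symm (𝟙 (b ⊗ c))) := R.D.injective (by
        rw [R.D_right, Equiv.apply_symm_apply, Category.id_comp])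
    have e₂ : act D (Prod.mkHom (𝟙 a) (R.D d')) (𝟙 s) d =
        act D (𝟙 (a, b ⊗ c)) ((a ◁ R.D d') ≫ R.D d) (R.D.symm (𝟙 (a ⊗ (b ⊗ c)))) :=
      R.D.injective (by
        rw [R.D_right, R.D_left, Equiv.apply_symm_apply, Category.id_comp, id_tensorHom])
    conv_lhs => rw [e₁]
    rw [comulComulMul_slide₁, e₂, comulComulMul_slide₂]
  have h' := h ε
  rw [← R.ev_left, ← R.ev_left] at h'
  rw [nf, nf e, R.ev_injective hε h']

end Frame

end Prof

namespace Prof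

open MonoidalCategory

variable {C : Type u} [SmallCategory C] [MonoidalCategory C]

/-- A representation of a Frobenius pseudomonoid by a `*`-autonomous category. -/
structure FrobFrame (F : FrobeniusPseudomonoid C) (o : C) extends Frame o F.M F.H F.D F.E where
  coassoc : ∀ {a b c x t t' : C} (d : El F.D (t, c) x) (d' : El F.D (a, b) t)
    (f : El F.D (a, t') x) (f' : El F.D (b, c) t'),
    ap F.coassoc.hom (comulL d d') = comulR f f' →
    (α_ a b c).hom ≫ (a ◁ D f') ≫ D f = (D d' ▷ c) ≫ D d
  counitL : ∀ {a x t : C} (d : El F.D (t, a) x) (e : El F.E pt t),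
    (ap F.counitL.hom (counL d e) : a ⟶ x) = (λ_ a).inv ≫ (E e ▷ a) ≫ D d
  counitR : ∀ {a x t : C} (d : El F.D (a, t) x) (e : El F.E pt t),
    (ap F.counitR.hom (counR d e) : a ⟶ x) = (ρ_ a).inv ≫ (a ◁ E e) ≫ D d
  assoc : ∀ {x y z w t t' u v : C} (m : El F.M w (t, z)) (m' : El F.M t (x, y))
    (n : El F.M w (x, t')) (n' : El F.M t' (y, z)) (δ : z ⊗ u ⟶ o) (δ' : y ⊗ v ⟶ o),
    ap F.assoc.hom (mulL m m') = mulR n n' →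
    (ev m δ ▷ v) ≫ ev m' δ' = (α_ w u v).hom ≫ ev n (toFrame.pair n' δ δ')
  unitL : ∀ {x z t w : C} (m : El F.M z (t, x)) (n : El F.H t pt) (δ : x ⊗ w ⟶ o),
    ((ap F.unitL.hom (unL m n) : z ⟶ x) ▷ w) ≫ δ = ev m δ ≫ H n
  unitR : ∀ {x z t : C} (m : El F.M z (x, t)) (n : El F.H t pt),
    (ap F.unitR.hom (unR m n) : z ⟶ x) = (ρ_ z).inv ≫ ev m ((ρ_ t).hom ≫ H n)
  phiL : ∀ {a b x y t v w : C} (m : El F.M b (t, y)) (d : El F.D (a, t) x)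
    (d' : El F.D (a, b) v) (m' : El F.M v (x, y)) (δ : y ⊗ w ⟶ o),
    ap F.phiL.hom (frobL m d) = frobM d' m' →
    (α_ a b w).hom ≫ (a ◁ ev m δ) ≫ D d = (D d' ▷ w) ≫ ev m' δ
  phiR : ∀ {a b x y t v w : C} (m : El F.M a (x, t)) (d : El F.D (t, b) y)
    (d' : El F.D (a, b) v) (m' : El F.M v (x, y)) (δ : y ⊗ w ⟶ o),
    ap F.phiR.hom (frobR m d) = frobM d' m' →
    (α_ a b w).hom ≫ ev m ((α_ t b w).inv ≫ (D d ▷ w) ≫ δ) = (D d' ▷ w) ≫ ev m' δ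

section Comonoidal

variable {F : FrobeniusPseudomonoid C} (K : Comonoidal F.toPseudocomonoid) {o : C}

namespace Comonoidal

theorem D_right {a b x x' : C} (h : x ⟶ x') (d : El F.D (a, b) x) :
    K.D (act F.D (𝟙 (a, b)) h d) = K.D d ≫ h := by
  have e := K.D_act (𝟙 a) (𝟙 b) h d
  rwa [id_tensorHom_id, Category.id_comp] at e

theorem D_left {a a' b b' x : C} (f : a' ⟶ a) (g : b' ⟶ b) (d : El F.D (a, b) x) :
    K.D (act F.D (Prod.mkHom f g) (𝟙 x) d) = (f ⊗ₘ g) ≫ K.D d := by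
  have e := K.D_act f g (𝟙 x) d
  rwa [Category.comp_id] at e

/-- Evaluation of an element of `μ`. -/
def ev (h : El F.H o pt) {x y z w : C} (m : El F.M z (x, y)) (δ : y ⊗ w ⟶ o) : z ⊗ w ⟶ x :=
  K.D (evR h m (K.D.symm δ))

variable {h : El F.H o pt}

theorem ev_D {x y z w : C} (m : El F.M z (x, y)) (d : El F.D (y, w) o) :
    K.ev h m (K.D d) = K.D (evR h m d) := by
  rw [ev, Equiv.symm_apply_apply]

theorem ev_left {x y z z' w : C} (f : z' ⟶ z) (m : El F.M z (x, y)) (δ : y ⊗ w ⟶ o) :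
    K.ev h (act F.M f (𝟙 (x, y)) m) δ = (f ▷ w) ≫ K.ev h m δ := by
  rw [ev, evR_act_left, K.D_left, tensorHom_id]
  rfl

theorem ev_slide {x y y' z w : C} (k : y ⟶ y') (m : El F.M z (x, y)) (δ : y' ⊗ w ⟶ o) :
    K.ev h (act F.M (𝟙 z) (Prod.mkHom (𝟙 x) k) m) δ = K.ev h m ((k ▷ w) ≫ δ) := by
  obtain ⟨d, rfl⟩ := K.D.surjective δ
  rw [ev_D, evR_slide, ← tensorHom_id, ← K.D_left, ev_D]

theorem ev_act {x x' y y' z z' w : C} (f : z' ⟶ z) (g : x ⟶ x') (k : y ⟶ y') (m : El F.M z (x, y))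
    (δ : y' ⊗ w ⟶ o) :
    K.ev h (act F.M f (Prod.mkHom g k) m) δ = (f ▷ w) ≫ K.ev h m ((k ▷ w) ≫ δ) ≫ g := by
  have e : act F.M f (Prod.mkHom g k) m =
      act F.M f (𝟙 (x', y')) (act F.M (𝟙 z) (Prod.mkHom g (𝟙 y'))
        (act F.M (𝟙 z) (Prod.mkHom (𝟙 x) k) m)) := by
    rw [act_act, act_act]
    simp
  rw [e, ev_left, ev, evR_act_mid, K.D_right, ← K.ev_slide]
  rfl

theorem ev_nat {x y z w w' : C} (m : El F.M z (x, y)) (k : w' ⟶ w) (δ : y ⊗ w ⟶ o) :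
    K.ev h m ((y ◁ k) ≫ δ) = (z ◁ k) ≫ K.ev h m δ := by
  obtain ⟨d, rfl⟩ := K.D.surjective δ
  rw [← id_tensorHom, ← K.D_left, ev_D, evR_act_right, K.D_left, ev_D, id_tensorHom]

/-- A dual pair is an exact pairing. -/
theorem isExactPairing (hu : Univ F.H h) {y y' : C} (p : DualPair h y y') :
    IsExactPairing (K.D p.u) := by
  refine ⟨fun x => ⟨fun f g e => ?_, fun δ => ?_⟩, fun x => ⟨fun f g e => ?_, fun δ => ?_⟩⟩
  · change (y ◁ f) ≫ K.D p.u = (y ◁ g) ≫ K.D p.u at e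
    rw [← id_tensorHom, ← id_tensorHom, ← K.D_left, ← K.D_left] at e
    rw [← p.pairR_act f, ← p.pairR_act g, K.D.injective e]
  · obtain ⟨d, rfl⟩ := K.D.surjective δ
    refine ⟨pairR h p.e p.m d, ?_⟩
    change (y ◁ _) ≫ K.D p.u = _
    rw [← id_tensorHom, ← K.D_left, p.act_right hu]
  · change (f ▷ y') ≫ K.D p.u = (g ▷ y') ≫ K.D p.u at e
    rw [← tensorHom_id, ← tensorHom_id, ← K.D_left, ← K.D_left] at e
    rw [← p.pairL_act f, ← p.pairL_act g, K.D.injective e]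
  · obtain ⟨d, rfl⟩ := K.D.surjective δ
    refine ⟨pairL h p.e p.m d, ?_⟩
    change (_ ▷ y') ≫ K.D p.u = _
    rw [← tensorHom_id, ← K.D_left, p.act_left hu]

/-- An exact pairing is a dual pair. -/
theorem exists_dualPair (hu : Univ F.H h) {y y' : C} {ε : y ⊗ y' ⟶ o} (hε : IsExactPairing ε) :
    ∃ p : DualPair h y y', K.D p.u = ε := by
  obtain ⟨b, y₁, e, m, d, hp⟩ := exists_pairR_eq hu y'
  have hd : act F.D (Prod.mkHom (hε.lcurry (K.D d)) (𝟙 y')) (𝟙 o) (K.D.symm ε) = d :=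
    K.D.injective (by
      rw [K.D_left, Equiv.apply_symm_apply, tensorHom_id, hε.lcurry_spec])
  have h₁ : pairR h e (act F.M (𝟙 b) (Prod.mkHom (𝟙 y') (hε.lcurry (K.D d))) m) (K.D.symm ε) =
      𝟙 y' := by rw [pairR_slide, hd, hp]
  refine ⟨⟨K.D.symm ε, b, e, act F.M (𝟙 b) (Prod.mkHom (𝟙 y') (hε.lcurry (K.D d))) m, h₁, ?_⟩,
    K.D.apply_symm_apply ε⟩
  apply hε.lhom_ext
  have g := congrArg K.D (act_pairR_eq_act_pairL hu e
    (act F.M (𝟙 b) (Prod.mkHom (𝟙 y') (hε.lcurry (K.D d))) m) (K.D.symm ε) (K.D.symm ε))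
  rw [h₁, K.D_left, K.D_left, Equiv.apply_symm_apply, id_tensorHom_id, Category.id_comp,
    tensorHom_id] at g
  rw [← g, id_whiskerRight, Category.id_comp]

theorem isDualizing [IsIdempotentComplete C] (K : Comonoidal F.toPseudocomonoid) (hu : Univ F.H h) : IsDualizing o := by
  constructor
  · intro y
    obtain ⟨y', ⟨p⟩⟩ := exists_dualPair_right hu y
    exact ⟨y', _, K.isExactPairing hu p⟩
  · intro y
    obtain ⟨y', ⟨p⟩⟩ := exists_dualPair_left hu y
    exact ⟨y', _, K.isExactPairing hu p⟩

theorem ev_bijective (hu : Univ F.H h) {x y y' z : C} {ε : y ⊗ y' ⟶ o} (hε : IsExactPairing ε) :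
    Function.Bijective (fun m : El F.M z (x, y) => K.ev h m ε) := by
  obtain ⟨p, rfl⟩ := K.exists_dualPair hu hε
  refine ⟨fun m m' e => p.evR_injective hu (K.D.injective ?_), fun f => ?_⟩
  · rw [← ev_D, ← ev_D]
    exact e
  · obtain ⟨m, hm⟩ := p.exists_evR_eq hu (K.D.symm f)
    exact ⟨m, by change K.ev h m _ = f; rw [ev_D, hm, Equiv.apply_symm_apply]⟩

/-- Evaluation through the right Frobenius 2-cell. -/
theorem ev_eq {x y z w v : C} {m : El F.M z (x, y)} {d : El F.D (y, w) o} {d' : El F.D (z, w) v}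
    {m' : El F.M v (x, o)} (e : ap F.phiR.hom (frobR m d) = frobM d' m') :
    K.ev h m (K.D d) = K.D d' ≫ uniR m' h := by
  rw [ev_D, evR_eq e, K.D_right]

/-- The value of an element of `ComulComulMul` with last input `o`. -/
def comulComulMulVal (h : El F.H o pt) {a b c x : C} :
    El (ComulComulMul F.M F.D) (a, (b, c)) (x, o) → (a ⊗ (b ⊗ c) ⟶ x) :=
  liftComulComulMul (fun d d' m => (a ◁ K.D d') ≫ K.D d ≫ uniR m h)
    (fun d k d' m => by
      rw [K.D_right, K.D_left, id_tensorHom, MonoidalCategory.whiskerLeft_comp_assoc,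
        Category.assoc])
    (fun d k d' m => by rw [K.D_right, uniR_act_left, Category.assoc])

theorem comulComulMulVal_mk {a b c x s t : C} (d : El F.D (a, t) s) (d' : El F.D (b, c) t)
    (m : El F.M s (x, o)) :
    K.comulComulMulVal h (comulComulMul d d' m) = (a ◁ K.D d') ≫ K.D d ≫ uniR m h :=
  liftComulComulMul_mk (fun d d' m => (a ◁ K.D d') ≫ K.D d ≫ uniR m h) (fun d k d' m => by
      rw [K.D_right, K.D_left, id_tensorHom, MonoidalCategory.whiskerLeft_comp_assoc,
        Category.assoc])
    (fun d k d' m => by rw [K.D_right, uniR_act_left, Category.assoc]) d d' m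

theorem ev_phiR {a b x y t v w : C} (m : El F.M a (x, t)) (d : El F.D (t, b) y)
    (d' : El F.D (a, b) v) (m' : El F.M v (x, y)) (δ : y ⊗ w ⟶ o)
    (e : ap F.phiR.hom (frobR m d) = frobM d' m') :
    (α_ a b w).hom ≫ K.ev h m ((α_ t b w).inv ≫ (K.D d ▷ w) ≫ δ) = (K.D d' ▷ w) ≫ K.ev h m' δ := by
  obtain ⟨g, rfl⟩ := K.D.surjective δ
  obtain ⟨r, d₂, m₂, e₂⟩ := exists_frobM (ap F.phiR.hom (frobR m' g))
  obtain ⟨p, d₃, d₄, e₃⟩ := exists_comulR (ap F.coassoc.hom (comulL d₂ d'))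
  obtain ⟨p', f₁, f₂, e₄⟩ := exists_comulR (ap F.coassoc.hom (comulL g d))
  obtain ⟨k, d₅, m₅, e₅⟩ := exists_frobM (ap F.phiR.hom (frobR m f₁))
  have key := congrArg (K.comulComulMulVal h)
    (F.phiR_coassoc g d m d' m' d₂ m₂ d₃ d₄ f₁ f₂ d₅ m₅ e e₂.symm e₃.symm e₄.symm e₅.symm)
  rw [comulComulMulVal_mk, comulComulMulVal_mk, ← K.ev_eq e₅.symm, ← ev_nat] at key
  have h₃ := K.coassoc d₂ d' d₃ d₄ e₃.symm
  have h₄ := K.coassoc g d f₁ f₂ e₄.symm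
  rw [← Iso.eq_inv_comp] at h₄
  rw [h₄] at key
  rw [← key, K.ev_eq e₂.symm, reassoc_of% h₃]

theorem ev_phiL {a b x y t v w : C} (m : El F.M b (t, y)) (d : El F.D (a, t) x)
    (d' : El F.D (a, b) v) (m' : El F.M v (x, y)) (δ : y ⊗ w ⟶ o)
    (e : ap F.phiL.hom (frobL m d) = frobM d' m') :
    (α_ a b w).hom ≫ (a ◁ K.ev h m δ) ≫ K.D d = (K.D d' ▷ w) ≫ K.ev h m' δ := by
  obtain ⟨g, rfl⟩ := K.D.surjective δ
  obtain ⟨r, d₂, m₂, e₂⟩ := exists_frobM (ap F.phiR.hom (frobR m' g))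
  obtain ⟨p, d₃, d₄, e₃⟩ := exists_comulR (ap F.coassoc.hom (comulL d₂ d'))
  obtain ⟨k, d₄', m₄, e₄⟩ := exists_frobM (ap F.phiR.hom (frobR m g))
  obtain ⟨l, d₅, m₅, e₅⟩ := exists_frobM (ap F.phiL.hom (frobL m₄ d))
  have key := congrArg (K.comulComulMulVal h)
    (F.phi_comul d m g d' m' d₂ m₂ d₃ d₄ d₄' m₄ d₅ m₅ e e₂.symm e₃.symm e₄.symm e₅.symm)
  have h₅ : act F.D (Prod.mkHom (𝟙 a) (uniR m₄ h)) (𝟙 x) d = act F.D (𝟙 (a, k)) (uniR m₅ h) d₅ :=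
    F.phiL_unit d m₄ h d₅ m₅ e₅.symm
  replace h₅ := congrArg K.D h₅
  rw [K.D_left, K.D_right, id_tensorHom] at h₅
  have h₃ := K.coassoc d₂ d' d₃ d₄ e₃.symm
  rw [comulComulMulVal_mk, comulComulMulVal_mk, ← h₅, ← MonoidalCategory.whiskerLeft_comp_assoc,
    ← K.ev_eq e₄.symm] at key
  rw [← key, K.ev_eq e₂.symm, reassoc_of% h₃]

/-- The value of an element of `ComulMulMul` with last input `o`. -/
def comulMulMulVal (h : El F.H o pt) {a b x y v : C} (δ : y ⊗ v ⟶ o) :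
    El (ComulMulMul F.M F.D) (a, b) (x, (y, o)) → ((a ⊗ b) ⊗ v ⟶ x) :=
  liftComulMulMul (fun d m m' => (K.D d ▷ v) ≫ K.ev h m ((uniR m' h ▷ v) ≫ δ))
    (fun d k m m' => by rw [K.D_right, ev_left, comp_whiskerRight_assoc])
    (fun d m k m' => by rw [ev_slide, uniR_act_left, comp_whiskerRight_assoc])

theorem comulMulMulVal_mk {a b x y v s t : C} (δ : y ⊗ v ⟶ o) (d : El F.D (a, b) s)
    (m : El F.M s (x, t)) (m' : El F.M t (y, o)) :
    K.comulMulMulVal h δ (comulMulMul d m m') =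
      (K.D d ▷ v) ≫ K.ev h m ((uniR m' h ▷ v) ≫ δ) :=
  liftComulMulMul_mk (fun d m m' => (K.D d ▷ v) ≫ K.ev h m ((uniR m' h ▷ v) ≫ δ))
    (fun d k m m' => by rw [K.D_right, ev_left, comp_whiskerRight_assoc])
    (fun d m k m' => by rw [ev_slide, uniR_act_left, comp_whiskerRight_assoc]) d m m'

theorem ev_assoc (hu : Univ F.H h) {x y z w t t' u v : C} (m : El F.M w (t, z))
    (m' : El F.M t (x, y)) (n : El F.M w (x, t')) (n' : El F.M t' (y, z)) (δ : z ⊗ u ⟶ o)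
    (δ' : y ⊗ v ⟶ o) (e : ap F.assoc.hom (mulL m m') = mulR n n') :
    (K.ev h m δ ▷ v) ≫ K.ev h m' δ' =
      (α_ w u v).hom ≫ K.ev h n ((α_ t' u v).inv ≫ (K.ev h n' δ ▷ v) ≫ δ') := by
  obtain ⟨d, rfl⟩ := K.D.surjective δ
  obtain ⟨r, d₁, m₁, e₁⟩ := exists_frobM (ap F.phiR.hom (frobR n' d))
  obtain ⟨r', d₂, m₂, e₂⟩ := exists_frobM (ap F.phiR.hom (frobR n d₁))
  obtain ⟨r'', d₃, m₃, e₃⟩ := exists_frobM (ap F.phiR.hom (frobR m d))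
  obtain ⟨q, m₄, m₅, e₄⟩ := exists_mulR (ap F.assoc.hom (mulL m₃ m'))
  have key := congrArg (K.comulMulMulVal h δ')
    (F.phiR_assoc n n' d d₁ m₁ d₂ m₂ m m' d₃ m₃ m₄ m₅ e₁.symm e₂.symm e e₃.symm e₄.symm)
  rw [comulMulMulVal_mk, comulMulMulVal_mk, ← K.ev_phiR _ _ _ _ _ e₂.symm, ← K.ev_slide,
    ← act_uniR_of_assoc hu e₄.symm, ev_left, ← comp_whiskerRight_assoc, ← comp_whiskerRight_assoc,
    ← K.ev_eq e₁.symm, ← K.ev_eq e₃.symm] at key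
  exact key.symm

end Comonoidal

/-- A representation of the pseudocomonoid of a Frobenius pseudomonoid represents the Frobenius
pseudomonoid. -/
theorem exists_frobFrame [IsIdempotentComplete C] (H : ∀ {z : C}, El F.H z pt ≃ (z ⟶ o))
    (H_act : ∀ {z z' : C} (h : z' ⟶ z) (n : El F.H z pt), H (act F.H h (𝟙 pt) n) = h ≫ H n) :
    ∃ R : FrobFrame F o, (∀ {a b x : C} (d : El F.D (a, b) x), R.D d = K.D d) ∧
      (∀ {x : C} (e : El F.E pt x), R.E e = K.E e) ∧ ∀ {z : C} (n : El F.H z pt), R.H n = H n := by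
  let h : El F.H o pt := H.symm (𝟙 o)
  have hH : ∀ {z : C} (n : El F.H z pt), act F.H (H n) (𝟙 pt) h = n := fun n => H.injective (by
    rw [H_act, Equiv.apply_symm_apply, Category.comp_id])
  have hu : Univ F.H h := fun z n => ⟨H n, hH n, fun f hf => by
    change act F.H f (𝟙 pt) h = n at hf
    rw [← hf, H_act, Equiv.apply_symm_apply, Category.comp_id]⟩
  have cR : ∀ {a x t : C} (d : El F.D (a, t) x) (e : El F.E pt t),
    couR d e = (ρ_ a).inv ≫ (a ◁ K.E e) ≫ K.D d := K.counitR
  let R : Frame o F.M F.H F.D F.E :=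
    { D := K.D
      E := K.E
      H := H
      ev := K.ev h
      D_act := K.D_act
      E_act := K.E_act
      H_act := H_act
      ev_act := K.ev_act
      ev_nat := K.ev_nat
      ev_bijective := K.ev_bijective hu
      dual := K.isDualizing hu }
  refine ⟨{ R with
    coassoc := K.coassoc
    counitL := K.counitL
    counitR := K.counitR
    assoc := fun m m' n n' δ δ' e => K.ev_assoc hu m m' n n' δ δ' e
    unitL := fun {x z t w} m n δ => ?_
    unitR := fun {x z t} m n => ?_
    phiL := K.ev_phiL
    phiR := K.ev_phiR }, fun _ => rfl, fun _ => rfl, fun _ => rfl⟩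
  · change (uniL m n ▷ w) ≫ δ = K.ev h m δ ≫ H n
    obtain ⟨d, rfl⟩ := K.D.surjective δ
    obtain ⟨v, d₁, m₁, e⟩ := exists_frobM (ap F.phiR.hom (frobR m d))
    have key : act F.D (Prod.mkHom (uniL m n) (𝟙 w)) (𝟙 o) d =
        act F.D (𝟙 (z, w)) (uniL m₁ n) d₁ := F.phiR_unit d m n d₁ m₁ e.symm
    replace key := congrArg K.D key
    rw [K.D_left, K.D_right, tensorHom_id] at key
    rw [key, K.ev_eq e.symm, Category.assoc]
    conv_lhs => rw [← hH n, ← uniL_slide, uniL_eq_uniR hu, uniR_act_right]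
  · change uniR m n = (ρ_ z).inv ≫ K.ev h m ((ρ_ t).hom ≫ H n)
    let d : El F.D (t, 𝟙_ C) o := K.D.symm ((ρ_ t).hom ≫ H n)
    have hd : K.D d = (ρ_ t).hom ≫ H n := K.D.apply_symm_apply _
    let e : El F.E pt (𝟙_ C) := K.E.symm (𝟙 _)
    have he : K.E e = 𝟙 _ := K.E.apply_symm_apply _
    obtain ⟨v, d₁, m₁, eq⟩ := exists_frobM (ap F.phiR.hom (frobR m d))
    have key : act F.M (𝟙 z) (Prod.mkHom (𝟙 x) (couR d e)) m =
        act F.M (couR d₁ e) (𝟙 (x, o)) m₁ := F.phiR_counit e d m d₁ m₁ eq.symm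
    rw [cR, cR, hd, he, MonoidalCategory.whiskerLeft_id, MonoidalCategory.whiskerLeft_id,
      Category.id_comp, Category.id_comp, Iso.inv_hom_id_assoc] at key
    have key' := congrArg (fun m => uniR m h) key
    change uniR _ h = uniR _ h at key'
    rw [uniR_slide, hH, uniR_act_left, Category.assoc, ← K.ev_eq eq.symm, hd] at key'
    exact key'

end Comonoidal

end Prof

namespace Prof

open MonoidalCategory

variable {C : Type u} [SmallCategory C] [MonoidalCategory C]

namespace Frame

variable {o : C} {M : Profunctor.{u} (C × C) C} {H : Profunctor.{u} One C}
    {D : Profunctor.{u} C (C × C)} {E : Profunctor.{u} C One} (R : Frame o M H D E)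

/-- The relation between `MulL` and `MulR` that defines the associator of `μ`. -/
def Assoc {x y z w t t' : C} (m : El M w (t, z)) (m' : El M t (x, y)) (n : El M w (x, t'))
    (n' : El M t' (y, z)) : Prop :=
  ∀ {u v : C} (δ : z ⊗ u ⟶ o) (δ' : y ⊗ v ⟶ o),
    R.ev n (R.pair n' δ δ') = (α_ w u v).inv ≫ (R.ev m δ ▷ v) ≫ R.ev m' δ'

/-- The relation between `ComulL` and `ComulR` that defines the coassociator of `Δ`. -/
def Coassoc {a b c x t t' : C} (d : El D (t, c) x) (d' : El D (a, b) t) (f : El D (a, t') x)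
    (f' : El D (b, c) t') : Prop :=
  (a ◁ R.D f') ≫ R.D f = (α_ a b c).inv ≫ (R.D d' ▷ c) ≫ R.D d

/-- The relation between `FrobL` and `FrobM` that defines the left Frobenius 2-cell. -/
def PhiL {a b x y t v : C} (m : El M b (t, y)) (d : El D (a, t) x) (d' : El D (a, b) v)
    (m' : El M v (x, y)) : Prop :=
  ∀ {w : C} (δ : y ⊗ w ⟶ o),
    (R.D d' ▷ w) ≫ R.ev m' δ = (α_ a b w).hom ≫ (a ◁ R.ev m δ) ≫ R.D d

/-- The relation between `FrobR` and `FrobM` that defines the right Frobenius 2-cell. -/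
def PhiR {a b x y t v : C} (m : El M a (x, t)) (d : El D (t, b) y) (d' : El D (a, b) v)
    (m' : El M v (x, y)) : Prop :=
  ∀ {w : C} (δ : y ⊗ w ⟶ o),
    (R.D d' ▷ w) ≫ R.ev m' δ = (α_ a b w).hom ≫ R.ev m ((α_ t b w).inv ≫ (R.D d ▷ w) ≫ δ)

variable {R}

theorem pentagon {x y z w v s t p q r p' q' : C}
    {m₁ : El M v (s, w)} {m₂ : El M s (t, z)} {m₃ : El M t (x, y)}
    {a₁ : El M s (x, p)} {a₂ : El M p (y, z)} {b₁ : El M v (x, q)} {b₂ : El M q (p, w)}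
    {c₁ : El M q (y, r)} {c₂ : El M r (z, w)}
    {a₁' : El M v (t, p')} {a₂' : El M p' (z, w)} {b₁' : El M v (x, q')} {b₂' : El M q' (y, p')}
    (h₁ : R.Assoc m₂ m₃ a₁ a₂) (h₂ : R.Assoc m₁ a₁ b₁ b₂) (h₃ : R.Assoc b₂ a₂ c₁ c₂)
    (h₄ : R.Assoc m₁ m₂ a₁' a₂') (h₅ : R.Assoc a₁' m₃ b₁' b₂') :
    mulMulMul b₁ c₁ c₂ = mulMulMul b₁' b₂' a₂' := by
  apply R.mulMulMul_ext
  intro a b c δ δ' δ''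
  have e : R.pair c₁ (R.pair c₂ δ δ') δ'' =
      (q ◁ (α_ a b c).hom) ≫ R.pair b₂ δ (R.pair a₂ δ' δ'') := by
    rw [pair, h₃, pair, pair]
    generalize R.ev b₂ δ = f
    generalize R.ev a₂ δ' = g
    monoidal
  rw [h₅, h₄, e, R.ev_nat, h₂, h₁]
  generalize R.ev m₁ δ = f
  generalize R.ev m₂ δ' = g
  generalize R.ev m₃ δ'' = h
  monoidal

theorem triangle {x y z s t t' : C} {m : El M z (t, y)} {m' : El M t (x, s)} {n : El H s pt}
    {a₁ : El M z (x, t')} {a₂ : El M t' (s, y)} (h : R.Assoc m m' a₁ a₂) {f : t ⟶ x} {g : t' ⟶ y}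
    (hf : f = (ρ_ t).inv ≫ R.ev m' ((ρ_ s).hom ≫ R.H n))
    (hg : ∀ {w : C} (δ : y ⊗ w ⟶ o), (g ▷ w) ≫ δ = R.ev a₂ δ ≫ R.H n) :
    act M (𝟙 z) (Prod.mkHom f (𝟙 y)) m = act M (𝟙 z) (Prod.mkHom (𝟙 x) g) a₁ := by
  apply R.ext
  intro w δ
  rw [R.ev_mid, R.ev_slide, hg, hf]
  have e : R.pair a₂ δ ((ρ_ s).hom ≫ R.H n) = (t' ◁ (ρ_ w).hom) ≫ R.ev a₂ δ ≫ R.H n := by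
    rw [pair, rightUnitor_naturality_assoc]
    monoidal
  have key := h δ ((ρ_ s).hom ≫ R.H n)
  rw [e, R.ev_nat] at key
  have key' := congrArg (fun k => (z ◁ (ρ_ w).inv) ≫ k) key
  simp only [whiskerLeft_inv_hom_assoc] at key'
  rw [key']
  generalize R.ev m' ((ρ_ s).hom ≫ R.H n) = k
  generalize R.ev m δ = l
  monoidal

theorem copentagon {a b c e x p q s t r s' t' : C}
    {d₁ : El D (p, e) x} {d₂ : El D (q, c) p} {d₃ : El D (a, b) q}
    {f₁ : El D (a, s) p} {f₂ : El D (b, c) s} {g₁ : El D (a, t) x} {g₂ : El D (s, e) t}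
    {h₁ : El D (b, r) t} {h₂ : El D (c, e) r}
    {f₁' : El D (q, s') x} {f₂' : El D (c, e) s'} {g₁' : El D (a, t') x} {g₂' : El D (b, s') t'}
    (k₁ : R.Coassoc d₂ d₃ f₁ f₂) (k₂ : R.Coassoc d₁ f₁ g₁ g₂) (k₃ : R.Coassoc g₂ f₂ h₁ h₂)
    (k₄ : R.Coassoc d₁ d₂ f₁' f₂') (k₅ : R.Coassoc f₁' d₃ g₁' g₂') :
    comulComulComul g₁ h₁ h₂ = comulComulComul g₁' g₂' f₂' := by
  apply R.comulComulComul_ext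
  rw [k₃, MonoidalCategory.whiskerLeft_comp, MonoidalCategory.whiskerLeft_comp, Category.assoc,
    Category.assoc, k₂, associator_inv_naturality_middle_assoc, ← comp_whiskerRight_assoc, k₁,
    MonoidalCategory.whiskerLeft_comp, Category.assoc, k₅, associator_inv_naturality_right_assoc,
    whisker_exchange_assoc, k₄]
  generalize R.D d₁ = u₁
  generalize R.D d₂ = u₂
  generalize R.D d₃ = u₃
  monoidal

theorem cotriangle {a b x s t t' : C} {d : El D (t, b) x} {d' : El D (a, s) t} {e : El E pt s}
    {f₁ : El D (a, t') x} {f₂ : El D (s, b) t'} (h : R.Coassoc d d' f₁ f₂) :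
    act D (Prod.mkHom ((ρ_ a).inv ≫ (a ◁ R.E e) ≫ R.D d') (𝟙 b)) (𝟙 x) d =
      act D (Prod.mkHom (𝟙 a) ((λ_ b).inv ≫ (R.E e ▷ b) ≫ R.D f₂)) (𝟙 x) f₁ := by
  apply R.D.injective
  rw [R.D_left, R.D_left, id_tensorHom, tensorHom_id, MonoidalCategory.whiskerLeft_comp,
    MonoidalCategory.whiskerLeft_comp, Category.assoc, Category.assoc, h]
  generalize R.D d = u
  generalize R.D d' = v
  generalize R.E e = w
  monoidal

theorem phiL_unit {a b x s t v : C} {d : El D (a, t) x} {m : El M b (t, s)} {n : El H s pt}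
    {d₁ : El D (a, b) v} {m₁ : El M v (x, s)} (h : R.PhiL m d d₁ m₁) :
    act D (Prod.mkHom (𝟙 a) ((ρ_ b).inv ≫ R.ev m ((ρ_ s).hom ≫ R.H n))) (𝟙 x) d =
      act D (𝟙 (a, b)) ((ρ_ v).inv ≫ R.ev m₁ ((ρ_ s).hom ≫ R.H n)) d₁ := by
  apply R.D.injective
  rw [R.D_left, R.D_right, id_tensorHom, rightUnitor_inv_naturality_assoc, h]
  generalize R.ev m ((ρ_ s).hom ≫ R.H n) = k
  generalize R.D d = l
  monoidal

theorem phiR_unit {a b y s t v : C} {d : El D (t, b) y} {m : El M a (s, t)} {n : El H s pt}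
    {d₁ : El D (a, b) v} {m₁ : El M v (s, y)} (h : R.PhiR m d d₁ m₁) {f : a ⟶ t} {g : v ⟶ y}
    (hf : ∀ {w : C} (δ : t ⊗ w ⟶ o), (f ▷ w) ≫ δ = R.ev m δ ≫ R.H n)
    (hg : ∀ {w : C} (δ : y ⊗ w ⟶ o), (g ▷ w) ≫ δ = R.ev m₁ δ ≫ R.H n) :
    act D (Prod.mkHom f (𝟙 b)) (𝟙 y) d = act D (𝟙 (a, b)) g d₁ := by
  apply R.D.injective
  obtain ⟨y', ε, hε⟩ := R.dual.1 y
  apply hε.lhom_ext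
  rw [R.D_left, R.D_right, tensorHom_id, comp_whiskerRight_assoc, comp_whiskerRight_assoc, hg,
    reassoc_of% (h ε), ← hf, associator_inv_naturality_left_assoc, Iso.hom_inv_id_assoc]

theorem phiL_counit {b x y s t v : C} {e : El E pt s} {d : El D (s, t) x} {m : El M b (t, y)}
    {d₁ : El D (s, b) v} {m₁ : El M v (x, y)} (h : R.PhiL m d d₁ m₁) :
    act M (𝟙 b) (Prod.mkHom ((λ_ t).inv ≫ (R.E e ▷ t) ≫ R.D d) (𝟙 y)) m =
      act M ((λ_ b).inv ≫ (R.E e ▷ b) ≫ R.D d₁) (𝟙 (x, y)) m₁ := by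
  apply R.ext
  intro w δ
  rw [R.ev_mid, R.ev_left, comp_whiskerRight_assoc, comp_whiskerRight_assoc, h,
    associator_naturality_left_assoc, ← whisker_exchange_assoc]
  generalize R.ev m δ = k
  generalize R.D d = l
  generalize R.E e = f
  monoidal

theorem phiR_counit {a x y s t v : C} {e : El E pt s} {d : El D (t, s) y} {m : El M a (x, t)}
    {d₁ : El D (a, s) v} {m₁ : El M v (x, y)} (h : R.PhiR m d d₁ m₁) :
    act M (𝟙 a) (Prod.mkHom (𝟙 x) ((ρ_ t).inv ≫ (t ◁ R.E e) ≫ R.D d)) m =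
      act M ((ρ_ a).inv ≫ (a ◁ R.E e) ≫ R.D d₁) (𝟙 (x, y)) m₁ := by
  apply R.ext
  intro w δ
  have e₁ : (((ρ_ t).inv ≫ (t ◁ R.E e) ≫ R.D d) ▷ w) ≫ δ =
      (t ◁ ((λ_ w).inv ≫ (R.E e ▷ w))) ≫ (α_ t s w).inv ≫ (R.D d ▷ w) ≫ δ := by
    generalize R.D d = l
    generalize R.E e = f
    monoidal
  rw [R.ev_slide, R.ev_left, e₁, R.ev_nat, comp_whiskerRight_assoc, comp_whiskerRight_assoc, h]
  generalize R.ev m ((α_ t s w).inv ≫ (R.D d ▷ w) ≫ δ) = k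
  generalize R.E e = f
  monoidal

theorem phiL_assoc {a b x y z s t v r q k r' : C}
    {d : El D (a, t) x} {n : El M s (t, y)} {m : El M b (s, z)}
    {d₁ : El D (a, s) v} {n₁ : El M v (x, y)} {d₂ : El D (a, b) r} {m₂ : El M r (v, z)}
    {m₃ : El M r (x, r')} {n₃ : El M r' (y, z)}
    {m₁' : El M b (t, q)} {n₁' : El M q (y, z)} {d₂' : El D (a, b) k} {m₂' : El M k (x, q)}
    (h₁ : R.PhiL n d d₁ n₁) (h₂ : R.PhiL m d₁ d₂ m₂) (h₃ : R.Assoc m₂ n₁ m₃ n₃)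
    (h₄ : R.Assoc m n m₁' n₁') (h₅ : R.PhiL m₁' d d₂' m₂') :
    comulMulMul d₂ m₃ n₃ = comulMulMul d₂' m₂' n₁' := by
  apply R.comulMulMul_ext
  intro u v δ δ'
  rw [h₃, h₅, h₄, associator_inv_naturality_left_assoc, ← comp_whiskerRight_assoc, h₂,
    comp_whiskerRight_assoc, comp_whiskerRight_assoc, h₁]
  generalize R.ev m δ = f
  generalize R.ev n δ' = g
  generalize R.D d = h
  monoidal

theorem phiR_assoc {a b x y z s t v v' q r r' : C}
    {m : El M a (x, s)} {m' : El M s (y, t)} {d : El D (t, b) z}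
    {d₁ : El D (s, b) v} {m₁ : El M v (y, z)} {d₂ : El D (a, b) v'} {m₂ : El M v' (x, v)}
    {n : El M a (q, t)} {n' : El M q (x, y)} {d₃ : El D (a, b) r} {m₃ : El M r (q, z)}
    {m₄ : El M r (x, r')} {m₅ : El M r' (y, z)}
    (h₁ : R.PhiR m' d d₁ m₁) (h₂ : R.PhiR m d₁ d₂ m₂) (h₃ : R.Assoc n n' m m')
    (h₄ : R.PhiR n d d₃ m₃) (h₅ : R.Assoc m₃ n' m₄ m₅) :
    comulMulMul d₂ m₂ m₁ = comulMulMul d₃ m₄ m₅ := by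
  apply R.comulMulMul_ext
  intro u v δ δ'
  have e : (α_ s b (u ⊗ v)).inv ≫ (R.D d₁ ▷ (u ⊗ v)) ≫ R.pair m₁ δ δ' =
      (s ◁ (α_ b u v).inv) ≫ R.pair m' ((α_ t b u).inv ≫ (R.D d ▷ u) ≫ δ) δ' := by
    rw [pair, associator_inv_naturality_left_assoc, ← comp_whiskerRight_assoc, h₁, pair]
    generalize R.ev m' ((α_ t b u).inv ≫ (R.D d ▷ u) ≫ δ) = f
    monoidal
  rw [h₂, e, R.ev_nat, h₃, h₅, associator_inv_naturality_left_assoc, ← comp_whiskerRight_assoc, h₄]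
  generalize R.ev n ((α_ t b u).inv ≫ (R.D d ▷ u) ≫ δ) = f
  generalize R.ev n' δ' = g
  monoidal

theorem phi_mul {a b x y z s t v w r v' w' : C}
    {m : El M a (x, s)} {d : El D (s, t) y} {m' : El M b (t, z)}
    {d₁ : El D (a, t) v} {m₁ : El M v (x, y)} {d₂ : El D (a, b) w} {m₂ : El M w (v, z)}
    {m₃ : El M w (x, r)} {m₄ : El M r (y, z)}
    {d₁' : El D (s, b) v'} {m₁' : El M v' (y, z)} {d₂' : El D (a, b) w'} {m₂' : El M w' (x, v')}
    (h₁ : R.PhiR m d d₁ m₁) (h₂ : R.PhiL m' d₁ d₂ m₂) (h₃ : R.Assoc m₂ m₁ m₃ m₄)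
    (h₄ : R.PhiL m' d d₁' m₁') (h₅ : R.PhiR m d₁' d₂' m₂') :
    comulMulMul d₂ m₃ m₄ = comulMulMul d₂' m₂' m₁' := by
  apply R.comulMulMul_ext
  intro u v δ δ'
  have e : (α_ s b (u ⊗ v)).inv ≫ (R.D d₁' ▷ (u ⊗ v)) ≫ R.pair m₁' δ δ' =
      (s ◁ ((α_ b u v).inv ≫ (R.ev m' δ ▷ v))) ≫ (α_ s t v).inv ≫ (R.D d ▷ v) ≫ δ' := by
    rw [pair, associator_inv_naturality_left_assoc, ← comp_whiskerRight_assoc, h₄]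
    generalize R.ev m' δ = f
    generalize R.D d = g
    monoidal
  rw [h₅, e, R.ev_nat, h₃, associator_inv_naturality_left_assoc, ← comp_whiskerRight_assoc, h₂,
    comp_whiskerRight_assoc, comp_whiskerRight_assoc, h₁]
  generalize R.ev m ((α_ s t v).inv ≫ (R.D d ▷ v) ≫ δ') = f
  generalize R.ev m' δ = g
  monoidal

theorem phiR_coassoc {a b c x y q s v r p p' k : C}
    {d : El D (q, c) y} {d' : El D (s, b) q} {m : El M a (x, s)}
    {d₁ : El D (a, b) v} {m₁ : El M v (x, q)} {d₂ : El D (v, c) r} {m₂ : El M r (x, y)}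
    {d₃ : El D (a, p) r} {d₄ : El D (b, c) p}
    {f₁ : El D (s, p') y} {f₂ : El D (b, c) p'} {d₁' : El D (a, p') k} {m₁' : El M k (x, y)}
    (h₁ : R.PhiR m d' d₁ m₁) (h₂ : R.PhiR m₁ d d₂ m₂) (h₃ : R.Coassoc d₂ d₁ d₃ d₄)
    (h₄ : R.Coassoc d d' f₁ f₂) (h₅ : R.PhiR m f₁ d₁' m₁') :
    comulComulMul d₃ d₄ m₂ = comulComulMul d₁' f₂ m₁' := by
  apply R.comulComulMul_ext
  intro w δ
  have e : (s ◁ (R.D f₂ ▷ w)) ≫ (α_ s p' w).inv ≫ (R.D f₁ ▷ w) ≫ δ =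
      (s ◁ (α_ b c w).hom) ≫ (α_ s b (c ⊗ w)).inv ≫ (R.D d' ▷ (c ⊗ w)) ≫ (α_ q c w).inv ≫
        (R.D d ▷ w) ≫ δ := by
    rw [associator_inv_naturality_middle_assoc, ← comp_whiskerRight_assoc, h₄]
    generalize R.D d' = g
    generalize R.D d = h
    monoidal
  have e' : ((a ◁ R.D f₂) ▷ w) ≫ (α_ a p' w).hom = (α_ a (b ⊗ c) w).hom ≫ (a ◁ (R.D f₂ ▷ w)) := by
    simp
  rw [h₃, comp_whiskerRight_assoc, comp_whiskerRight_assoc, comp_whiskerRight_assoc, h₂, h₅,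
    associator_naturality_left_assoc, h₁, reassoc_of% e', ← R.ev_nat, e, R.ev_nat]
  generalize R.ev m _ = f
  monoidal

theorem phiL_coassoc {a b c x y q s v p p' k r : C}
    {d : El D (q, s) x} {d' : El D (a, b) q} {m : El M c (s, y)}
    {d₁ : El D (q, c) v} {m₁ : El M v (x, y)} {d₂ : El D (a, p) v} {d₃ : El D (b, c) p}
    {f₁ : El D (a, p') x} {f₂ : El D (b, s) p'} {d₁' : El D (b, c) k} {m₁' : El M k (p', y)}
    {d₂' : El D (a, k) r} {m₂' : El M r (x, y)}
    (h₁ : R.PhiL m d d₁ m₁) (h₂ : R.Coassoc d₁ d' d₂ d₃) (h₃ : R.Coassoc d d' f₁ f₂)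
    (h₄ : R.PhiL m f₂ d₁' m₁') (h₅ : R.PhiL m₁' f₁ d₂' m₂') :
    comulComulMul d₂ d₃ m₁ = comulComulMul d₂' d₁' m₂' := by
  apply R.comulComulMul_ext
  intro w δ
  have e' : ((a ◁ R.D d₁') ▷ w) ≫ (α_ a k w).hom = (α_ a (b ⊗ c) w).hom ≫ (a ◁ (R.D d₁' ▷ w)) := by
    simp
  rw [h₂, comp_whiskerRight_assoc, comp_whiskerRight_assoc, comp_whiskerRight_assoc, h₁, h₅,
    reassoc_of% e', ← MonoidalCategory.whiskerLeft_comp_assoc, h₄, MonoidalCategory.whiskerLeft_comp,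
    MonoidalCategory.whiskerLeft_comp, Category.assoc, Category.assoc, h₃]
  generalize R.D d = f
  generalize R.D d' = g
  generalize R.ev m δ = h
  rw [associator_naturality_left_assoc, ← whisker_exchange_assoc]
  monoidal

theorem phi_comul {a b c x y s t v r p k r' : C}
    {d : El D (a, s) x} {m : El M b (s, t)} {d' : El D (t, c) y}
    {d₁ : El D (a, b) v} {m₁ : El M v (x, t)} {d₂ : El D (v, c) r} {m₂ : El M r (x, y)}
    {d₃ : El D (a, p) r} {d₄ : El D (b, c) p}
    {d₁' : El D (b, c) k} {m₁' : El M k (s, y)} {d₂' : El D (a, k) r'} {m₂' : El M r' (x, y)}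
    (h₁ : R.PhiL m d d₁ m₁) (h₂ : R.PhiR m₁ d' d₂ m₂) (h₃ : R.Coassoc d₂ d₁ d₃ d₄)
    (h₄ : R.PhiR m d' d₁' m₁') (h₅ : R.PhiL m₁' d d₂' m₂') :
    comulComulMul d₃ d₄ m₂ = comulComulMul d₂' d₁' m₂' := by
  apply R.comulComulMul_ext
  intro w δ
  have e' : ((a ◁ R.D d₁') ▷ w) ≫ (α_ a k w).hom = (α_ a (b ⊗ c) w).hom ≫ (a ◁ (R.D d₁' ▷ w)) := by
    simp
  rw [h₃, comp_whiskerRight_assoc, comp_whiskerRight_assoc, comp_whiskerRight_assoc, h₂, h₅,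
    associator_naturality_left_assoc, h₁, reassoc_of% e', ← MonoidalCategory.whiskerLeft_comp_assoc,
    h₄]
  generalize R.ev m _ = f
  generalize R.D d = g
  monoidal

end Frame

end Prof

namespace Prof

open MonoidalCategory

variable {C : Type u} [SmallCategory C] [MonoidalCategory C]

namespace Frame

variable {o : C} {M : Profunctor.{u} (C × C) C} {H : Profunctor.{u} One C}
    {D : Profunctor.{u} C (C × C)} {E : Profunctor.{u} C One} (R : Frame o M H D E)

theorem exists_assoc : ∃ i : MulL M ≅ MulR M,
    ∀ {x y z w : C} (p : El (MulL M) w ((x, y), z)) (q : El (MulR M) w ((x, y), z)),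
      ap i.hom p = q ↔
        ∀ {u v : C} (δ : z ⊗ u ⟶ o) (δ' : y ⊗ v ⟶ o), R.mulLVal δ δ' p = R.mulRVal δ δ' q := by
  refine Exists.imp (fun i hi => fun p q => hi p q) (exists_iso_of_values (P := MulL M) (Q := MulR M)
    (fun {w a} p q => ∀ {u v : C} (δ : a.2 ⊗ u ⟶ o) (δ' : a.1.2 ⊗ v ⟶ o),
      R.mulLVal (x := a.1.1) (w := w) δ δ' p = R.mulRVal (x := a.1.1) (w := w) δ δ' q) ?_ ?_)
  · rintro w w' ⟨⟨x, y⟩, z⟩ ⟨⟨x', y'⟩, z'⟩ h ⟨⟨f, g⟩, k⟩ p q e u v δ δ'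
    refine (R.mulLVal_act h f g k δ δ' p).trans (.trans ?_ (R.mulRVal_act h f g k δ δ' q).symm)
    rw [e]
  · rintro w ⟨⟨x, y⟩, z⟩
    obtain ⟨y', ε', hε'⟩ := R.dual.1 y
    obtain ⟨z', ε, hε⟩ := R.dual.1 z
    refine ⟨_, R.mulLVal ε ε', R.mulRVal ε ε', R.mulLVal_bijective hε hε',
      R.mulRVal_bijective hε hε', fun p q => ⟨fun e u v δ δ' => ?_, fun e => e ε ε'⟩⟩
    change R.mulLVal δ δ' p = R.mulRVal δ δ' q
    rw [← hε.curry_spec δ, ← hε'.curry_spec δ', mulLVal_nat, mulRVal_nat, e]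

theorem exists_unitL : ∃ i : UnL M H ≅ idP C,
    ∀ {x z : C} (p : El (UnL M H) z x) (f : z ⟶ x), (ap i.hom p : z ⟶ x) = f ↔
      ∀ {w : C} (δ : x ⊗ w ⟶ o), R.unLVal δ p = (f ▷ w) ≫ δ := by
  refine Exists.imp (fun i hi => fun p q => hi p q) (exists_iso_of_values (P := UnL M H) (Q := idP C)
    (fun {z x} p q => ∀ {w : C} (δ : x ⊗ w ⟶ o), R.unLVal δ p = (uhel q ▷ w) ≫ δ) ?_ ?_)
  · intro z z' x x' g f p q e w δ
    rw [unLVal_act, e]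
    rw [show uhel (act (idP C) g f q) = g ≫ uhel q ≫ f from act_idP g f q, comp_whiskerRight_assoc,
      comp_whiskerRight_assoc]
  · intro z x
    obtain ⟨x', ε, hε⟩ := R.dual.1 x
    refine ⟨_, R.unLVal ε, fun q => (uhel q ▷ x') ≫ ε, R.unLVal_bijective hε, hε.2 z,
      fun p q => ⟨fun e w δ => ?_, fun e => e ε⟩⟩
    rw [← hε.curry_spec δ, unLVal_nat, e, whisker_exchange_assoc]

theorem exists_unitR : ∃ i : UnR M H ≅ idP C,
    ∀ {x z : C} (p : El (UnR M H) z x), (ap i.hom p : z ⟶ x) = R.unRVal p := by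
  obtain ⟨i, hi⟩ := exists_iso_of_values (P := UnR M H) (Q := idP C)
    (fun {z x} p q => R.unRVal p = uhel q)
    (fun g f p q e => by rw [unRVal_act, e]; exact (act_idP g f (uhel q)).symm)
    (fun z x => ⟨_, R.unRVal, uhel, R.unRVal_bijective, Function.bijective_id, fun _ _ => Iff.rfl⟩)
  exact ⟨i, fun p => (hi p (hel (R.unRVal p))).2 rfl⟩

theorem exists_coassoc : ∃ i : ComulL D ≅ ComulR D,
    ∀ {a b c x : C} (p : El (ComulL D) ((a, b), c) x) (q : El (ComulR D) ((a, b), c) x),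
      ap i.hom p = q ↔ R.comulLVal p = R.comulRVal q := by
  refine Exists.imp (fun i hi => fun p q => hi p q) (exists_iso_of_values (P := ComulL D) (Q := ComulR D)
    (fun {a x} p q => R.comulLVal (a := a.1.1) (b := a.1.2) (c := a.2) p =
      R.comulRVal (a := a.1.1) (b := a.1.2) (c := a.2) q) ?_ ?_)
  · rintro ⟨⟨a, b⟩, c⟩ ⟨⟨a', b'⟩, c'⟩ x x' ⟨⟨f, g⟩, k⟩ h p q e
    refine (R.comulLVal_act f g k h p).trans (.trans ?_ (R.comulRVal_act f g k h q).symm)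
    rw [e]
  · rintro ⟨⟨a, b⟩, c⟩ x
    exact ⟨_, R.comulLVal, R.comulRVal, R.comulLVal_bijective, R.comulRVal_bijective,
      fun _ _ => Iff.rfl⟩

theorem exists_counitL : ∃ i : CounL D E ≅ idP C,
    ∀ {a x : C} (p : El (CounL D E) a x), (ap i.hom p : a ⟶ x) = R.counLVal p := by
  obtain ⟨i, hi⟩ := exists_iso_of_values (P := CounL D E) (Q := idP C)
    (fun {a x} p q => R.counLVal p = uhel q)
    (fun g f p q e => by rw [counLVal_act, e]; exact (act_idP g f (uhel q)).symm)
    (fun a x => ⟨_, R.counLVal, uhel, R.counLVal_bijective, Function.bijective_id,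
      fun _ _ => Iff.rfl⟩)
  exact ⟨i, fun p => (hi p (hel (R.counLVal p))).2 rfl⟩

theorem exists_counitR : ∃ i : CounR D E ≅ idP C,
    ∀ {a x : C} (p : El (CounR D E) a x), (ap i.hom p : a ⟶ x) = R.counRVal p := by
  obtain ⟨i, hi⟩ := exists_iso_of_values (P := CounR D E) (Q := idP C)
    (fun {a x} p q => R.counRVal p = uhel q)
    (fun g f p q e => by rw [counRVal_act, e]; exact (act_idP g f (uhel q)).symm)
    (fun a x => ⟨_, R.counRVal, uhel, R.counRVal_bijective, Function.bijective_id,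
      fun _ _ => Iff.rfl⟩)
  exact ⟨i, fun p => (hi p (hel (R.counRVal p))).2 rfl⟩

theorem exists_phiL : ∃ i : FrobL M D ≅ FrobM M D,
    ∀ {a b x y : C} (p : El (FrobL M D) (a, b) (x, y)) (q : El (FrobM M D) (a, b) (x, y)),
      ap i.hom p = q ↔ ∀ {w : C} (δ : y ⊗ w ⟶ o), R.frobLVal δ p = R.frobMVal δ q := by
  refine Exists.imp (fun i hi => fun p q => hi p q) (exists_iso_of_values (P := FrobL M D) (Q := FrobM M D)
    (fun {a x} p q => ∀ {w : C} (δ : x.2 ⊗ w ⟶ o),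
      R.frobLVal (a := a.1) (b := a.2) (x := x.1) δ p =
        R.frobMVal (a := a.1) (b := a.2) (x := x.1) δ q) ?_ ?_)
  · rintro ⟨a, b⟩ ⟨a', b'⟩ ⟨x, y⟩ ⟨x', y'⟩ ⟨f, g⟩ ⟨h, k⟩ p q e w δ
    refine (R.frobLVal_act f g h k δ p).trans (.trans ?_ (R.frobMVal_act f g h k δ q).symm)
    rw [e]
  · rintro ⟨a, b⟩ ⟨x, y⟩
    obtain ⟨y', ε, hε⟩ := R.dual.1 y
    refine ⟨_, R.frobLVal ε, R.frobMVal ε, R.frobLVal_bijective hε, R.frobMVal_bijective hε,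
      fun p q => ⟨fun e w δ => ?_, fun e => e ε⟩⟩
    change R.frobLVal δ p = R.frobMVal δ q
    rw [← hε.curry_spec δ, frobLVal_nat, frobMVal_nat, e]

theorem exists_phiR : ∃ i : FrobR M D ≅ FrobM M D,
    ∀ {a b x y : C} (p : El (FrobR M D) (a, b) (x, y)) (q : El (FrobM M D) (a, b) (x, y)),
      ap i.hom p = q ↔ ∀ {w : C} (δ : y ⊗ w ⟶ o), R.frobRVal δ p = R.frobMVal δ q := by
  refine Exists.imp (fun i hi => fun p q => hi p q) (exists_iso_of_values (P := FrobR M D) (Q := FrobM M D)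
    (fun {a x} p q => ∀ {w : C} (δ : x.2 ⊗ w ⟶ o),
      R.frobRVal (a := a.1) (b := a.2) (x := x.1) δ p =
        R.frobMVal (a := a.1) (b := a.2) (x := x.1) δ q) ?_ ?_)
  · rintro ⟨a, b⟩ ⟨a', b'⟩ ⟨x, y⟩ ⟨x', y'⟩ ⟨f, g⟩ ⟨h, k⟩ p q e w δ
    refine (R.frobRVal_act f g h k δ p).trans (.trans ?_ (R.frobMVal_act f g h k δ q).symm)
    rw [e]
  · rintro ⟨a, b⟩ ⟨x, y⟩
    obtain ⟨y', ε, hε⟩ := R.dual.1 y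
    refine ⟨_, R.frobRVal ε, R.frobMVal ε, R.frobRVal_bijective hε, R.frobMVal_bijective hε,
      fun p q => ⟨fun e w δ => ?_, fun e => e ε⟩⟩
    change R.frobRVal δ p = R.frobMVal δ q
    rw [← hε.curry_spec δ, frobRVal_nat, frobMVal_nat, e]

/-- Four profunctors represented by a `*`-autonomous category underlie a Frobenius pseudomonoid. -/
theorem exists_frobFrame (R : Frame o M H D E) :
    ∃ F : FrobeniusPseudomonoid C, Nonempty (FrobFrame F o) := by
  obtain ⟨α, hα⟩ := R.exists_assoc
  obtain ⟨l, hl⟩ := R.exists_unitL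
  obtain ⟨r, hr⟩ := R.exists_unitR
  obtain ⟨β, hβ⟩ := R.exists_coassoc
  obtain ⟨cl, hcl⟩ := R.exists_counitL
  obtain ⟨cr, hcr⟩ := R.exists_counitR
  obtain ⟨φ, hφ⟩ := R.exists_phiL
  obtain ⟨ψ, hψ⟩ := R.exists_phiR
  have hα' : ∀ {x y z w t t' : C} {m : El M w (t, z)} {m' : El M t (x, y)} {n : El M w (x, t')}
      {n' : El M t' (y, z)}, ap α.hom (mulL m m') = mulR n n' → R.Assoc m m' n n' :=
    fun {x y z w t t' m m' n n'} e u v δ δ' => by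
      have := (hα _ _).1 e δ δ'
      rw [mulLVal_mk, mulRVal_mk] at this
      rw [this, Iso.inv_hom_id_assoc]
  have hl' : ∀ {x z t : C} (m : El M z (t, x)) (n : El H t pt) {w : C} (δ : x ⊗ w ⟶ o),
      ((ap l.hom (unL m n) : z ⟶ x) ▷ w) ≫ δ = R.ev m δ ≫ R.H n := fun m n w δ => by
    rw [← (hl (unL m n) _).1 rfl, unLVal_mk]
  have hr' : ∀ {x z t : C} (m : El M z (x, t)) (n : El H t pt),
      (ap r.hom (unR m n) : z ⟶ x) = (ρ_ z).inv ≫ R.ev m ((ρ_ t).hom ≫ R.H n) := fun m n => by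
    rw [hr, unRVal_mk]
  have hβ' : ∀ {a b c x t t' : C} {d : El D (t, c) x} {d' : El D (a, b) t} {f : El D (a, t') x}
      {f' : El D (b, c) t'}, ap β.hom (comulL d d') = comulR f f' → R.Coassoc d d' f f' :=
    fun e => by
      have := (hβ _ _).1 e
      rw [comulLVal_mk, comulRVal_mk] at this
      rw [Coassoc, this, Iso.inv_hom_id_assoc]
  have hcl' : ∀ {a x t : C} (d : El D (t, a) x) (e : El E pt t),
      (ap cl.hom (counL d e) : a ⟶ x) = (λ_ a).inv ≫ (R.E e ▷ a) ≫ R.D d := fun d e => by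
    rw [hcl, counLVal_mk]
  have hcr' : ∀ {a x t : C} (d : El D (a, t) x) (e : El E pt t),
      (ap cr.hom (counR d e) : a ⟶ x) = (ρ_ a).inv ≫ (a ◁ R.E e) ≫ R.D d := fun d e => by
    rw [hcr, counRVal_mk]
  have hφ' : ∀ {a b x y t v : C} {m : El M b (t, y)} {d : El D (a, t) x}
      {d' : El D (a, b) v} {m' : El M v (x, y)},
      ap φ.hom (frobL m d) = frobM d' m' → R.PhiL m d d' m' :=
    fun {a b x y t v m d d' m'} e w δ => by
      have := (hφ _ _).1 e δ
      rw [frobLVal_mk, frobMVal_mk] at this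
      exact this.symm
  have hψ' : ∀ {a b x y t v : C} {m : El M a (x, t)} {d : El D (t, b) y}
      {d' : El D (a, b) v} {m' : El M v (x, y)},
      ap ψ.hom (frobR m d) = frobM d' m' → R.PhiR m d d' m' :=
    fun {a b x y t v m d d' m'} e w δ => by
      have := (hψ _ _).1 e δ
      rw [frobRVal_mk, frobMVal_mk] at this
      exact this.symm
  let F : FrobeniusPseudomonoid C :=
    { M := M
      H := H
      assoc := α
      unitL := l
      unitR := r
      pentagon := fun _ _ _ _ _ _ _ _ _ _ _ _ _ h₁ h₂ h₃ h₄ h₅ =>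
        pentagon (hα' h₁) (hα' h₂) (hα' h₃) (hα' h₄) (hα' h₅)
      triangle := fun m m' n a₁ a₂ h => triangle (hα' h) (hr' m' n) (hl' a₂ n)
      D := D
      E := E
      coassoc := β
      counitL := cl
      counitR := cr
      copentagon := fun _ _ _ _ _ _ _ _ _ _ _ _ _ h₁ h₂ h₃ h₄ h₅ =>
        copentagon (hβ' h₁) (hβ' h₂) (hβ' h₃) (hβ' h₄) (hβ' h₅)
      cotriangle := fun d d' e f₁ f₂ h => by
        rw [hcl', hcr']
        exact cotriangle (hβ' h)
      phiL := φ
      phiR := ψ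
      phiL_unit := fun d m n d₁ m₁ h => by
        rw [hr', hr']
        exact phiL_unit (hφ' h)
      phiR_unit := fun d m n d₁ m₁ h => phiR_unit (hψ' h) (hl' m n) (hl' m₁ n)
      phiL_counit := fun e d m d₁ m₁ h => by
        rw [hcl', hcl']
        exact phiL_counit (hφ' h)
      phiR_counit := fun e d m d₁ m₁ h => by
        rw [hcr', hcr']
        exact phiR_counit (hψ' h)
      phiL_assoc := fun _ _ _ _ _ _ _ _ _ _ _ _ _ h₁ h₂ h₃ h₄ h₅ =>
        phiL_assoc (hφ' h₁) (hφ' h₂) (hα' h₃) (hα' h₄) (hφ' h₅)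
      phiR_assoc := fun _ _ _ _ _ _ _ _ _ _ _ _ _ h₁ h₂ h₃ h₄ h₅ =>
        phiR_assoc (hψ' h₁) (hψ' h₂) (hα' h₃) (hψ' h₄) (hα' h₅)
      phi_mul := fun _ _ _ _ _ _ _ _ _ _ _ _ _ h₁ h₂ h₃ h₄ h₅ =>
        phi_mul (hψ' h₁) (hφ' h₂) (hα' h₃) (hφ' h₄) (hψ' h₅)
      phiR_coassoc := fun _ _ _ _ _ _ _ _ _ _ _ _ _ h₁ h₂ h₃ h₄ h₅ =>
        phiR_coassoc (hψ' h₁) (hψ' h₂) (hβ' h₃) (hβ' h₄) (hψ' h₅)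
      phiL_coassoc := fun _ _ _ _ _ _ _ _ _ _ _ _ _ h₁ h₂ h₃ h₄ h₅ =>
        phiL_coassoc (hφ' h₁) (hβ' h₂) (hβ' h₃) (hφ' h₄) (hφ' h₅)
      phi_comul := fun _ _ _ _ _ _ _ _ _ _ _ _ _ h₁ h₂ h₃ h₄ h₅ =>
        phi_comul (hφ' h₁) (hψ' h₂) (hβ' h₃) (hψ' h₄) (hφ' h₅) }
  exact ⟨F, ⟨{ R with
    coassoc := fun d d' f f' e => (Iso.eq_inv_comp _).1 (hβ' e)
    counitL := hcl'
    counitR := hcr'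
    assoc := fun m m' n n' δ δ' e => ((Iso.eq_inv_comp _).1 (hα' e δ δ').symm.symm).symm
    unitL := fun m n δ => hl' m n δ
    unitR := hr'
    phiL := fun m d d' m' δ e => (hφ' e δ).symm
    phiR := fun m d d' m' δ e => (hψ' e δ).symm }⟩⟩

end Frame

/-- The right adjoints of the multiplication and of the unit exist. -/
theorem FrobFrame.exists_rightAdjoint {F : FrobeniusPseudomonoid C} {o : C} (R : FrobFrame F o) :
    ∃ G : RightAdjointFrobenius C, G.toFrobeniusPseudomonoid = F := by
  choose p n hn using R.toFrame.exists_univ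
  obtain ⟨Mr, ⟨adjM⟩⟩ := exists_adj F.M (fun a => p a.1 a.2) (fun a => n a.1 a.2)
    (fun {a b} q => hn a.1 a.2 q)
  obtain ⟨Hr, ⟨adjH⟩⟩ := exists_adj F.H (fun _ => o) (fun _ => R.H.symm (𝟙 o))
    (fun {a b} n => ⟨R.H n, R.H.injective (by
      refine (R.H_act _ _).trans ?_
      rw [Equiv.apply_symm_apply, Category.comp_id]), fun f hf => by
      change act F.H f (𝟙 pt) _ = n at hf
      rw [← hf, R.H_act, Equiv.apply_symm_apply, Category.comp_id]⟩)
  exact ⟨⟨F, Mr, Hr, adjM, adjH⟩, rfl⟩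

section Concrete

variable (C)

/-- The profunctor `Hom(- ⊗ -, -)`. -/
def tensorHomP : Profunctor.{u} C (C × C) :=
  Profunctor.ofCore
    { obj := fun x a => (a.1 ⊗ a.2 ⟶ x)
      map := fun f g => TypeCat.ofHom (fun d => (g.1 ⊗ₘ g.2) ≫ d ≫ f)
      map_id := by intro a b; ext d; simp
      map_comp := by intros; ext d; simp }

/-- The profunctor `Hom(I, -)`. -/
def unitHomP : Profunctor.{u} C One :=
  Profunctor.ofCore
    { obj := fun x _ => (𝟙_ C ⟶ x)
      map := fun f _ => TypeCat.ofHom (fun d => d ≫ f)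
      map_id := by intro a b; ext d; simp
      map_comp := by intros; ext d; simp }

variable {C}

/-- The profunctor `Hom(-, o)`. -/
def homP (o : C) : Profunctor.{u} One C :=
  Profunctor.ofCore
    { obj := fun _ z => (z ⟶ o)
      map := fun _ g => TypeCat.ofHom (fun d => g ≫ d)
      map_id := by intro a b; ext d; simp
      map_comp := by intros; ext d; simp }

/-- A natural family of functions `Hom(y ⊗ w, o) → Hom(z ⊗ w, x)`. -/
@[ext]
structure ParFamily (o x y z : C) where
  /-- the value -/
  val : ∀ {w : C}, (y ⊗ w ⟶ o) → (z ⊗ w ⟶ x)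
  nat : ∀ {w w' : C} (k : w' ⟶ w) (δ : y ⊗ w ⟶ o), val ((y ◁ k) ≫ δ) = (z ◁ k) ≫ val δ

/-- The action of morphisms on natural families. -/
def ParFamily.map {o x x' y y' z z' : C} (f : z' ⟶ z) (g : x ⟶ x') (h : y ⟶ y')
    (m : ParFamily o x y z) : ParFamily o x' y' z' where
  val {w} δ := (f ▷ w) ≫ m.val ((h ▷ w) ≫ δ) ≫ g
  nat k δ := by
    rw [← whisker_exchange_assoc, m.nat, Category.assoc, whisker_exchange_assoc]

/-- The par profunctor. -/
def parP (o : C) : Profunctor.{u} (C × C) C :=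
  Profunctor.ofCore
    { obj := fun a z => ParFamily o a.1 a.2 z
      map := fun f g => TypeCat.ofHom (fun m => m.map g f.1 f.2)
      map_id := by intro a b; ext m; simp [ParFamily.map]
      map_comp := by intros; ext m; simp [ParFamily.map] }

/-- A dualizing object gives a frame. -/
def frameOfDualizing {o : C} (ho : IsDualizing o) :
    Frame o (parP o) (homP o) (tensorHomP C) (unitHomP C) where
  D := Equiv.refl _
  E := Equiv.refl _
  H := Equiv.refl _
  ev m δ := ParFamily.val m δ
  D_act f g h d := by
    have e : ∀ d : _ ⟶ _, (𝟙 _ ⊗ₘ 𝟙 _) ≫ ((f ⊗ₘ g) ≫ d ≫ 𝟙 _) ≫ h = (f ⊗ₘ g) ≫ d ≫ h := by simp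
    exact e d
  E_act h e := by
    have e' : ∀ e : 𝟙_ C ⟶ _, (e ≫ 𝟙 _) ≫ h = e ≫ h := by simp
    exact e' e
  H_act h n := by
    have e : ∀ n : _ ⟶ o, 𝟙 _ ≫ h ≫ n = h ≫ n := by simp
    exact e n
  ev_act {x x' y y' z z' w} f g h m δ := by
    have e : ∀ m : ParFamily o x y z, (𝟙 _ ▷ w) ≫ ((f ▷ w) ≫
        m.val ((𝟙 _ ▷ w) ≫ (h ▷ w) ≫ δ) ≫ 𝟙 _) ≫ g = (f ▷ w) ≫ m.val ((h ▷ w) ≫ δ) ≫ g := by simp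
    refine Eq.trans ?_ (e m)
    rfl
  ev_nat m k δ := ParFamily.nat m k δ
  ev_bijective {x y y' z ε} hε := by
    constructor
    · intro m m' e
      apply ParFamily.ext
      funext w δ
      have h₁ := ParFamily.nat m (hε.curry δ) ε
      have h₂ := ParFamily.nat m' (hε.curry δ) ε
      rw [hε.curry_spec] at h₁ h₂
      rw [h₁, h₂]
      exact congrArg _ e
    · intro f
      refine ⟨⟨fun {w} δ => (z ◁ hε.curry δ) ≫ f, fun k δ => ?_⟩, ?_⟩
      · rw [← MonoidalCategory.whiskerLeft_comp_assoc]
        congr 2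
        apply hε.hom_ext
        rw [MonoidalCategory.whiskerLeft_comp_assoc, hε.curry_spec, hε.curry_spec]
      · change (z ◁ hε.curry ε) ≫ f = f
        have e : hε.curry ε = 𝟙 y' := hε.hom_ext (by
          rw [hε.curry_spec, MonoidalCategory.whiskerLeft_id, Category.id_comp])
        rw [e, MonoidalCategory.whiskerLeft_id, Category.id_comp]
  dual := ho

end Concrete

/-- A dualizing object of a monoidal category represents a right-adjoint Frobenius pseudomonoid. -/
theorem exists_frobFrame_of_isDualizing {o : C} (ho : IsDualizing o) :
    ∃ F : RightAdjointFrobenius C, Nonempty (FrobFrame F.toFrobeniusPseudomonoid o) := by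
  obtain ⟨F, ⟨R⟩⟩ := (frameOfDualizing ho).exists_frobFrame
  obtain ⟨G, rfl⟩ := R.exists_rightAdjoint
  exact ⟨G, ⟨R⟩⟩

end Prof

namespace Prof

open MonoidalCategory

variable {C : Type u} [SmallCategory C]

theorem Adj.exists_couv_eq_id {A B : Type u} [SmallCategory A] [SmallCategory B]
    {P : Profunctor.{u} A B} {Q : Profunctor.{u} B A} (h : Adj P Q) {r : B} {a : A} {p₀ : El P r a}
    (hu : Univ P p₀) : ∃ q₁ : El Q a r, couv h p₀ q₁ = 𝟙 r ∧
      ∀ {b : B} (q : El Q a b), act Q (𝟙 a) (couv h p₀ q) q₁ = q := by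
  obtain ⟨c, q, p', hq⟩ := exists_mk (ap h.unit (b := a) (a := a) (𝟙 a))
  refine ⟨act Q (𝟙 a) (hu.desc p') q, hu.hom_ext ?_, fun {b} q' => ?_⟩
  · have e := h.triangle_left p₀ q p' hq.symm
    change act P (couv h p₀ q) (𝟙 a) p' = p₀ at e
    have e' := congrArg (act P (couv h p₀ q) (𝟙 a)) (hu.act_desc p')
    rw [act_act, e, Category.comp_id] at e'
    rw [couv_act_right, e', act_id]
  · have e := h.triangle_right q' q p' hq.symm
    change act Q (𝟙 a) (couv h p' q') q = q' at e
    rw [act_act, ← couv_act_left, hu.act_desc, Category.comp_id, e]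

variable [MonoidalCategory C]

namespace FrobFrame

section Cups

variable {F : RightAdjointFrobenius C} {o : C} (R : FrobFrame F.toFrobeniusPseudomonoid o)

theorem ev_D_H {x y z w t v : C} {m : El F.M z (x, y)} {d : El F.D (y, w) t} {n : El F.H t pt}
    {d' : El F.D (z, w) v} {m' : El F.M v (x, t)}
    (e : ap F.phiR.hom (frobR m d) = frobM d' m') :
    R.D d' ≫ (ap F.unitR.hom (unR m' n) : v ⟶ x) = R.ev m (R.D d ≫ R.H n) := by
  have h := R.phiR m d d' m' ((ρ_ t).hom ≫ R.H n) e
  have e₁ : (α_ y w (𝟙_ C)).inv ≫ (R.D d ▷ 𝟙_ C) ≫ (ρ_ t).hom ≫ R.H n =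
      (y ◁ (ρ_ w).hom) ≫ R.D d ≫ R.H n := by
    rw [rightUnitor_naturality_assoc]
    simp
  have key : ∀ f : v ⟶ x, f = (ρ_ v).inv ≫ R.ev m' ((ρ_ t).hom ≫ R.H n) →
      R.D d' ≫ f = R.ev m (R.D d ≫ R.H n) := by
    rintro _ rfl
    rw [rightUnitor_inv_naturality_assoc, ← h, e₁, R.ev_nat]
    simp
  exact key _ (R.unitR m' n)

theorem snake_iff {z x r s t : C} (e : El F.E pt s) (m : El F.M s (x, r)) (d : El F.D (r, z) t)
    (n : El F.H t pt) (f : z ⟶ x) :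
    Snake e m d n f ↔ f = (λ_ z).inv ≫ (R.E e ▷ z) ≫ R.ev m (R.D d ≫ R.H n) := by
  have key : ∀ {v : C} (d' : El F.D (s, z) v) (m' : El F.M v (x, t)),
      ap F.phiR.hom (frobR m d) = frobM d' m' →
      (ap F.counitL.hom (counL d' e) : z ⟶ v) ≫ (ap F.unitR.hom (unR m' n) : v ⟶ x) =
        (λ_ z).inv ≫ (R.E e ▷ z) ≫ R.ev m (R.D d ≫ R.H n) := fun {v} d' m' hm => by
    rw [← R.ev_D_H hm]
    have := R.counitL d' e
    have h : ∀ k : z ⟶ v, k = (λ_ z).inv ≫ (R.E e ▷ z) ≫ R.D d' → ∀ l : v ⟶ x,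
        k ≫ l = (λ_ z).inv ≫ (R.E e ▷ z) ≫ R.D d' ≫ l := by
      rintro _ rfl l
      simp
    exact h _ this _
  constructor
  · rintro ⟨v, d', m', hm, rfl⟩
    exact key d' m' hm
  · rintro rfl
    obtain ⟨v, d', m', hm⟩ := exists_frobM (ap F.phiR.hom (frobR m d))
    exact ⟨v, d', m', hm.symm, (key d' m' hm.symm).symm⟩

/-- The value of a cup. -/
def cupVal {x y w : C} (c : El (cup F.toFrobeniusPseudomonoid) pt (x, y)) (δ : y ⊗ w ⟶ o) : w ⟶ x :=
  compLift (G := F.E) (F := F.M) (fun {s} e m => (λ_ w).inv ≫ (R.E e ▷ w) ≫ R.ev m δ)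
    (fun e k m => by rw [R.E_act, R.ev_left, comp_whiskerRight_assoc]) c

theorem cupVal_mk {x y w s : C} (e : El F.E pt s) (m : El F.M s (x, y)) (δ : y ⊗ w ⟶ o) :
    R.cupVal (cupMk e m) δ = (λ_ w).inv ≫ (R.E e ▷ w) ≫ R.ev m δ := rfl

theorem cupVal_nat {x y w w' : C} (c : El (cup F.toFrobeniusPseudomonoid) pt (x, y)) (k : w' ⟶ w) (δ : y ⊗ w ⟶ o) :
    R.cupVal c ((y ◁ k) ≫ δ) = k ≫ R.cupVal c δ := by
  obtain ⟨s, e, m, rfl⟩ := exists_cupMk c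
  rw [cupVal_mk, cupVal_mk, R.ev_nat, ← whisker_exchange_assoc, leftUnitor_inv_naturality_assoc]

theorem cupVal_act {x y x' y' w : C} (f : x ⟶ x') (g : y ⟶ y') (c : El (cup F.toFrobeniusPseudomonoid) pt (x, y))
    (δ : y' ⊗ w ⟶ o) :
    R.cupVal (act (cup F.toFrobeniusPseudomonoid) (𝟙 pt) (Prod.mkHom f g) c) δ = R.cupVal c ((g ▷ w) ≫ δ) ≫ f := by
  obtain ⟨s, e, m, rfl⟩ := exists_cupMk c
  rw [act_cupMk, cupVal_mk, cupVal_mk, R.ev_act]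
  simp

theorem cupVal_bijective {x y y' : C} {ε : y ⊗ y' ⟶ o} (hε : IsExactPairing ε) :
    Function.Bijective (fun c : El (cup F.toFrobeniusPseudomonoid) pt (x, y) => R.cupVal c ε) := by
  have hE : ∀ {s : C} (e : El F.E pt s), act F.E (𝟙 pt) (R.E e) (R.E.symm (𝟙 _)) = e := fun e =>
    R.E.injective (by rw [R.E_act, Equiv.apply_symm_apply, Category.id_comp])
  constructor
  · intro c c' h
    obtain ⟨s, e, m, rfl⟩ := exists_cupMk c
    obtain ⟨s', e', m', rfl⟩ := exists_cupMk c'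
    change R.cupVal (cupMk e m) ε = R.cupVal (cupMk e' m') ε at h
    rw [cupVal_mk, cupVal_mk, ← R.ev_left, ← R.ev_left, cancel_epi] at h
    rw [← hE e, ← hE e', cupMk_slide, cupMk_slide, R.ev_injective hε h]
  · intro f
    obtain ⟨m, hm⟩ := R.exists_ev (z := 𝟙_ C) hε ((λ_ y').hom ≫ f)
    refine ⟨cupMk (R.E.symm (𝟙 _)) m, ?_⟩
    change R.cupVal (cupMk _ m) ε = f
    rw [cupVal_mk, hm]
    simp

/-- The value of a cap. -/
def capVal {x y : C} (c : El (cap F.toFrobeniusPseudomonoid) (x, y) pt) : x ⊗ y ⟶ o :=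
  compLift (G := F.D) (F := F.H) (fun d n => R.D d ≫ R.H n)
    (fun d k n => by rw [R.D_right, R.H_act, Category.assoc]) c

theorem capVal_mk {x y t : C} (d : El F.D (x, y) t) (n : El F.H t pt) :
    R.capVal (capMk d n) = R.D d ≫ R.H n := rfl

theorem capVal_act {x y x' y' : C} (f : x' ⟶ x) (g : y' ⟶ y) (c : El (cap F.toFrobeniusPseudomonoid) (x, y) pt) :
    R.capVal (act (cap F.toFrobeniusPseudomonoid) (Prod.mkHom f g) (𝟙 pt) c) = (f ⊗ₘ g) ≫ R.capVal c := by
  obtain ⟨t, d, n, rfl⟩ := exists_capMk c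
  rw [act_capMk, capVal_mk, capVal_mk, R.D_left, Category.assoc]

theorem capVal_bijective {x y : C} : Function.Bijective (R.capVal (x := x) (y := y)) := by
  have hH : ∀ {s : C} (n : El F.H s pt), act F.H (R.H n) (𝟙 pt) (R.H.symm (𝟙 _)) = n := fun n =>
    R.H.injective (by rw [R.H_act, Equiv.apply_symm_apply, Category.comp_id])
  constructor
  · intro c c' h
    obtain ⟨s, d, n, rfl⟩ := exists_capMk c
    obtain ⟨s', d', n', rfl⟩ := exists_capMk c'
    rw [capVal_mk, capVal_mk, ← R.D_right, ← R.D_right] at h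
    rw [← hH n, ← hH n', ← capMk_slide, ← capMk_slide, R.D.injective h]
  · intro f
    refine ⟨capMk (R.D.symm f) (R.H.symm (𝟙 _)), ?_⟩
    rw [capVal_mk, Equiv.apply_symm_apply, Equiv.apply_symm_apply, Category.comp_id]

theorem exists_univ_H : ∃ h : El F.H o pt, R.H h = 𝟙 o ∧ Univ F.H h ∧
    ∀ {z : C} (n : El F.H z pt), act F.H (R.H n) (𝟙 pt) h = n := by
  have hH : ∀ {s : C} (n : El F.H s pt), act F.H (R.H n) (𝟙 pt) (R.H.symm (𝟙 _)) = n := fun n =>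
    R.H.injective (by rw [R.H_act, Equiv.apply_symm_apply, Category.comp_id])
  refine ⟨R.H.symm (𝟙 o), R.H.apply_symm_apply _, fun z n => ⟨R.H n, hH n, fun f hf => ?_⟩, hH⟩
  change act F.H f (𝟙 pt) _ = n at hf
  rw [← hf, R.H_act, Equiv.apply_symm_apply, Category.comp_id]

/-- `μ` is represented by the par product. -/
theorem existsUnique_phiR {x y y' z : C} {ε : y ⊗ y' ⟶ o} (hε : IsExactPairing ε) (g : z ⊗ y' ⟶ x) :
    ∃! m : El F.M z (x, y), ∃ (v : C) (d : El F.D (z, y') v) (m' : El F.M v (x, o)),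
      ap F.phiR.hom (frobR m (R.D.symm ε)) = frobM d m' ∧
      R.D d ≫ (ap F.unitR.hom (unR m' (R.H.symm (𝟙 o))) : v ⟶ x) = g := by
  have key : ∀ (m : El F.M z (x, y)) {v : C} (d : El F.D (z, y') v) (m' : El F.M v (x, o)),
      ap F.phiR.hom (frobR m (R.D.symm ε)) = frobM d m' →
      R.D d ≫ (ap F.unitR.hom (unR m' (R.H.symm (𝟙 o))) : v ⟶ x) = R.ev m ε := fun m v d m' h => by
    rw [R.ev_D_H h, Equiv.apply_symm_apply, Equiv.apply_symm_apply, Category.comp_id]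
  obtain ⟨m, hm⟩ := R.exists_ev (z := z) hε g
  obtain ⟨v, d, m', h⟩ := exists_frobM (ap F.phiR.hom (frobR m (R.D.symm ε)))
  refine ⟨m, ⟨v, d, m', h.symm, (key m d m' h.symm).trans hm⟩, ?_⟩
  rintro m₁ ⟨v₁, d₁, m₁', h₁, h₁'⟩
  exact R.ev_injective hε (((key m₁ d₁ m₁' h₁).symm.trans h₁').trans hm.symm)

end Cups

end FrobFrame

end Prof

namespace Prof

open MonoidalCategory

variable {C : Type u} [SmallCategory C] [MonoidalCategory C]

namespace FrobFrame

variable {F : RightAdjointFrobenius C} {o : C} (R : FrobFrame F.toFrobeniusPseudomonoid o)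

/-- Pairings `δ`, `δ'` on the inputs of `μ` and a morphism `θ` between their parameters that
transport `w ∈ μ*` to the pairing `ω`. -/
def Transports {p q r u v z : C} (w : El F.Mr (p, q) r) (ω : r ⊗ z ⟶ o) (δ : q ⊗ u ⟶ o)
    (δ' : p ⊗ v ⟶ o) (θ : z ⟶ u ⊗ v) : Prop :=
  ∀ {s : C} (n : El F.M s (p, q)), (s ◁ θ) ≫ R.pair n δ δ' = (couv F.adjM n w ▷ z) ≫ ω

theorem exists_transports {p q r p' q' z : C} {ε : q ⊗ q' ⟶ o} {ε' : p ⊗ p' ⟶ o}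
    (hε : IsExactPairing ε) (hε' : IsExactPairing ε') (w : El F.Mr (p, q) r) (ω : r ⊗ z ⟶ o) :
    ∃ θ : z ⟶ q' ⊗ p', R.Transports w ω ε ε' θ := by
  obtain ⟨P, u₀, hu⟩ := R.exists_univ p q
  have hπ := R.pair_exact hu hε hε'
  refine ⟨hπ.curry ((couv F.adjM u₀ w ▷ z) ≫ ω), fun {s} n => ?_⟩
  rw [← hu.act_desc n, R.pair_left, couv_act_left, whisker_exchange_assoc, hπ.curry_spec,
    comp_whiskerRight_assoc]

theorem Transports.nat {p q r u v u' v' z : C} {w : El F.Mr (p, q) r} {ω : r ⊗ z ⟶ o}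
    {δ : q ⊗ u ⟶ o} {δ' : p ⊗ v ⟶ o} {θ : z ⟶ u' ⊗ v'} {k : u' ⟶ u} {l : v' ⟶ v}
    (h : R.Transports w ω ((q ◁ k) ≫ δ) ((p ◁ l) ≫ δ') θ) :
    R.Transports w ω δ δ' (θ ≫ (k ⊗ₘ l)) := fun {s} n => by
  rw [MonoidalCategory.whiskerLeft_comp, Category.assoc, ← R.pair_nat, h n]

theorem Transports.unique {p q r p' q' z : C} {ε : q ⊗ q' ⟶ o} {ε' : p ⊗ p' ⟶ o}
    (hε : IsExactPairing ε) (hε' : IsExactPairing ε') {w : El F.Mr (p, q) r} {ω : r ⊗ z ⟶ o}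
    {θ θ' : z ⟶ q' ⊗ p'} (h : R.Transports w ω ε ε' θ) (h' : R.Transports w ω ε ε' θ') :
    θ = θ' := by
  obtain ⟨P, u₀, hu⟩ := R.exists_univ p q
  exact (R.pair_exact hu hε hε').hom_ext ((h u₀).trans (h' u₀).symm)

theorem exists_tenVal {a b z p q r : C} (c₁ : El (cup F.toFrobeniusPseudomonoid) pt (b, p))
    (c₂ : El (cup F.toFrobeniusPseudomonoid) pt (a, q)) (w : El F.Mr (p, q) r)
    (ω : r ⊗ z ⟶ o) :
    ∃ f : z ⟶ a ⊗ b, ∀ {u v : C} (δ : q ⊗ u ⟶ o) (δ' : p ⊗ v ⟶ o) (θ : z ⟶ u ⊗ v),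
      R.Transports w ω δ δ' θ → θ ≫ (R.cupVal c₂ δ ⊗ₘ R.cupVal c₁ δ') = f := by
  obtain ⟨q', ε, hε⟩ := R.dual.1 q
  obtain ⟨p', ε', hε'⟩ := R.dual.1 p
  obtain ⟨θ₀, h₀⟩ := R.exists_transports hε hε' w ω
  refine ⟨θ₀ ≫ (R.cupVal c₂ ε ⊗ₘ R.cupVal c₁ ε'), fun {u v} δ δ' θ h => ?_⟩
  rw [← hε.curry_spec δ, ← hε'.curry_spec δ'] at h
  rw [← hε.curry_spec δ, ← hε'.curry_spec δ', R.cupVal_nat, R.cupVal_nat, ← tensorHom_comp_tensorHom,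
    ← Category.assoc, Transports.unique R hε hε' (Transports.nat R h) h₀]

/-- The value of a tuple in the derived tensor product. -/
noncomputable def tenTupleVal {a b z p q r : C}
    (c₁ : El (cup F.toFrobeniusPseudomonoid) pt (b, p))
    (c₂ : El (cup F.toFrobeniusPseudomonoid) pt (a, q)) (w : El F.Mr (p, q) r)
    (ω : r ⊗ z ⟶ o) : z ⟶ a ⊗ b := (R.exists_tenVal c₁ c₂ w ω).choose

theorem tenTupleVal_eq {a b z p q r u v : C} (c₁ : El (cup F.toFrobeniusPseudomonoid) pt (b, p))
    (c₂ : El (cup F.toFrobeniusPseudomonoid) pt (a, q)) {w : El F.Mr (p, q) r}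
    {ω : r ⊗ z ⟶ o} {δ : q ⊗ u ⟶ o} {δ' : p ⊗ v ⟶ o} {θ : z ⟶ u ⊗ v}
    (h : R.Transports w ω δ δ' θ) :
    R.tenTupleVal c₁ c₂ w ω = θ ≫ (R.cupVal c₂ δ ⊗ₘ R.cupVal c₁ δ') :=
  ((R.exists_tenVal c₁ c₂ w ω).choose_spec δ δ' θ h).symm

theorem tenTupleVal_slide₁ {a b z p q r p' q' : C}
    (c₁ : El (cup F.toFrobeniusPseudomonoid) pt (b, p))
    (c₂ : El (cup F.toFrobeniusPseudomonoid) pt (a, q)) (k : p ⟶ p') (l : q ⟶ q')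
    (w : El F.Mr (p', q') r) (ω : r ⊗ z ⟶ o) :
    R.tenTupleVal (act _ (𝟙 pt) (Prod.mkHom (𝟙 b) k) c₁) (act _ (𝟙 pt) (Prod.mkHom (𝟙 a) l) c₂)
      w ω = R.tenTupleVal c₁ c₂ (act F.Mr (Prod.mkHom k l) (𝟙 r) w) ω := by
  obtain ⟨q'', ε, hε⟩ := R.dual.1 q'
  obtain ⟨p'', ε', hε'⟩ := R.dual.1 p'
  obtain ⟨θ, h⟩ := R.exists_transports hε hε' w ω
  rw [R.tenTupleVal_eq _ _ h, R.cupVal_act, R.cupVal_act, Category.comp_id, Category.comp_id]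
  refine (R.tenTupleVal_eq _ _ (fun {s} n => ?_)).symm
  have e := R.pair_act (𝟙 s) k l n ε ε'
  rw [id_whiskerRight, Category.id_comp] at e
  rw [← e, h, couv_slide]

theorem tenTupleVal_slide₂ {a b z p q r r' : C}
    (c₁ : El (cup F.toFrobeniusPseudomonoid) pt (b, p))
    (c₂ : El (cup F.toFrobeniusPseudomonoid) pt (a, q)) (k : r ⟶ r')
    (w : El F.Mr (p, q) r) (ω : r' ⊗ z ⟶ o) :
    R.tenTupleVal c₁ c₂ (act F.Mr (𝟙 (p, q)) k w) ω = R.tenTupleVal c₁ c₂ w ((k ▷ z) ≫ ω) := by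
  obtain ⟨q', ε, hε⟩ := R.dual.1 q
  obtain ⟨p', ε', hε'⟩ := R.dual.1 p
  obtain ⟨θ, h⟩ := R.exists_transports hε hε' (act F.Mr (𝟙 (p, q)) k w) ω
  rw [R.tenTupleVal_eq _ _ h]
  refine (R.tenTupleVal_eq _ _ (fun {s} n => ?_)).symm
  rw [h, couv_act_right, comp_whiskerRight_assoc]

/-- The derived tensor product is represented by the tensor product. -/
noncomputable def tenVal {a b z : C} : El (Ten F) z (a, b) → (z ⟶ a ⊗ b) :=
  liftTen (fun c₁ c₂ w c => R.tenTupleVal c₁ c₂ w (R.capVal c))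
    (fun c₁ c₂ k l w c => R.tenTupleVal_slide₁ c₁ c₂ k l w _)
    (fun c₁ c₂ w k c => by rw [R.tenTupleVal_slide₂, R.capVal_act, tensorHom_id])

theorem tenVal_mk {a b z p q r : C} (c₁ : El (cup F.toFrobeniusPseudomonoid) pt (b, p))
    (c₂ : El (cup F.toFrobeniusPseudomonoid) pt (a, q)) (w : El F.Mr (p, q) r)
    (c : El (cap F.toFrobeniusPseudomonoid) (r, z) pt) :
    R.tenVal (tenPair c₁ c₂ w c) = R.tenTupleVal c₁ c₂ w (R.capVal c) :=
  liftTen_mk (fun c₁ c₂ w c => R.tenTupleVal c₁ c₂ w (R.capVal c))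
    (fun c₁ c₂ k l w c => R.tenTupleVal_slide₁ c₁ c₂ k l w _)
    (fun c₁ c₂ w k c => by rw [R.tenTupleVal_slide₂, R.capVal_act, tensorHom_id]) c₁ c₂ w c

theorem tenVal_act {a a' b b' z z' : C} (f : a ⟶ a') (g : b ⟶ b') (h : z' ⟶ z)
    (τ : El (Ten F) z (a, b)) :
    R.tenVal (act (Ten F) h (Prod.mkHom f g) τ) = h ≫ R.tenVal τ ≫ (f ⊗ₘ g) := by
  obtain ⟨p, q, r, c₁, c₂, w, c, rfl⟩ := exists_tenPair τ
  obtain ⟨q', ε, hε⟩ := R.dual.1 q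
  obtain ⟨p', ε', hε'⟩ := R.dual.1 p
  obtain ⟨θ, hθ⟩ := R.exists_transports hε hε' w (R.capVal c)
  have hθ' : R.Transports w (R.capVal (act _ (Prod.mkHom (𝟙 r) h) (𝟙 pt) c)) ε ε' (h ≫ θ) :=
    fun {s} n => by
      rw [R.capVal_act, id_tensorHom, MonoidalCategory.whiskerLeft_comp, Category.assoc, hθ n,
        whisker_exchange_assoc]
  rw [act_tenPair, tenVal_mk, tenVal_mk, R.tenTupleVal_eq _ _ hθ, R.tenTupleVal_eq _ _ hθ',
    R.cupVal_act, R.cupVal_act, id_whiskerRight, id_whiskerRight, Category.id_comp,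
    Category.id_comp, ← tensorHom_comp_tensorHom, Category.assoc, Category.assoc]

theorem tenVal_bijective {a b z : C} : Function.Bijective (R.tenVal (a := a) (b := b) (z := z)) := by
  obtain ⟨q, ε, hε⟩ := R.dual.2 a
  obtain ⟨p, ε', hε'⟩ := R.dual.2 b
  obtain ⟨c₁, h₁⟩ := (R.cupVal_bijective (x := b) hε').2 (𝟙 b)
  obtain ⟨c₂, h₂⟩ := (R.cupVal_bijective (x := a) hε).2 (𝟙 a)
  change R.cupVal c₁ ε' = _ at h₁
  change R.cupVal c₂ ε = _ at h₂
  obtain ⟨P, u₀, hu⟩ := R.exists_univ p q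
  obtain ⟨w₁, hw, hw'⟩ := F.adjM.exists_couv_eq_id hu
  have hπ := R.pair_exact hu hε hε'
  have hc : ∀ {x x' y : C} {η : y ⊗ x ⟶ o} (hη : IsExactPairing η)
      {c₀ : El (cup F.toFrobeniusPseudomonoid) pt (x, y)} (_ : R.cupVal c₀ η = 𝟙 x)
      (c : El (cup F.toFrobeniusPseudomonoid) pt (x, x')),
      ∃ k : y ⟶ x', act _ (𝟙 pt) (Prod.mkHom (𝟙 x) k) c₀ = c := by
    intro x x' y η hη c₀ h₀ c
    obtain ⟨v, ε₁, hε₁⟩ := R.dual.1 x'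
    refine ⟨hε₁.lcurry ((y ◁ R.cupVal c ε₁) ≫ η), (R.cupVal_bijective hε₁).1 ?_⟩
    change R.cupVal (act _ _ _ c₀) ε₁ = R.cupVal c ε₁
    rw [R.cupVal_act, hε₁.lcurry_spec, R.cupVal_nat, h₀, Category.comp_id, Category.comp_id]
  have normal : ∀ τ : El (Ten F) z (a, b), ∃ c : El (cap F.toFrobeniusPseudomonoid) (P, z) pt,
      tenPair c₁ c₂ w₁ c = τ := by
    intro τ
    obtain ⟨p₁, q₁, r, c₁', c₂', w, c, rfl⟩ := exists_tenPair τ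
    obtain ⟨k, rfl⟩ := hc hε' h₁ c₁'
    obtain ⟨l, rfl⟩ := hc hε h₂ c₂'
    exact ⟨act _ (Prod.mkHom (couv F.adjM u₀ (act F.Mr (Prod.mkHom k l) (𝟙 r) w)) (𝟙 z)) (𝟙 pt) c,
      by rw [tenPair_slide₁, ← tenPair_slide₂, hw']⟩
  have val : ∀ c : El (cap F.toFrobeniusPseudomonoid) (P, z) pt,
      (P ◁ R.tenVal (tenPair c₁ c₂ w₁ c)) ≫ R.pair u₀ ε ε' = R.capVal c := by
    intro c
    obtain ⟨θ, hθ⟩ := R.exists_transports hε hε' w₁ (R.capVal c)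
    rw [tenVal_mk, R.tenTupleVal_eq _ _ hθ, h₁, h₂, id_tensorHom_id, Category.comp_id, hθ, hw,
      id_whiskerRight, Category.id_comp]
  constructor
  · intro τ τ' e
    obtain ⟨c, rfl⟩ := normal τ
    obtain ⟨c', rfl⟩ := normal τ'
    rw [R.capVal_bijective.1 ((val c).symm.trans ((congrArg (fun t => (P ◁ t) ≫ _) e).trans (val c')))]
  · intro f
    obtain ⟨c, hc⟩ := R.capVal_bijective.2 ((P ◁ f) ≫ R.pair u₀ ε ε')
    exact ⟨tenPair c₁ c₂ w₁ c, hπ.hom_ext ((val c).trans hc)⟩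

theorem tenCounit_iff {a b x z : C} (τ : El (Ten F) z (a, b)) (δ : El F.D (a, b) x) (f : z ⟶ x) :
    TenCounit τ δ f ↔ f = R.tenVal τ ≫ R.D δ := by
  have key : ∀ {p q r s₁ s₂ t v u : C} (e₁ : El F.E pt s₁) (m₁ : El F.M s₁ (b, p))
      (e₂ : El F.E pt s₂) (m₂ : El F.M s₂ (a, q)) (w : El F.Mr (p, q) r) (d : El F.D (r, z) t)
      (n : El F.H t pt) (d' : El F.D (a, s₁) v) (m' : El F.M v (x, p))
      (m₃ : El F.M s₂ (x, u)) (m₄ : El F.M u (p, q)),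
      ap F.phiL.hom (frobL m₁ δ) = frobM d' m' →
      ap F.assoc.hom (mulL m₂ (act F.M (couR d' e₁) (𝟙 (x, p)) m')) = mulR m₃ m₄ →
      (λ_ z).inv ≫ (R.E e₂ ▷ z) ≫
        R.ev (act F.M (𝟙 s₂) (Prod.mkHom (𝟙 x) (couv F.adjM m₄ w)) m₃) (R.D d ≫ R.H n) =
      R.tenVal (tenMk e₁ m₁ e₂ m₂ w d n) ≫ R.D δ := by
    intro p q r s₁ s₂ t v u e₁ m₁ e₂ m₂ w d n d' m' m₃ m₄ h₁ h₂
    obtain ⟨q', ε, hε⟩ := R.dual.1 q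
    obtain ⟨p', ε', hε'⟩ := R.dual.1 p
    obtain ⟨θ, hθ⟩ := R.exists_transports hε hε' w (R.D d ≫ R.H n)
    have hc : couR d' e₁ = (ρ_ a).inv ≫ (a ◁ R.E e₁) ≫ R.D d' := R.counitR d' e₁
    have hl := R.phiL m₁ δ d' m' ε' h₁
    have ha := R.assoc _ _ _ _ ε ε' h₂
    rw [R.ev_left, hc, comp_whiskerRight_assoc, comp_whiskerRight_assoc, ← hl] at ha
    have ha' := (Iso.eq_inv_comp _).2 ha.symm
    rw [tenMk_eq, tenVal_mk, capVal_mk, R.tenTupleVal_eq _ _ hθ, R.ev_slide, ← hθ m₄, R.ev_nat,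
      ha', cupVal_mk, cupVal_mk]
    generalize R.ev m₂ ε = f₂
    generalize R.ev m₁ ε' = f₁
    generalize R.E e₁ = g₁
    generalize R.E e₂ = g₂
    generalize R.D δ = g
    rw [← whisker_exchange_assoc, ← leftUnitor_inv_naturality_assoc, Category.assoc]
    congr 1
    have e₁ : (λ_ q').inv ≫ (g₂ ▷ q') ≫ f₂ = ((λ_ q').inv ≫ g₂ ▷ q') ≫ f₂ := by simp
    have e₂ : f₂ ▷ p' ≫ (ρ_ a).inv ▷ p' ≫ (a ◁ g₁) ▷ p' ≫ (α_ a s₁ p').hom ≫ a ◁ f₁ ≫ g =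
        f₂ ▷ p' ≫ (a ◁ ((λ_ p').inv ≫ (g₁ ▷ p') ≫ f₁)) ≫ g := by monoidal
    rw [e₂, MonoidalCategory.tensorHom_def, comp_whiskerRight, comp_whiskerRight]
    monoidal
  constructor
  · rintro ⟨p, q, r, s₁, s₂, t, v, u, e₁, m₁, e₂, m₂, w, d, n, d', m', m₃, m₄, rfl, h₁, h₂, h₃⟩
    exact ((R.snake_iff _ _ _ _ _).1 h₃).trans (key e₁ m₁ e₂ m₂ w d n d' m' m₃ m₄ h₁ h₂)
  · rintro rfl
    obtain ⟨p, q, r, s₁, s₂, t, e₁, m₁, e₂, m₂, w, d, n, rfl⟩ := exists_tenMk τ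
    obtain ⟨v, d', m', h₁⟩ := exists_frobM (ap F.phiL.hom (frobL m₁ δ))
    obtain ⟨u, m₃, m₄, h₂⟩ := exists_mulR
      (ap F.assoc.hom (mulL m₂ (act F.M (couR d' e₁) (𝟙 (x, p)) m')))
    exact ⟨p, q, r, s₁, s₂, t, v, u, e₁, m₁, e₂, m₂, w, d, n, d', m', m₃, m₄, rfl, h₁.symm, h₂.symm,
      (R.snake_iff _ _ _ _ _).2 (key e₁ m₁ e₂ m₂ w d n d' m' m₃ m₄ h₁.symm h₂.symm).symm⟩

/-- The value of a tuple in the derived unit. -/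
noncomputable def uniTupleVal {r z : C} (w : El F.Hr pt r) (ω : r ⊗ z ⟶ o) : z ⟶ 𝟙_ C :=
  (isExactPairing_rightUnitor R.dual).curry ((couv F.adjH (R.H.symm (𝟙 o)) w ▷ z) ≫ ω)

theorem uniTupleVal_spec {r z s : C} (w : El F.Hr pt r) (ω : r ⊗ z ⟶ o) (n : El F.H s pt) :
    (s ◁ R.uniTupleVal w ω) ≫ (ρ_ s).hom ≫ R.H n = (couv F.adjH n w ▷ z) ≫ ω := by
  have hn : act F.H (R.H n) (𝟙 pt) (R.H.symm (𝟙 o)) = n := R.H.injective (by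
    rw [R.H_act, Equiv.apply_symm_apply, Category.comp_id])
  have e := (isExactPairing_rightUnitor R.dual).curry_spec
    ((couv F.adjH (R.H.symm (𝟙 o)) w ▷ z) ≫ ω)
  conv_rhs => rw [← hn, couv_act_left, comp_whiskerRight_assoc, ← e]
  rw [← whisker_exchange_assoc, rightUnitor_naturality]
  rfl

theorem uniTupleVal_eq {r z : C} {w : El F.Hr pt r} {ω : r ⊗ z ⟶ o} {f : z ⟶ 𝟙_ C}
    {h : El F.H o pt} (hh : R.H h = 𝟙 o) (e : (o ◁ f) ≫ (ρ_ o).hom = (couv F.adjH h w ▷ z) ≫ ω) :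
    R.uniTupleVal w ω = f := by
  have e' := R.uniTupleVal_spec w ω h
  rw [hh, Category.comp_id] at e'
  exact (isExactPairing_rightUnitor R.dual).hom_ext (e'.trans e.symm)

/-- The derived unit is represented by the unit object. -/
noncomputable def uniVal {z : C} : El (Uni F) z pt → (z ⟶ 𝟙_ C) :=
  liftUni (fun w c => R.uniTupleVal w (R.capVal c)) (fun w k c => by
    refine R.uniTupleVal_eq (R.H.apply_symm_apply _) ?_
    have e := R.uniTupleVal_spec w (R.capVal (act _ (Prod.mkHom k (𝟙 z)) (𝟙 pt) c))
      (R.H.symm (𝟙 o))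
    rw [Equiv.apply_symm_apply, Category.comp_id] at e
    rw [e, R.capVal_act, couv_act_right, comp_whiskerRight_assoc, tensorHom_id])

theorem uniVal_mk {z r t : C} (w : El F.Hr pt r) (d : El F.D (r, z) t) (n : El F.H t pt) :
    R.uniVal (uniMk w d n) = R.uniTupleVal w (R.D d ≫ R.H n) := by
  refine (liftUni_mk (fun w c => R.uniTupleVal w (R.capVal c)) (fun w k c => ?_) w d n)
  refine R.uniTupleVal_eq (R.H.apply_symm_apply _) ?_
  have e := R.uniTupleVal_spec w (R.capVal (act _ (Prod.mkHom k (𝟙 z)) (𝟙 pt) c))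
    (R.H.symm (𝟙 o))
  rw [Equiv.apply_symm_apply, Category.comp_id] at e
  rw [e, R.capVal_act, couv_act_right, comp_whiskerRight_assoc, tensorHom_id]

theorem uniVal_act {z z' : C} (h : z' ⟶ z) (ι : El (Uni F) z pt) :
    R.uniVal (act (Uni F) h (𝟙 pt) ι) = h ≫ R.uniVal ι := by
  obtain ⟨r, t, w, d, n, rfl⟩ := exists_uniMk ι
  obtain ⟨h₀, hh, -, -⟩ := R.exists_univ_H
  have e := R.uniTupleVal_spec w (R.D d ≫ R.H n) h₀
  rw [hh, Category.comp_id] at e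
  rw [act_uniMk, uniVal_mk, uniVal_mk]
  refine R.uniTupleVal_eq hh ?_
  rw [MonoidalCategory.whiskerLeft_comp, Category.assoc, e, R.D_left, id_tensorHom, Category.assoc,
    whisker_exchange_assoc]

theorem uniVal_bijective {z : C} : Function.Bijective (R.uniVal (z := z)) := by
  obtain ⟨h₀, hh, hu, -⟩ := R.exists_univ_H
  obtain ⟨w₁, hw, hw'⟩ := F.adjH.exists_couv_eq_id hu
  have normal : ∀ ι : El (Uni F) z pt, ∃ d : El F.D (o, z) o, uniMk w₁ d h₀ = ι := by
    intro ι
    obtain ⟨r, t, w, d, n, rfl⟩ := exists_uniMk ι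
    refine ⟨act F.D (Prod.mkHom (couv F.adjH h₀ w) (𝟙 z)) (hu.desc n) d, ?_⟩
    have e : act F.D (Prod.mkHom (couv F.adjH h₀ w) (𝟙 z)) (hu.desc n) d =
        act F.D (Prod.mkHom (couv F.adjH h₀ w) (𝟙 z)) (𝟙 o) (act F.D (𝟙 (r, z)) (hu.desc n) d) := by
      rw [act_act, Category.comp_id, Category.comp_id]
    rw [e, ← uniMk_slide, hw', uniMk_slide', hu.act_desc]
  have val : ∀ d : El F.D (o, z) o, (o ◁ R.uniVal (uniMk w₁ d h₀)) ≫ (ρ_ o).hom = R.D d := by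
    intro d
    have e := R.uniTupleVal_spec w₁ (R.D d ≫ R.H h₀) h₀
    rw [hh, hw, id_whiskerRight] at e
    simp only [Category.id_comp, Category.comp_id] at e
    rw [uniVal_mk, hh, Category.comp_id, e]
  constructor
  · intro ι ι' e
    obtain ⟨d, rfl⟩ := normal ι
    obtain ⟨d', rfl⟩ := normal ι'
    rw [R.D.injective ((val d).symm.trans ((congrArg (fun t => (o ◁ t) ≫ _) e).trans (val d')))]
  · intro f
    refine ⟨uniMk w₁ (R.D.symm ((o ◁ f) ≫ (ρ_ o).hom)) h₀,
      (isExactPairing_rightUnitor R.dual).hom_ext ((val _).trans (R.D.apply_symm_apply _))⟩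

theorem uniCounit_iff {x z : C} (ι : El (Uni F) z pt) (e : El F.E pt x) (f : z ⟶ x) :
    UniCounit ι e f ↔ f = R.uniVal ι ≫ R.E e := by
  have key : ∀ {r t u : C} (w : El F.Hr pt r) (d : El F.D (r, z) t) (n : El F.H t pt)
      (m : El F.M x (x, u)) (n' : El F.H u pt), uniR m n' = 𝟙 x →
      (λ_ z).inv ≫ (R.E e ▷ z) ≫
        R.ev (act F.M (𝟙 x) (Prod.mkHom (𝟙 x) (couv F.adjH n' w)) m) (R.D d ≫ R.H n) =
      R.uniVal (uniMk w d n) ≫ R.E e := by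
    intro r t u w d n m n' hm
    have hm' : uniR m n' = (ρ_ x).inv ≫ R.ev m ((ρ_ u).hom ≫ R.H n') := R.unitR m n'
    rw [hm] at hm'
    replace hm' := (Iso.eq_inv_comp _).1 hm'
    rw [Category.comp_id] at hm'
    rw [R.ev_slide, uniVal_mk, ← R.uniTupleVal_spec w _ n', R.ev_nat, ← hm',
      ← whisker_exchange_assoc, rightUnitor_naturality, ← leftUnitor_inv_naturality_assoc]
    congr 1
    monoidal
  constructor
  · rintro ⟨r, t, u, w, d, n, m, n', rfl, h₁, h₂⟩
    exact ((R.snake_iff _ _ _ _ _).1 h₂).trans (key w d n m n' h₁)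
  · rintro rfl
    obtain ⟨r, t, w, d, n, rfl⟩ := exists_uniMk ι
    obtain ⟨h₀, hh, hu, -⟩ := R.exists_univ_H
    obtain ⟨m, hm⟩ := exists_uniR_eq hu (𝟙 x)
    exact ⟨r, t, o, w, d, n, m, h₀, rfl, hm, (R.snake_iff _ _ _ _ _).2 (key w d n m h₀ hm).symm⟩

end FrobFrame

end Prof

namespace Prof

open MonoidalCategory

variable {C : Type u} [SmallCategory C] [MonoidalCategory C]

namespace FrobFrame

variable {F : RightAdjointFrobenius C} {o : C} (R : FrobFrame F.toFrobeniusPseudomonoid o)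

theorem tenVal_right {a b b' z : C} (k : b ⟶ b') (τ : El (Ten F) z (a, b)) :
    R.tenVal (act (Ten F) (𝟙 z) (Prod.mkHom (𝟙 a) k) τ) = R.tenVal τ ≫ (a ◁ k) := by
  rw [R.tenVal_act, Category.id_comp, id_tensorHom]

theorem tenVal_left {a a' b z : C} (k : a ⟶ a') (τ : El (Ten F) z (a, b)) :
    R.tenVal (act (Ten F) (𝟙 z) (Prod.mkHom k (𝟙 b)) τ) = R.tenVal τ ≫ (k ▷ b) := by
  rw [R.tenVal_act, Category.id_comp, tensorHom_id]

theorem tenVal_precomp {a b z z' : C} (h : z' ⟶ z) (τ : El (Ten F) z (a, b)) :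
    R.tenVal (act (Ten F) h (𝟙 (a, b)) τ) = h ≫ R.tenVal τ := by
  have e := R.tenVal_act (𝟙 a) (𝟙 b) h τ
  rwa [id_tensorHom_id, Category.comp_id] at e

theorem D_whisker {a b b' x : C} (k : b' ⟶ b) (d : El F.D (a, b) x) :
    R.D (act F.D (Prod.mkHom (𝟙 a) k) (𝟙 x) d) = (a ◁ k) ≫ R.D d := by
  rw [R.D_left, id_tensorHom]

theorem exists_tenVal_eq {a b z : C} (f : z ⟶ a ⊗ b) : ∃ τ : El (Ten F) z (a, b), R.tenVal τ = f :=
  R.tenVal_bijective.2 f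

/-- Every morphism `a ⊗ x ⟶ b ⊗ y` is the value of a tuple in the source of the trace. -/
theorem exists_loop {a b x y : C} (f : a ⊗ x ⟶ b ⊗ y) : ∃ (x' : C) (m : El F.M a (b ⊗ y, x'))
    (τ : El (Ten F) (b ⊗ y) (b, y)) (c : El (cap F.toFrobeniusPseudomonoid) (x', x) pt),
    IsExactPairing (R.capVal c) ∧ R.tenVal τ = 𝟙 _ ∧ R.ev m (R.capVal c) = f := by
  obtain ⟨x', ε, hε⟩ := R.dual.2 x
  obtain ⟨c, rfl⟩ := R.capVal_bijective.2 ε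
  obtain ⟨τ, hτ⟩ := R.exists_tenVal_eq (𝟙 (b ⊗ y))
  obtain ⟨m, hm⟩ := R.exists_ev hε f
  exact ⟨x', m, τ, c, hε, hτ, hm⟩

theorem loopPair_ext {a b w w' x y y' : C} {m : El F.M a (w, y)} {τ : El (Ten F) w (b, x)}
    {c : El (cap F.toFrobeniusPseudomonoid) (y, x) pt} {m' : El F.M a (w', y')}
    {τ' : El (Ten F) w' (b, x)} {c' : El (cap F.toFrobeniusPseudomonoid) (y', x) pt}
    (e : R.ev m (R.capVal c) ≫ R.tenVal τ = R.ev m' (R.capVal c') ≫ R.tenVal τ') :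
    loopPair m τ c = loopPair m' τ' c' := by
  obtain ⟨y₁, m₁, τ₁, c₁, hε, hτ, hm⟩ := R.exists_loop (R.ev m (R.capVal c) ≫ R.tenVal τ)
  have key : ∀ {w y : C} (m : El F.M a (w, y)) (τ : El (Ten F) w (b, x))
      (c : El (cap F.toFrobeniusPseudomonoid) (y, x) pt),
      R.ev m₁ (R.capVal c₁) = R.ev m (R.capVal c) ≫ R.tenVal τ →
      loopPair m₁ τ₁ c₁ = loopPair m τ c := by
    intro w y m τ c h
    have h₁ : act (Ten F) (R.tenVal τ) (𝟙 (b, x)) τ₁ = τ :=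
      R.tenVal_bijective.1 (by rw [R.tenVal_precomp, hτ, Category.comp_id])
    have h₂ : act _ (Prod.mkHom (hε.lcurry (R.capVal c)) (𝟙 x)) (𝟙 pt) c₁ = c :=
      R.capVal_bijective.1 (by rw [R.capVal_act, tensorHom_id, hε.lcurry_spec])
    have h₃ : m₁ = act F.M (𝟙 a) (Prod.mkHom (R.tenVal τ) (𝟙 y₁))
        (act F.M (𝟙 a) (Prod.mkHom (𝟙 w) (hε.lcurry (R.capVal c))) m) :=
      R.ev_injective hε (by rw [R.ev_mid, R.ev_slide, hε.lcurry_spec, h])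
    have e := loopPair_slide₂ m τ (𝟙 x) (hε.lcurry (R.capVal c)) c₁
    have e' : act (Ten F) (𝟙 w) (Prod.mkHom (𝟙 b) (𝟙 x)) τ = τ := act_id _ _
    rw [e', h₂] at e
    rw [h₃, loopPair_slide₁, h₁, e]
  exact (key m τ c hm).symm.trans (key m' τ' c' (hm.trans e))

/-- The 2-cell `tr` and the function `θ` on morphisms have the same values. -/
def Realizes (tr : Loop F ⟶ idP C) (θ : ∀ a b x : C, (a ⊗ x ⟶ b ⊗ x) → (a ⟶ b)) : Prop :=
  ∀ {a b w x y : C} (m : El F.M a (w, y)) (τ : El (Ten F) w (b, x))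
    (c : El (cap F.toFrobeniusPseudomonoid) (y, x) pt),
    (ap tr (loopPair m τ c) : a ⟶ b) = θ a b x (R.ev m (R.capVal c) ≫ R.tenVal τ)

theorem exists_traceAt (tr : Loop F ⟶ idP C) {a b x z : C} (δ : El F.D (a, x) z)
    (τ : El (Ten F) z (b, x)) : ∃ (y : C) (m : El F.M a (z, y))
      (c : El (cap F.toFrobeniusPseudomonoid) (y, x) pt), R.ev m (R.capVal c) = R.D δ ∧
      TraceAt tr δ τ (ap tr (loopPair m τ c)) := by
  obtain ⟨h, hh, hu, -⟩ := R.exists_univ_H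
  obtain ⟨m₀, hm₀⟩ := exists_uniR_eq hu (𝟙 z)
  obtain ⟨y, m, d, e⟩ := exists_frobR (ap F.phiR.inv (frobM δ m₀))
  have e' : ap F.phiR.hom (frobR m d) = frobM δ m₀ := by rw [e, ap_inv_hom]
  refine ⟨y, m, capMk d h, ?_, o, y, m₀, h, m, d, hm₀, e', rfl⟩
  rw [capVal_mk, ← R.ev_D_H e']
  exact (congrArg (fun t => R.D δ ≫ t) hm₀).trans (Category.comp_id _)

theorem traceAt_loop {tr : Loop F ⟶ idP C} {a b x z : C} {δ : El F.D (a, x) z}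
    {τ : El (Ten F) z (b, x)} {f : a ⟶ b} (h : TraceAt tr δ τ f) : ∃ (y : C) (m : El F.M a (z, y))
      (c : El (cap F.toFrobeniusPseudomonoid) (y, x) pt), R.ev m (R.capVal c) = R.D δ ∧
      f = ap tr (loopPair m τ c) := by
  obtain ⟨u, y, m₀, n, m, d, h₀, e, rfl⟩ := h
  refine ⟨y, m, capMk d n, ?_, rfl⟩
  rw [capVal_mk, ← R.ev_D_H e]
  exact (congrArg (fun t => R.D δ ≫ t) h₀).trans (Category.comp_id _)

variable {R}

theorem Realizes.traceAt_iff {tr : Loop F ⟶ idP C}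
    {θ : ∀ a b x : C, (a ⊗ x ⟶ b ⊗ x) → (a ⟶ b)} (hθ : R.Realizes tr θ) {a b x z : C}
    (δ : El F.D (a, x) z) (τ : El (Ten F) z (b, x)) (f : a ⟶ b) :
    TraceAt tr δ τ f ↔ f = θ a b x (R.D δ ≫ R.tenVal τ) := by
  constructor
  · intro h
    obtain ⟨y, m, c, e, rfl⟩ := R.traceAt_loop h
    rw [← e]
    exact hθ m τ c
  · rintro rfl
    obtain ⟨y, m, c, e, h⟩ := R.exists_traceAt tr δ τ
    have e' := hθ m τ c
    rw [e] at e'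
    exact (congrArg (TraceAt tr δ τ) e').mp h

theorem realizes_of_traceAt_iff {tr : Loop F ⟶ idP C}
    {θ : ∀ a b x : C, (a ⊗ x ⟶ b ⊗ x) → (a ⟶ b)}
    (h : ∀ {a b x z : C} (δ : El F.D (a, x) z) (τ : El (Ten F) z (b, x)) (f : a ⟶ b),
      TraceAt tr δ τ f → f = θ a b x (R.D δ ≫ R.tenVal τ)) : R.Realizes tr θ := by
  intro a b w x y m τ c
  obtain ⟨y', m', c', e, h'⟩ := R.exists_traceAt tr (R.D.symm (R.ev m (R.capVal c))) τ
  have h₁ := h _ _ _ h'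
  rw [Equiv.apply_symm_apply] at h₁ e
  exact (congrArg (fun t => (ap tr t : a ⟶ b)) (R.loopPair_ext (by rw [e]))).trans h₁

variable (R)

theorem tenAssoc_iff {b p q z s s' : C} (τ₁ : El (Ten F) z (b, s)) (τ₂ : El (Ten F) s (p, q))
    (τ₃ : El (Ten F) z (s', q)) (τ₄ : El (Ten F) s' (b, p)) :
    TenAssoc τ₁ τ₂ τ₃ τ₄ ↔
      R.tenVal τ₁ ≫ (b ◁ R.tenVal τ₂) ≫ (α_ b p q).inv = R.tenVal τ₃ ≫ (R.tenVal τ₄ ▷ q) := by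
  constructor
  · intro h
    obtain ⟨t, δ₃, δ₄, e⟩ := exists_comulR (ap F.coassoc.hom
      (comulL (R.D.symm (𝟙 ((b ⊗ p) ⊗ q))) (R.D.symm (𝟙 (b ⊗ p)))))
    have h₁ := R.coassoc _ _ _ _ e.symm
    have h₂ := h _ _ _ _ _ _ _ _ e.symm ((R.tenCounit_iff _ _ _).2 rfl)
      ((R.tenCounit_iff _ _ _).2 rfl) ((R.tenCounit_iff _ _ _).2 rfl)
      ((R.tenCounit_iff _ _ _).2 rfl)
    rw [Equiv.apply_symm_apply, Equiv.apply_symm_apply, id_whiskerRight, Category.comp_id] at h₁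
    rw [R.tenVal_right, R.tenVal_left, Equiv.apply_symm_apply, Equiv.apply_symm_apply,
      Category.comp_id, Category.comp_id, MonoidalCategory.whiskerLeft_comp, Category.assoc,
      Category.assoc, (Iso.eq_inv_comp _).2 h₁, Category.comp_id] at h₂
    exact h₂
  · intro h x t t' δ₁ δ₂ δ₃ δ₄ k k' l l' e h₁ h₂ h₃ h₄
    rw [R.tenCounit_iff] at h₁ h₂ h₃ h₄
    subst h₁ h₃
    have e' := R.coassoc _ _ _ _ e
    rw [h₂, h₄, R.tenVal_right, R.tenVal_left, comp_whiskerRight, Category.assoc, Category.assoc,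
      Category.assoc, ← e', reassoc_of% h.symm]
    simp

end FrobFrame

end Prof

namespace Prof

open MonoidalCategory

variable {C : Type u} [SmallCategory C] [MonoidalCategory C]

namespace FrobFrame

variable {F : RightAdjointFrobenius C} {o : C} (R : FrobFrame F.toFrobeniusPseudomonoid o)

theorem exists_realizes (tr : Loop F ⟶ idP C) :
    ∃ θ : ∀ a b x : C, (a ⊗ x ⟶ b ⊗ x) → (a ⟶ b), R.Realizes tr θ := by
  choose x' m' τ' c' hc hτ hm using fun (a b x : C) (f : a ⊗ x ⟶ b ⊗ x) => R.exists_loop f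
  refine ⟨fun a b x f => uhel (ap tr (loopPair (m' a b x f) (τ' a b x f) (c' a b x f))), ?_⟩
  intro a b w x y m τ c
  refine congrArg (fun t => uhel (ap tr t)) (R.loopPair_ext ?_)
  rw [hτ, hm, Category.comp_id]

theorem exists_realizing (θ : RightTrace C) :
    ∃ tr : Loop F ⟶ idP C, R.Realizes tr (fun _ _ x f => θ.tr x f) := by
  have h₁ : ∀ {a b w w' x y : C} (m : El F.M a (w, y)) (k : w ⟶ w')
      (τ : El (Ten F) w' (b, x)) (c : El (cap F.toFrobeniusPseudomonoid) (y, x) pt),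
      θ.tr x (R.ev (act F.M (𝟙 a) (Prod.mkHom k (𝟙 y)) m) (R.capVal c) ≫ R.tenVal τ) =
        θ.tr x (R.ev m (R.capVal c) ≫ R.tenVal (act (Ten F) k (𝟙 (b, x)) τ)) :=
    fun m k τ c => by rw [R.ev_mid, R.tenVal_precomp, Category.assoc]
  have h₂ : ∀ {a b w x y x' y' : C} (m : El F.M a (w, y)) (τ : El (Ten F) w (b, x))
      (l : x ⟶ x') (h : y ⟶ y') (c : El (cap F.toFrobeniusPseudomonoid) (y', x') pt),
      θ.tr x' (R.ev (act F.M (𝟙 a) (Prod.mkHom (𝟙 w) h) m) (R.capVal c) ≫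
        R.tenVal (act (Ten F) (𝟙 w) (Prod.mkHom (𝟙 b) l) τ)) =
        θ.tr x (R.ev m (R.capVal (act _ (Prod.mkHom h l) (𝟙 pt) c)) ≫ R.tenVal τ) :=
    fun {a b w x y x' y'} m τ l h c => by
      rw [R.ev_slide, R.tenVal_right, R.capVal_act, MonoidalCategory.tensorHom_def', Category.assoc,
        R.ev_nat, Category.assoc, ← Category.assoc (R.ev _ _), θ.sliding]
  refine ⟨homMk (fun {a b} => liftLoop (fun {w x y} m τ c =>
    hel (θ.tr x (R.ev m (R.capVal c) ≫ R.tenVal τ))) h₁ h₂) (fun {a a' b b'} g f p => ?_),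
    fun {a b w x y} m τ c => ?_⟩
  · obtain ⟨w, x, y, m, τ, c, rfl⟩ := exists_loopPair p
    rw [act_loopPair, liftLoop_mk (fun {w x y} m τ c =>
      hel (θ.tr x (R.ev m (R.capVal c) ≫ R.tenVal τ))) h₁ h₂, liftLoop_mk (fun {w x y} m τ c =>
      hel (θ.tr x (R.ev m (R.capVal c) ≫ R.tenVal τ))) h₁ h₂, act_hel, R.ev_left, R.tenVal_left,
      ← θ.tightening]
    simp only [Category.assoc]
  · exact liftLoop_mk (fun {w x y} m τ c =>
      hel (θ.tr x (R.ev m (R.capVal c) ≫ R.tenVal τ))) h₁ h₂ m τ c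

end FrobFrame

section Axioms

variable {I : Interp C} {o : C} (R : FrobFrame I.toFrobeniusPseudomonoid o)
  {θ : ∀ a b x : C, (a ⊗ x ⟶ b ⊗ x) → (a ⟶ b)}

theorem FrobFrame.Realizes.tightening (h : R.Realizes I.tr θ) {a a' b b' x : C} (g : a' ⟶ a)
    (f : a ⊗ x ⟶ b ⊗ x) (k : b ⟶ b') :
    θ a' b' x ((g ▷ x) ≫ f ≫ (k ▷ x)) = g ≫ θ a b x f ≫ k := by
  obtain ⟨y, m, τ, c, -, hτ, hm⟩ := R.exists_loop f
  have e₁ := h m τ c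
  have e₂ := h (act I.M g (𝟙 (b ⊗ x, y)) m) (act (Ten _) (𝟙 (b ⊗ x)) (Prod.mkHom k (𝟙 x)) τ) c
  rw [← act_loopPair, R.tenVal_left, R.ev_left, hτ, hm, Category.id_comp, Category.assoc] at e₂
  rw [hτ, hm, Category.comp_id] at e₁
  exact e₂.symm.trans ((uhel_ap_act I.tr g k _).trans (congrArg (fun t => g ≫ t ≫ k) e₁))

theorem FrobFrame.Realizes.sliding (h : R.Realizes I.tr θ) {a b x y : C} (f : a ⊗ x ⟶ b ⊗ y)
    (g : y ⟶ x) : θ a b x (f ≫ (b ◁ g)) = θ a b y ((a ◁ g) ≫ f) := by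
  obtain ⟨x', m, τ, c, -, hτ, hm⟩ := R.exists_loop f
  have e₁ := h m (act (Ten _) (𝟙 (b ⊗ y)) (Prod.mkHom (𝟙 b) g) τ) c
  have e₂ := h m τ (act _ (Prod.mkHom (𝟙 x') g) (𝟙 pt) c)
  have e₃ := loopPair_slide₂ m τ g (𝟙 x') c
  have e₄ : act I.M (𝟙 a) (Prod.mkHom (𝟙 (b ⊗ y)) (𝟙 x')) m = m := act_id _ _
  rw [e₄] at e₃
  rw [R.tenVal_right, hτ, hm, Category.id_comp, e₃] at e₁
  rw [R.capVal_act, id_tensorHom, R.ev_nat, hτ, hm, Category.comp_id] at e₂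
  exact e₁.symm.trans e₂

theorem FrobFrame.Realizes.vanishing_unit (h : R.Realizes I.tr θ) {a b : C}
    (f : a ⊗ 𝟙_ C ⟶ b ⊗ 𝟙_ C) : θ a b (𝟙_ C) f = (ρ_ a).inv ≫ f ≫ (ρ_ b).hom := by
  obtain ⟨τ, hτ⟩ := R.exists_tenVal_eq (𝟙 (b ⊗ 𝟙_ C))
  obtain ⟨ι, hι⟩ := R.uniVal_bijective.2 (𝟙 (𝟙_ C))
  have he : R.E (R.E.symm (𝟙 (𝟙_ C))) = 𝟙 (𝟙_ C) := R.E.apply_symm_apply _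
  have hρ : R.D (R.D.symm (ρ_ b).hom) = (ρ_ b).hom := R.D.apply_symm_apply _
  have hc : ∀ (x : C) (d : El I.D (a, 𝟙_ C) x),
      couR d (R.E.symm (𝟙 (𝟙_ C))) = (ρ_ a).inv ≫ R.D d := fun x d =>
    (R.counitR d _).trans (by rw [he, MonoidalCategory.whiskerLeft_id, Category.id_comp])
  have hk := (R.uniCounit_iff ι (R.E.symm (𝟙 (𝟙_ C))) (𝟙 _)).2 (by rw [hι, he, Category.comp_id])
  have h₀ : couR (R.D.symm (ρ_ b).hom) (R.E.symm (𝟙 (𝟙_ C))) = 𝟙 b :=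
    (R.counitR _ _).trans (by
      rw [he, hρ, MonoidalCategory.whiskerLeft_id, Category.id_comp, Iso.inv_hom_id])
  have e := I.vanishing_unit (R.D.symm f) _ ι τ _ _ _ _ _ _ hk ((h.traceAt_iff _ _ _).2 rfl) h₀ hk
    ((R.tenCounit_iff _ _ _).2 rfl)
  rw [R.D_whisker, R.D_whisker, hτ, hρ, Equiv.apply_symm_apply, MonoidalCategory.whiskerLeft_id,
    Category.id_comp, Category.comp_id, MonoidalCategory.whiskerLeft_id, Category.id_comp,
    Category.id_comp] at e
  refine e.trans ((congrArg (fun t => t ≫ (ρ_ b).hom) (hc _ _)).trans ?_)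
  rw [Equiv.apply_symm_apply, Category.assoc]

theorem FrobFrame.Realizes.vanishing_tensor (h : R.Realizes I.tr θ) {a b x y : C}
    (f : a ⊗ (x ⊗ y) ⟶ b ⊗ (x ⊗ y)) :
    θ a b (x ⊗ y) f = θ a b x (θ _ _ y ((α_ a x y).hom ≫ f ≫ (α_ b x y).inv)) := by
  obtain ⟨τ₁, h₁⟩ := R.exists_tenVal_eq (𝟙 (b ⊗ (x ⊗ y)))
  obtain ⟨τ₂, h₂⟩ := R.exists_tenVal_eq (𝟙 (x ⊗ y))
  obtain ⟨τ₃, h₃⟩ := R.exists_tenVal_eq (α_ b x y).inv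
  obtain ⟨τ₄, h₄⟩ := R.exists_tenVal_eq (𝟙 (b ⊗ x))
  obtain ⟨r, d, d', e⟩ := exists_comulL (ap I.coassoc.inv
    (comulR (R.D.symm f) (R.D.symm (𝟙 (x ⊗ y)))))
  have e₁ : ap I.coassoc.hom (comulL d d') = comulR (R.D.symm f) (R.D.symm (𝟙 (x ⊗ y))) := by
    rw [e, ap_inv_hom]
  have e₂ := R.coassoc _ _ _ _ e₁
  rw [Equiv.apply_symm_apply, Equiv.apply_symm_apply, MonoidalCategory.whiskerLeft_id,
    Category.id_comp] at e₂
  have key := I.vanishing_tensor (R.D.symm f) (R.D.symm (𝟙 (x ⊗ y))) τ₁ τ₂ d d' τ₃ τ₄ (𝟙 _) _ _ _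
    ((R.tenCounit_iff _ _ _).2 (by rw [h₂, Equiv.apply_symm_apply, Category.comp_id]))
    ((h.traceAt_iff _ _ _).2 rfl) e₁ ((R.tenAssoc_iff _ _ _ _).2 (by simp [h₁, h₂, h₃, h₄]))
    ((h.traceAt_iff _ _ _).2 rfl) ((h.traceAt_iff _ _ _).2 rfl)
  rw [R.tenVal_right, R.D_right, h₁, h₃, h₄, Equiv.apply_symm_apply, Category.id_comp,
    MonoidalCategory.whiskerLeft_id, Category.comp_id, Category.comp_id] at key
  rw [key, reassoc_of% e₂]
  have t := h.tightening R (R.D d') (R.D d ≫ (α_ b x y).inv) (𝟙 _)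
  rw [id_whiskerRight, Category.comp_id, Category.comp_id] at t
  rw [t]

theorem FrobFrame.Realizes.superposing (h : R.Realizes I.tr θ) {a b x : C} (c : C)
    (f : a ⊗ x ⟶ b ⊗ x) :
    θ _ _ x ((α_ c a x).hom ≫ (c ◁ f) ≫ (α_ c b x).inv) = c ◁ θ a b x f := by
  obtain ⟨τ, h₁⟩ := R.exists_tenVal_eq (𝟙 (b ⊗ x))
  obtain ⟨τ₀, h₀⟩ := R.exists_tenVal_eq (𝟙 (c ⊗ a))
  obtain ⟨τ', h'⟩ := R.exists_tenVal_eq (𝟙 ((c ⊗ b) ⊗ x))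
  have key := I.superposing (R.D.symm f) τ _ τ₀ (R.D.symm (𝟙 (c ⊗ b)))
    (R.D.symm ((α_ c a x).hom ≫ (c ◁ f) ≫ (α_ c b x).inv)) τ' _ _ ((h.traceAt_iff _ _ _).2 rfl)
    ((R.tenCounit_iff _ _ _).2 rfl) (fun {w s t} d d₁ d₂ f₁ f₂ k k₂ k₃ e₁ e₂ e₃ e₄ e₅ => by
      rw [R.tenCounit_iff] at e₂ e₄ e₅
      subst e₂ e₄ e₅
      replace e₁ := R.coassoc _ _ _ _ e₁
      replace e₃ := R.coassoc _ _ _ _ e₃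
      apply R.D.injective
      rw [R.D_right, R.D_left, Equiv.apply_symm_apply, h₀, h', tensorHom_id, Category.id_comp,
        Category.id_comp, ← e₃, R.D_right, Equiv.apply_symm_apply, h₁, Category.id_comp]
      rw [Equiv.apply_symm_apply, id_whiskerRight, Category.id_comp] at e₁
      rw [← e₁]
      simp)
    ((h.traceAt_iff _ _ _).2 rfl)
  rw [R.D_whisker, Equiv.apply_symm_apply, Equiv.apply_symm_apply, Equiv.apply_symm_apply, h₀, h',
    h₁, Category.comp_id, Category.comp_id, Category.comp_id, Category.id_comp] at key
  exact key.symm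

theorem FrobFrame.exists_rightTrace :
    ∃ θ : RightTrace C, R.Realizes I.tr (fun _ _ x f => θ.tr x f) := by
  obtain ⟨θ, h⟩ := R.exists_realizes I.tr
  exact ⟨{ tr := fun {a b} x f => θ a b x f
           tightening := fun g f k => h.tightening R g f k
           sliding := fun f g => h.sliding R f g
           vanishing_unit := fun f => h.vanishing_unit R f
           vanishing_tensor := fun f => h.vanishing_tensor R f
           superposing := fun c f => h.superposing R c f }, h⟩

end Axioms

theorem FrobFrame.exists_interp {F : RightAdjointFrobenius C} {o : C}
    (R : FrobFrame F.toFrobeniusPseudomonoid o) (θ : RightTrace C) :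
    ∃ (I : Interp C) (R' : FrobFrame I.toFrobeniusPseudomonoid o),
      R'.Realizes I.tr (fun _ _ x f => θ.tr x f) := by
  obtain ⟨tr, h⟩ := R.exists_realizing θ
  refine ⟨{ F with
    tr := tr
    vanishing_unit := ?_
    vanishing_tensor := ?_
    superposing := ?_ }, R, h⟩
  · intro a b x x' z s δ e ι τ k δ₀ e₀ k₀ f g h₁ h₂ h₃ h₄ h₅
    rw [R.uniCounit_iff] at h₁ h₄
    rw [R.tenCounit_iff] at h₅
    rw [h.traceAt_iff] at h₂
    subst h₁ h₄
    have e₀' : (ρ_ b).inv ≫ (b ◁ R.E e₀) ≫ R.D δ₀ = 𝟙 b := (R.counitR δ₀ e₀).symm.trans h₃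
    rw [Iso.inv_comp_eq, Category.comp_id] at e₀'
    have ec : couR δ e = (ρ_ a).inv ≫ (a ◁ R.E e) ≫ R.D δ := R.counitR δ e
    change f = couR δ e ≫ g
    have s := θ.sliding ((a ◁ R.E e) ≫ R.D δ ≫ R.tenVal τ) (R.uniVal ι)
    rw [θ.vanishing_unit] at s
    rw [h₂, h₅, ec, R.D_whisker, R.D_whisker, MonoidalCategory.whiskerLeft_comp,
      MonoidalCategory.whiskerLeft_comp]
    simp only [Category.assoc, e₀'] at s ⊢
    rw [s]
  · intro a b p q x x' z r r' δ₁ δ₂ τ₁ τ₂ δ₃ δ₄ τ₃ τ₄ k f f' g h₁ h₂ h₃ h₄ h₅ h₆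
    rw [R.tenCounit_iff] at h₁
    rw [h.traceAt_iff] at h₂ h₅ h₆
    rw [R.tenAssoc_iff] at h₄
    replace h₃ := R.coassoc _ _ _ _ h₃
    subst h₁ h₅
    have t := θ.tightening (R.D δ₄) (R.D δ₃ ≫ R.tenVal τ₃) (R.tenVal τ₄)
    rw [Category.assoc, ← h₄, ← reassoc_of% h₃] at t
    have v := θ.vanishing_tensor ((a ◁ R.D δ₂) ≫ R.D δ₁ ≫ R.tenVal τ₁ ≫ (b ◁ R.tenVal τ₂))
    have s := θ.sliding (R.D δ₁ ≫ R.tenVal τ₁ ≫ (b ◁ R.tenVal τ₂)) (R.D δ₂)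
    rw [h₂, h₆, R.tenVal_right, R.D_right, Category.assoc, ← t]
    simp only [Category.assoc, MonoidalCategory.whiskerLeft_comp] at s v ⊢
    rw [s, v]
  · intro a b c x z r v z' δ τ f τ₀ δ₀ δ' τ' l l' h₁ h₂ h₃ h₄
    rw [h.traceAt_iff] at h₁ h₄
    rw [R.tenCounit_iff] at h₂
    subst h₁
    obtain ⟨s, d₁, d₂, e₁⟩ := exists_comulR (ap F.coassoc.hom (comulL (R.D.symm (𝟙 (v ⊗ x))) δ₀))
    obtain ⟨t, f₁, f₂, e₂⟩ := exists_comulL (ap F.coassoc.inv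
      (comulR d₁ (act F.D (𝟙 (a, x)) (R.tenVal τ ≫ R.D d₂) δ)))
    have e₃ : ap F.coassoc.hom (comulL f₁ f₂) =
        comulR d₁ (act F.D (𝟙 (a, x)) (R.tenVal τ ≫ R.D d₂) δ) := by rw [e₂, ap_inv_hom]
    have key := congrArg R.D (h₃ _ _ _ _ _ _ _ _ e₁.symm ((R.tenCounit_iff _ _ _).2 rfl) e₃
      ((R.tenCounit_iff _ _ _).2 rfl) ((R.tenCounit_iff _ _ _).2 rfl))
    have c₁ := R.coassoc _ _ _ _ e₁.symm
    have c₂ := R.coassoc _ _ _ _ e₃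
    rw [Equiv.apply_symm_apply, Category.comp_id] at c₁
    rw [R.D_right, R.D_left, Equiv.apply_symm_apply, Category.comp_id, tensorHom_id,
      comp_whiskerRight, Category.assoc, ← c₂, R.D_right, MonoidalCategory.whiskerLeft_comp,
      MonoidalCategory.whiskerLeft_comp, Category.assoc, Category.assoc,
      (Iso.eq_inv_comp _).2 c₁] at key
    have s := θ.superposing c (R.D δ ≫ R.tenVal τ)
    have t := θ.tightening (R.tenVal τ₀)
      ((α_ c a x).hom ≫ (c ◁ (R.D δ ≫ R.tenVal τ)) ≫ (α_ c b x).inv) (R.D δ₀)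
    rw [h₂, h₄, key, R.D_whisker, ← s, ← t]
    simp

end Prof

namespace Prof

open MonoidalCategory

variable {C : Type u} [SmallCategory C]

section Comparison

variable [MonoidalCategory C] {o : C} {I J : Interp C} (R : FrobFrame I.toFrobeniusPseudomonoid o)
  (Q : FrobFrame J.toFrobeniusPseudomonoid o)

/-- Isomorphisms of interpretations that are compatible with two representations. -/
structure Matches (f : InterpHom I J) : Prop where
  D : ∀ {a b x : C} (d : El I.D (a, b) x), Q.D (ap f.D.hom d) = R.D d
  E : ∀ {x : C} (e : El I.E pt x), Q.E (ap f.E.hom e) = R.E e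
  H : ∀ {z : C} (n : El I.H z pt), Q.H (ap f.H.hom n) = R.H n

variable {R Q}

theorem Matches.ev {f : InterpHom I J} (hf : Matches R Q f) {x y z w : C} (m : El I.M z (x, y))
    (δ : y ⊗ w ⟶ o) : Q.ev (ap f.M.hom m) δ = R.ev m δ := by
  obtain ⟨c, rfl⟩ := R.capVal_bijective.2 δ
  obtain ⟨t, d, n, rfl⟩ := exists_capMk c
  obtain ⟨v, d', m', e⟩ := exists_frobM (ap I.phiR.hom (frobR m d))
  have e₁ := R.ev_D_H (n := n) e.symm
  have e₂ := Q.ev_D_H (n := ap f.H.hom n) (f.phiR _ _ _ _ e.symm)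
  rw [hf.D, hf.D, hf.H] at e₂
  rw [R.capVal_mk, ← e₁, ← e₂]
  exact congrArg (fun t => R.D d' ≫ t) (f.unitR m' n)

theorem Matches.unique {f f' : InterpHom I J} (hf : Matches R Q f) (hf' : Matches R Q f') :
    f = f' := by
  have hM : f.M = f'.M := iso_ext_ap (fun {z a} m => Q.ext (x := a.1) (y := a.2) (fun δ => by
    rw [hf.ev (x := a.1) (y := a.2), hf'.ev (x := a.1) (y := a.2)]))
  have hH : f.H = f'.H := iso_ext_ap (fun {z a} n => Q.H.injective ((hf.H n).trans (hf'.H n).symm))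
  refine InterpHom.ext hM hH ?_ ?_ ?_ ?_
  · exact iso_ext_ap (fun {a x} d =>
      Q.D.injective ((hf.D (a := a.1) (b := a.2) d).trans (hf'.D (a := a.1) (b := a.2) d).symm))
  · exact iso_ext_ap (fun {a x} e => Q.E.injective ((hf.E e).trans (hf'.E e).symm))
  · exact eq_of_couv (h := I.adjM) (h' := J.adjM) (i := f.M) (fun {a _ _} p q =>
      f.counitM (x := a.1) (y := a.2) p q)
      (fun {a _ _} p q => by rw [hM]; exact f'.counitM (x := a.1) (y := a.2) p q)
  · exact eq_of_couv (h := I.adjH) (h' := J.adjH) (i := f.H) (fun p q => f.counitH p q)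
      (fun p q => by rw [hH]; exact f'.counitH p q)

variable (R Q) in
theorem exists_matches {θ : ∀ a b x : C, (a ⊗ x ⟶ b ⊗ x) → (a ⟶ b)} (hR : R.Realizes I.tr θ)
    (hQ : Q.Realizes J.tr θ) : ∃ f : InterpHom I J, Matches R Q f := by
  obtain ⟨iD, hD⟩ := exists_iso_of_values (P := I.D) (Q := J.D)
    (fun {a x} d d' => R.D (a := a.1) (b := a.2) d = Q.D (a := a.1) (b := a.2) d')
    (by
      rintro ⟨a, b⟩ ⟨a', b'⟩ x x' ⟨f, g⟩ h d d' e
      exact (R.D_act f g h d).trans (.trans (by rw [e]) (Q.D_act f g h d').symm))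
    (fun a x => ⟨_, R.D (a := a.1) (b := a.2), Q.D (a := a.1) (b := a.2), R.D.bijective,
      Q.D.bijective, fun _ _ => Iff.rfl⟩)
  obtain ⟨iE, hE⟩ := exists_iso_of_values (P := I.E) (Q := J.E) (fun e e' => R.E e = Q.E e')
    (fun f h d d' e => (R.E_act h d).trans (.trans (by rw [e]) (Q.E_act h d').symm))
    (fun _ x => ⟨_, R.E, Q.E, R.E.bijective, Q.E.bijective, fun _ _ => Iff.rfl⟩)
  obtain ⟨iH, hH⟩ := exists_iso_of_values (P := I.H) (Q := J.H) (fun e e' => R.H e = Q.H e')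
    (fun h f d d' e => (R.H_act h d).trans (.trans (by rw [e]) (Q.H_act h d').symm))
    (fun x _ => ⟨_, R.H, Q.H, R.H.bijective, Q.H.bijective, fun _ _ => Iff.rfl⟩)
  obtain ⟨iM, hM⟩ := exists_iso_of_values (P := I.M) (Q := J.M)
    (fun {z a} m m' => ∀ {w : C} (δ : a.2 ⊗ w ⟶ o),
      R.ev (x := a.1) (y := a.2) m δ = Q.ev (x := a.1) (y := a.2) m' δ)
    (by
      rintro z z' ⟨x, y⟩ ⟨x', y'⟩ f ⟨g, h⟩ m m' e w δ
      exact (R.ev_act f g h m δ).trans (.trans (by rw [e]) (Q.ev_act f g h m' δ).symm))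
    (by
      rintro z ⟨x, y⟩
      obtain ⟨y', ε, hε⟩ := R.dual.1 y
      refine ⟨_, _, _, R.ev_bijective hε, Q.ev_bijective hε, fun m m' => ⟨fun e w δ => ?_,
        fun e => e ε⟩⟩
      have e' : R.ev m ε = Q.ev m' ε := e
      exact (R.ev_eq hε m δ).trans (.trans (by rw [e']) (Q.ev_eq hε m' δ).symm))
  replace hD : ∀ {a b x : C} (d : El I.D (a, b) x), Q.D (ap iD.hom d) = R.D d :=
    fun {a b x} d => ((hD (b := (a, b)) d _).1 rfl).symm
  replace hE : ∀ {x : C} (e : El I.E pt x), Q.E (ap iE.hom e) = R.E e :=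
    fun e => ((hE e _).1 rfl).symm
  replace hH : ∀ {z : C} (n : El I.H z pt), Q.H (ap iH.hom n) = R.H n :=
    fun n => ((hH n _).1 rfl).symm
  replace hM : ∀ {x y z w : C} (m : El I.M z (x, y)) (δ : y ⊗ w ⟶ o),
      Q.ev (ap iM.hom m) δ = R.ev m δ := fun {x y z w} m δ => ((hM (a := (x, y)) m _).1 rfl δ).symm
  obtain ⟨iMr, uM, cM⟩ := exists_iso_of_adj I.adjM J.adjM iM
  obtain ⟨iHr, uH, cH⟩ := exists_iso_of_adj I.adjH J.adjH iH
  have hpair : ∀ {t y z u v : C} (n : El I.M t (y, z)) (δ : z ⊗ u ⟶ o) (δ' : y ⊗ v ⟶ o),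
      Q.pair (ap iM.hom n) δ δ' = R.pair n δ δ' := fun n δ δ' => by
    rw [Frame.pair, Frame.pair, hM]
  have hcup : ∀ {x y w s : C} (e : El I.E pt s) (m : El I.M s (x, y)) (δ : y ⊗ w ⟶ o),
      Q.cupVal (cupMk (ap iE.hom e) (ap iM.hom m)) δ = R.cupVal (cupMk e m) δ := fun e m δ => by
    rw [Q.cupVal_mk, R.cupVal_mk, hE, hM]
  have hcap : ∀ {x y t : C} (d : El I.D (x, y) t) (n : El I.H t pt),
      Q.capVal (capMk (ap iD.hom d) (ap iH.hom n)) = R.capVal (capMk d n) := fun d n => by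
    rw [Q.capVal_mk, R.capVal_mk, hD, hH]
  have hten : ∀ {a b z p q r s₁ s₂ t : C} (e₁ : El I.E pt s₁) (m₁ : El I.M s₁ (b, p))
      (e₂ : El I.E pt s₂) (m₂ : El I.M s₂ (a, q)) (w : El I.Mr (p, q) r) (d : El I.D (r, z) t)
      (n : El I.H t pt), Q.tenVal (tenMk (ap iE.hom e₁) (ap iM.hom m₁) (ap iE.hom e₂)
        (ap iM.hom m₂) (ap iMr.hom w) (ap iD.hom d) (ap iH.hom n)) =
      R.tenVal (tenMk e₁ m₁ e₂ m₂ w d n) := by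
    intro a b z p q r s₁ s₂ t e₁ m₁ e₂ m₂ w d n
    obtain ⟨q', ε, hε⟩ := R.dual.1 q
    obtain ⟨p', ε', hε'⟩ := R.dual.1 p
    obtain ⟨θ, hθ⟩ := R.exists_transports hε hε' w (R.capVal (capMk d n))
    have hθ' : Q.Transports (ap iMr.hom w) (R.capVal (capMk d n)) ε ε' θ := fun {s} m => by
      have e := hθ (ap iM.inv m)
      have e' := cM (ap iM.inv m) w
      rw [ap_inv_hom] at e'
      rw [e', ← e, ← hpair, ap_inv_hom]
    rw [tenMk_eq, tenMk_eq, Q.tenVal_mk, R.tenVal_mk, hcap, Q.tenTupleVal_eq _ _ hθ',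
      R.tenTupleVal_eq _ _ hθ, hcup, hcup]
  refine ⟨{
    M := iM
    H := iH
    D := iD
    E := iE
    Mr := iMr
    Hr := iHr
    assoc := ?_
    unitL := ?_
    unitR := ?_
    coassoc := ?_
    counitL := ?_
    counitR := ?_
    phiL := ?_
    phiR := ?_
    unitM := fun w m e => uM w m e
    counitM := fun m w => cM m w
    unitH := fun w n e => uH w n e
    counitH := fun n w => cH n w
    tr := ?_ }, hD, hE, hH⟩
  · intro x y z w t t' m m' n n' e
    obtain ⟨q, k, k', e'⟩ := exists_mulR (ap J.assoc.hom (mulL (ap iM.hom m) (ap iM.hom m')))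
    rw [← e']
    refine Q.mulR_ext (fun {u v} δ δ' => ?_)
    rw [← cancel_epi (α_ w u v).hom, ← Q.assoc _ _ _ _ δ δ' e'.symm, hpair, hM, hM, hM,
      R.assoc _ _ _ _ δ δ' e]
  · intro x z t m n
    obtain ⟨x', ε, hε⟩ := R.dual.1 x
    refine hε.lhom_ext ((Q.unitL _ _ ε).trans (.trans ?_ (R.unitL m n ε).symm))
    rw [hM, hH]
  · intro x z t m n
    refine (Q.unitR _ _).trans (.trans ?_ (R.unitR m n).symm)
    rw [hM, hH]
  · intro a b c x t t' d d' f f' e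
    obtain ⟨q, k, k', e'⟩ := exists_comulR (ap J.coassoc.hom (comulL (ap iD.hom d) (ap iD.hom d')))
    rw [← e']
    refine Q.comulR_ext ?_
    rw [← cancel_epi (α_ a b c).hom, Q.coassoc _ _ _ _ e'.symm, hD, hD, hD, hD, R.coassoc _ _ _ _ e]
  · intro a x t d e
    refine (Q.counitL _ _).trans (.trans ?_ (R.counitL d e).symm)
    rw [hD, hE]
  · intro a x t d e
    refine (Q.counitR _ _).trans (.trans ?_ (R.counitR d e).symm)
    rw [hD, hE]
  · intro a b x y t v m d d' m' e
    obtain ⟨q, k, k', e'⟩ := exists_frobM (ap J.phiL.hom (frobL (ap iM.hom m) (ap iD.hom d)))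
    rw [← e']
    refine Q.frobM_ext (fun {w} δ => ?_)
    rw [← Q.phiL _ _ _ _ δ e'.symm, hM, hM, hD, hD, R.phiL _ _ _ _ δ e]
  · intro a b x y t v m d d' m' e
    obtain ⟨q, k, k', e'⟩ := exists_frobM (ap J.phiR.hom (frobR (ap iM.hom m) (ap iD.hom d)))
    rw [← e']
    refine Q.frobM_ext (fun {w} δ => ?_)
    rw [← Q.phiR _ _ _ _ δ e'.symm, hM, hM, hD, hD, R.phiR _ _ _ _ δ e]
  · intro a b o' x y t p q r s₁ s₂ t' m e₁ m₁ e₂ m₂ w d n d' n'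
    rw [loopMk_eq, loopMk_eq]
    refine (hQ _ _ _).trans (.trans ?_ (hR _ _ _).symm)
    rw [hcap, hM, hten]

end Comparison

/-- A representation of a Frobenius pseudomonoid with trace, as in the definition of
representations. -/
noncomputable def FrobFrame.represents [MonoidalCategory C] {o : C} {I : Interp C} (R : FrobFrame I.toFrobeniusPseudomonoid o)
    {θ : RightTrace C} (h : R.Realizes I.tr (fun _ _ x f => θ.tr x f)) : Represents I o θ where
  D := R.D
  E := R.E
  H := R.H
  T := Equiv.ofBijective _ R.tenVal_bijective
  U := Equiv.ofBijective _ R.uniVal_bijective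
  D_act := R.D_act
  E_act := R.E_act
  H_act := R.H_act
  T_act := R.tenVal_act
  U_act := R.uniVal_act
  T_counit := R.tenCounit_iff
  U_counit := R.uniCounit_iff
  coassoc := R.coassoc
  counitL := R.counitL
  counitR := R.counitR
  par _ hε g := R.existsUnique_phiR hε g
  trace d τ f := h.traceAt_iff d τ f

/-- Every interpretation is represented by a traced `*`-autonomous structure. -/
theorem exists_representedBy [IsIdempotentComplete C] (I : Interp C) :
    ∃ S : TracedStarAut C, Nonempty (RepresentedBy I S) := by
  obtain ⟨o, h, hu⟩ := exists_universal_of_adj I.adjH pt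
  have hM : ∀ x y : C, ∃ (r : C) (m : El I.M r (x, y)), Univ I.M m := fun x y => by
    obtain ⟨r, m, hm⟩ := exists_universal_of_adj I.adjM (x, y)
    exact ⟨r, m, fun _ p => hm p⟩
  replace hu : Univ I.H h := fun _ p => hu p
  obtain ⟨mon, ⟨K⟩⟩ := exists_comonoidal I.toPseudocomonoid (exists_couniv_D hu hM)
    (exists_couniv_E hu)
  have h₁ : ∀ {z z' : C} (k : z' ⟶ z) (n : El I.H z pt), hu.desc (act I.H k (𝟙 pt) n) =
      k ≫ hu.desc n := fun k n => hu.desc_act' k n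
  obtain ⟨R, -⟩ := exists_frobFrame K (o := o)
    (fun {z} => ⟨hu.desc, fun f => act I.H f (𝟙 pt) h, hu.act_desc, hu.desc_act⟩) h₁
  obtain ⟨θ, hθ⟩ := R.exists_rightTrace
  exact ⟨⟨mon, o, R.dual, θ⟩, ⟨R.represents hθ⟩⟩

/-- Every traced `*`-autonomous structure represents an interpretation. -/
theorem exists_interp_representedBy (S : TracedStarAut C) :
    ∃ I : Interp C, Nonempty (RepresentedBy I S) := by
  let _ := S.mon
  obtain ⟨F, ⟨R⟩⟩ := exists_frobFrame_of_isDualizing S.dualizing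
  obtain ⟨I, R', h⟩ := R.exists_interp S.trace
  exact ⟨I, ⟨R'.represents h⟩⟩

end Prof

namespace Prof

variable {C : Type u} [SmallCategory C]

section Map

variable {I J : Interp C} (f : InterpHom I J)

theorem InterpHom.exists_snake {z x r s t : C} (e : El I.E pt s) (m : El I.M s (x, r))
    (d : El I.D (r, z) t) (n : El I.H t pt) :
    ∃ k : z ⟶ x, Snake (F := I.toRightAdjointFrobenius) e m d n k ∧
      Snake (F := J.toRightAdjointFrobenius) (ap f.E.hom e) (ap f.M.hom m) (ap f.D.hom d)
        (ap f.H.hom n) k := by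
  obtain ⟨v, d', m', h⟩ := exists_frobM (ap I.phiR.hom (frobR m d))
  refine ⟨_, ⟨v, d', m', h.symm, rfl⟩, v, _, _, f.phiR _ _ _ _ h.symm, ?_⟩
  rw [f.counitL, f.unitR]

theorem InterpHom.exists_tenCounit {a b x z p q r s₁ s₂ t : C} (e₁ : El I.E pt s₁)
    (m₁ : El I.M s₁ (b, p)) (e₂ : El I.E pt s₂) (m₂ : El I.M s₂ (a, q)) (w : El I.Mr (p, q) r)
    (d : El I.D (r, z) t) (n : El I.H t pt) (δ : El I.D (a, b) x) :
    ∃ k : z ⟶ x, TenCounit (F := I.toRightAdjointFrobenius) (tenMk e₁ m₁ e₂ m₂ w d n) δ k ∧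
      TenCounit (F := J.toRightAdjointFrobenius) (tenMk (ap f.E.hom e₁) (ap f.M.hom m₁)
        (ap f.E.hom e₂) (ap f.M.hom m₂) (ap f.Mr.hom w) (ap f.D.hom d) (ap f.H.hom n))
        (ap f.D.hom δ) k := by
  obtain ⟨v, d', m', h₁⟩ := exists_frobM (ap I.phiL.hom (frobL m₁ δ))
  obtain ⟨u, m₃, m₄, h₂⟩ := exists_mulR
    (ap I.assoc.hom (mulL m₂ (act I.M (couR d' e₁) (𝟙 (x, p)) m')))
  obtain ⟨k, hk, hk'⟩ := f.exists_snake e₂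
    (act I.M (𝟙 s₂) (Prod.mkHom (𝟙 x) (couv I.adjM m₄ w)) m₃) d n
  refine ⟨k, ⟨p, q, r, s₁, s₂, t, v, u, e₁, m₁, e₂, m₂, w, d, n, d', m', m₃, m₄, rfl, h₁.symm,
    h₂.symm, hk⟩, p, q, r, s₁, s₂, t, v, u, _, _, _, _, _, _, _, _, _, ap f.M.hom m₃,
    ap f.M.hom m₄, rfl, f.phiL _ _ _ _ h₁.symm, ?_, ?_⟩
  · have e := f.assoc _ _ _ _ h₂.symm
    rw [ap_act] at e
    rw [f.counitR]
    exact e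
  · rw [ap_act] at hk'
    rw [f.counitM]
    exact hk'

theorem InterpHom.exists_traceAt {a b x z p q r s₁ s₂ t : C} (δ : El I.D (a, x) z)
    (e₁ : El I.E pt s₁) (m₁ : El I.M s₁ (x, p)) (e₂ : El I.E pt s₂) (m₂ : El I.M s₂ (b, q))
    (w : El I.Mr (p, q) r) (d : El I.D (r, z) t) (n : El I.H t pt) :
    ∃ k : a ⟶ b, TraceAt I.tr δ (tenMk e₁ m₁ e₂ m₂ w d n) k ∧
      TraceAt J.tr (ap f.D.hom δ) (tenMk (ap f.E.hom e₁) (ap f.M.hom m₁)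
        (ap f.E.hom e₂) (ap f.M.hom m₂) (ap f.Mr.hom w) (ap f.D.hom d) (ap f.H.hom n)) k := by
  obtain ⟨u, m₀, n₀, h₀⟩ := exists_unR (ap I.unitR.inv (hel (𝟙 z)))
  have h₀' : ap I.unitR.hom (unR m₀ n₀) = hel (𝟙 z) := by rw [h₀, ap_inv_hom]
  obtain ⟨y, m, d', h⟩ := exists_frobR (ap I.phiR.inv (frobM δ m₀))
  have h' : ap I.phiR.hom (frobR m d') = frobM δ m₀ := by rw [h, ap_inv_hom]
  exact ⟨_, ⟨u, y, m₀, n₀, m, d', h₀', h', rfl⟩, u, y, _, _, _, _, (f.unitR m₀ n₀).trans h₀',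
    f.phiR _ _ _ _ h', (f.tr _ _ _ _ _ _ _ _ _ _).symm⟩

end Map

section Representation

variable {J : Interp C} {T : TracedStarAut C} (r : RepresentedBy J T)

/-- `Δ` in terms of the tensor product of `T`. -/
abbrev repD {a b x : C} : El J.D (a, b) x ≃ (T.mon.tensorObj a b ⟶ x) :=
  @Represents.D C _ J T.mon T.bot T.trace r a b x

/-- `ε` in terms of the unit of `T`. -/
abbrev repE {x : C} : El J.E pt x ≃ (T.mon.tensorUnit ⟶ x) :=
  @Represents.E C _ J T.mon T.bot T.trace r x

/-- `η` in terms of the dualizing object of `T`. -/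
abbrev repH {z : C} : El J.H z pt ≃ (z ⟶ T.bot) :=
  @Represents.H C _ J T.mon T.bot T.trace r z

/-- The derived tensor product in terms of the tensor product of `T`. -/
abbrev repT {a b z : C} : El (Ten J.toRightAdjointFrobenius) z (a, b) ≃ (z ⟶ T.mon.tensorObj a b) :=
  @Represents.T C _ J T.mon T.bot T.trace r a b z

theorem repD_act {a a' b b' x x' : C} (f : a' ⟶ a) (g : b' ⟶ b) (h : x ⟶ x') (d : El J.D (a, b) x) :
    repD r (act J.D (Prod.mkHom f g) h d) = T.mon.tensorHom f g ≫ repD r d ≫ h :=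
  @Represents.D_act C _ J T.mon T.bot T.trace r _ _ _ _ _ _ f g h d

theorem repD_right {a b x x' : C} (h : x ⟶ x') (d : El J.D (a, b) x) :
    repD r (act J.D (𝟙 (a, b)) h d) = repD r d ≫ h := by
  have e := repD_act r (𝟙 a) (𝟙 b) h d
  rw [@MonoidalCategory.id_tensorHom_id C _ T.mon, Category.id_comp] at e
  exact e

theorem repE_act {x x' : C} (h : x ⟶ x') (e : El J.E pt x) :
    repE r (act J.E (𝟙 pt) h e) = repE r e ≫ h :=
  @Represents.E_act C _ J T.mon T.bot T.trace r _ _ h e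

theorem repH_act {z z' : C} (h : z' ⟶ z) (n : El J.H z pt) :
    repH r (act J.H h (𝟙 pt) n) = h ≫ repH r n :=
  @Represents.H_act C _ J T.mon T.bot T.trace r _ _ h n

theorem repT_counit {a b x z : C} {τ : El (Ten J.toRightAdjointFrobenius) z (a, b)}
    {d : El J.D (a, b) x} {f : z ⟶ x} (h : TenCounit τ d f) : f = repT r τ ≫ repD r d :=
  (@Represents.T_counit C _ J T.mon T.bot T.trace r _ _ _ _ τ d f).1 h

theorem rep_trace {a b x z : C} {d : El J.D (a, x) z}
    {τ : El (Ten J.toRightAdjointFrobenius) z (b, x)} {f : a ⟶ b} (h : TraceAt J.tr d τ f) :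
    f = @RightTrace.tr C _ T.mon T.trace a b x (repD r d ≫ repT r τ) :=
  (@Represents.trace C _ J T.mon T.bot T.trace r _ _ _ _ d τ f).1 h

theorem rep_coassoc {a b c x t t' : C} {d : El J.D (t, c) x} {d' : El J.D (a, b) t}
    {f : El J.D (a, t') x} {f' : El J.D (b, c) t'}
    (h : ap J.coassoc.hom (comulL d d') = comulR f f') :
    (T.mon.associator a b c).hom ≫ T.mon.tensorHom (𝟙 a) (repD r f') ≫ repD r f =
      T.mon.tensorHom (repD r d') (𝟙 c) ≫ repD r d := by
  have e := @Represents.coassoc C _ J T.mon T.bot T.trace r _ _ _ _ _ _ d d' f f' h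
  rwa [← @MonoidalCategory.id_tensorHom C _ T.mon, ← @MonoidalCategory.tensorHom_id C _ T.mon] at e

theorem rep_counitL {a x t : C} (d : El J.D (t, a) x) (e : El J.E pt t) :
    couL d e = (T.mon.leftUnitor a).inv ≫ T.mon.tensorHom (repE r e) (𝟙 a) ≫ repD r d := by
  rw [@MonoidalCategory.tensorHom_id C _ T.mon]
  exact @Represents.counitL C _ J T.mon T.bot T.trace r _ _ _ d e

theorem rep_counitR {a x t : C} (d : El J.D (a, t) x) (e : El J.E pt t) :
    couR d e = (T.mon.rightUnitor a).inv ≫ T.mon.tensorHom (𝟙 a) (repE r e) ≫ repD r d := by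
  rw [@MonoidalCategory.id_tensorHom C _ T.mon]
  exact @Represents.counitR C _ J T.mon T.bot T.trace r _ _ _ d e

/-- Composition with an isomorphism. -/
def precompEquiv {x y z : C} (i : x ≅ y) : (y ⟶ z) ≃ (x ⟶ z) where
  toFun f := i.hom ≫ f
  invFun f := i.inv ≫ f
  left_inv f := by simp
  right_inv f := by simp

/-- Composition with an isomorphism. -/
def postcompEquiv {x y z : C} (i : x ≅ y) : (z ⟶ x) ≃ (z ⟶ y) where
  toFun f := f ≫ i.hom
  invFun f := f ≫ i.inv
  left_inv f := by simp
  right_inv f := by simp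

theorem tensorHom_comp_id (S : TracedStarAut C) {a b c d : C} (f : a ⟶ b) (g : b ⟶ c) :
    S.mon.tensorHom (f ≫ g) (𝟙 d) = S.mon.tensorHom f (𝟙 d) ≫ S.mon.tensorHom g (𝟙 d) := by
  let _ := S.mon
  simp

theorem tensorHom_id_comp (S : TracedStarAut C) {a b c d : C} (f : a ⟶ b) (g : b ⟶ c) :
    S.mon.tensorHom (𝟙 d) (f ≫ g) = S.mon.tensorHom (𝟙 d) f ≫ S.mon.tensorHom (𝟙 d) g := by
  let _ := S.mon
  simp

variable {S : TracedStarAut C} (g : TracedStarAutHom S T)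

/-- A representation by `T` is transported to an isomorphic structure `S`. -/
def transport : @Comonoidal C _ J.toPseudocomonoid S.mon :=
  let _ := S.mon
  { D := (repD r).trans (precompEquiv (g.tens _ _))
    E := (repE r).trans (precompEquiv g.unit)
    D_act := fun f h k d => by
      change (g.tens _ _).hom ≫ repD r _ = S.mon.tensorHom f h ≫ ((g.tens _ _).hom ≫ repD r d) ≫ k
      rw [repD_act, ← reassoc_of% (g.natural f h), Category.assoc]
    E_act := fun h e => by
      change g.unit.hom ≫ repE r _ = (g.unit.hom ≫ repE r _) ≫ h
      rw [repE_act, Category.assoc]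
    coassoc := fun {a b c x t t'} d d' f f' h => by
      have e := rep_coassoc r h
      rw [← MonoidalCategory.id_tensorHom, ← MonoidalCategory.tensorHom_id]
      change (S.mon.associator a b c).hom ≫ S.mon.tensorHom (𝟙 a) ((g.tens _ _).hom ≫ repD r f') ≫
        (g.tens _ _).hom ≫ repD r f =
        S.mon.tensorHom ((g.tens _ _).hom ≫ repD r d') (𝟙 c) ≫ (g.tens _ _).hom ≫ repD r d
      rw [tensorHom_comp_id, tensorHom_id_comp, Category.assoc, Category.assoc,
        reassoc_of% (g.natural (𝟙 a) (repD r f')), reassoc_of% (g.natural (repD r d') (𝟙 c)), ← e,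
        reassoc_of% (g.assoc a b c)]
    counitL := fun {a x t} d e => by
      rw [← MonoidalCategory.tensorHom_id]
      change couL d e = (S.mon.leftUnitor a).inv ≫ S.mon.tensorHom (g.unit.hom ≫ repE r e) (𝟙 a) ≫
        (g.tens _ _).hom ≫ repD r d
      have h : (S.mon.leftUnitor a).inv ≫ S.mon.tensorHom g.unit.hom (𝟙 a) ≫
          (g.tens T.mon.tensorUnit a).hom = (T.mon.leftUnitor a).inv := by
        rw [Iso.inv_comp_eq, ← g.left]
        simp
      rw [rep_counitL r, tensorHom_comp_id, Category.assoc,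
        reassoc_of% (g.natural (repE r e) (𝟙 a)), reassoc_of% h]
    counitR := fun {a x t} d e => by
      rw [← MonoidalCategory.id_tensorHom]
      change couR d e = (S.mon.rightUnitor a).inv ≫ S.mon.tensorHom (𝟙 a) (g.unit.hom ≫ repE r e) ≫
        (g.tens _ _).hom ≫ repD r d
      have h : (S.mon.rightUnitor a).inv ≫ S.mon.tensorHom (𝟙 a) g.unit.hom ≫
          (g.tens a T.mon.tensorUnit).hom = (T.mon.rightUnitor a).inv := by
        rw [Iso.inv_comp_eq, ← g.right]
        simp
      rw [rep_counitR r, tensorHom_id_comp, Category.assoc,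
        reassoc_of% (g.natural (𝟙 a) (repE r e)), reassoc_of% h] }

theorem exists_frobFrame_transport [IsIdempotentComplete C] :
    let _ := S.mon
    ∃ Q : FrobFrame J.toFrobeniusPseudomonoid S.bot,
      (∀ {a b x : C} (d : El J.D (a, b) x), Q.D d = (g.tens a b).hom ≫ repD r d) ∧
      (∀ {x : C} (e : El J.E pt x), Q.E e = g.unit.hom ≫ repE r e) ∧
      (∀ {z : C} (n : El J.H z pt), Q.H n = repH r n ≫ g.bot.inv) ∧
      Q.Realizes J.tr (fun _ _ x f => S.trace.tr x f) := by
  intro _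
  obtain ⟨Q, hD, hE, hH⟩ := exists_frobFrame (transport r g) (o := S.bot)
    ((repH r).trans (postcompEquiv g.bot.symm)) (fun h n => by
      change repH r _ ≫ g.bot.inv = h ≫ repH r n ≫ g.bot.inv
      rw [repH_act, Category.assoc])
  replace hD : ∀ {a b x : C} (d : El J.D (a, b) x), Q.D d = (g.tens a b).hom ≫ repD r d := hD
  refine ⟨Q, hD, hE, hH, FrobFrame.realizes_of_traceAt_iff (fun {a b x z} δ τ f h => ?_)⟩
  have hτ := repT_counit r ((Q.tenCounit_iff τ ((repD r).symm (𝟙 _)) _).2 rfl)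
  rw [hD, Equiv.apply_symm_apply, Category.comp_id, Category.comp_id] at hτ
  rw [rep_trace r h, ← hτ, hD, ← g.trace]
  simp

end Representation

end Prof

namespace Prof

variable {C : Type u} [SmallCategory C]

theorem exists_iso_of_natural {A B : C} (φ : ∀ {x : C}, (A ⟶ x) ≃ (B ⟶ x))
    (h : ∀ {x y : C} (f : A ⟶ x) (g : x ⟶ y), φ (f ≫ g) = φ f ≫ g) :
    ∃ i : B ≅ A, ∀ {x : C} (f : A ⟶ x), φ f = i.hom ≫ f := by
  have e : ∀ {x : C} (f : A ⟶ x), φ f = φ (𝟙 A) ≫ f := fun f => by rw [← h, Category.id_comp]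
  refine ⟨⟨φ (𝟙 A), φ.symm (𝟙 B), ?_, ?_⟩, e⟩
  · rw [← e, Equiv.apply_symm_apply]
  · apply φ.injective
    rw [h, Equiv.apply_symm_apply, Category.id_comp]

/-- The action of an invertible 2-cell on elements. -/
def apEquiv {A B : Type u} [SmallCategory A] [SmallCategory B] {P Q : Profunctor.{u} A B}
    (i : P ≅ Q) {b : B} {a : A} : El P b a ≃ El Q b a :=
  ⟨ap i.hom, ap i.inv, ap_hom_inv i, ap_inv_hom i⟩

section Correspondence

variable {I J : Interp C} {S T : TracedStarAut C} (r : RepresentedBy I S) (r' : RepresentedBy J T)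

theorem existsUnique_interpHom [IsIdempotentComplete C] (g : TracedStarAutHom S T) :
    ∃! f : InterpHom I J, Corresponds r r' f g := by
  let _ := S.mon
  obtain ⟨R, hD, hE, hH, hθ⟩ := exists_frobFrame_transport r (TracedStarAutHom.id S)
  obtain ⟨Q, hD', hE', hH', hθ'⟩ := exists_frobFrame_transport r' g
  replace hD : ∀ {a b x : C} (d : El I.D (a, b) x), R.D d = repD r d := fun d =>
    (hD d).trans (Category.id_comp _)
  replace hE : ∀ {x : C} (e : El I.E pt x), R.E e = repE r e := fun e =>
    (hE e).trans (Category.id_comp _)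
  replace hH : ∀ {z : C} (n : El I.H z pt), R.H n = repH r n := fun n =>
    (hH n).trans (Category.comp_id _)
  have key : ∀ f : InterpHom I J, Matches R Q f ↔ Corresponds r r' f g := fun f => by
    constructor
    · intro h
      exact ⟨fun d => ((hD d).symm.trans (h.D d).symm).trans (hD' _),
        fun e => ((hE e).symm.trans (h.E e).symm).trans (hE' _),
        fun n => (Iso.comp_inv_eq _).1 (((hH' _).symm.trans (h.H n)).trans (hH n))⟩
    · intro h
      exact ⟨fun d => ((hD' _).trans (h.1 d).symm).trans (hD d).symm,
        fun e => ((hE' _).trans (h.2.1 e).symm).trans (hE e).symm,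
        fun n => ((hH' _).trans ((Iso.comp_inv_eq _).2 (h.2.2 n))).trans (hH n).symm⟩
  obtain ⟨f, hf⟩ := exists_matches R Q hθ hθ'
  exact ⟨f, (key f).1 hf, fun f' hf' => ((key f').2 hf').unique hf⟩

theorem existsUnique_starAutHom (f : InterpHom I J) :
    ∃! g : TracedStarAutHom S T, Corresponds r r' f g := by
  have htens : ∀ a b : C, ∃ i : S.mon.tensorObj a b ≅ T.mon.tensorObj a b,
      ∀ {x : C} (d : El I.D (a, b) x), repD r d = i.hom ≫ repD r' (ap f.D.hom d) := by
    intro a b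
    obtain ⟨i, hi⟩ := exists_iso_of_natural
      (fun {x} => (repD r' (a := a) (b := b) (x := x)).symm.trans
        ((apEquiv f.D).symm.trans (repD r))) (fun {x y} k l => by
        obtain ⟨d, rfl⟩ := (repD r').surjective k
        obtain ⟨d, rfl⟩ := (apEquiv f.D).surjective d
        change repD r ((apEquiv f.D).symm ((repD r').symm _)) =
          repD r ((apEquiv f.D).symm ((repD r').symm _)) ≫ l
        have e : act J.D (𝟙 (a, b)) l (apEquiv f.D d) = apEquiv f.D (act I.D (𝟙 (a, b)) l d) :=
          (ap_act _ _ _ _).symm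
        rw [← repD_right, e, Equiv.symm_apply_apply, Equiv.symm_apply_apply,
          Equiv.symm_apply_apply, Equiv.symm_apply_apply, repD_right])
    refine ⟨i, fun {x} d => ?_⟩
    rw [← hi]
    change _ = repD r ((apEquiv f.D).symm ((repD r').symm (repD r' (apEquiv f.D d))))
    rw [Equiv.symm_apply_apply, Equiv.symm_apply_apply]
  obtain ⟨j, hj⟩ : ∃ i : S.mon.tensorUnit ≅ T.mon.tensorUnit,
      ∀ {x : C} (e : El I.E pt x), repE r e = i.hom ≫ repE r' (ap f.E.hom e) := by
    obtain ⟨i, hi⟩ := exists_iso_of_natural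
      (fun {x} => (repE r' (x := x)).symm.trans ((apEquiv f.E).symm.trans (repE r)))
      (fun {x y} k l => by
        obtain ⟨d, rfl⟩ := (repE r').surjective k
        obtain ⟨d, rfl⟩ := (apEquiv f.E).surjective d
        change repE r ((apEquiv f.E).symm ((repE r').symm _)) =
          repE r ((apEquiv f.E).symm ((repE r').symm _)) ≫ l
        have e : act J.E (𝟙 pt) l (apEquiv f.E d) = apEquiv f.E (act I.E (𝟙 pt) l d) :=
          (ap_act _ _ _ _).symm
        rw [← repE_act, e, Equiv.symm_apply_apply, Equiv.symm_apply_apply,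
          Equiv.symm_apply_apply, Equiv.symm_apply_apply, repE_act])
    refine ⟨i, fun {x} d => ?_⟩
    rw [← hi]
    change _ = repE r ((apEquiv f.E).symm ((repE r').symm (repE r' (apEquiv f.E d))))
    rw [Equiv.symm_apply_apply, Equiv.symm_apply_apply]
  have hH : ∀ {z : C} (n : El I.H z pt),
      repH r' (ap f.H.hom n) = repH r n ≫ repH r' (ap f.H.hom ((repH r).symm (𝟙 _))) := by
    intro z n
    rw [← repH_act, ← ap_act]
    refine congrArg (fun t => repH r' (ap f.H.hom t)) ((repH r).injective ?_)
    rw [repH_act, Equiv.apply_symm_apply, Category.comp_id]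
  have hH' : ∀ {z : C} (n : El J.H z pt),
      repH r (ap f.H.inv n) = repH r' n ≫ repH r (ap f.H.inv ((repH r').symm (𝟙 _))) := by
    intro z n
    rw [← repH_act, ← ap_act]
    refine congrArg (fun t => repH r (ap f.H.inv t)) ((repH r').injective ?_)
    rw [repH_act, Equiv.apply_symm_apply, Category.comp_id]
  let k : S.bot ≅ T.bot :=
    { hom := repH r' (ap f.H.hom ((repH r).symm (𝟙 _)))
      inv := repH r (ap f.H.inv ((repH r').symm (𝟙 _)))
      hom_inv_id := by rw [← hH', ap_hom_inv, Equiv.apply_symm_apply]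
      inv_hom_id := by rw [← hH, ap_inv_hom, Equiv.apply_symm_apply] }
  choose i hi using htens
  have exD : ∀ {a b x : C} (t : T.mon.tensorObj a b ⟶ x), ∃ d : El I.D (a, b) x,
      repD r' (ap f.D.hom d) = t := fun t =>
    ⟨ap f.D.inv ((repD r').symm t), by rw [ap_inv_hom, Equiv.apply_symm_apply]⟩
  have natural : ∀ {a a' b b' : C} (g : a ⟶ a') (h : b ⟶ b'),
      S.mon.tensorHom g h ≫ (i a' b').hom = (i a b).hom ≫ T.mon.tensorHom g h := by
    intro a a' b b' g h
    obtain ⟨d, hd⟩ := exD (𝟙 (T.mon.tensorObj a' b'))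
    have e := hi _ _ (act I.D (Prod.mkHom g h) (𝟙 _) d)
    rw [repD_act, ap_act, repD_act, hi, hd, Category.comp_id, Category.comp_id, Category.comp_id,
      Category.comp_id] at e
    exact e
  have assoc : ∀ a b c : C, S.mon.tensorHom (i a b).hom (𝟙 c) ≫ (i (T.mon.tensorObj a b) c).hom ≫
      (T.mon.associator a b c).hom = (S.mon.associator a b c).hom ≫
        S.mon.tensorHom (𝟙 a) (i b c).hom ≫ (i a (T.mon.tensorObj b c)).hom := by
    intro a b c
    obtain ⟨d₁, h₁⟩ := exD (𝟙 (T.mon.tensorObj a (T.mon.tensorObj b c)))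
    obtain ⟨d₂, h₂⟩ := exD (𝟙 (T.mon.tensorObj b c))
    obtain ⟨t, d, d', e⟩ := exists_comulL (ap I.coassoc.inv (comulR d₁ d₂))
    have e' : ap I.coassoc.hom (comulL d d') = comulR d₁ d₂ := by rw [e, ap_inv_hom]
    have e₁ := rep_coassoc r e'
    have e₂ := rep_coassoc r' (f.coassoc _ _ _ _ e')
    rw [hi, hi, hi, hi, h₁, h₂, Category.comp_id, Category.comp_id, tensorHom_comp_id,
      Category.assoc, reassoc_of% (natural (repD r' (ap f.D.hom d')) (𝟙 c)), ← e₂, h₁, h₂,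
      @MonoidalCategory.id_tensorHom_id C _ T.mon, Category.comp_id, Category.comp_id] at e₁
    exact e₁.symm
  have exE : ∃ e : El I.E pt T.mon.tensorUnit, repE r' (ap f.E.hom e) = 𝟙 _ :=
    ⟨ap f.E.inv ((repE r').symm (𝟙 _)), by rw [ap_inv_hom, Equiv.apply_symm_apply]⟩
  obtain ⟨e₀, he₀⟩ := exE
  have left : ∀ a : C, S.mon.tensorHom j.hom (𝟙 a) ≫ (i T.mon.tensorUnit a).hom ≫
      (T.mon.leftUnitor a).hom = (S.mon.leftUnitor a).hom := by
    intro a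
    obtain ⟨d, hd⟩ := exD (T.mon.leftUnitor a).hom
    have e : couL (ap f.D.hom d) (ap f.E.hom e₀) = couL d e₀ := f.counitL d e₀
    rw [rep_counitL r, rep_counitL r', hi, hj, hd, he₀, @MonoidalCategory.id_tensorHom_id C _ T.mon,
      Category.id_comp, Iso.inv_hom_id, Category.comp_id, Iso.eq_inv_comp, Category.comp_id] at e
    exact e.symm
  have right : ∀ a : C, S.mon.tensorHom (𝟙 a) j.hom ≫ (i a T.mon.tensorUnit).hom ≫
      (T.mon.rightUnitor a).hom = (S.mon.rightUnitor a).hom := by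
    intro a
    obtain ⟨d, hd⟩ := exD (T.mon.rightUnitor a).hom
    have e : couR (ap f.D.hom d) (ap f.E.hom e₀) = couR d e₀ := f.counitR d e₀
    rw [rep_counitR r, rep_counitR r', hi, hj, hd, he₀, @MonoidalCategory.id_tensorHom_id C _ T.mon,
      Category.id_comp, Iso.inv_hom_id, Category.comp_id, Iso.eq_inv_comp, Category.comp_id] at e
    exact e.symm
  have trace : ∀ {a b : C} (x : C) (h : S.mon.tensorObj a x ⟶ S.mon.tensorObj b x),
      @RightTrace.tr C _ T.mon T.trace a b x ((i a x).inv ≫ h ≫ (i b x).hom) =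
        @RightTrace.tr C _ S.mon S.trace a b x h := by
    intro a b x h
    obtain ⟨d, rfl⟩ := (repD r).surjective h
    obtain ⟨τ, hτ⟩ := (repT r).surjective (𝟙 (S.mon.tensorObj b x))
    obtain ⟨p, q, s, s₁, s₂, t, e₁, m₁, e₂, m₂, w, d', n, rfl⟩ := exists_tenMk τ
    obtain ⟨l, hl, hl'⟩ := f.exists_traceAt d e₁ m₁ e₂ m₂ w d' n
    obtain ⟨δ, hδ⟩ := exD (𝟙 (T.mon.tensorObj b x))
    obtain ⟨l', hc, hc'⟩ := f.exists_tenCounit e₁ m₁ e₂ m₂ w d' n δ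
    have e₃ := (repT_counit r hc).symm.trans (repT_counit r' hc')
    rw [hτ, hi, hδ, Category.id_comp, Category.comp_id, Category.comp_id] at e₃
    have e₄ := rep_trace r hl
    have e₅ := rep_trace r' hl'
    rw [hτ, Category.comp_id] at e₄
    rw [← e₄, e₅, ← e₃, hi, Category.assoc, Iso.inv_hom_id_assoc]
  refine ⟨⟨i, j, k, natural, assoc, left, right, trace⟩, ⟨fun d => hi _ _ d, fun e => hj e,
    fun n => hH n⟩, ?_⟩
  rintro g ⟨h₁, h₂, h₃⟩
  have e₁ : g.tens = i := by
    funext a b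
    obtain ⟨d, hd⟩ := exD (𝟙 (T.mon.tensorObj a b))
    have e := (h₁ d).symm.trans (hi _ _ d)
    change _ ≫ repD r' (ap f.D.hom d) = _ at e
    rw [hd, Category.comp_id, Category.comp_id] at e
    exact Iso.ext e
  have e₂ : g.unit = j := by
    have e := (h₂ e₀).symm.trans (hj e₀)
    change _ ≫ repE r' (ap f.E.hom e₀) = _ at e
    rw [he₀, Category.comp_id, Category.comp_id] at e
    exact Iso.ext e
  have e₃ : g.bot = k := by
    have e := h₃ ((repH r).symm (𝟙 _))
    change _ = repH r ((repH r).symm (𝟙 _)) ≫ _ at e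
    rw [Equiv.apply_symm_apply, Category.id_comp] at e
    exact Iso.ext e.symm
  exact TracedStarAutHom.ext e₁ e₂ e₃

theorem corresponds_id : Corresponds r r (InterpHom.id I) (TracedStarAutHom.id S) :=
  ⟨fun _ => (Category.id_comp _).symm, fun _ => (Category.id_comp _).symm,
    fun _ => (Category.comp_id _).symm⟩

theorem corresponds_comp {K : Interp C} {U : TracedStarAut C} {r : RepresentedBy I S}
    {r' : RepresentedBy J T} {r'' : RepresentedBy K U} {f : InterpHom I J} {f' : InterpHom J K}
    {g : TracedStarAutHom S T} {g' : TracedStarAutHom T U} (h : Corresponds r r' f g)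
    (h' : Corresponds r' r'' f' g') :
    Corresponds r r'' (f.comp f') (g.comp g') := by
  refine ⟨fun d => ?_, fun e => ?_, fun n => ?_⟩
  · exact (h.1 d).trans ((congrArg (fun t => _ ≫ t) (h'.1 (ap f.D.hom d))).trans
      (Category.assoc _ _ _).symm)
  · exact (h.2.1 e).trans ((congrArg (fun t => _ ≫ t) (h'.2.1 (ap f.E.hom e))).trans
      (Category.assoc _ _ _).symm)
  · exact (h'.2.2 (ap f.H.hom n)).trans ((congrArg (fun t => t ≫ _) (h.2.2 n)).trans
      (Category.assoc _ _ _))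

end Correspondence

end Prof

theorem proposition2 {C : Type u} [SmallCategory C] [IsIdempotentComplete C] :
    ∃ (Φ : Prof.Interp C ≌ TracedStarAut C)
      (r : ∀ I : Prof.Interp C, RepresentedBy I (Φ.functor.obj I)),
      ∀ (I J : Prof.Interp C) (f : I ⟶ J), Corresponds (r I) (r J) f (Φ.functor.map f) := by
  choose S r using fun I : Prof.Interp C => Prof.exists_representedBy I
  replace r := fun I => (r I).some
  choose G hG hG' using fun (I J : Prof.Interp C) (f : I ⟶ J) =>
    Prof.existsUnique_starAutHom (r I) (r J) f
  let Φ : Prof.Interp C ⥤ TracedStarAut C :=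
    { obj := S
      map := fun {I J} f => G I J f
      map_id := fun I => (hG' I I _ _ (Prof.corresponds_id (r I))).symm
      map_comp := fun {I J K} f g =>
        (hG' I K _ _ (Prof.corresponds_comp (hG I J f) (hG J K g))).symm }
  have : Φ.Faithful := ⟨fun {I J f f'} e => by
    have h := hG I J f
    have e' : G I J f = G I J f' := e
    rw [e'] at h
    exact (Prof.existsUnique_interpHom (r I) (r J) _).unique h (hG I J f')⟩
  have : Φ.Full := ⟨fun {I J} g => by
    obtain ⟨f, hf, -⟩ := Prof.existsUnique_interpHom (r I) (r J) g
    exact ⟨f, (hG' I J f g hf).symm⟩⟩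
  have : Φ.EssSurj := ⟨fun T => by
    obtain ⟨I, ⟨r'⟩⟩ := Prof.exists_interp_representedBy T
    obtain ⟨g, hg, -⟩ := Prof.existsUnique_starAutHom (r I) r' (Prof.InterpHom.id I)
    obtain ⟨g', hg', -⟩ := Prof.existsUnique_starAutHom r' (r I) (Prof.InterpHom.id I)
    have e := (Prof.existsUnique_starAutHom (r I) (r I) (Prof.InterpHom.id I)).unique
      (Prof.corresponds_comp hg hg') (Prof.corresponds_id (r I))
    have e' := (Prof.existsUnique_starAutHom r' r' (Prof.InterpHom.id I)).unique
      (Prof.corresponds_comp hg' hg) (Prof.corresponds_id r')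
    exact ⟨I, ⟨⟨g, g', e, e'⟩⟩⟩⟩
  have : Φ.IsEquivalence := { }
  exact ⟨Φ.asEquivalence, r, fun I J f => hG I J f⟩
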